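/- **Theorem.** An instance of the preemptive $s$-bounded General Profit Scheduling Problem ($s$-GPSP) consists of a number $s\in\mathbb{N}$ and $n$ jobs, where job $j$ has a release date $r_j\ge 0$, a processing time $p_j>0$ (real numbers) and a non-increasing profit function $f_j:[0,\infty)\to\mathbb{R}$. A preemptive schedule selects a set $\bar J$ of at most $s$ jobs and processes them on a single machine: each $j\in\bar J$ is processed during finitely many intervals, none of which begins before $r_j$, of total length exactly $p_j$; no other job is processed, and at most one job is processed at a time. The completion time $C_j$ is the end of the last interval in which $j$ is processed. The schedule is optimal if it maximizes $\sum_{j\in\bar J} f_j(C_j)$. Let $\overline{p}$ denote the number of distinct processing times of the instance. Algorithms are (deterministic) programs for a random access machine with cells for natural numbers and cells for real numbers, which can be added, subtracted and compared, and with an oracle that returns $f_j(t)$ for a given job $j$ and time $t$; every elementary operation and every oracle query takes one step. There are such an algorithm and a constant $c$ such that, for every instance of preemptive $s$-GPSP, the algorithm halts and outputs an optimal preemptive schedule, and for $n\ge 2$ and $s\ge 1$ it does so within $2^{c s}\cdot s^{c\,\overline{p}}\cdot n^{4}\log n$ steps. That is, it runs in time $2^{O(s)}s^{O(\overline{p})}n^4\log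 n$. -/

import Mathlib

namespace GPSP

/-! ### The scheduling problem -/

/-- A set of `n` jobs: release dates, processing times and non-increasing profit functions. -/
structure Instance (n : ℕ) where
  release : Fin n → ℝ
  proc : Fin n → ℝ
  profit : Fin n → ℝ → ℝ
  release_nonneg : ∀ j, 0 ≤ release j
  proc_pos : ∀ j, 0 < proc j
  profit_antitoneOn : ∀ j, AntitoneOn (profit j) (Set.Ici 0)

/-- The number of distinct processing times. -/
noncomputable def Instance.numProc {n : ℕ} (I : Instance n) : ℕ :=
  (Set.range I.proc).ncard

/-- A piece of a schedule: `job` is processed throughout `[start, finish)`. -/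
structure Piece (n : ℕ) where
  job : Fin n
  start : ℝ
  finish : ℝ

/-- A preemptive schedule on one machine is a finite list of pieces (in any order). -/
abbrev Schedule (n : ℕ) : Type := List (Piece n)

/-- The set of scheduled jobs. -/
def Schedule.jobs {n : ℕ} (L : Schedule n) : Finset (Fin n) :=
  (L.map Piece.job).toFinset

/-- The total amount of processing that job `j` receives. -/
noncomputable def Schedule.work {n : ℕ} (L : Schedule n) (j : Fin n) : ℝ :=
  ((L.filter (fun x => x.job = j)).map (fun x => x.finish - x.start)).sum

/-- The completion time of a scheduled job: the latest end of one of its pieces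
(the set below is finite, and nonempty for a scheduled job). -/
noncomputable def Schedule.completion {n : ℕ} (L : Schedule n) (j : Fin n) : ℝ :=
  sSup {t : ℝ | ∃ x ∈ L, x.job = j ∧ x.finish = t}

/-- `L` is a feasible preemptive schedule of at most `s` of the jobs. -/
structure Instance.Feasible {n : ℕ} (I : Instance n) (s : ℕ) (L : Schedule n) : Prop where
  nonempty_pieces : ∀ x ∈ L, x.start < x.finish
  after_release : ∀ x ∈ L, I.release x.job ≤ x.start
  one_at_a_time : L.Pairwise (fun x y => x.finish ≤ y.start ∨ y.finish ≤ x.start)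
  complete : ∀ j ∈ L.jobs, L.work j = I.proc j
  card_le : L.jobs.card ≤ s

/-- The total profit of the scheduled jobs. -/
noncomputable def Instance.value {n : ℕ} (I : Instance n) (L : Schedule n) : ℝ :=
  ∑ j ∈ L.jobs, I.profit j (L.completion j)

/-- `L` is an optimal preemptive schedule for the problem of scheduling at most `s` jobs. -/
def Instance.Optimal {n : ℕ} (I : Instance n) (s : ℕ) (L : Schedule n) : Prop :=
  I.Feasible s L ∧ ∀ L' : Schedule n, I.Feasible s L' → I.value L' ≤ I.value L

/-! ### The machine model

A random access machine with two kinds of cells: cells that hold natural numbers (used for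
counters, job indices and addresses) and cells that hold real numbers (times and profits).
The cells of each kind are organized in arrays; a program mentions finitely many of them.
Arithmetic is restricted to addition, subtraction and comparison, in both kinds of cells; there
is no multiplication, rounding or conversion between the two kinds. The profit functions can
only be accessed through an oracle. Every elementary operation, including an oracle query,
costs one step. -/

/-- Natural number expressions. -/
inductive NExp where
  | const (k : ℕ)
  | read (a : ℕ) (i : NExp)
  | add (e₁ e₂ : NExp)
  | sub (e₁ e₂ : NExp)

/-- Real number expressions; `query j t` asks the oracle for the profit of job `j` at time `t`. -/
inductive RExp where
  | read (a : ℕ) (i : NExp)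
  | add (e₁ e₂ : RExp)
  | sub (e₁ e₂ : RExp)
  | query (j : NExp) (t : RExp)

/-- Tests. -/
inductive Test where
  | ltNat (e₁ e₂ : NExp)
  | ltReal (e₁ e₂ : RExp)

/-- Programs. -/
inductive Program where
  | skip
  | writeNat (a : ℕ) (i e : NExp)
  | writeReal (a : ℕ) (i : NExp) (e : RExp)
  | seq (P Q : Program)
  | ifThenElse (b : Test) (P Q : Program)
  | whileDo (b : Test) (P : Program)

/-- Memory contents: `nat a i` and `real a i` are the `i`-th cells of the `a`-th arrays. -/
structure Memory where
  nat : ℕ → ℕ → ℕ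
  real : ℕ → ℕ → ℝ

/-- Overwriting cell `i` of array `a`. -/
def update {α : Type} (M : ℕ → ℕ → α) (a i : ℕ) (v : α) : ℕ → ℕ → α :=
  fun a' i' => if a' = a ∧ i' = i then v else M a' i'

def NExp.eval (M : Memory) : NExp → ℕ
  | .const k => k
  | .read a i => M.nat a (i.eval M)
  | .add e₁ e₂ => e₁.eval M + e₂.eval M
  | .sub e₁ e₂ => e₁.eval M - e₂.eval M

def NExp.cost : NExp → ℕ
  | .const _ => 1
  | .read _ i => i.cost + 1
  | .add e₁ e₂ => e₁.cost + e₂.cost + 1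
  | .sub e₁ e₂ => e₁.cost + e₂.cost + 1

noncomputable def RExp.eval (f : ℕ → ℝ → ℝ) (M : Memory) : RExp → ℝ
  | .read a i => M.real a (i.eval M)
  | .add e₁ e₂ => e₁.eval f M + e₂.eval f M
  | .sub e₁ e₂ => e₁.eval f M - e₂.eval f M
  | .query j t => f (j.eval M) (t.eval f M)

def RExp.cost : RExp → ℕ
  | .read _ i => i.cost + 1
  | .add e₁ e₂ => e₁.cost + e₂.cost + 1
  | .sub e₁ e₂ => e₁.cost + e₂.cost + 1
  | .query j t => j.cost + t.cost + 1

def Test.Holds (f : ℕ → ℝ → ℝ) (M : Memory) : Test → Prop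
  | .ltNat e₁ e₂ => e₁.eval M < e₂.eval M
  | .ltReal e₁ e₂ => e₁.eval f M < e₂.eval f M

def Test.cost : Test → ℕ
  | .ltNat e₁ e₂ => e₁.cost + e₂.cost + 1
  | .ltReal e₁ e₂ => e₁.cost + e₂.cost + 1

/-- `Runs f P M t M'`: with oracle `f` and initial memory `M`, the program `P` halts after
exactly `t` steps with final memory `M'`. -/
inductive Runs (f : ℕ → ℝ → ℝ) : Program → Memory → ℕ → Memory → Prop where
  | skip (M : Memory) : Runs f .skip M 1 M
  | writeNat (M : Memory) (a : ℕ) (i e : NExp) :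
      Runs f (.writeNat a i e) M (i.cost + e.cost + 1)
        { M with nat := update M.nat a (i.eval M) (e.eval M) }
  | writeReal (M : Memory) (a : ℕ) (i : NExp) (e : RExp) :
      Runs f (.writeReal a i e) M (i.cost + e.cost + 1)
        { M with real := update M.real a (i.eval M) (e.eval f M) }
  | seq {P Q : Program} {M M' M'' : Memory} {t t' : ℕ} :
      Runs f P M t M' → Runs f Q M' t' M'' → Runs f (.seq P Q) M (t + t') M''
  | ifTrue {b : Test} {P Q : Program} {M M' : Memory} {t : ℕ} :
      b.Holds f M → Runs f P M t M' → Runs f (.ifThenElse b P Q) M (b.cost + t) M'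
  | ifFalse {b : Test} {P Q : Program} {M M' : Memory} {t : ℕ} :
      ¬ b.Holds f M → Runs f Q M t M' → Runs f (.ifThenElse b P Q) M (b.cost + t) M'
  | whileTrue {b : Test} {P : Program} {M M' M'' : Memory} {t t' : ℕ} :
      b.Holds f M → Runs f P M t M' → Runs f (.whileDo b P) M' t' M'' →
      Runs f (.whileDo b P) M (b.cost + t + t') M''
  | whileFalse {b : Test} {P : Program} {M : Memory} :
      ¬ b.Holds f M → Runs f (.whileDo b P) M b.cost M

/-- The machine is deterministic: running time and result are determined by the input. -/
theorem Runs.deterministic {f : ℕ → ℝ → ℝ} {P : Program} {M M₁ M₂ : Memory} {t₁ t₂ : ℕ}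
    (h₁ : Runs f P M t₁ M₁) (h₂ : Runs f P M t₂ M₂) : t₁ = t₂ ∧ M₁ = M₂ := by
  induction h₁ generalizing t₂ M₂ with
  | skip M => cases h₂; exact ⟨rfl, rfl⟩
  | writeNat M a i e => cases h₂; exact ⟨rfl, rfl⟩
  | writeReal M a i e => cases h₂; exact ⟨rfl, rfl⟩
  | seq _ _ ih₁ ih₂ =>
    cases h₂ with
    | seq hP hQ =>
      obtain ⟨rfl, rfl⟩ := ih₁ hP
      obtain ⟨rfl, rfl⟩ := ih₂ hQ
      exact ⟨rfl, rfl⟩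
  | ifTrue hb _ ih =>
    cases h₂ with
    | ifTrue _ hP => obtain ⟨rfl, rfl⟩ := ih hP; exact ⟨rfl, rfl⟩
    | ifFalse hb' _ => exact absurd hb hb'
  | ifFalse hb _ ih =>
    cases h₂ with
    | ifTrue hb' _ => exact absurd hb' hb
    | ifFalse _ hQ => obtain ⟨rfl, rfl⟩ := ih hQ; exact ⟨rfl, rfl⟩
  | whileTrue hb _ _ ih₁ ih₂ =>
    cases h₂ with
    | whileTrue _ hP hW =>
      obtain ⟨rfl, rfl⟩ := ih₁ hP
      obtain ⟨rfl, rfl⟩ := ih₂ hW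
      exact ⟨rfl, rfl⟩
    | whileFalse hb' => exact absurd hb hb'
  | whileFalse hb =>
    cases h₂ with
    | whileTrue hb' _ _ => exact absurd hb' hb
    | whileFalse _ => exact ⟨rfl, rfl⟩

/-! ### Input and output -/

/-- A function on the jobs, continued by a default value to all natural numbers. -/
def extend {n : ℕ} {α : Type} (g : Fin n → α) (d : α) (j : ℕ) : α :=
  if h : j < n then g ⟨j, h⟩ else d

/-- The profit oracle of an instance. -/
def Instance.oracle {n : ℕ} (I : Instance n) : ℕ → ℝ → ℝ :=
  extend I.profit (fun _ => 0)

/-- The initial memory: `n` and `s` are in cells `0` and `1` of natural number array `0`; the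
release dates and processing times are in the real arrays `0` and `1`; all else is zero. -/
def Instance.input {n : ℕ} (I : Instance n) (s : ℕ) : Memory where
  nat := update (update (fun _ _ => 0) 0 0 n) 0 1 s
  real a i := if a = 0 then extend I.release 0 i else if a = 1 then extend I.proc 0 i else 0

/-- The memory `M` holds the schedule `L`: the number of pieces is in cell `0` of natural number
array `1`, the jobs of the pieces are in natural number array `2`, their starting points in real
array `2`, and their end points in real array `3`. -/
def Memory.Holds {n : ℕ} (M : Memory) (L : Schedule n) : Prop :=
  M.nat 1 0 = L.length ∧
    ∀ (k : ℕ) (hk : k < L.length),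
      M.nat 2 k = (L[k].job : ℕ) ∧ M.real 2 k = L[k].start ∧ M.real 3 k = L[k].finish

end GPSP

/-! Every feasible schedule can be replaced by a priority schedule of a recursive shape. Order its
jobs by completion time and insert them one by one, each with lower priority than all earlier ones,
into the idle time left after its release date. At every stage the busy time splits into blocks that
are processed without interruption, and each block starts at a release date. When job `k` is
inserted last, it ends at the end `C` of its block. All jobs of that block are released at or after
its start and complete no later than `k` in the given schedule, so by the interval condition
(`Feasible.add_sum_proc_le`) `C` is at most the completion time of `k` there, and no profit is lost
(`Feasible.exists_chain`). Without `k`, the block is a smaller block from the same start followed by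
a chain of later blocks, and `k` uses what is left of the time until `C`; this is the recursion
`Instance.Blk`. Conversely, each such combination of stored schedules is again a schedule
(`Good.append`, `Good.fill`).

This gives a dynamic program over the position of the start among the sorted release dates, the
total length, and the set of jobs. Total lengths of at most `s` jobs are sums with at most `s`
copies of each distinct processing time, so a table of `(s + 1) ^ numProc` sums covers them. The set
of jobs is replaced by its colours: a job of colour `b` has weight `2 ^ b`, and a set is represented
by its sum of weights. Adding two codes keeps the total number of binary ones only if there is no
carry, and in that case the two sets are disjoint (`disjoint_of_popc`). Hence every table entry is a
genuine schedule under any colouring, and an optimal value is reached under each colouring that is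
injective on the jobs of an optimal schedule.

The algorithm tries an explicit family of colourings that contains an injective one for every set of
at most `s` jobs (`exists_colour`). Jobs are first hashed modulo a prime between `n` and `2 * n`
into a range of quadratic size in `s`, then into linearly many colours by a cascade of hash
functions in which only colliding elements go on to the next, half as large, level. The cascade has
logarithmically many multipliers of polynomial size in `s` and one mark for each bucket, altogether
`2 ^ O(s)` possibilities. The first hash contributes a factor of order `n ^ 2`; the dynamic program
contributes another `n ^ 2`, one factor for the start of a block and one for either the rows of
chains or the last job. This gives `n ^ 4`; of the factor `log n` only a positive lower bound is
used.

The machine programs are written in a language of bounded loops, whose time is bounded by the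
nesting depth of the loops (`Cmd.runs`). Their correctness rests on two properties of entries:
`EntOK` (a valid entry stores a schedule of its kind and a value that it attains) and `LB` (an entry
is valid and at least as good as a given value). Updates preserve the first and never destroy the
second. At most one job (`s = 1` or `n ≤ 1`) is treated separately, since `(s + 1) ^ numProc` is not
bounded by a power of `s` if `s = 1`. -/

namespace GPSP

/-! ### Loop programs -/

/-- Programs with bounded loops only; `loop v d c` runs `c` with cell `0` of the natural number
array `v` going through all values smaller than cell `0` of the array `d`. -/
inductive Cmd where
  | skip
  | setN (a : ℕ) (i e : NExp)
  | setR (a : ℕ) (i : NExp) (e : RExp)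
  | seq (c d : Cmd)
  | ite (b : Test) (c d : Cmd)
  | loop (v d : ℕ) (c : Cmd)

/-- The variable `a`: cell `0` of the array `a`. -/
abbrev nv (a : ℕ) : NExp := .read a (.const 0)

/-- The real variable `a`. -/
abbrev rv (a : ℕ) : RExp := .read a (.const 0)

def Memory.setN (M : Memory) (a i v : ℕ) : Memory := { M with nat := update M.nat a i v }

def Memory.setR (M : Memory) (a i : ℕ) (v : ℝ) : Memory := { M with real := update M.real a i v }

theorem Memory.setN_nat (M : Memory) (a i v a' i' : ℕ) :
    (M.setN a i v).nat a' i' = if a' = a ∧ i' = i then v else M.nat a' i' := rfl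

@[simp] theorem Memory.setN_real (M : Memory) (a i v : ℕ) : (M.setN a i v).real = M.real := rfl

@[simp] theorem Memory.setR_nat (M : Memory) (a i : ℕ) (v : ℝ) : (M.setR a i v).nat = M.nat := rfl

theorem Memory.setR_real (M : Memory) (a i : ℕ) (v : ℝ) (a' i' : ℕ) :
    (M.setR a i v).real a' i' = if a' = a ∧ i' = i then v else M.real a' i' := rfl

@[simp] theorem Memory.setN_same (M : Memory) (a i v : ℕ) : (M.setN a i v).nat a i = v := by
  simp [Memory.setN_nat]

@[simp] theorem Memory.setR_same (M : Memory) (a i : ℕ) (v : ℝ) :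
    (M.setR a i v).real a i = v := by
  simp [Memory.setR_real]

theorem Memory.setN_row (M : Memory) {a i v a' : ℕ} (h : a' ≠ a) :
    (M.setN a i v).nat a' = M.nat a' := by
  funext x; simp [Memory.setN_nat, h]

theorem Memory.setR_row (M : Memory) {a i : ℕ} {v : ℝ} {a' : ℕ} (h : a' ≠ a) :
    (M.setR a i v).real a' = M.real a' := by
  funext x; simp [Memory.setR_real, h]

namespace Cmd

def toProgram : Cmd → Program
  | skip => .skip
  | setN a i e => .writeNat a i e
  | setR a i e => .writeReal a i e
  | seq c d => .seq c.toProgram d.toProgram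
  | ite b c d => .ifThenElse b c.toProgram d.toProgram
  | loop v d c => .seq (.writeNat v (.const 0) (.const 0))
      (.whileDo (.ltNat (nv v) (nv d))
        (.seq c.toProgram (.writeNat v (.const 0) (.add (nv v) (.const 1)))))

open Classical in
/-- The memory after running a loop program. -/
noncomputable def run (f : ℕ → ℝ → ℝ) : Cmd → Memory → Memory
  | skip, M => M
  | setN a i e, M => M.setN a (i.eval M) (e.eval M)
  | setR a i e, M => M.setR a (i.eval M) (e.eval f M)
  | seq c d, M => d.run f (c.run f M)
  | ite b c d, M => if b.Holds f M then c.run f M else d.run f M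
  | loop v d c, M =>
      Nat.rec (M.setN v 0 0) (fun x M' => (c.run f M').setN v 0 (x + 1)) (M.nat d 0)

/-- The natural number arrays written by a loop program. -/
def wN : Cmd → List ℕ
  | skip => []
  | setN a _ _ => [a]
  | setR _ _ _ => []
  | seq c d => c.wN ++ d.wN
  | ite _ c d => c.wN ++ d.wN
  | loop v _ c => v :: c.wN

/-- The real arrays written by a loop program. -/
def wR : Cmd → List ℕ
  | skip => []
  | setN _ _ _ => []
  | setR a _ _ => [a]
  | seq c d => c.wR ++ d.wR
  | ite _ c d => c.wR ++ d.wR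
  | loop _ _ c => c.wR

/-- The arrays that hold loop bounds. -/
def dims : Cmd → List ℕ
  | skip => []
  | setN _ _ _ => []
  | setR _ _ _ => []
  | seq c d => c.dims ++ d.dims
  | ite _ c d => c.dims ++ d.dims
  | loop _ d c => d :: c.dims

/-- No loop variable is written in the body of its loop. -/
def wf : Cmd → Bool
  | skip => true
  | setN _ _ _ => true
  | setR _ _ _ => true
  | seq c d => c.wf && d.wf
  | ite _ c d => c.wf && d.wf
  | loop v _ c => !(c.wN.elem v) && c.wf

def size : Cmd → ℕ
  | skip => 1
  | setN _ i e => i.cost + e.cost + 1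
  | setR _ i e => i.cost + e.cost + 1
  | seq c d => c.size + d.size
  | ite b c d => b.cost + c.size + d.size
  | loop _ _ c => c.size + 25

/-- The nesting depth of the loops whose bound is of the kind `k`. -/
def deg (k : ℕ → Bool) : Cmd → ℕ
  | skip => 0
  | setN _ _ _ => 0
  | setR _ _ _ => 0
  | seq c d => max (c.deg k) (d.deg k)
  | ite _ c d => max (c.deg k) (d.deg k)
  | loop _ d c => c.deg k + if k d then 1 else 0

/-- `when gs c` runs `c` if the tests `gs` have the prescribed results. -/
def when : List (Bool × Test) → Cmd → Cmd
  | [], c => c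
  | (true, t) :: gs, c => ite t (when gs c) skip
  | (false, t) :: gs, c => ite t skip (when gs c)

/-- Sequential composition of a list of commands. -/
def block : List Cmd → Cmd
  | [] => skip
  | [c] => c
  | c :: d :: l => seq c (block (d :: l))

@[simp] theorem run_skip (f M) : skip.run f M = M := rfl
@[simp] theorem run_setN (f M a i e) :
    (setN a i e).run f M = M.setN a (i.eval M) (e.eval M) := rfl
@[simp] theorem run_setR (f M a i e) :
    (setR a i e).run f M = M.setR a (i.eval M) (e.eval f M) := rfl
@[simp] theorem run_seq (f M c d) : (seq c d).run f M = d.run f (c.run f M) := rfl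
theorem run_ite_pos {f M b c d} (h : Test.Holds f M b) : (ite b c d).run f M = c.run f M := by
  simp [run, h]
theorem run_ite_neg {f M b c d} (h : ¬ Test.Holds f M b) :
    (ite b c d).run f M = d.run f M := by
  simp [run, h]

/-- The tests have the prescribed results. -/
def Guard (f : ℕ → ℝ → ℝ) (M : Memory) : List (Bool × Test) → Prop
  | [] => True
  | (true, t) :: gs => t.Holds f M ∧ Guard f M gs
  | (false, t) :: gs => ¬ t.Holds f M ∧ Guard f M gs

theorem run_when_pos {f M c} : ∀ {gs}, Guard f M gs → (when gs c).run f M = c.run f M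
  | [], _ => rfl
  | (true, _) :: _, h => by rw [when, run_ite_pos h.1, run_when_pos h.2]
  | (false, _) :: _, h => by rw [when, run_ite_neg h.1, run_when_pos h.2]

theorem run_when_neg {f M c} : ∀ {gs}, ¬ Guard f M gs → (when gs c).run f M = M
  | [], h => absurd trivial h
  | (true, t) :: gs, h => by
    by_cases ht : t.Holds f M
    · rw [when, run_ite_pos ht, run_when_neg (fun h' => h ⟨ht, h'⟩)]
    · rw [when, run_ite_neg ht, run_skip]
  | (false, t) :: gs, h => by
    by_cases ht : t.Holds f M
    · rw [when, run_ite_pos ht, run_skip]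
    · rw [when, run_ite_neg ht, run_when_neg (fun h' => h ⟨ht, h'⟩)]

theorem run_when_true {f M c t} (h : Test.Holds f M t) :
    (when [(true, t)] c).run f M = c.run f M := run_ite_pos h

theorem run_when_false {f M c t} (h : ¬ Test.Holds f M t) :
    (when [(true, t)] c).run f M = M := run_ite_neg h

/-- Frame rule: the syntactic list of written arrays is an upper bound for what can change. In
concrete programs, membership in this list is settled by `decide` or `simp`. -/
theorem run_nat (f : ℕ → ℝ → ℝ) {c : Cmd} {a : ℕ} (M : Memory) (h : a ∉ c.wN) :
    (c.run f M).nat a = M.nat a := by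
  induction c generalizing M with
  | skip => rfl
  | setN b i e => exact M.setN_row (by simpa [wN] using h)
  | setR b i e => rfl
  | seq c d ihc ihd =>
    simp only [wN, List.mem_append, not_or] at h
    rw [run_seq, ihd _ h.2, ihc _ h.1]
  | ite b c d ihc ihd =>
    simp only [wN, List.mem_append, not_or] at h
    by_cases hb : b.Holds f M
    · rw [run_ite_pos hb, ihc _ h.1]
    · rw [run_ite_neg hb, ihd _ h.2]
  | loop v d c ih =>
    simp only [wN, List.mem_cons, not_or] at h
    have : ∀ x, (Nat.rec (motive := fun _ => Memory) (M.setN v 0 0)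
        (fun x M' => (c.run f M').setN v 0 (x + 1)) x).nat a = M.nat a := by
      intro x
      induction x with
      | zero => exact M.setN_row h.1
      | succ x ihx => exact (Memory.setN_row _ h.1).trans ((ih _ h.2).trans ihx)
    exact this _

theorem run_real (f : ℕ → ℝ → ℝ) {c : Cmd} {a : ℕ} (M : Memory) (h : a ∉ c.wR) :
    (c.run f M).real a = M.real a := by
  induction c generalizing M with
  | skip => rfl
  | setN b i e => rfl
  | setR b i e => exact M.setR_row (by simpa [wR] using h)
  | seq c d ihc ihd =>
    simp only [wR, List.mem_append, not_or] at h
    rw [run_seq, ihd _ h.2, ihc _ h.1]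
  | ite b c d ihc ihd =>
    simp only [wR, List.mem_append, not_or] at h
    by_cases hb : b.Holds f M
    · rw [run_ite_pos hb, ihc _ h.1]
    · rw [run_ite_neg hb, ihd _ h.2]
  | loop v d c ih =>
    simp only [wR] at h
    have : ∀ x, (Nat.rec (motive := fun _ => Memory) (M.setN v 0 0)
        (fun x M' => (c.run f M').setN v 0 (x + 1)) x).real a = M.real a := by
      intro x
      induction x with
      | zero => rfl
      | succ x ihx => exact (ih _ h).trans ihx
    exact this _

/-- The memories `M` and `M'` agree outside the arrays `wn` and `wr`. -/
structure SameOff (wn wr : List ℕ) (M M' : Memory) : Prop where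
  nat : ∀ a, a ∉ wn → M'.nat a = M.nat a
  real : ∀ a, a ∉ wr → M'.real a = M.real a

theorem sameOff_run (f : ℕ → ℝ → ℝ) (c : Cmd) (M : Memory) :
    SameOff c.wN c.wR M (c.run f M) :=
  ⟨fun _ h => run_nat f M h, fun _ h => run_real f M h⟩

theorem SameOff.trans {wn wr M M' M''} (h : SameOff wn wr M M') (h' : SameOff wn wr M' M'') :
    SameOff wn wr M M'' :=
  ⟨fun a ha => (h'.nat a ha).trans (h.nat a ha), fun a ha => (h'.real a ha).trans (h.real a ha)⟩

theorem SameOff.mono {wn wr wn' wr' M M'} (h : SameOff wn wr M M') (hn : wn ⊆ wn')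
    (hr : wr ⊆ wr') : SameOff wn' wr' M M' :=
  ⟨fun a ha => h.nat a fun h' => ha (hn h'), fun a ha => h.real a fun h' => ha (hr h')⟩

theorem sameOff_setN (wn wr : List ℕ) (M : Memory) {a i v : ℕ} (h : a ∈ wn) :
    SameOff wn wr M (M.setN a i v) :=
  ⟨fun _ hb => M.setN_row fun h' => hb (h' ▸ h), fun _ _ => rfl⟩

/-- An ordinary loop invariant, except that the counter is written outside the body, so the
invariant must be insensitive to cell `0` of `v`. The `SameOff` hypothesis of the step supplies all
facts about arrays that the loop never writes; they need not be part of the invariant. -/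
theorem loop_rule {f : ℕ → ℝ → ℝ} {v d : ℕ} {c : Cmd} {M : Memory} (Inv : ℕ → Memory → Prop)
    (hv : ∀ x M' y, Inv x M' → Inv x (M'.setN v 0 y)) (h0 : Inv 0 M)
    (hs : ∀ x < M.nat d 0, ∀ M', SameOff (v :: c.wN) c.wR M M' → M'.nat v 0 = x → Inv x M' →
      Inv (x + 1) (c.run f M')) :
    Inv (M.nat d 0) ((loop v d c).run f M) := by
  have key : ∀ x, x ≤ M.nat d 0 → ∃ M', (Nat.rec (motive := fun _ => Memory) (M.setN v 0 0)
        (fun x M' => (c.run f M').setN v 0 (x + 1)) x) = M' ∧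
        SameOff (v :: c.wN) c.wR M M' ∧ M'.nat v 0 = x ∧ Inv x M' := by
    intro x
    induction x with
    | zero =>
      exact fun _ => ⟨_, rfl, sameOff_setN _ _ _ (by simp), by simp, hv _ _ _ h0⟩
    | succ x ih =>
      intro hx
      obtain ⟨M', e, h1, h2, h3⟩ := ih (by omega)
      refine ⟨_, rfl, ?_, by simp, hv _ _ _ ?_⟩
      · refine (h1.trans ?_).trans (sameOff_setN _ _ _ (by simp))
        simp only [e]
        exact (sameOff_run f c M').mono (by simp) (by simp)
      · simp only [e]
        exact hs x (by omega) M' h1 h2 h3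
  obtain ⟨M', e, -, -, h⟩ := key _ le_rfl
  rw [← e] at h
  exact h

/-- The running time of a loop program, if no loop bound is overwritten: loop bounds of the kind
`k` are at most `N`, the others are at most `X`. -/
theorem runs (f : ℕ → ℝ → ℝ) (k : ℕ → Bool) {N X : ℕ} (hN : 1 ≤ N) (hX : 1 ≤ X) (c : Cmd)
    (hwf : c.wf = true) (M : Memory) (hd : ∀ d ∈ c.dims, d ∉ c.wN)
    (hM : ∀ d ∈ c.dims, M.nat d 0 ≤ if k d then N else X) :
    ∃ t ≤ c.size * (N ^ c.deg k * X ^ c.deg (fun d => !k d)),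
      Runs f c.toProgram M t (c.run f M) := by
  have pos : ∀ a b : ℕ, 1 ≤ N ^ a * X ^ b := fun a b => Nat.mul_pos (pow_pos hN a) (pow_pos hX b)
  have mono : ∀ a a' b b' : ℕ, a ≤ a' → b ≤ b' → N ^ a * X ^ b ≤ N ^ a' * X ^ b' :=
    fun a a' b b' h h' => Nat.mul_le_mul (Nat.pow_le_pow_right hN h) (Nat.pow_le_pow_right hX h')
  induction c generalizing M with
  | skip => exact ⟨1, by simp [size, deg], .skip M⟩
  | setN a i e => exact ⟨_, by simp [size, deg], .writeNat M a i e⟩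
  | setR a i e => exact ⟨_, by simp [size, deg], .writeReal M a i e⟩
  | seq c d ihc ihd =>
    simp only [wf, Bool.and_eq_true] at hwf
    simp only [dims, wN, List.mem_append, not_or] at hd hM
    obtain ⟨t, ht, h⟩ := ihc hwf.1 M (fun x hx => (hd x (.inl hx)).1) (fun x hx => hM x (.inl hx))
    obtain ⟨t', ht', h'⟩ := ihd hwf.2 (c.run f M) (fun x hx => (hd x (.inr hx)).2)
      (fun x hx => by rw [run_nat f M (hd x (.inr hx)).1]; exact hM x (.inr hx))
    refine ⟨t + t', ?_, .seq h h'⟩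
    simp only [size, deg, add_mul]
    exact add_le_add (ht.trans (Nat.mul_le_mul_left _ (mono _ _ _ _ (by simp) (by simp))))
      (ht'.trans (Nat.mul_le_mul_left _ (mono _ _ _ _ (by simp) (by simp))))
  | ite b c d ihc ihd =>
    simp only [wf, Bool.and_eq_true] at hwf
    simp only [dims, wN, List.mem_append, not_or] at hd hM
    obtain ⟨t, ht, h⟩ := ihc hwf.1 M (fun x hx => (hd x (.inl hx)).1) (fun x hx => hM x (.inl hx))
    obtain ⟨t', ht', h'⟩ := ihd hwf.2 M (fun x hx => (hd x (.inr hx)).2)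
      (fun x hx => hM x (.inr hx))
    have h1 := pos (max (c.deg k) (d.deg k))
      (max (c.deg (fun d => !k d)) (d.deg (fun d => !k d)))
    simp only [size, deg, add_mul]
    have hb := Nat.le_mul_of_pos_right b.cost h1
    have hc := ht.trans (Nat.mul_le_mul_left c.size (mono (c.deg k) (max (c.deg k) (d.deg k))
      (c.deg (fun d => !k d)) (max (c.deg (fun d => !k d)) (d.deg (fun d => !k d)))
      (by simp) (by simp)))
    have hd' := ht'.trans (Nat.mul_le_mul_left d.size (mono (d.deg k) (max (c.deg k) (d.deg k))
      (d.deg (fun d => !k d)) (max (c.deg (fun d => !k d)) (d.deg (fun d => !k d)))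
      (by simp) (by simp)))
    by_cases hb' : b.Holds f M
    · exact ⟨b.cost + t, by omega, by rw [run_ite_pos hb']; exact .ifTrue hb' h⟩
    · exact ⟨b.cost + t', by omega, by rw [run_ite_neg hb']; exact .ifFalse hb' h'⟩
  | loop v d c ih =>
    simp only [wf, Bool.and_eq_true, Bool.not_eq_true', List.elem_eq_mem,
      decide_eq_false_iff_not] at hwf
    simp only [dims, wN, List.mem_cons, not_or] at hd hM
    have hdv : d ≠ v := (hd d (.inl rfl)).1
    set B := c.size * (N ^ c.deg k * X ^ c.deg (fun d => !k d)) with hB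
    -- `it x` is the memory before round `x`. Neither the counter nor a bound is written by the
    -- body, so at `it x` the test of the while loop compares `x` with the initial bound.
    set it : ℕ → Memory := fun x => Nat.rec (motive := fun _ => Memory) (M.setN v 0 0)
        (fun x M' => (c.run f M').setN v 0 (x + 1)) x with hit
    have hsame : ∀ x, SameOff (v :: c.wN) c.wR M (it x) := by
      intro x
      induction x with
      | zero => exact sameOff_setN _ _ _ (by simp)
      | succ x ihx =>
        exact (ihx.trans ((sameOff_run f c _).mono (by simp) (by simp))).trans
          (sameOff_setN _ _ _ (by simp))
    have hval : ∀ x, (it x).nat v 0 = x := by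
      rintro (_ | x) <;> simp [hit]
    have hdim : ∀ x, ∀ e, (e = d ∨ e ∈ c.dims) → (it x).nat e = M.nat e := fun x e he =>
      (hsame x).nat e (by have := hd e he; simp [this.1, this.2])
    have step : ∀ x, ∃ t ≤ B, Runs f c.toProgram (it x) t (c.run f (it x)) := fun x =>
      ih hwf.2 (it x) (fun e he => (hd e (.inr he)).2)
        (fun e he => by rw [hdim x e (.inr he)]; exact hM e (.inr he))
    -- Induction on the number `m` of remaining rounds. A round costs 5 for the test and 6 for the
    -- increment besides its body, and the last test costs 5; the constants 13 and 6 leave some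
    -- room.
    have key : ∀ m x, x + m = M.nat d 0 → ∃ t ≤ m * (B + 13) + 6,
        Runs f (.whileDo (.ltNat (nv v) (nv d))
        (.seq c.toProgram (.writeNat v (.const 0) (.add (nv v) (.const 1))))) (it x) t
        (it (M.nat d 0)) := by
      intro m
      induction m with
      | zero =>
        intro x hx
        have hx' : x = M.nat d 0 := by omega
        rw [← hx']
        refine ⟨_, ?_, Runs.whileFalse ?_⟩
        · simp [Test.cost, NExp.cost]
        · simp [Test.Holds, NExp.eval, hval, hdim x d (.inl rfl), ← hx']
      | succ m ihm =>
        intro x hx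
        obtain ⟨t, ht, h⟩ := step x
        obtain ⟨t', ht', h'⟩ := ihm (x + 1) (by omega)
        have hw := Runs.seq h (show Runs f _ _ _ ((c.run f (it x)).setN v
          ((NExp.const 0).eval (c.run f (it x)))
          ((NExp.add (nv v) (.const 1)).eval (c.run f (it x)))) from Runs.writeNat _ _ _ _)
        have e : (c.run f (it x)).nat v 0 = x := by rw [run_nat f _ hwf.1, hval]
        have e' : (c.run f (it x)).setN v ((NExp.const 0).eval (c.run f (it x)))
            ((NExp.add (nv v) (.const 1)).eval (c.run f (it x))) = it (x + 1) := by
          simp only [NExp.eval, e]; rfl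
        rw [e'] at hw
        refine ⟨_, ?_, Runs.whileTrue ?_ hw h'⟩
        · simp only [Test.cost, NExp.cost]
          have : (m + 1) * (B + 13) = m * (B + 13) + (B + 13) := by ring
          omega
        · simp only [Test.Holds, NExp.eval, hval, hdim x d (.inl rfl)]; omega
    obtain ⟨t, ht, h⟩ := key (M.nat d 0) 0 (by omega)
    refine ⟨_, ?_, Runs.seq (Runs.writeNat M v (.const 0) (.const 0)) h⟩
    have hMd := hM d (.inl rfl)
    have hp := pos (c.deg k) (c.deg (fun d => !k d))
    -- Each round uses 13 of the 25 extra units. The other 12 of a single round pay for the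
    -- initialization of the counter and for the last test, which is why the bound `Y` has to be
    -- positive.
    have hBp : B + 25 ≤ (c.size + 25) * (N ^ c.deg k * X ^ c.deg (fun d => !k d)) := by
      rw [add_mul]; omega
    have goal : ∀ Y, 1 ≤ Y → M.nat d 0 ≤ Y →
        3 + t ≤ Y * ((c.size + 25) * (N ^ c.deg k * X ^ c.deg (fun d => !k d))) := by
      intro Y hY hle
      have h1 : M.nat d 0 * (B + 13) ≤ Y * (B + 13) := Nat.mul_le_mul_right _ hle
      have h2 := Nat.mul_le_mul_left Y hBp
      have h3 : Y * (B + 25) = Y * (B + 13) + Y * 12 := by ring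
      omega
    simp only [NExp.cost, size, deg]
    by_cases hk : k d
    · simp only [hk, if_true] at hMd ⊢
      calc _ ≤ 3 + t := by omega
        _ ≤ _ := goal N hN hMd
        _ = _ := by simp only [Bool.not_true, Bool.false_eq_true, if_false]; ring
    · simp only [hk] at hMd ⊢
      calc _ ≤ 3 + t := by omega
        _ ≤ _ := goal X hX (by simpa using hMd)
        _ = _ := by simp only [Bool.not_false, if_true]; simp; ring

end Cmd
end GPSP

namespace GPSP

/-! ### Binary digit sums -/

/-- The sum of the binary digits. -/
def popc (x : ℕ) : ℕ := (Nat.digits 2 x).sum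

@[simp] theorem popc_zero : popc 0 = 0 := by simp [popc]

theorem popc_two_mul (x : ℕ) : popc (2 * x) = popc x := by
  rcases Nat.eq_zero_or_pos x with rfl | h
  · simp
  · simp [popc, Nat.digits_def' (b := 2) (by norm_num) (show 0 < 2 * x by omega)]

theorem popc_two_mul_add_one (x : ℕ) : popc (2 * x + 1) = popc x + 1 := by
  have h : (2 * x + 1) / 2 = x := by omega
  have h' : (2 * x + 1) % 2 = 1 := by omega
  rw [popc, popc, Nat.digits_def' (by norm_num) (by omega), h, h', List.sum_cons, add_comm]

theorem popc_succ_le (x : ℕ) : popc (x + 1) ≤ popc x + 1 := by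
  induction x using Nat.strong_induction_on with
  | _ x ih =>
    obtain ⟨y, rfl | rfl⟩ := Nat.even_or_odd' x
    · rw [popc_two_mul_add_one, popc_two_mul]
    · rw [show 2 * y + 1 + 1 = 2 * (y + 1) by ring, popc_two_mul, popc_two_mul_add_one]
      have := ih y (by omega)
      omega

/-- In binary addition each carry turns two ones into one. The induction strips the last digits;
only two odd numbers produce a carry, and it is absorbed by `popc_succ_le`. -/
theorem popc_add_le (x y : ℕ) : popc (x + y) ≤ popc x + popc y := by
  induction x using Nat.strong_induction_on generalizing y with
  | _ x ih =>
    rcases Nat.eq_zero_or_pos x with rfl | hx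
    · simp
    obtain ⟨a, rfl | rfl⟩ := Nat.even_or_odd' x <;> obtain ⟨b, rfl | rfl⟩ := Nat.even_or_odd' y
    · rw [← mul_add, popc_two_mul, popc_two_mul, popc_two_mul]
      exact ih a (by omega) b
    · rw [← add_assoc, ← mul_add, popc_two_mul, popc_two_mul_add_one, popc_two_mul_add_one]
      have := ih a (by omega) b
      omega
    · rw [show 2 * a + 1 + 2 * b = 2 * (a + b) + 1 by ring, popc_two_mul, popc_two_mul_add_one,
        popc_two_mul_add_one]
      have := ih a (by omega) b
      omega
    · rw [show 2 * a + 1 + (2 * b + 1) = 2 * (a + b + 1) by ring, popc_two_mul,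
        popc_two_mul_add_one, popc_two_mul_add_one]
      have := ih a (by omega) b
      have := popc_succ_le (a + b)
      omega

theorem popc_two_pow_add {b x : ℕ} (h : x < 2 ^ b) : popc (2 ^ b + x) = popc x + 1 := by
  induction b generalizing x with
  | zero =>
    obtain rfl : x = 0 := by simpa using h
    simp [popc]
  | succ b ih =>
    rw [pow_succ] at *
    obtain ⟨a, rfl | rfl⟩ := Nat.even_or_odd' x
    · rw [mul_comm, ← mul_add, popc_two_mul, popc_two_mul, ih (by omega)]
    · rw [mul_comm, ← add_assoc, ← mul_add, popc_two_mul_add_one, popc_two_mul_add_one,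
        ih (by omega)]

theorem popc_two_pow (b : ℕ) : popc (2 ^ b) = 1 := by
  simpa using popc_two_pow_add (b := b) (x := 0) (by positivity)

theorem popc_le_of_lt_two_pow {x k : ℕ} (h : x < 2 ^ k) : popc x ≤ k := by
  induction k generalizing x with
  | zero =>
    obtain rfl : x = 0 := by simpa using h
    simp
  | succ k ih =>
    rw [pow_succ] at h
    obtain ⟨a, rfl | rfl⟩ := Nat.even_or_odd' x
    · rw [popc_two_mul]
      have := ih (x := a) (by omega)
      omega
    · rw [popc_two_mul_add_one]
      have := ih (x := a) (by omega)
      omega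

/-- Distinct powers of two are added without carries. Adding the largest exponent last keeps the
smaller part below it. -/
theorem popc_sum_two_pow (B : Finset ℕ) : popc (∑ b ∈ B, 2 ^ b) = B.card := by
  induction B using Finset.induction_on_max with
  | empty => simp
  | insert b B hb ih =>
    have hnot : b ∉ B := fun h => lt_irrefl _ (hb b h)
    rw [Finset.sum_insert hnot, Finset.card_insert_of_notMem hnot, ← ih]
    exact popc_two_pow_add (Nat.geomSum_lt le_rfl hb)

theorem popc_sum_le {ι : Type*} (J : Finset ι) (w : ι → ℕ) (hw : ∀ j, ∃ b, w j = 2 ^ b) :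
    popc (∑ j ∈ J, w j) ≤ J.card := by
  classical
  induction J using Finset.induction_on with
  | empty => simp
  | insert j J hj ih =>
    rw [Finset.sum_insert hj, Finset.card_insert_of_notMem hj]
    obtain ⟨b, hb⟩ := hw j
    have := popc_add_le (w j) (∑ j ∈ J, w j)
    rw [hb, popc_two_pow] at this
    rw [hb]
    omega

/-- A common element would contribute its power of two twice, and `2 ^ b + 2 ^ b` is one digit
instead of two. With subadditivity the digit sum would then be at most the sum of the cardinalities
minus one. -/
theorem disjoint_of_popc {ι : Type*} {J₁ J₂ : Finset ι} {w : ι → ℕ}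
    (hw : ∀ j, ∃ b, w j = 2 ^ b)
    (h : J₁.card + J₂.card ≤ popc (∑ j ∈ J₁, w j + ∑ j ∈ J₂, w j)) : Disjoint J₁ J₂ := by
  classical
  rw [Finset.disjoint_left]
  intro j h₁ h₂
  obtain ⟨b, hb⟩ := hw j
  have e : ∑ j ∈ J₁, w j + ∑ j ∈ J₂, w j =
      2 ^ (b + 1) + (∑ j ∈ J₁.erase j, w j + ∑ j ∈ J₂.erase j, w j) := by
    rw [← Finset.add_sum_erase J₁ w h₁, ← Finset.add_sum_erase J₂ w h₂, hb]; ring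
  have i₁ := popc_add_le (2 ^ (b + 1)) (∑ j ∈ J₁.erase j, w j + ∑ j ∈ J₂.erase j, w j)
  have i₂ := popc_add_le (∑ j ∈ J₁.erase j, w j) (∑ j ∈ J₂.erase j, w j)
  have i₃ := popc_sum_le (J₁.erase j) w hw
  have i₄ := popc_sum_le (J₂.erase j) w hw
  rw [Finset.card_erase_of_mem h₁] at i₃
  rw [Finset.card_erase_of_mem h₂] at i₄
  rw [popc_two_pow] at i₁
  have := Finset.card_pos.2 ⟨j, h₁⟩
  have := Finset.card_pos.2 ⟨j, h₂⟩
  rw [e] at h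
  omega

/-! ### Partial schedules -/

section Schedules

variable {n : ℕ}

/-- The total length of the pieces of a schedule. -/
noncomputable def Schedule.total (L : Schedule n) : ℝ :=
  (L.map fun x => x.finish - x.start).sum

namespace Schedule

@[simp] theorem total_nil : total ([] : Schedule n) = 0 := rfl
@[simp] theorem total_cons (x : Piece n) (L : Schedule n) :
    total (x :: L) = (x.finish - x.start) + total L := by simp [total]
@[simp] theorem total_append (L L' : Schedule n) : total (L ++ L') = total L + total L' := by
  simp [total]
@[simp] theorem work_nil (j : Fin n) : work ([] : Schedule n) j = 0 := rfl
theorem work_cons (x : Piece n) (L : Schedule n) (j : Fin n) :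
    work (x :: L) j = (if x.job = j then x.finish - x.start else 0) + work L j := by
  by_cases h : x.job = j <;> simp [work, h]
@[simp] theorem work_append (L L' : Schedule n) (j : Fin n) :
    work (L ++ L') j = work L j + work L' j := by
  simp [work]
@[simp] theorem jobs_nil : jobs ([] : Schedule n) = ∅ := rfl
@[simp] theorem jobs_append (L L' : Schedule n) : jobs (L ++ L') = jobs L ∪ jobs L' := by
  simp [jobs]
theorem mem_jobs {L : Schedule n} {j : Fin n} : j ∈ jobs L ↔ ∃ x ∈ L, x.job = j := by
  simp [jobs]
@[simp] theorem jobs_cons (x : Piece n) (L : Schedule n) :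
    jobs (x :: L) = insert x.job (jobs L) := by
  simp [jobs]

theorem work_eq_zero {L : Schedule n} {j : Fin n} (h : j ∉ jobs L) : work L j = 0 := by
  induction L with
  | nil => rfl
  | cons x L ih =>
    simp only [jobs_cons, Finset.mem_insert, not_or] at h
    rw [work_cons, if_neg (fun h' => h.1 h'.symm), ih h.2, zero_add]

theorem total_eq_sum_work (L : Schedule n) (J : Finset (Fin n)) (h : jobs L ⊆ J) :
    total L = ∑ j ∈ J, work L j := by
  induction L with
  | nil => simp
  | cons x L ih =>
    simp only [jobs_cons, Finset.insert_subset_iff] at h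
    simp [work_cons, Finset.sum_add_distrib, ih h.2, h.1]

end Schedule

/-- A sorted schedule that gives each of its jobs the required processing, has total length `e`,
whose jobs have weights that add up to `S` without carries, and whose value is at least `v`. -/
structure Instance.Good (I : Instance n) (w : ℕ → ℕ) (e : ℝ) (S : ℕ) (v : ℝ) (L : Schedule n) :
    Prop where
  nonempty_pieces : ∀ x ∈ L, x.start < x.finish
  after_release : ∀ x ∈ L, I.release x.job ≤ x.start
  sorted : L.Pairwise (fun x y => x.finish ≤ y.start)
  complete : ∀ j ∈ L.jobs, L.work j = I.proc j
  total : L.total = e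
  code : ∑ j ∈ L.jobs, w j = S
  popc : popc S = L.jobs.card
  length : L.length + 1 ≤ 2 ^ L.jobs.card
  val : ∃ c : Fin n → ℝ, (∀ x ∈ L, x.finish ≤ c x.job) ∧ v ≤ ∑ j ∈ L.jobs, I.profit j (c j)

theorem Instance.good_nil (I : Instance n) (w : ℕ → ℕ) : I.Good w 0 0 0 [] := by
  constructor <;> simp

/-- The last hypothesis excludes carries between the codes, so the job sets are disjoint; then work,
code, length and value can be treated separately on the two lists. -/
theorem Instance.Good.append {I : Instance n} {w : ℕ → ℕ} {e₁ e₂ : ℝ} {S₁ S₂ : ℕ} {v₁ v₂ : ℝ}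
    {L₁ L₂ : Schedule n} (h₁ : I.Good w e₁ S₁ v₁ L₁) (h₂ : I.Good w e₂ S₂ v₂ L₂)
    (hsep : ∀ x ∈ L₁, ∀ y ∈ L₂, x.finish ≤ y.start) (hw : ∀ j : Fin n, ∃ b, w j = 2 ^ b)
    (hp : GPSP.popc S₁ + GPSP.popc S₂ ≤ GPSP.popc (S₁ + S₂)) :
    I.Good w (e₁ + e₂) (S₁ + S₂) (v₁ + v₂) (L₁ ++ L₂) := by
  have hd : Disjoint L₁.jobs L₂.jobs := by
    apply disjoint_of_popc (w := fun j : Fin n => w j) hw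
    rw [h₁.code, h₂.code, ← h₁.popc, ← h₂.popc]
    exact hp
  have hc : (Schedule.jobs (L₁ ++ L₂)).card = L₁.jobs.card + L₂.jobs.card := by
    rw [Schedule.jobs_append, Finset.card_union_of_disjoint hd]
  constructor
  · intro x hx
    rcases List.mem_append.1 hx with h | h
    exacts [h₁.nonempty_pieces x h, h₂.nonempty_pieces x h]
  · intro x hx
    rcases List.mem_append.1 hx with h | h
    exacts [h₁.after_release x h, h₂.after_release x h]
  · exact List.pairwise_append.2 ⟨h₁.sorted, h₂.sorted, hsep⟩
  · intro j hj
    rw [Schedule.jobs_append, Finset.mem_union] at hj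
    rw [Schedule.work_append]
    rcases hj with h | h
    · rw [h₁.complete j h, Schedule.work_eq_zero (Finset.disjoint_left.1 hd h), add_zero]
    · rw [h₂.complete j h, Schedule.work_eq_zero (Finset.disjoint_right.1 hd h), zero_add]
  · rw [Schedule.total_append, h₁.total, h₂.total]
  · rw [Schedule.jobs_append, Finset.sum_union hd, h₁.code, h₂.code]
  · rw [hc, ← h₁.popc, ← h₂.popc]
    exact le_antisymm (popc_add_le _ _) hp
  -- From `a + 1 ≤ A` and `b + 1 ≤ B` follows `a + b + 1 ≤ A * B`. The summand one in the length
  -- bound makes it stable both under this product and under the doubling in `fill`.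
  · have l₁ := h₁.length
    have l₂ := h₂.length
    rw [hc, pow_add, List.length_append]
    nlinarith
  · obtain ⟨c₁, b₁, i₁⟩ := h₁.val
    obtain ⟨c₂, b₂, i₂⟩ := h₂.val
    refine ⟨fun j => if j ∈ L₁.jobs then c₁ j else c₂ j, ?_, ?_⟩
    · intro x hx
      dsimp only
      rcases List.mem_append.1 hx with h | h
      · rw [if_pos (Schedule.mem_jobs.2 ⟨x, h, rfl⟩)]
        exact b₁ x h
      · rw [if_neg (Finset.disjoint_right.1 hd (Schedule.mem_jobs.2 ⟨x, h, rfl⟩))]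
        exact b₂ x h
    · rw [Schedule.jobs_append, Finset.sum_union hd]
      refine add_le_add (i₁.trans_eq (Finset.sum_congr rfl fun j hj => ?_))
        (i₂.trans_eq (Finset.sum_congr rfl fun j hj => ?_))
      · dsimp only
        rw [if_pos hj]
      · dsimp only
        rw [if_neg (Finset.disjoint_right.1 hd hj)]

/-- The schedule that consists of the piece `[a, b)` of job `k`, if this interval is nonempty. -/
noncomputable def gap (k : Fin n) (a b : ℝ) : Schedule n := if a < b then [⟨k, a, b⟩] else []

/-- The schedule obtained from `L` by filling the gaps between `a` and `b` with job `k`. -/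
noncomputable def fill (k : Fin n) : ℝ → Schedule n → ℝ → Schedule n
  | a, [], b => gap k a b
  | a, x :: L, b => gap k a x.start ++ x :: fill k x.finish L b

theorem mem_gap {k : Fin n} {a b : ℝ} {x : Piece n} (h : x ∈ gap k a b) :
    x.job = k ∧ x.start = a ∧ x.finish = b ∧ a < b := by
  unfold gap at h
  split_ifs at h with hab
  · rw [List.mem_singleton.1 h]
    exact ⟨rfl, rfl, rfl, hab⟩
  · simp at h

theorem length_gap_le (k : Fin n) (a b : ℝ) : (gap k a b).length ≤ 1 := by
  unfold gap; split_ifs <;> simp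

theorem total_gap {k : Fin n} {a b : ℝ} (h : a ≤ b) : (gap k a b).total = b - a := by
  unfold gap
  split_ifs with h'
  · simp
  · simp; linarith

theorem work_gap_self {k : Fin n} {a b : ℝ} (h : a ≤ b) : (gap k a b).work k = b - a := by
  unfold gap
  split_ifs with h'
  · simp [Schedule.work_cons]
  · simp; linarith

theorem work_gap_ne {k j : Fin n} {a b : ℝ} (h : j ≠ k) : (gap k a b).work j = 0 :=
  Schedule.work_eq_zero fun h' => by
    obtain ⟨x, hx, rfl⟩ := Schedule.mem_jobs.1 h'
    exact h (mem_gap hx).1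

theorem mem_fill {k : Fin n} {L : Schedule n} {a b : ℝ} {x : Piece n} (h : x ∈ fill k a L b) :
    x ∈ L ∨ x.job = k ∧ x.start < x.finish := by
  induction L generalizing a with
  | nil =>
    obtain ⟨h₁, h₂, h₃, h₄⟩ := mem_gap h
    exact .inr ⟨h₁, by rw [h₂, h₃]; exact h₄⟩
  | cons y L ih =>
    simp only [fill, List.mem_append, List.mem_cons] at h
    rcases h with h | rfl | h
    · obtain ⟨h₁, h₂, h₃, h₄⟩ := mem_gap h
      exact .inr ⟨h₁, by rw [h₂, h₃]; exact h₄⟩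
    · exact .inl (by simp)
    · exact (ih h).imp (List.mem_cons_of_mem _) id

theorem subset_fill (k : Fin n) (L : Schedule n) (a b : ℝ) : L ⊆ fill k a L b := by
  induction L generalizing a with
  | nil => simp
  | cons y L ih =>
    simp only [fill]
    intro x hx
    rcases List.mem_cons.1 hx with rfl | hx
    · simp
    · simp [ih y.finish hx]

theorem length_fill_le (k : Fin n) (L : Schedule n) (a b : ℝ) :
    (fill k a L b).length ≤ 2 * L.length + 1 := by
  induction L generalizing a with
  | nil => exact length_gap_le k a b
  | cons y L ih =>
    have := length_gap_le k a y.start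
    have := ih y.finish
    simp only [fill, List.length_append, List.length_cons]
    omega

theorem work_fill_ne {k j : Fin n} (h : j ≠ k) (L : Schedule n) (a b : ℝ) :
    (fill k a L b).work j = L.work j := by
  induction L generalizing a with
  | nil => exact work_gap_ne h
  | cons y L ih => simp [fill, Schedule.work_cons, ih, work_gap_ne h]

section

variable {k : Fin n} {L : Schedule n} {a b : ℝ} (hab : a ≤ b) (hne : ∀ x ∈ L, x.start < x.finish)
  (hs : L.Pairwise (fun x y => x.finish ≤ y.start)) (ha : ∀ x ∈ L, a ≤ x.start)
  (hb : ∀ x ∈ L, x.finish ≤ b)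
include hab hne hs ha hb

theorem fill_bounds : ∀ x ∈ fill k a L b, a ≤ x.start ∧ x.finish ≤ b := by
  induction L generalizing a with
  | nil =>
    intro x hx
    obtain ⟨h₁, h₂, h₃, h₄⟩ := mem_gap hx
    exact ⟨h₂.ge, h₃.le⟩
  | cons y L ih =>
    rw [List.pairwise_cons] at hs
    simp only [List.mem_cons, forall_eq_or_imp] at hne ha hb
    intro x hx
    simp only [fill, List.mem_append, List.mem_cons] at hx
    rcases hx with h | rfl | h
    · obtain ⟨h₁, h₂, h₃, h₄⟩ := mem_gap h
      exact ⟨h₂.ge, by linarith⟩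
    · exact ⟨ha.1, hb.1⟩
    · obtain ⟨h₁, h₂⟩ := ih hb.1 hne.2 hs.2 hs.1 hb.2 x h
      exact ⟨by linarith, h₂⟩

theorem fill_sorted : (fill k a L b).Pairwise (fun x y => x.finish ≤ y.start) := by
  induction L generalizing a with
  | nil => simp only [fill, gap]; split_ifs <;> simp
  | cons y L ih =>
    rw [List.pairwise_cons] at hs
    simp only [List.mem_cons, forall_eq_or_imp] at hne ha hb
    have hB := fill_bounds (k := k) hb.1 hne.2 hs.2 hs.1 hb.2
    simp only [fill]
    refine List.pairwise_append.2 ⟨?_, List.pairwise_cons.2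
      ⟨fun z hz => (hB z hz).1, ih hb.1 hne.2 hs.2 hs.1 hb.2⟩, ?_⟩
    · simp only [gap]; split_ifs <;> simp
    · intro x hx z hz
      rw [(mem_gap hx).2.2.1]
      rcases List.mem_cons.1 hz with rfl | hz
      · exact le_rfl
      · have := (hB z hz).1
        linarith

theorem total_fill : (fill k a L b).total = b - a := by
  induction L generalizing a with
  | nil => exact total_gap hab
  | cons y L ih =>
    rw [List.pairwise_cons] at hs
    simp only [List.mem_cons, forall_eq_or_imp] at hne ha hb
    simp only [fill, Schedule.total_append, Schedule.total_cons, total_gap ha.1,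
      ih hb.1 hne.2 hs.2 hs.1 hb.2]
    ring

/-- The gaps of a sorted list inside `[a, b]` make up the length of the interval minus that of the
list. -/
theorem work_fill_self (hk : k ∉ L.jobs) : (fill k a L b).work k = b - a - L.total := by
  induction L generalizing a with
  | nil => simpa [fill] using work_gap_self hab
  | cons y L ih =>
    rw [List.pairwise_cons] at hs
    simp only [List.mem_cons, forall_eq_or_imp] at hne ha hb
    simp only [Schedule.jobs_cons, Finset.mem_insert, not_or] at hk
    simp only [fill, Schedule.work_append, Schedule.work_cons, work_gap_self ha.1,
      ih hb.1 hne.2 hs.2 hs.1 hb.2 hk.2, Schedule.total_cons, if_neg (Ne.symm hk.1)]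
    ring

end

/-- By the hypothesis on `b - a`, the idle time between `a` and `b` is exactly the processing time
of `k`, and `k` is available from `a` on. No carry means that `k` is not yet scheduled. -/
theorem Instance.Good.fill {I : Instance n} {w : ℕ → ℕ} {e : ℝ} {S : ℕ} {v : ℝ}
    {L : Schedule n} {k : Fin n} {a b : ℝ} (h : I.Good w e S v L) (hr : I.release k ≤ a)
    (hab : b - a = e + I.proc k) (ha : ∀ x ∈ L, a ≤ x.start)
    (hb : ∀ x ∈ L, x.finish ≤ b) (hw : ∀ j : Fin n, ∃ b, w j = 2 ^ b)
    (hp : GPSP.popc S + 1 ≤ GPSP.popc (S + w k)) :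
    I.Good w (e + I.proc k) (S + w k) (v + I.profit k b) (GPSP.fill k a L b) := by
  have hk : k ∉ L.jobs := by
    have : Disjoint L.jobs {k} := by
      apply disjoint_of_popc (w := fun j : Fin n => w j) hw
      rw [h.code, ← h.popc, Finset.card_singleton, Finset.sum_singleton]
      exact hp
    simpa using this
  have he : 0 ≤ e := by
    rw [← h.total]
    refine List.sum_nonneg fun x hx => ?_
    obtain ⟨y, hy, rfl⟩ := List.mem_map.1 hx
    linarith [h.nonempty_pieces y hy]
  have hpk := I.proc_pos k
  have hle : a ≤ b := by linarith
  have wk : Schedule.work (GPSP.fill k a L b) k = I.proc k := by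
    rw [work_fill_self hle h.nonempty_pieces h.sorted ha hb hk, h.total, hab]; ring
  have hj : (GPSP.fill k a L b).jobs = insert k L.jobs := by
    ext j
    rw [Finset.mem_insert]
    constructor
    · intro hj
      obtain ⟨x, hx, rfl⟩ := Schedule.mem_jobs.1 hj
      rcases mem_fill hx with h' | h'
      · exact .inr (Schedule.mem_jobs.2 ⟨x, h', rfl⟩)
      · exact .inl h'.1
    · rintro (rfl | hj)
      · by_contra hn
        rw [Schedule.work_eq_zero hn] at wk
        linarith
      · obtain ⟨x, hx, rfl⟩ := Schedule.mem_jobs.1 hj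
        exact Schedule.mem_jobs.2 ⟨x, subset_fill k L a b hx, rfl⟩
  have hB := fill_bounds (k := k) hle h.nonempty_pieces h.sorted ha hb
  obtain ⟨c, hc, hv⟩ := h.val
  constructor
  · intro x hx
    rcases mem_fill hx with h' | h'
    exacts [h.nonempty_pieces x h', h'.2]
  · intro x hx
    rcases mem_fill hx with h' | h'
    · exact h.after_release x h'
    · rw [h'.1]
      exact hr.trans (hB x hx).1
  · exact fill_sorted hle h.nonempty_pieces h.sorted ha hb
  · intro j hj'
    by_cases hjk : j = k
    · rw [hjk, wk]
    · rw [work_fill_ne hjk]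
      rw [hj, Finset.mem_insert] at hj'
      exact h.complete j (hj'.resolve_left hjk)
  · rw [total_fill hle h.nonempty_pieces h.sorted ha hb, hab]
  · rw [hj, Finset.sum_insert hk, h.code, add_comm]
  · rw [hj, Finset.card_insert_of_notMem hk, ← h.popc]
    obtain ⟨c, hc⟩ := hw k
    have := popc_add_le S (w k)
    rw [hc, popc_two_pow] at this
    rw [hc] at hp ⊢
    omega
  · have := length_fill_le k L a b
    have := h.length
    rw [hj, Finset.card_insert_of_notMem hk, pow_succ]
    omega
  -- The end `b` of the interval is recorded for `k` even if its last piece ends earlier: only upper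
  -- bounds of completion times are required.
  · refine ⟨fun j => if j = k then b else c j, fun x hx => ?_, ?_⟩
    · dsimp only
      split_ifs with hxk
      · exact (hB x hx).2
      · exact hc x ((mem_fill hx).resolve_right fun h' => hxk h'.1)
    · rw [hj, Finset.sum_insert hk]
      dsimp only
      rw [if_pos rfl, add_comm]
      gcongr
      refine hv.trans_eq (Finset.sum_congr rfl fun j hj' => ?_)
      rw [if_neg (show j ≠ k from fun h' => hk (h' ▸ hj'))]

theorem Schedule.le_completion {L : Schedule n} {x : Piece n} (hx : x ∈ L) :
    x.finish ≤ L.completion x.job := by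
  refine le_csSup ?_ ⟨x, hx, rfl, rfl⟩
  have : {t : ℝ | ∃ y ∈ L, y.job = x.job ∧ y.finish = t} ⊆
      ((L.map Piece.finish).toFinset : Set ℝ) := by
    rintro t ⟨y, hy, -, rfl⟩
    simp only [List.coe_toFinset, List.mem_map, Set.mem_ofPred_eq]
    exact ⟨y, hy, rfl⟩
  exact (Finset.bddAbove _).mono this

theorem Schedule.completion_le {L : Schedule n} {j : Fin n} {c : ℝ} (hj : j ∈ L.jobs)
    (h : ∀ x ∈ L, x.job = j → x.finish ≤ c) : L.completion j ≤ c := by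
  obtain ⟨x, hx, hxj⟩ := Schedule.mem_jobs.1 hj
  refine csSup_le ⟨_, x, hx, hxj, rfl⟩ ?_
  rintro t ⟨y, hy, hyj, rfl⟩
  exact h y hy hyj

theorem Instance.Feasible.release_le_completion {I : Instance n} {s : ℕ} {L : Schedule n}
    (h : I.Feasible s L) {j : Fin n} (hj : j ∈ L.jobs) : I.release j ≤ L.completion j := by
  obtain ⟨x, hx, rfl⟩ := Schedule.mem_jobs.1 hj
  have := Schedule.le_completion hx
  have := h.nonempty_pieces x hx
  have := h.after_release x hx
  linarith

theorem Instance.Good.feasible {I : Instance n} {w : ℕ → ℕ} {e : ℝ} {S s : ℕ} {v : ℝ}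
    {L : Schedule n} (h : I.Good w e S v L) (hs : GPSP.popc S ≤ s) : I.Feasible s L :=
  ⟨h.nonempty_pieces, h.after_release, h.sorted.imp .inl, h.complete, h.popc ▸ hs⟩

/-- True completion times are at most the recorded bounds, and profits do not increase with time;
the stored value can only underestimate. -/
theorem Instance.Good.le_value {I : Instance n} {w : ℕ → ℕ} {e : ℝ} {S : ℕ} {v : ℝ}
    {L : Schedule n} (h : I.Good w e S v L) : v ≤ I.value L := by
  obtain ⟨c, hc, hv⟩ := h.val
  refine hv.trans (Finset.sum_le_sum fun j hj => ?_)
  have h₀ := ((h.feasible le_rfl).release_le_completion hj)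
  have h₁ := I.release_nonneg j
  have h₂ := Schedule.completion_le hj (c := c j) fun x hx hxj => hxj ▸ hc x hx
  exact I.profit_antitoneOn j (h₁.trans h₀) ((h₁.trans h₀).trans h₂) h₂

/-! ### Feasible schedules satisfy the interval condition -/

/-- The pieces are pairwise disjoint half-open intervals inside `[a, b]`, listed in arbitrary order,
so their total length is the Lebesgue measure of their union. -/
theorem Schedule.total_le {L : Schedule n} {a b : ℝ} (hab : a ≤ b)
    (hL : L.Pairwise (fun x y => x.finish ≤ y.start ∨ y.finish ≤ x.start))
    (h : ∀ x ∈ L, a ≤ x.start ∧ x.start < x.finish ∧ x.finish ≤ b) : L.total ≤ b - a := by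
  have key : MeasureTheory.volume (⋃ x ∈ L, Set.Ico x.start x.finish) =
      ENNReal.ofReal L.total ∧ 0 ≤ L.total := by
    induction L with
    | nil => simp
    | cons x L ih =>
      rw [List.pairwise_cons] at hL
      simp only [List.mem_cons, forall_eq_or_imp] at h
      obtain ⟨i₁, i₂⟩ := ih hL.2 h.2
      have hm : MeasurableSet (⋃ x ∈ L, Set.Ico x.start x.finish) := by
        refine MeasurableSet.biUnion (Set.Finite.countable ?_) fun y _ => measurableSet_Ico
        exact (List.finite_toSet L)
      have hd : Disjoint (Set.Ico x.start x.finish) (⋃ x ∈ L, Set.Ico x.start x.finish) := by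
        simp only [Set.disjoint_iUnion_right]
        intro y hy
        rw [Set.disjoint_left]
        rintro t ⟨h₁, h₂⟩ ⟨h₃, h₄⟩
        rcases hL.1 y hy with h' | h' <;> linarith
      have hx : 0 ≤ x.finish - x.start := by linarith [h.1.2.1]
      constructor
      · simp only [List.mem_cons, Set.iUnion_iUnion_eq_or_left]
        rw [MeasureTheory.measure_union hd hm, i₁, Real.volume_Ico, Schedule.total_cons,
          ENNReal.ofReal_add hx i₂]
      · rw [Schedule.total_cons]; linarith
  have hsub : (⋃ x ∈ L, Set.Ico x.start x.finish) ⊆ Set.Icc a b := by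
    refine Set.iUnion₂_subset fun x hx t ht => ?_
    obtain ⟨h₁, h₂, h₃⟩ := h x hx
    exact ⟨h₁.trans ht.1, ht.2.le.trans h₃⟩
  have := MeasureTheory.measure_mono (μ := MeasureTheory.volume) hsub
  rw [key.1, Real.volume_Icc] at this
  exact (ENNReal.ofReal_le_ofReal_iff (by linarith)).1 this

/-- The interval condition: all processing of jobs that are released at or after `a` and completed
by `b` takes place between `a` and `b`. -/
theorem Instance.Feasible.add_sum_proc_le {I : Instance n} {s : ℕ} {L : Schedule n}
    (h : I.Feasible s L) {J : Finset (Fin n)} (hJ : J ⊆ L.jobs) {a b : ℝ} (hne : J.Nonempty)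
    (ha : ∀ j ∈ J, a ≤ I.release j) (hb : ∀ j ∈ J, L.completion j ≤ b) :
    a + ∑ j ∈ J, I.proc j ≤ b := by
  classical
  set L' : Schedule n := L.filter (fun x => x.job ∈ J)
  have hmem : ∀ x ∈ L', x ∈ L ∧ x.job ∈ J := fun x hx => by simpa [L'] using hx
  have hwork : ∀ j ∈ J, L'.work j = I.proc j := by
    intro j hj
    rw [← h.complete j (hJ hj), Schedule.work, Schedule.work, List.filter_filter]
    congr 2
    refine List.filter_congr fun x _ => ?_
    by_cases hx : x.job = j
    · simp [hx, hj]
    · simp [hx]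
  have htot : L'.total = ∑ j ∈ J, I.proc j := by
    rw [Schedule.total_eq_sum_work L' J, Finset.sum_congr rfl hwork]
    intro j hj
    obtain ⟨x, hx, rfl⟩ := Schedule.mem_jobs.1 hj
    exact (hmem x hx).2
  obtain ⟨j, hj⟩ := hne
  have hab : a ≤ b := (ha j hj).trans ((h.release_le_completion (hJ hj)).trans (hb j hj))
  have := Schedule.total_le (L := L') hab (h.one_at_a_time.filter _) fun x hx => by
    obtain ⟨h₁, h₂⟩ := hmem x hx
    exact ⟨(ha _ h₂).trans (h.after_release x h₁), h.nonempty_pieces x h₁,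
      (Schedule.le_completion h₁).trans (hb _ h₂)⟩
  rw [htot] at this
  linarith

/-! ### Decomposition into blocks -/

/-- A set of jobs to be processed without interruption from `start` on, with value `val`. -/
structure Segment (n : ℕ) where
  start : ℝ
  jobs : Finset (Fin n)
  val : ℝ

namespace Instance

variable (I : Instance n)

/-- The total processing time of a set of jobs. -/
def len (J : Finset (Fin n)) : ℝ := ∑ j ∈ J, I.proc j

theorem len_nonneg (J : Finset (Fin n)) : 0 ≤ I.len J :=
  Finset.sum_nonneg fun j _ => (I.proc_pos j).le

theorem len_pos {J : Finset (Fin n)} (h : J.Nonempty) : 0 < I.len J :=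
  Finset.sum_pos (fun j _ => I.proc_pos j) h

theorem len_union {J J' : Finset (Fin n)} (h : Disjoint J J') :
    I.len (J ∪ J') = I.len J + I.len J' := Finset.sum_union h

theorem len_insert {J : Finset (Fin n)} {k : Fin n} (h : k ∉ J) :
    I.len (insert k J) = I.proc k + I.len J := Finset.sum_insert h

/-- The end of a segment. -/
def fin (b : Segment n) : ℝ := b.start + I.len b.jobs

end Instance

/-- The jobs of a list of segments. -/
def allJobs (l : List (Segment n)) : Finset (Fin n) := l.foldr (fun b J => b.jobs ∪ J) ∅

/-- The total value of a list of segments. -/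
def allVal (l : List (Segment n)) : ℝ := (l.map Segment.val).sum

@[simp] theorem allJobs_nil : allJobs ([] : List (Segment n)) = ∅ := rfl
@[simp] theorem allJobs_cons (b : Segment n) (l) : allJobs (b :: l) = b.jobs ∪ allJobs l := rfl
@[simp] theorem allJobs_append (l l' : List (Segment n)) :
    allJobs (l ++ l') = allJobs l ∪ allJobs l' := by
  induction l with
  | nil => simp
  | cons b l ih => simp [ih, Finset.union_assoc]
@[simp] theorem allVal_nil : allVal ([] : List (Segment n)) = 0 := rfl
@[simp] theorem allVal_cons (b : Segment n) (l) : allVal (b :: l) = b.val + allVal l := by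
  simp [allVal]
@[simp] theorem allVal_append (l l' : List (Segment n)) :
    allVal (l ++ l') = allVal l + allVal l' := by simp [allVal]

/-- A list of nonempty segments with disjoint job sets, one after the other, from `a` on, each
starting at a release date. -/
def Instance.Chain (I : Instance n) : ℝ → List (Segment n) → Prop
  | _, [] => True
  | a, b :: l => a ≤ b.start ∧ (∃ j, I.release j = b.start) ∧ b.jobs.Nonempty ∧
      Disjoint b.jobs (allJobs l) ∧ I.Chain (I.fin b) l

/-- Job sets that can be processed without interruption from time `a` on: in the remaining time of
a smaller set and a chain of such sets, a job of lowest priority is processed. -/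
inductive Instance.Blk (I : Instance n) : ℝ → Finset (Fin n) → ℝ → Prop
  | empty (a : ℝ) : Blk I a ∅ 0
  | step {a : ℝ} {J : Finset (Fin n)} {v : ℝ} {l : List (Segment n)} {k : Fin n} {C : ℝ}
      (hJ : Blk I a J v) (hl : ∀ b ∈ l, Blk I b.start b.jobs b.val)
      (hchain : I.Chain (a + I.len J) l) (hgt : ∀ b ∈ l, a < b.start)
      (hfin : ∀ b ∈ l, I.fin b ≤ C) (hC : C = a + I.len J + I.len (allJobs l) + I.proc k)
      (hd : Disjoint J (allJobs l)) (hk : k ∉ J ∪ allJobs l) (hr : I.release k ≤ a + I.len J) :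
      Blk I a (insert k (J ∪ allJobs l)) (v + allVal l + I.profit k C)

namespace Instance

variable {I : Instance n}

theorem Chain.le_start {a : ℝ} {l : List (Segment n)} (h : I.Chain a l) :
    ∀ b ∈ l, a ≤ b.start := by
  induction l generalizing a with
  | nil => simp
  | cons b l ih =>
    intro c hc
    rcases List.mem_cons.1 hc with rfl | hc
    · exact h.1
    · have h₁ := ih h.2.2.2.2 c hc
      have h₂ := h.1
      have h₃ := I.len_nonneg b.jobs
      unfold Instance.fin at h₁
      linarith

/-- Think of a low-priority job that would end at `C` if the chain were absent. Each block that
starts before the current end delays this end by its own length; the first block that starts at or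
after the current end stops the process. The absorbed blocks are `l₁`, and the final end is `C` plus
their total length. -/
theorem Chain.absorb {a C : ℝ} {l : List (Segment n)} (h : I.Chain a l) (haC : a ≤ C) :
    ∃ l₁ l₂, l = l₁ ++ l₂ ∧ I.Chain a l₁ ∧ (∀ b ∈ l₁, I.fin b ≤ C + I.len (allJobs l₁)) ∧
      I.Chain (C + I.len (allJobs l₁)) l₂ ∧ Disjoint (allJobs l₁) (allJobs l₂) := by
  induction l generalizing a C with
  | nil => exact ⟨[], [], rfl, trivial, by simp, trivial, by simp⟩
  | cons b l ih =>
    by_cases hb : C ≤ b.start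
    · exact ⟨[], b :: l, rfl, trivial, by simp, ⟨by simpa [Instance.len] using hb, h.2⟩, by simp⟩
    · push Not at hb
      obtain ⟨h₁, h₂, h₃, h₄, h₅⟩ := h
      have hf : I.fin b ≤ C + I.len b.jobs := by unfold Instance.fin; linarith
      obtain ⟨l₁, l₂, rfl, g₁, g₂, g₃, g₄⟩ := ih h₅ hf
      simp only [allJobs_append, Finset.disjoint_union_right] at h₄
      have e : C + I.len (allJobs (b :: l₁)) = C + I.len b.jobs + I.len (allJobs l₁) := by
        rw [allJobs_cons, I.len_union h₄.1]; ring
      refine ⟨b :: l₁, l₂, rfl, ⟨h₁, h₂, h₃, h₄.1, g₁⟩, ?_, e ▸ g₃, ?_⟩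
      · rw [e]
        intro c hc
        rcases List.mem_cons.1 hc with rfl | hc
        · have := I.len_nonneg (allJobs l₁)
          linarith
        · exact g₂ c hc
      · rw [allJobs_cons, Finset.disjoint_union_left]
        exact ⟨h₄.2, g₄⟩

/-- A segment is derivable and its jobs are not released before its start. -/
def Ok (I : Instance n) (b : Segment n) : Prop :=
  I.Blk b.start b.jobs b.val ∧ ∀ j ∈ b.jobs, b.start ≤ I.release j

/-- Inserts the job `k` of lowest priority behind the block `J`, in which or at whose end it is
released. It runs in the idle time from the end of `J` on, and the blocks it swallows merge with `J`
and `k` into one block from `a` on. The case `J = ∅` creates a new block at the release date of `k`.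
The number `d` is the completion time of `k` in the schedule to be beaten, and `hdl` is the interval
condition for it. -/
theorem insert_at {a lo d v : ℝ} {J : Finset (Fin n)} {l : List (Segment n)} {k : Fin n}
    (hJ : I.Blk a J v) (hrel : ∀ j ∈ J, a ≤ I.release j) (hl : ∀ b ∈ l, I.Ok b)
    (hchain : I.Chain (a + I.len J) l) (hgt : ∀ b ∈ l, a < b.start)
    (hd : Disjoint J (allJobs l)) (hk : k ∉ J ∪ allJobs l) (hr : I.release k ≤ a + I.len J)
    (har : a ≤ I.release k) (hlo : lo ≤ a) (hst : ∃ j, I.release j = a)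
    (hdl : ∀ J' ⊆ insert k (J ∪ allJobs l), k ∈ J' → (∀ j ∈ J', a ≤ I.release j) →
      a + I.len J' ≤ d) :
    ∃ l', I.Chain lo l' ∧ (∀ b ∈ l', I.Ok b) ∧ allJobs l' = insert k (J ∪ allJobs l) ∧
      v + allVal l + I.profit k d ≤ allVal l' := by
  have hpk := I.proc_pos k
  obtain ⟨l₁, l₂, rfl, g₁, g₂, g₃, g₄⟩ := hchain.absorb (C := a + I.len J + I.proc k)
    (by linarith)
  simp only [List.mem_append, or_imp, forall_and] at hl hgt
  simp only [allJobs_append, Finset.mem_union, not_or, Finset.disjoint_union_right] at hk hd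
  have hk₁ : k ∉ J ∪ allJobs l₁ := by simp [hk.1, hk.2.1]
  set C := a + I.len J + I.len (allJobs l₁) + I.proc k with hC
  have eC : a + I.len J + I.proc k + I.len (allJobs l₁) = C := by rw [hC]; ring
  rw [eC] at g₂ g₃
  have hlen : I.len (insert k (J ∪ allJobs l₁)) = C - a := by
    rw [I.len_insert hk₁, I.len_union hd.1, hC]; ring
  have hrel₁ : ∀ j ∈ insert k (J ∪ allJobs l₁), a ≤ I.release j := by
    intro j hj
    simp only [Finset.mem_insert, Finset.mem_union] at hj
    rcases hj with rfl | hj | hj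
    · exact har
    · exact hrel j hj
    · have : ∀ l : List (Segment n), (∀ b ∈ l, I.Ok b) → (∀ b ∈ l, a < b.start) →
          j ∈ allJobs l → a ≤ I.release j := by
        intro l
        induction l with
        | nil => simp
        | cons b l ih =>
          intro h₁ h₂ hj
          simp only [List.mem_cons, forall_eq_or_imp] at h₁ h₂
          rw [allJobs_cons, Finset.mem_union] at hj
          rcases hj with hj | hj
          · exact h₂.1.le.trans (h₁.1.2 j hj)
          · exact ih h₁.2 h₂.2 hj
      exact this l₁ hl.1 hgt.1 hj
  -- The merged block fills the time from `a` to `C` with jobs that are all released at or after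
  -- `a`, so the interval condition for exactly this set gives the bound. Hence the profit of `k` at
  -- `C` is at least the one at `d`.
  have hCd : C ≤ d := by
    have := hdl (insert k (J ∪ allJobs l₁)) (by
      rw [allJobs_append, ← Finset.union_assoc]
      exact Finset.insert_subset_insert _ Finset.subset_union_left) (by simp) hrel₁
    rw [hlen] at this
    linarith
  have hC0 : 0 ≤ C := by
    have := I.release_nonneg k
    have := I.len_nonneg (allJobs l₁)
    linarith
  refine ⟨⟨a, insert k (J ∪ allJobs l₁), v + allVal l₁ + I.profit k C⟩ :: l₂,
    ⟨hlo, hst, by simp, ?_, ?_⟩, ?_, ?_, ?_⟩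
  · simp only [Finset.disjoint_insert_left, Finset.disjoint_union_left]
    exact ⟨hk.2.2, hd.2, g₄⟩
  · have : I.fin ⟨a, insert k (J ∪ allJobs l₁), v + allVal l₁ + I.profit k C⟩ = C := by
      unfold Instance.fin
      rw [hlen]; ring
    rw [this]
    exact g₃
  · intro b hb
    rcases List.mem_cons.1 hb with rfl | hb
    · exact ⟨.step hJ (fun b hb => (hl.1 b hb).1) g₁ hgt.1 g₂ hC hd.1 hk₁ hr, hrel₁⟩
    · exact hl.2 b hb
  · simp [Finset.union_assoc]
  · have := I.profit_antitoneOn k hC0 (hC0.trans hCd) hCd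
    simp only [allVal_append, allVal_cons]
    linarith

/-- The place of `k` depends on its release date relative to the first block: after its end, pass to
the rest of the chain; between its start and its end, enlarge this block; before its start, open a
new block at the release date of `k`, which may swallow the following ones. -/
theorem Chain.insert {lo d : ℝ} {l : List (Segment n)} {k : Fin n} (h : I.Chain lo l)
    (hl : ∀ b ∈ l, I.Ok b) (hlo : lo ≤ I.release k) (hk : k ∉ allJobs l)
    (hdl : ∀ a, ∀ J' ⊆ insert k (allJobs l), k ∈ J' → (∀ j ∈ J', a ≤ I.release j) →
      a + I.len J' ≤ d) :
    ∃ l', I.Chain lo l' ∧ (∀ b ∈ l', I.Ok b) ∧ allJobs l' = insert k (allJobs l) ∧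
      allVal l + I.profit k d ≤ allVal l' := by
  have len0 : I.len ∅ = 0 := by simp [Instance.len]
  induction l generalizing lo with
  | nil =>
    simpa using insert_at (I := I) (a := I.release k) (lo := lo) (d := d) (v := 0) (J := ∅)
      (l := []) (k := k) (.empty _) (by simp) (by simp) trivial (by simp) (by simp) (by simp)
      (by rw [len0]; simp) le_rfl hlo ⟨k, rfl⟩
      (fun J' hJ' hkJ hj => hdl _ J' (by simpa using hJ') hkJ hj)
  | cons b l ih =>
    have hl' := hl
    simp only [List.mem_cons, forall_eq_or_imp] at hl
    rw [allJobs_cons, Finset.mem_union, not_or] at hk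
    obtain ⟨h₁, h₂, h₃, h₄, h₅⟩ := h
    have hpos := I.len_pos h₃
    by_cases hfb : I.fin b < I.release k
    · obtain ⟨l', g₁, g₂, g₃, g₄⟩ := ih h₅ hl.2 hfb.le hk.2 fun a J' hJ' => hdl a J'
        (hJ'.trans (Finset.insert_subset_insert _ (by simp)))
      refine ⟨b :: l', ⟨h₁, h₂, h₃, ?_, g₁⟩, ?_, ?_, ?_⟩
      · rw [g₃, Finset.disjoint_insert_right]
        exact ⟨hk.1, h₄⟩
      · simp only [List.mem_cons, forall_eq_or_imp]
        exact ⟨hl.1, g₂⟩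
      · rw [allJobs_cons, g₃, allJobs_cons, Finset.union_insert]
      · simp only [allVal_cons]; linarith
    · push Not at hfb
      by_cases hb : b.start ≤ I.release k
      · have := insert_at (lo := lo) (d := d) hl.1.1 hl.1.2 hl.2 h₅ (fun c hc => by
          have := h₅.le_start c hc
          unfold Instance.fin at this
          linarith) h₄ (by simp [hk.1, hk.2]) hfb hb h₁ h₂ (hdl _)
        simpa using this
      · push Not at hb
        simpa using insert_at (I := I) (a := I.release k) (lo := lo) (d := d) (v := 0) (J := ∅)
          (l := b :: l) (k := k) (.empty _) (by simp) hl'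
          ⟨by rw [len0]; linarith, h₂, h₃, h₄, h₅⟩
          (by
            intro c hc
            rcases List.mem_cons.1 hc with rfl | hc
            · exact hb
            · have := h₅.le_start c hc
              unfold Instance.fin at this
              linarith) (by simp) (by simp [hk.1, hk.2]) (by rw [len0]; simp) le_rfl hlo ⟨k, rfl⟩
          (fun J' hJ' hkJ hj => hdl _ J' (by simpa using hJ') hkJ hj)

/-- Jobs are inserted in the order of their completion times in `L`. The newly inserted job has the
largest one so far, so each set that contains it satisfies the interval condition with that
completion time as its right end. -/
theorem Feasible.exists_chain {s : ℕ} {L : Schedule n} (h : I.Feasible s L) :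
    ∃ l, I.Chain 0 l ∧ (∀ b ∈ l, I.Ok b) ∧ allJobs l = L.jobs ∧ I.value L ≤ allVal l := by
  suffices H : ∀ J ⊆ L.jobs, ∃ l, I.Chain 0 l ∧ (∀ b ∈ l, I.Ok b) ∧ allJobs l = J ∧
      ∑ j ∈ J, I.profit j (L.completion j) ≤ allVal l from H _ (Finset.Subset.refl _)
  intro J
  induction J using Finset.induction_on_max_value L.completion with
  | empty => exact fun _ => ⟨[], trivial, by simp, rfl, by simp⟩
  | insert k J hk hmax ih =>
    intro hJ
    obtain ⟨l, h₁, h₂, h₃, h₄⟩ := ih ((Finset.subset_insert _ _).trans hJ)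
    obtain ⟨l', g₁, g₂, g₃, g₄⟩ := h₁.insert (d := L.completion k) h₂ (I.release_nonneg k)
      (h₃ ▸ hk) fun a J' hJ' hkJ hj => by
        rw [h₃] at hJ'
        refine h.add_sum_proc_le (hJ'.trans hJ) ⟨k, hkJ⟩ hj fun j hj' => ?_
        rcases Finset.mem_insert.1 (hJ' hj') with rfl | h'
        · exact le_rfl
        · exact hmax j h'
    refine ⟨l', g₁, g₂, h₃ ▸ g₃, ?_⟩
    rw [Finset.sum_insert hk]
    linarith

end Instance

end Schedules

end GPSP

namespace GPSP

/-! ### Hashing -/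

/-- Multiplicative hashing with multiplier `a` modulo `p` into `m` buckets. -/
def hsh (a y p m : ℕ) : ℕ := a * y % p % m

/-- The pairs of distinct elements of `U` in the same bucket. -/
def collisions (a p m : ℕ) (U : Finset ℕ) : Finset (ℕ × ℕ) :=
  U.offDiag.filter fun z => hsh a z.1 p m = hsh a z.2 p m

/-- For a colliding multiplier `a`, the difference `δ a` of the two residues is a nonzero multiple
of `m` of absolute value less than `p`; there are at most `2 * ((p - 1) / m)` of these. Modulo `p`
it is `a * (x - y)`, so it determines `a`. -/
theorem card_colliding_multipliers {p m x y : ℕ} (hp : p.Prime) (hm : 0 < m) (hx : x < p)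
    (hy : y < p) (hxy : x ≠ y) :
    m * ((Finset.Ico 1 p).filter fun a => hsh a x p m = hsh a y p m).card ≤ 2 * (p - 1) := by
  set F := (Finset.Ico 1 p).filter fun a => hsh a x p m = hsh a y p m
  set δ : ℕ → ℤ := fun a => ((a * x % p : ℕ) : ℤ) - ((a * y % p : ℕ) : ℤ)
  set q := (p - 1) / m
  have hpp := hp.pos
  have hδ : ∀ a, ((p : ℤ) ∣ δ a - a * ((x : ℤ) - y)) := by
    intro a
    have h₁ : (p : ℤ) ∣ (a * x : ℕ) - ((a * x % p : ℕ) : ℤ) := by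
      push_cast
      exact Int.dvd_self_sub_emod
    have h₂ : (p : ℤ) ∣ (a * y : ℕ) - ((a * y % p : ℕ) : ℤ) := by
      push_cast
      exact Int.dvd_self_sub_emod
    have e : δ a - a * ((x : ℤ) - y) = ((a * y : ℕ) - ((a * y % p : ℕ) : ℤ)) -
        ((a * x : ℕ) - ((a * x % p : ℕ) : ℤ)) := by
      simp only [δ, Nat.cast_mul]
      ring
    rw [e]
    exact dvd_sub h₂ h₁
  have hxy' : ¬ (p : ℤ) ∣ (x : ℤ) - y := by
    intro h
    have h3 := Int.eq_zero_of_abs_lt_dvd h (by rw [abs_lt]; constructor <;> omega)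
    omega
  have hinj : Set.InjOn δ F := by
    intro a ha b hb hab
    have ha' := (Finset.mem_Ico.1 (Finset.mem_filter.1 ha).1)
    have hb' := (Finset.mem_Ico.1 (Finset.mem_filter.1 hb).1)
    have h := dvd_sub (hδ b) (hδ a)
    rw [hab] at h
    have h' : (p : ℤ) ∣ ((a : ℤ) - b) * ((x : ℤ) - y) := by
      have e : ((a : ℤ) - b) * ((x : ℤ) - y) =
          δ b - b * ((x : ℤ) - y) - (δ b - a * ((x : ℤ) - y)) := by ring
      rw [e]
      exact h
    rcases (Nat.prime_iff_prime_int.1 hp).dvd_or_dvd h' with h | h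
    · have h3 := Int.eq_zero_of_abs_lt_dvd h (by rw [abs_lt]; constructor <;> omega)
      omega
    · exact absurd h hxy'
  have hmap : ∀ a ∈ F, δ a ∈ ((Finset.Icc (-(q : ℤ)) q).erase 0).image (fun k => (m : ℤ) * k) := by
    intro a ha
    obtain ⟨h₁, h₂⟩ := Finset.mem_filter.1 ha
    have h₁ := Finset.mem_Ico.1 h₁
    have hd : (m : ℤ) ∣ δ a := by
      have : ((a * x % p : ℕ) : ℤ) % m = ((a * y % p : ℕ) : ℤ) % m := by exact_mod_cast h₂
      exact Int.ModEq.dvd (Int.ModEq.symm this)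
    obtain ⟨k, hk⟩ := hd
    have hne : δ a ≠ 0 := by
      intro h0
      have h := hδ a
      rw [h0, zero_sub, dvd_neg] at h
      rcases (Nat.prime_iff_prime_int.1 hp).dvd_or_dvd h with h | h
      · have := Int.eq_zero_of_abs_lt_dvd h (by rw [abs_lt]; constructor <;> omega)
        omega
      · exact absurd h hxy'
    have hlt : |δ a| ≤ (p : ℤ) - 1 := by
      have i₁ := Nat.mod_lt (a * x) hpp
      have i₂ := Nat.mod_lt (a * y) hpp
      simp only [δ]
      rw [abs_le]
      constructor <;> omega
    have hkq : k.natAbs ≤ q := by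
      rw [Nat.le_div_iff_mul_le hm]
      have : (k.natAbs : ℤ) * m ≤ (p : ℤ) - 1 := by
        rw [← Int.abs_eq_natAbs]
        rw [hk, abs_mul, Nat.abs_cast] at hlt
        linarith
      zify [hp.one_le]
      simpa using this
    refine Finset.mem_image.2 ⟨k, Finset.mem_erase.2 ⟨?_, Finset.mem_Icc.2 ?_⟩, hk.symm⟩
    · rintro rfl
      exact hne (by simpa using hk)
    · omega
  have hcard : F.card ≤ 2 * q := by
    refine (Finset.card_le_card_of_injOn δ hmap hinj).trans (Finset.card_image_le.trans ?_)
    rw [Finset.card_erase_of_mem (by simp), Int.card_Icc]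
    omega
  have := Nat.mul_div_le (p - 1) m
  calc m * F.card ≤ m * (2 * q) := Nat.mul_le_mul_left _ hcard
    _ = 2 * (m * q) := by ring
    _ ≤ _ := by simp only [q]; omega

/-- Averaging over all multipliers: sum the previous bound over the ordered pairs of distinct
elements of `U` and pick a multiplier that is not worse than the mean. -/
theorem exists_few_collisions {p m : ℕ} (hp : p.Prime) (hm : 0 < m) {U : Finset ℕ}
    (hU : ∀ y ∈ U, y < p) :
    ∃ a < p, m * (collisions a p m U).card ≤ 2 * (U.card * U.card) := by
  have hsum : ∑ a ∈ Finset.Ico 1 p, m * (collisions a p m U).card ≤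
      ∑ _a ∈ Finset.Ico 1 p, 2 * (U.card * U.card) := by
    have e : ∑ a ∈ Finset.Ico 1 p, (collisions a p m U).card = ∑ z ∈ U.offDiag,
        ((Finset.Ico 1 p).filter fun a => hsh a z.1 p m = hsh a z.2 p m).card := by
      simp only [collisions, Finset.card_filter]
      exact Finset.sum_comm
    rw [← Finset.mul_sum, e, Finset.mul_sum]
    calc _ ≤ ∑ z ∈ U.offDiag, 2 * (p - 1) := by
          refine Finset.sum_le_sum fun z hz => ?_
          obtain ⟨h₁, h₂, h₃⟩ := Finset.mem_offDiag.1 hz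
          exact card_colliding_multipliers hp hm (hU _ h₁) (hU _ h₂) h₃
      _ = (U.card * U.card - U.card) * (2 * (p - 1)) := by
          simp [Finset.offDiag_card]
      _ ≤ (U.card * U.card) * (2 * (p - 1)) := Nat.mul_le_mul_right _ (Nat.sub_le _ _)
      _ = _ := by simp; ring
  obtain ⟨a, ha, h⟩ := Finset.exists_le_of_sum_le (by simpa using hp.one_lt) hsum
  exact ⟨a, (Finset.mem_Ico.1 ha).2, h⟩

/-- For this size of the range, the bound on the number of collisions is less than one. -/
theorem exists_hsh_injOn {p m : ℕ} (hp : p.Prime) {U : Finset ℕ}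
    (hU : ∀ y ∈ U, y < p) (hm : 2 * (U.card * U.card) < m) :
    ∃ a < p, Set.InjOn (fun y => hsh a y p m) U := by
  obtain ⟨a, ha, h⟩ := exists_few_collisions hp (by omega : 0 < m) hU
  refine ⟨a, ha, fun x hx y hy hxy => ?_⟩
  by_contra hne
  have : 0 < (collisions a p m U).card :=
    Finset.card_pos.2 ⟨(x, y), Finset.mem_filter.2 ⟨Finset.mem_offDiag.2 ⟨hx, hy, hne⟩, hxy⟩⟩
  have := Nat.le_mul_of_pos_right m this
  omega

/-- The colour of `y`: the buckets of level `t` have the numbers from `2 ^ t` to `2 ^ (t + 1) - 1`;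
the colour is the first bucket, from the highest level down, that is not marked by `B`. -/
def col (p : ℕ) (as : ℕ → ℕ) (B : ℕ → ℕ) : ℕ → ℕ → ℕ
  | 0, _ => 0
  | t + 1, y => if 0 < B (2 ^ t + hsh (as t) y p (2 ^ t)) then col p as B t y
      else 2 ^ t + hsh (as t) y p (2 ^ t)

theorem bucket_lt (a y p t : ℕ) : 2 ^ t + hsh a y p (2 ^ t) < 2 ^ (t + 1) := by
  have : hsh a y p (2 ^ t) < 2 ^ t := Nat.mod_lt _ (by positivity)
  rw [pow_succ]
  omega

theorem col_lt (p : ℕ) (as B : ℕ → ℕ) (t y : ℕ) : col p as B t y < 2 ^ t := by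
  induction t with
  | zero => simp [col]
  | succ t ih =>
    rw [col]
    split_ifs
    · rw [pow_succ]; omega
    · exact bucket_lt _ _ _ _

theorem col_congr {p : ℕ} {as as' B B' : ℕ → ℕ} {t : ℕ} (y : ℕ) (h : ∀ i < t, as i = as' i)
    (hB : ∀ b < 2 ^ t, B b = B' b) : col p as B t y = col p as' B' t y := by
  induction t with
  | zero => rfl
  | succ t ih =>
    rw [col, col, ih (fun i hi => h i (by omega)) (fun b hb => hB b (by rw [pow_succ]; omega)),
      h t (by omega), hB _ (bucket_lt _ _ _ _)]

/-- At the top level at least four buckets per element are available. A good multiplier leaves at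
most half of the elements in collisions; exactly their buckets are marked, and they go on to the
next level, where the number of buckets is also halved. Elements without collision keep their
bucket, and buckets of different levels have different numbers. So linearly many colours suffice. -/
theorem exists_col_injOn {p : ℕ} (hp : p.Prime) (t : ℕ) (U : Finset ℕ) (hU : ∀ y ∈ U, y < p)
    (h : 8 * U.card ≤ 2 ^ t) :
    ∃ as B : ℕ → ℕ, (∀ i, as i < p) ∧ (∀ b, B b < 2) ∧ Set.InjOn (col p as B t) U := by
  induction t generalizing U with
  | zero =>
    have : U = ∅ := Finset.card_eq_zero.1 (by rw [pow_zero] at h; omega)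
    exact ⟨fun _ => 0, fun _ => 0, fun _ => hp.pos, fun _ => by norm_num, by simp [this]⟩
  | succ t ih =>
    rw [pow_succ] at h
    obtain ⟨a, ha, hcoll⟩ := exists_few_collisions hp (show 0 < 2 ^ t by positivity) hU
    set g : ℕ → ℕ := fun y => hsh a y p (2 ^ t)
    set U' := U.filter fun y => ∃ x ∈ U, x ≠ y ∧ g x = g y
    have hc' : U'.card ≤ (collisions a p (2 ^ t) U).card := by
      refine (Finset.card_le_card (t := (collisions a p (2 ^ t) U).image Prod.snd) ?_).trans
        Finset.card_image_le
      intro y hy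
      obtain ⟨h₁, x, h₂, h₃, h₄⟩ := Finset.mem_filter.1 hy
      exact Finset.mem_image.2 ⟨(x, y), Finset.mem_filter.2
        ⟨Finset.mem_offDiag.2 ⟨h₂, h₁, h₃⟩, h₄⟩, rfl⟩
    -- Combining `4 * U.card ≤ 2 ^ t` with the bound on collisions gives `4 * U.card * U'.card ≤ 2 *
    -- U.card ^ 2`, so `U'` has at most half as many elements as `U`.
    have hU' : 8 * U'.card ≤ 2 ^ t := by
      rcases Nat.eq_zero_or_pos U.card with h0 | h0
      · have : U'.card ≤ U.card := Finset.card_filter_le _ _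
        have : U'.card = 0 := by omega
        omega
      · have h4 : 4 * U.card ≤ 2 ^ t := by linarith
        have : 4 * U.card * U'.card ≤ 2 * (U.card * U.card) :=
          (Nat.mul_le_mul h4 hc').trans hcoll
        have : U.card * (2 * U'.card) ≤ U.card * U.card := by nlinarith
        have := Nat.le_of_mul_le_mul_left this h0
        omega
    obtain ⟨as, B, has, hB, hinj⟩ := ih U' (fun y hy => hU y (Finset.mem_filter.1 hy).1) hU'
    classical
    set as' : ℕ → ℕ := fun i => if i = t then a else as i
    -- Marks below `2 ^ t` belong to the lower levels and are inherited; at the top level the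
    -- buckets hit by colliding elements are marked.
    set B' : ℕ → ℕ := fun b => if b < 2 ^ t then B b else
      if ∃ y ∈ U', b = 2 ^ t + g y then 1 else 0
    have hcol : ∀ y, col p as' B' t y = col p as B t y := fun y =>
      col_congr y (fun i hi => if_neg hi.ne) (fun b hb => if_pos hb)
    have hB' : ∀ y, B' (2 ^ t + g y) = if ∃ x ∈ U', g y = g x then 1 else 0 := by
      intro y
      simp only [B', if_neg (show ¬ 2 ^ t + g y < 2 ^ t by omega), Nat.add_left_cancel_iff]
    have hat : as' t = a := if_pos rfl
    have key : ∀ y ∈ U, (y ∈ U' ∧ col p as' B' (t + 1) y = col p as B t y) ∨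
        (y ∉ U' ∧ col p as' B' (t + 1) y = 2 ^ t + g y) := by
      intro y hy
      rw [col, hat]
      change y ∈ U' ∧ (if 0 < B' (2 ^ t + g y) then _ else 2 ^ t + g y) = _ ∨
        y ∉ U' ∧ (if 0 < B' (2 ^ t + g y) then _ else 2 ^ t + g y) = _
      by_cases hyU : y ∈ U'
      · left
        have : B' (2 ^ t + g y) = 1 := by rw [hB', if_pos ⟨y, hyU, rfl⟩]
        simp [hyU, hcol, this]
      · right
        have : B' (2 ^ t + g y) = 0 := by
          rw [hB', if_neg]
          rintro ⟨x, hx, hxy⟩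
          obtain ⟨h₁, z, h₂, h₃, h₄⟩ := Finset.mem_filter.1 hx
          refine hyU (Finset.mem_filter.2 ⟨hy, ?_⟩)
          by_cases hxy' : x = y
          · exact ⟨z, h₂, hxy' ▸ h₃, h₄.trans hxy.symm⟩
          · exact ⟨x, h₁, hxy', hxy.symm⟩
        simp [hyU, this]
    refine ⟨as', B', ?_, ?_, ?_⟩
    · intro i
      simp only [as']
      split_ifs
      exacts [ha, has i]
    · intro b
      simp only [B']
      split_ifs
      exacts [hB b, by norm_num, by norm_num]
    · intro x hx y hy hxy
      have lx := col_lt p as B t x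
      have ly := col_lt p as B t y
      rcases key x hx with ⟨h₁, h₂⟩ | ⟨h₁, h₂⟩ <;> rcases key y hy with ⟨h₃, h₄⟩ | ⟨h₃, h₄⟩ <;>
        rw [h₂, h₄] at hxy
      · exact hinj h₁ h₃ hxy
      · omega
      · omega
      · by_contra hne
        exact h₁ (Finset.mem_filter.2 ⟨hx, y, hy, fun h => hne h.symm, by omega⟩)

/-- Expansion in base `A`. It lets one loop over a single number run through all sequences of
multipliers, or through all sets of marks. -/
theorem exists_digits {A : ℕ} (T : ℕ) (as : ℕ → ℕ) (h : ∀ i, as i < A) :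
    ∃ g < A ^ T, ∀ i < T, g / A ^ i % A = as i := by
  induction T generalizing as with
  | zero => exact ⟨0, by simp, by simp⟩
  | succ T ih =>
    obtain ⟨g, hg, hi⟩ := ih (fun i => as (i + 1)) fun i => h _
    have h0 := h 0
    refine ⟨as 0 + A * g, ?_, ?_⟩
    · rw [pow_succ]
      nlinarith
    · rintro (_ | i) hlt
      · rw [pow_zero, Nat.div_one, Nat.add_mul_mod_self_left, Nat.mod_eq_of_lt h0]
      · rw [pow_succ', ← Nat.div_div_eq_div_mul, Nat.add_mul_div_left _ _ (by omega),
          Nat.div_eq_of_lt h0, zero_add, hi i (by omega)]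

/-- The colour of job `x` for the given parameters. -/
def colour (p a m q A g D T x : ℕ) : ℕ :=
  col q (fun i => g / A ^ i % A) (fun b => D / 2 ^ b % 2) T (hsh a x p m)

/-- The first hash is injective on `U` because `m` exceeds twice the square of its size; this
replaces numbers below `n` by numbers below `m`, so the cascade that follows has parameters that do
not depend on `n`. The primes come from Bertrand's postulate and are passed as offsets, so the
algorithm can try all moduli in the range without testing primality. -/
theorem exists_colour {n s T m A W : ℕ} (hn : n ≠ 0) (hW : W = 2 ^ T) (hs : 4 * s ≤ W)
    (hm : m = W * W) (hA : A = m + m) (U : Finset ℕ) (hU : ∀ x ∈ U, x < n) (hUs : U.card ≤ s) :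
    ∃ p < n, ∃ a < n + n, ∃ q < m, ∃ g < A ^ (T + 1), ∃ D < 2 ^ (2 * W),
      Set.InjOn (colour (n + 1 + p) a m (m + 1 + q) A g D (T + 1)) U := by
  have hWpos : 0 < W := hW ▸ by positivity
  have hmpos : m ≠ 0 := by rw [hm]; positivity
  obtain ⟨p, hp, hp₁, hp₂⟩ := Nat.exists_prime_lt_and_le_two_mul n hn
  obtain ⟨q, hq, hq₁, hq₂⟩ := Nat.exists_prime_lt_and_le_two_mul m hmpos
  obtain ⟨a, ha, hinj⟩ := exists_hsh_injOn (m := m) hp (fun y hy => (hU y hy).trans hp₁)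
    (by rw [hm]; nlinarith)
  set V := U.image fun y => hsh a y p m
  have hV : V.card ≤ s := Finset.card_image_le.trans hUs
  have hVlt : ∀ y ∈ V, y < q := by
    intro y hy
    obtain ⟨x, -, rfl⟩ := Finset.mem_image.1 hy
    exact (Nat.mod_lt _ (Nat.pos_of_ne_zero hmpos)).trans hq₁
  obtain ⟨as, B, has, hB, hcol⟩ := exists_col_injOn hq (T + 1) V hVlt
    (by rw [pow_succ, ← hW]; omega)
  obtain ⟨g, hg, hg'⟩ := exists_digits (A := A) (T + 1) as fun i => (has i).trans_le (by omega)
  obtain ⟨D, hD, hD'⟩ := exists_digits (A := 2) (2 * W) B hB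
  -- A prime `p` with `n < p ≤ 2 * n` has offset `p - (n + 1) < n`, and similarly for `q` and `m`.
  -- The multiplier `a` is less than `p`, hence less than `n + n`.
  refine ⟨p - (n + 1), by omega, a, by omega, q - (m + 1), by omega, g, hg, D, hD, ?_⟩
  rw [show n + 1 + (p - (n + 1)) = p by omega, show m + 1 + (q - (m + 1)) = q by omega]
  have e : ∀ x, colour p a m q A g D (T + 1) x = col q as B (T + 1) (hsh a x p m) := fun x =>
    col_congr _ hg' fun b hb => hD' b (by rw [hW, mul_comm, ← pow_succ]; exact hb)
  intro x hx y hy hxy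
  rw [e, e] at hxy
  exact hinj hx hy (hcol (Finset.mem_coe.2 (Finset.mem_image_of_mem _ hx))
    (Finset.mem_coe.2 (Finset.mem_image_of_mem _ hy)) hxy)

end GPSP

namespace GPSP

/-! ### Tables of schedules

Every entry of the table of schedules consists of a flag (array `22`), a value (real array `4`), a
number of pieces (array `1`), and a list of pieces (array `2` and real arrays `2` and `3`, from
cell `st * D` on, if `st` is the number of the entry). Array `18` contains the multiples of `D`. -/

open Cmd

/-- The address of cell `y` of block `x`. -/
abbrev ad (x y : NExp) : NExp := .add (.read 18 x) y

/-- The number of an entry of the table. -/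
abbrev adr (r e S : NExp) : NExp := ad (ad r e) S

/-- The number of an entry of the table. -/
def addr (D r e S : ℕ) : ℕ := (r * D + e) * D + S

theorem addr_inj {D r e S r' e' S' : ℕ} (he : e < D) (hS : S < D) (he' : e' < D) (hS' : S' < D)
    (h : addr D r e S = addr D r' e' S') : r = r' ∧ e = e' ∧ S = S' := by
  have key : ∀ {a b c d : ℕ}, b < D → d < D → a * D + b = c * D + d → a = c ∧ b = d := by
    intro a b c d hb hd h
    have h₁ := congrArg (· / D) h
    have h₂ := congrArg (· % D) h
    simpa [Nat.mul_comm _ D, Nat.mul_add_div (by omega : 0 < D), Nat.div_eq_of_lt, hb, hd,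
      Nat.mod_eq_of_lt] using And.intro h₁ h₂
  obtain ⟨h₁, h₂⟩ := key hS hS' h
  obtain ⟨h₃, h₄⟩ := key he he' h₁
  exact ⟨h₃, h₄, h₂⟩

theorem addr_lt {D r e S N : ℕ} (hr : r < N) (he : e < D) (hS : S < D) :
    addr D r e S < N * D * D := by
  unfold addr
  have h₁ : r * D + e < N * D := by
    have := Nat.mul_le_mul_right D (show r + 1 ≤ N from hr)
    rw [add_mul, one_mul] at this
    omega
  have := Nat.mul_le_mul_right D (show r * D + e + 1 ≤ N * D from h₁)
  rw [add_mul, one_mul] at this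
  omega

theorem addr_pos {D r e S : ℕ} (hD : 0 < D) (hr : 0 < r) : 0 < addr D r e S := by
  unfold addr
  positivity

section Entries

variable {n : ℕ} {f : ℕ → ℝ → ℝ} {D Q N : ℕ}

/-- The contents of the cells for pieces. -/
def Memory.cells (M : Memory) (x : ℕ) : ℕ × ℝ × ℝ := (M.nat 2 x, M.real 2 x, M.real 3 x)

/-- A piece as cell contents. -/
def Piece.triple (x : Piece n) : ℕ × ℝ × ℝ := (x.job, x.start, x.finish)

/-- The cells from `b` on contain the list `L`. -/
def ListAt (c : ℕ → ℕ × ℝ × ℝ) (b : ℕ) (L : Schedule n) : Prop :=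
  ∀ k (h : k < L.length), c (b + k) = L[k].triple

theorem ListAt.snoc {c : ℕ → ℕ × ℝ × ℝ} {b : ℕ} {L : Schedule n} (h : ListAt c b L)
    (x : Piece n) : ListAt (Function.update c (b + L.length) x.triple) b (L ++ [x]) := by
  intro k hk
  rw [List.length_append, List.length_singleton] at hk
  rcases Nat.lt_succ_iff_lt_or_eq.1 hk with h' | rfl
  · rw [Function.update_of_ne (by omega), h k h', List.getElem_append_left h']
  · simp

theorem ListAt.congr {c c' : ℕ → ℕ × ℝ × ℝ} {b : ℕ} {L : Schedule n} (h : ListAt c b L)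
    (hc : ∀ k < L.length, c' (b + k) = c (b + k)) : ListAt c' b L :=
  fun k hk => (hc k hk).trans (h k hk)

/-- Append a piece to the list of the target entry. -/
def emit (j : NExp) (a b : RExp) : Cmd :=
  block [setN 2 (ad (nv 30) (nv 33)) j, setR 2 (ad (nv 30) (nv 33)) a,
    setR 3 (ad (nv 30) (nv 33)) b, setN 33 (.const 0) (.add (nv 33) (.const 1))]

theorem emit_spec {M : Memory} {j : NExp} {a b : RExp} {x J : ℕ} {A B : ℝ}
    (hx : M.nat 18 (M.nat 30 0) + M.nat 33 0 = x) (hj : j.eval M = J)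
    (ha : a.eval f (M.setN 2 x J) = A) (hb : b.eval f ((M.setN 2 x J).setR 2 x A) = B) :
    ((emit j a b).run f M).cells = Function.update M.cells x (J, A, B) ∧
      ((emit j a b).run f M).nat 33 0 = M.nat 33 0 + 1 := by
  have e : (emit j a b).run f M =
      (((M.setN 2 x J).setR 2 x A).setR 3 x B).setN 33 0 (M.nat 33 0 + 1) := by
    simp [emit, block, run, NExp.eval, hj, Memory.setN_nat, hx, ha, hb]
  rw [e]
  constructor
  · funext y
    by_cases hy : y = x
    · subst hy
      simp [Memory.cells, Memory.setN_nat, Memory.setR_real]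
    · simp [Memory.cells, Memory.setN_nat, Memory.setR_real, hy]
  · simp

/-- The target list is `L`. -/
def TargetIs (D tg : ℕ) (M : Memory) (L : Schedule n) : Prop :=
  ListAt M.cells (tg * D) L ∧ M.nat 33 0 = L.length

/-- The cells outside the list of entry `tg` agree. -/
def CellsOff (D tg : ℕ) (M M' : Memory) : Prop :=
  ∀ x, (x < tg * D ∨ tg * D + D ≤ x) → M'.cells x = M.cells x

theorem CellsOff.refl (D tg : ℕ) (M : Memory) : CellsOff D tg M M := fun _ _ => rfl

theorem CellsOff.trans {tg : ℕ} {M M' M'' : Memory} (h : CellsOff D tg M M')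
    (h' : CellsOff D tg M' M'') : CellsOff D tg M M'' :=
  fun x hx => (h' x hx).trans (h x hx)

theorem off_of_ne {st tg k : ℕ} (h : st ≠ tg) (hk : k < D) :
    st * D + k < tg * D ∨ tg * D + D ≤ st * D + k := by
  rcases Nat.lt_or_gt_of_ne h with h | h
  · have := Nat.mul_le_mul_right D (show st + 1 ≤ tg from h)
    rw [add_mul, one_mul] at this
    omega
  · have := Nat.mul_le_mul_right D (show tg + 1 ≤ st from h)
    rw [add_mul, one_mul] at this
    omega

theorem ListAt.off {st tg : ℕ} {M M' : Memory} {L : Schedule n}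
    (h : ListAt M.cells (st * D) L) (hL : L.length ≤ D) (hne : st ≠ tg)
    (ho : CellsOff D tg M M') : ListAt M'.cells (st * D) L :=
  h.congr fun k hk => ho _ (off_of_ne hne (by omega))

/-- The three components of a piece are written one after the other, so the start and the end are
evaluated in memories that already contain the earlier components. This explains the modified
memories in `ha` and `hb`. -/
theorem emit_target {M : Memory} {j : NExp} {a b : RExp} {tg : ℕ} {x : Piece n} {L : Schedule n}
    (h : TargetIs D tg M L) (h30 : M.nat 30 0 = tg) (h18 : M.nat 18 tg = tg * D)
    (hL : L.length < D) (hj : j.eval M = x.job)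
    (ha : a.eval f (M.setN 2 (tg * D + L.length) x.job) = x.start)
    (hb : b.eval f ((M.setN 2 (tg * D + L.length) x.job).setR 2 (tg * D + L.length) x.start)
      = x.finish) :
    TargetIs D tg ((emit j a b).run f M) (L ++ [x]) ∧ CellsOff D tg M ((emit j a b).run f M) := by
  obtain ⟨e₁, e₂⟩ := emit_spec (f := f) (M := M) (x := tg * D + L.length)
    (by rw [h30, h18, h.2]) hj ha hb
  refine ⟨⟨?_, ?_⟩, ?_⟩
  · rw [e₁]
    exact h.1.snoc x
  · rw [e₂, h.2, List.length_append, List.length_singleton]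
  · intro y hy
    rw [e₁, Function.update_of_ne (by omega)]

/-- The source piece number `q` is emitted. -/
def emitSrc (src : ℕ) : Cmd :=
  emit (.read 2 (ad (nv src) (nv 34))) (.read 2 (ad (nv src) (nv 34)))
    (.read 3 (ad (nv src) (nv 34)))

/-- Append the list of the source entry to the list of the target entry. -/
def appendSrc (src : ℕ) : Cmd :=
  loop 34 14 (when [(true, .ltNat (nv 34) (.read 1 (nv src)))] (emitSrc src))

theorem emitSrc_spec {M : Memory} {sv tg src q : ℕ} {Lt Ls : Schedule n}
    (hsv : sv = 31 ∨ sv = 32)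
    (h : TargetIs D tg M Lt) (h30 : M.nat 30 0 = tg) (h31 : M.nat sv 0 = src)
    (hq : M.nat 34 0 = q)
    (h18 : M.nat 18 tg = tg * D) (h18' : M.nat 18 src = src * D)
    (hL : Lt.length < D) (hLs : ListAt M.cells (src * D) Ls) (hqL : q < Ls.length)
    (hLsD : Ls.length ≤ D) (hne : src ≠ tg) :
    TargetIs D tg ((emitSrc sv).run f M) (Lt ++ [Ls[q]]) ∧
      CellsOff D tg M ((emitSrc sv).run f M) := by
  have hc := hLs q hqL
  simp only [Memory.cells, Piece.triple, Prod.mk.injEq] at hc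
  -- The storage areas of different entries are disjoint, so the partly written target piece does
  -- not affect the reads from the source.
  have hne' : src * D + q ≠ tg * D + Lt.length := by
    have := off_of_ne (k := q) hne (show q < D by omega)
    omega
  refine emit_target h h30 h18 hL ?_ ?_ ?_
  · simp [NExp.eval, h31, hq, h18', hc]
  · rcases hsv with rfl | rfl <;>
    simp [RExp.eval, NExp.eval, Memory.setN_nat, h31, hq, h18', hc]
  · rcases hsv with rfl | rfl <;>
    simp [RExp.eval, NExp.eval, Memory.setN_nat, Memory.setR_real, h31, hq, h18', hc]

/-- The loop always makes `Q` rounds, guarded by the actual length: its bound is a parameter that no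
program overwrites, as the time analysis requires. -/
theorem appendSrc_spec {M : Memory} {sv tg src : ℕ} {Lt Ls : Schedule n}
    (hsv : sv = 31 ∨ sv = 32)
    (h : TargetIs D tg M Lt) (h30 : M.nat 30 0 = tg) (h31 : M.nat sv 0 = src)
    (h14 : M.nat 14 0 = Q) (h1 : M.nat 1 src = Ls.length)
    (h18 : M.nat 18 tg = tg * D) (h18' : M.nat 18 src = src * D)
    (hL : Lt.length + Ls.length ≤ D) (hLs : ListAt M.cells (src * D) Ls)
    (hLsQ : Ls.length ≤ Q) (hne : src ≠ tg) :
    TargetIs D tg ((appendSrc sv).run f M) (Lt ++ Ls) ∧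
      CellsOff D tg M ((appendSrc sv).run f M) := by
  have key := loop_rule (f := f) (v := 34) (d := 14)
    (c := when [(true, .ltNat (nv 34) (.read 1 (nv sv)))] (emitSrc sv)) (M := M)
    (fun x M' => TargetIs D tg M' (Lt ++ Ls.take x) ∧ CellsOff D tg M M')
    (fun _ _ _ h => h) ⟨by simpa using h, .refl _ _ _⟩ ?_
  · rw [h14, List.take_of_length_le hLsQ] at key
    exact key
  · intro x hx M' hsame hx' ⟨ht, ho⟩
    have hs : ∀ a, a ≠ 34 → a ≠ 2 → a ≠ 33 → M'.nat a = M.nat a := fun a h₁ h₂ h₃ =>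
      hsame.nat a (by simp [emitSrc, emit, block, when, wN, h₁, h₂, h₃])
    have hsv' : M'.nat sv = M.nat sv := hs sv (by omega) (by omega) (by omega)
    have e1 : M'.nat 1 = M.nat 1 := hs 1 (by norm_num) (by norm_num) (by norm_num)
    by_cases hxL : x < Ls.length
    · rw [run_when_true (by simp [Test.Holds, NExp.eval, hx', hsv', e1, h31, h1, hxL])]
      have e18 : M'.nat 18 = M.nat 18 := hs 18 (by norm_num) (by norm_num) (by norm_num)
      have e30 : M'.nat 30 = M.nat 30 := hs 30 (by norm_num) (by norm_num) (by norm_num)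
      obtain ⟨g₁, g₂⟩ := emitSrc_spec (f := f) (sv := sv) hsv ht (by rw [e30, h30])
        (by rw [hsv', h31]) hx' (by rw [e18, h18]) (by rw [e18, h18'])
        (by rw [List.length_append, List.length_take]; omega)
        (hLs.off (by omega) hne ho) hxL (by omega) hne
      refine ⟨?_, ho.trans g₂⟩
      rwa [List.append_assoc, List.take_concat_get'] at g₁
    · rw [run_when_false (fun h => hxL (by simpa [Test.Holds, NExp.eval, hx', hsv', e1, h31, h1] using h))]
      rw [List.take_of_length_le (by omega)] at ht ⊢
      exact ⟨ht, ho⟩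

/-- The list `fill` without the last gap. -/
noncomputable def fillHead (k : Fin n) : ℝ → Schedule n → Schedule n
  | _, [] => []
  | a, x :: L => gap k a x.start ++ x :: fillHead k x.finish L

/-- The end of a list of pieces. -/
def endOf : ℝ → Schedule n → ℝ
  | a, [] => a
  | _, x :: L => endOf x.finish L

theorem fill_eq (k : Fin n) (a b : ℝ) (L : Schedule n) :
    fill k a L b = fillHead k a L ++ gap k (endOf a L) b := by
  induction L generalizing a with
  | nil => simp [fill, fillHead, endOf]
  | cons x L ih => simp [fill, fillHead, endOf, ih]

/-- `fill` recurses on the front of the list whereas the program appends at its end. Together with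
`endOf_snoc` this gives the effect of reading one more piece: close the gap before it, then copy it.
-/
theorem fillHead_snoc (k : Fin n) (a : ℝ) (L : Schedule n) (x : Piece n) :
    fillHead k a (L ++ [x]) = fillHead k a L ++ gap k (endOf a L) x.start ++ [x] := by
  induction L generalizing a with
  | nil => simp [fillHead, endOf]
  | cons y L ih => simp [fillHead, endOf, ih]

theorem endOf_snoc (a : ℝ) (L : Schedule n) (x : Piece n) : endOf a (L ++ [x]) = x.finish := by
  induction L generalizing a with
  | nil => simp [endOf]
  | cons y L ih => simp [endOf, ih]

theorem length_fillHead_le (k : Fin n) (a : ℝ) (L : Schedule n) :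
    (fillHead k a L).length ≤ 2 * L.length := by
  induction L generalizing a with
  | nil => simp [fillHead]
  | cons y L ih =>
    have := length_gap_le k a y.start
    have := ih y.finish
    simp only [fillHead, List.length_append, List.length_cons]
    omega

/-- Emit a piece of job number `41` from real variable `10` to `b`, if it is nonempty. -/
def emitGap (b : RExp) : Cmd := when [(true, .ltReal (rv 10) b)] (emit (nv 41) (rv 10) b)

/-- Append the list of the second source entry and fill its gaps. -/
def appendFill : Cmd :=
  seq (loop 34 14 (when [(true, .ltNat (nv 34) (.read 1 (nv 32)))]
    (block [emitGap (.read 2 (ad (nv 32) (nv 34))), emitSrc 32,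
      setR 10 (.const 0) (.read 3 (ad (nv 32) (nv 34)))]))) (emitGap (rv 8))

theorem emitGap_spec {M : Memory} {b : RExp} {tg : ℕ} {k : Fin n} {L : Schedule n} {B : ℝ}
    (h : TargetIs D tg M L) (h30 : M.nat 30 0 = tg) (h18 : M.nat 18 tg = tg * D)
    (h41 : M.nat 41 0 = k) (hL : L.length < D) (hb : b.eval f M = B)
    (hb' : b.eval f ((M.setN 2 (tg * D + L.length) k).setR 2 (tg * D + L.length)
      (M.real 10 0)) = B) :
    TargetIs D tg ((emitGap b).run f M) (L ++ gap k (M.real 10 0) B) ∧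
      CellsOff D tg M ((emitGap b).run f M) := by
  by_cases hlt : M.real 10 0 < B
  · rw [emitGap, run_when_true (by simpa [Test.Holds, RExp.eval, NExp.eval, hb] using hlt),
      gap, if_pos hlt]
    refine emit_target h h30 h18 hL ?_ ?_ hb'
    · simp [NExp.eval, h41]
    · simp [RExp.eval, NExp.eval]
  · rw [emitGap, run_when_false (fun h => hlt (by simpa [Test.Holds, RExp.eval, NExp.eval, hb]
      using h)), gap, if_neg hlt, List.append_nil]
    exact ⟨h, .refl _ _ _⟩

/-- Real variable `10` is a cursor at the end of the pieces treated so far. After `x` rounds the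
target holds `fillHead` of the first `x` source pieces, and the final gap up to real variable `8`
completes it to `fill`. -/
theorem appendFill_spec {M : Memory} {tg src : ℕ} {k : Fin n} {Lt Ls : Schedule n}
    (h : TargetIs D tg M Lt) (h30 : M.nat 30 0 = tg) (h32 : M.nat 32 0 = src)
    (h41 : M.nat 41 0 = k)
    (h14 : M.nat 14 0 = Q) (h1 : M.nat 1 src = Ls.length)
    (h18 : M.nat 18 tg = tg * D) (h18' : M.nat 18 src = src * D)
    (hL : Lt.length + (2 * Ls.length + 1) ≤ D) (hLs : ListAt M.cells (src * D) Ls)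
    (hLsQ : Ls.length ≤ Q) (hne : src ≠ tg) :
    TargetIs D tg (appendFill.run f M) (Lt ++ fill k (M.real 10 0) Ls (M.real 8 0)) ∧
      CellsOff D tg M (appendFill.run f M) := by
  set c := when [(true, .ltNat (nv 34) (.read 1 (nv 32)))]
    (block [emitGap (.read 2 (ad (nv 32) (nv 34))), emitSrc 32,
      setR 10 (.const 0) (.read 3 (ad (nv 32) (nv 34)))]) with hc
  set a := M.real 10 0 with hadef
  have key := loop_rule (f := f) (v := 34) (d := 14) (c := c) (M := M)
    (fun x M' => TargetIs D tg M' (Lt ++ fillHead k a (Ls.take x)) ∧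
      M'.real 10 0 = endOf a (Ls.take x) ∧ CellsOff D tg M M')
    (fun _ _ _ h => h) ⟨by simpa [fillHead] using h, rfl, .refl _ _ _⟩ ?_
  · rw [h14, List.take_of_length_le hLsQ] at key
    obtain ⟨g₁, g₂, g₃⟩ := key
    have hsame := sameOff_run f (loop 34 14 c) M
    rw [appendFill, run_seq, ← hc]
    set M' := (loop 34 14 c).run f M
    have hs : ∀ a, a ≠ 34 → a ≠ 2 → a ≠ 33 → M'.nat a = M.nat a := fun a h₁ h₂ h₃ =>
      hsame.nat a (by simp [hc, emitGap, emitSrc, emit, block, when, wN, h₁, h₂, h₃])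
    have e8 : M'.real 8 = M.real 8 :=
      hsame.real 8 (by simp [hc, emitGap, emitSrc, emit, block, when, wR])
    have hlen := length_fillHead_le k a Ls
    obtain ⟨i₁, i₂⟩ := emitGap_spec (f := f) (b := rv 8) (B := M.real 8 0) g₁
      (by rw [hs 30 (by norm_num) (by norm_num) (by norm_num), h30])
      (by rw [hs 18 (by norm_num) (by norm_num) (by norm_num), h18])
      (by rw [hs 41 (by norm_num) (by norm_num) (by norm_num), h41])
      (by rw [List.length_append]; omega)
      (by simp [RExp.eval, NExp.eval, e8])
      (by simp [RExp.eval, NExp.eval, e8, Memory.setR_real])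
    refine ⟨?_, g₃.trans i₂⟩
    rwa [fill_eq, ← List.append_assoc, ← g₂]
  · intro x hx M' hsame hx' ⟨ht, hcur, ho⟩
    have hs : ∀ a, a ≠ 34 → a ≠ 2 → a ≠ 33 → M'.nat a = M.nat a := fun a h₁ h₂ h₃ =>
      hsame.nat a (by simp [hc, emitGap, emitSrc, emit, block, when, wN, h₁, h₂, h₃])
    have e1 : M'.nat 1 = M.nat 1 := hs 1 (by norm_num) (by norm_num) (by norm_num)
    have e18 : M'.nat 18 = M.nat 18 := hs 18 (by norm_num) (by norm_num) (by norm_num)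
    have e30 : M'.nat 30 = M.nat 30 := hs 30 (by norm_num) (by norm_num) (by norm_num)
    have e32 : M'.nat 32 = M.nat 32 := hs 32 (by norm_num) (by norm_num) (by norm_num)
    have e41 : M'.nat 41 = M.nat 41 := hs 41 (by norm_num) (by norm_num) (by norm_num)
    by_cases hxL : x < Ls.length
    · rw [hc, run_when_true (by simp [Test.Holds, NExp.eval, hx', e32, e1, h32, h1, hxL])]
      simp only [block, run_seq]
      have hlen := length_fillHead_le k a (Ls.take x)
      have htk : (Ls.take x).length = x := by rw [List.length_take]; omega
      have hcell := (hLs.off (by omega) hne ho) x hxL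
      simp only [Memory.cells, Piece.triple, Prod.mk.injEq] at hcell
      have hne' : ∀ y < D, src * D + x ≠ tg * D + y := by
        intro y hy
        have := off_of_ne (k := x) hne (show x < D by omega)
        omega
      have hlt : (Lt ++ fillHead k a (Ls.take x)).length + 1 < D := by
        rw [List.length_append]; omega
      obtain ⟨i₁, i₂⟩ := emitGap_spec (f := f) (b := .read 2 (ad (nv 32) (nv 34)))
        (B := Ls[x].start) (k := k) ht (by rw [e30, h30]) (by rw [e18, h18]) (by rw [e41, h41])
        (by omega) (by simp [RExp.eval, NExp.eval, hx', e18, e32, h32, h18', hcell])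
        (by simp [RExp.eval, NExp.eval, hx', e18, e32, h32, h18', hcell, Memory.setN_nat,
          Memory.setR_real, hne' _ (show Lt.length + (fillHead k a (Ls.take x)).length < D by omega)])
      have hlg := length_gap_le k (M'.real 10 0) Ls[x].start
      set M₁ := (emitGap (.read 2 (ad (nv 32) (nv 34)))).run f M'
      have hs₁ : ∀ a, a ≠ 2 → a ≠ 33 → M₁.nat a = M'.nat a := fun a h₂ h₃ =>
        run_nat f M' (by simp [emitGap, emit, block, when, wN, h₂, h₃])
      obtain ⟨j₁, j₂⟩ := emitSrc_spec (f := f) (sv := 32) (.inr rfl) i₁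
        (by rw [hs₁ 30 (by norm_num) (by norm_num), e30, h30])
        (by rw [hs₁ 32 (by norm_num) (by norm_num), e32, h32])
        (by rw [hs₁ 34 (by norm_num) (by norm_num), hx'])
        (by rw [hs₁ 18 (by norm_num) (by norm_num), e18, h18])
        (by rw [hs₁ 18 (by norm_num) (by norm_num), e18, h18'])
        (by rw [List.length_append]; omega)
        (hLs.off (by omega) hne (ho.trans i₂)) hxL (by omega) hne
      set M₂ := (emitSrc 32).run f M₁
      have hs₂ : ∀ a, a ≠ 2 → a ≠ 33 → M₂.nat a = M₁.nat a := fun a h₂ h₃ =>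
        run_nat f M₁ (by simp [emitSrc, emit, block, wN, h₂, h₃])
      have hcell' := (hLs.off (by omega) hne ((ho.trans i₂).trans j₂)) x hxL
      simp only [Memory.cells, Piece.triple, Prod.mk.injEq] at hcell'
      have hval : (RExp.read 3 (ad (nv 32) (nv 34))).eval f M₂ = Ls[x].finish := by
        simp only [RExp.eval, NExp.eval]
        rw [hs₂ 18 (by norm_num) (by norm_num), hs₂ 32 (by norm_num) (by norm_num),
          hs₂ 34 (by norm_num) (by norm_num), hs₁ 18 (by norm_num) (by norm_num),
          hs₁ 32 (by norm_num) (by norm_num), hs₁ 34 (by norm_num) (by norm_num), e18, e32, h32,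
          h18', hx', hcell'.2.2]
      have etk : Ls.take (x + 1) = Ls.take x ++ [Ls[x]] := (List.take_concat_get' _ _ _).symm
      rw [run_setR, hval]
      refine ⟨⟨?_, ?_⟩, ?_, (ho.trans i₂).trans j₂⟩
      · rw [etk, fillHead_snoc, ← hcur, ← List.append_assoc, ← List.append_assoc]
        exact j₁.1
      · rw [etk, fillHead_snoc, ← hcur, ← List.append_assoc, ← List.append_assoc]
        exact j₁.2
      · rw [etk, endOf_snoc]
        simp [NExp.eval]
    · rw [hc, run_when_false (fun h => hxL (by
        simpa [Test.Holds, NExp.eval, hx', e32, e1, h32, h1] using h))]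
      rw [List.take_of_length_le (by omega)] at ht hcur ⊢
      exact ⟨ht, hcur, ho⟩

end Entries
end GPSP

namespace GPSP

open Cmd

/-! ### Nested loops -/

namespace Cmd

/-- Nested loops. -/
def loops : List (ℕ × ℕ) → Cmd → Cmd
  | [], c => c
  | p :: l, c => loop p.1 p.2 (loops l c)

theorem forall₂_imp_mem {α β : Type*} {R S : α → β → Prop} {xs : List α} {l : List β}
    (h : List.Forall₂ R xs l) (hRS : ∀ a, ∀ b ∈ l, R a b → S a b) : List.Forall₂ S xs l := by
  induction h with
  | nil => exact .nil
  | cons h _ ih => exact .cons (hRS _ _ (by simp) h) (ih fun a b hb => hRS a b (by simp [hb]))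

/-- `Ext` is a preorder of harmless changes and `Est xs` is what the body achieves for the tuple
`xs` of loop variables. If `Est` survives `Ext`, everything achieved in any round still holds at the
end, for all tuples in range. No order of the rounds has to be mentioned. -/
theorem loops_rule {f : ℕ → ℝ → ℝ} {c : Cmd} (Ext : Memory → Memory → Prop)
    (hrefl : ∀ M, Ext M M) (htrans : ∀ M M' M'', Ext M M' → Ext M' M'' → Ext M M'')
    (l : List (ℕ × ℕ)) (Est : List ℕ → Memory → Prop)
    (hEst : ∀ xs M M', Ext M M' → Est xs M → Est xs M')
    (hset : ∀ p ∈ l, ∀ M y, Ext M (M.setN p.1 0 y)) (hwf : (loops l c).wf = true) {M : Memory}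
    (hbody : ∀ M', SameOff (loops l c).wN (loops l c).wR M M' →
      (∀ p ∈ l, M'.nat p.1 0 < M.nat p.2 0) → Ext M M' →
      Ext M' (c.run f M') ∧ Est (l.map fun p => M'.nat p.1 0) (c.run f M'))
    (hd : ∀ p ∈ l, p.2 ∉ (loops l c).wN) :
    Ext M ((loops l c).run f M) ∧ ∀ xs, List.Forall₂ (fun x p => x < M.nat p.2 0) xs l →
      Est xs ((loops l c).run f M) := by
  induction l generalizing Est M with
  | nil =>
    obtain ⟨h₁, h₂⟩ := hbody M ⟨fun _ _ => rfl, fun _ _ => rfl⟩ (by simp) (hrefl M)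
    refine ⟨h₁, fun xs hxs => ?_⟩
    cases hxs
    exact h₂
  | cons p l ih =>
    simp only [loops, wf, Bool.and_eq_true, Bool.not_eq_true', List.elem_eq_mem,
      decide_eq_false_iff_not] at hwf
    simp only [loops, wN, wR, List.mem_cons, not_or, forall_eq_or_imp] at hbody hd hset
    have key := loop_rule (f := f) (v := p.1) (d := p.2) (c := loops l c) (M := M)
      (fun x M' => Ext M M' ∧ ∀ y < x, ∀ xs,
        List.Forall₂ (fun (x : ℕ) (p : ℕ × ℕ) => x < M.nat p.2 0) xs l →
        Est (y :: xs) M')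
      (fun x M' y h => ⟨htrans _ _ _ h.1 (hset.1 _ _), fun z hz xs hxs =>
        hEst _ _ _ (hset.1 _ _) (h.2 z hz xs hxs)⟩) ⟨hrefl M, by simp⟩ ?_
    · refine ⟨key.1, fun xs hxs => ?_⟩
      cases hxs with
      | cons h₁ h₂ => exact key.2 _ h₁ _ h₂
    · intro x hx M' hsame hx' ⟨hE, hI⟩
      have hdim : ∀ q ∈ l, M'.nat q.2 0 = M.nat q.2 0 := fun q hq => by
        rw [hsame.nat q.2 (by simpa using hd.2 q hq)]
      obtain ⟨h₁, h₂⟩ := ih (fun xs => Est (x :: xs)) (fun xs M M' h => hEst _ M M' h) hset.2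
        hwf.2 (M := M') (fun M'' hs hr hE' => by
          have e : M''.nat p.1 0 = x := by rw [hs.nat _ hwf.1, hx']
          have := hbody M'' (hsame.trans (hs.mono (by simp) (by simp)))
            ⟨by rw [e]; exact hx, fun q hq => by rw [← hdim q hq]; exact hr q hq⟩
            (htrans _ _ _ hE hE')
          rw [List.map_cons, e] at this
          exact this)
        (fun q hq => (hd.2 q hq).2)
      refine ⟨htrans _ _ _ hE h₁, fun y hy xs hxs => ?_⟩
      rcases Nat.lt_succ_iff_lt_or_eq.1 hy with hy | rfl
      · exact hEst _ _ _ h₁ (hI y hy xs hxs)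
      · exact h₂ xs (forall₂_imp_mem hxs fun a q hq h => (hdim q hq).symm ▸ h)

end Cmd

/-! ### Soundness and lower bounds of table entries; replacing an entry by a better one. -/

section Relax

variable {n : ℕ} {f : ℕ → ℝ → ℝ} {D Q N : ℕ}

/-- The entry `st` is valid and has at least the value `v`. -/
def LB (M : Memory) (st : ℕ) (v : ℝ) : Prop := 0 < M.nat 22 st ∧ v ≤ M.real 4 st

/-- If the entry `st` is valid then its value and its list have the property `G`. -/
def EntOK (D Q : ℕ) (G : ℝ → Schedule n → Prop) (M : Memory) (st : ℕ) : Prop :=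
  0 < M.nat 22 st → ∃ L : Schedule n, M.nat 1 st = L.length ∧ L.length ≤ Q ∧
    ListAt M.cells (st * D) L ∧ G (M.real 4 st) L

/-- The entry `st` is the same in both memories. -/
structure EntSame (D st : ℕ) (M M' : Memory) : Prop where
  fl : M'.nat 22 st = M.nat 22 st
  val : M'.real 4 st = M.real 4 st
  len : M'.nat 1 st = M.nat 1 st
  cells : ∀ k < D, M'.cells (st * D + k) = M.cells (st * D + k)

theorem EntSame.refl (D st : ℕ) (M : Memory) : EntSame D st M M := ⟨rfl, rfl, rfl, fun _ _ => rfl⟩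

theorem EntSame.trans {st : ℕ} {M M' M'' : Memory} (h : EntSame D st M M')
    (h' : EntSame D st M' M'') : EntSame D st M M'' :=
  ⟨h'.fl.trans h.fl, h'.val.trans h.val, h'.len.trans h.len,
    fun k hk => (h'.cells k hk).trans (h.cells k hk)⟩

theorem EntSame.of_sameOff {wn wr : List ℕ} {M M' : Memory} (h : SameOff wn wr M M')
    (hn : 22 ∉ wn ∧ 1 ∉ wn ∧ 2 ∉ wn) (hr : 4 ∉ wr ∧ 2 ∉ wr ∧ 3 ∉ wr) (st : ℕ) :
    EntSame D st M M' := by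
  refine ⟨by rw [h.nat _ hn.1], by rw [h.real _ hr.1], by rw [h.nat _ hn.2.1], fun k _ => ?_⟩
  simp only [Memory.cells, h.nat _ hn.2.2, h.real _ hr.2.1, h.real _ hr.2.2]

theorem LB.same {st : ℕ} {M M' : Memory} {v : ℝ} (h : LB M st v) (h' : EntSame D st M M') :
    LB M' st v := ⟨h'.fl ▸ h.1, h'.val ▸ h.2⟩

theorem LB.le {st : ℕ} {M : Memory} {v v' : ℝ} (h : LB M st v) (h' : v' ≤ v) : LB M st v' :=
  ⟨h.1, h'.trans h.2⟩

theorem EntOK.same {G : ℝ → Schedule n → Prop} {st : ℕ} {M M' : Memory}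
    (h : EntOK D Q G M st) (hQ : Q ≤ D) (h' : EntSame D st M M') : EntOK D Q G M' st := by
  intro hfl
  obtain ⟨L, h₁, h₂, h₃, h₄⟩ := h (h'.fl ▸ hfl)
  exact ⟨L, h'.len.trans h₁, h₂, h₃.congr fun k hk => h'.cells k (by omega), h'.val ▸ h₄⟩

/-- The entries in `A` have been improved and the other ones are unchanged. -/
structure Step (D Q : ℕ) (A : Set ℕ) (G : ℕ → ℝ → Schedule n → Prop) (M M' : Memory) : Prop where
  off : ∀ st, st ∉ A → EntSame D st M M'
  mono : ∀ st v, LB M st v → LB M' st v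
  ok : (∀ st ∈ A, EntOK D Q (G st) M st) → ∀ st ∈ A, EntOK D Q (G st) M' st

theorem Step.of_same {A : Set ℕ} {G : ℕ → ℝ → Schedule n → Prop} {M M' : Memory} (hQ : Q ≤ D)
    (h : ∀ st, EntSame D st M M') : Step D Q A G M M' :=
  ⟨fun st _ => h st, fun st _ hv => hv.same (h st), fun hok st hst => (hok st hst).same hQ (h st)⟩

theorem Step.trans {A : Set ℕ} {G : ℕ → ℝ → Schedule n → Prop} {M M' M'' : Memory}
    (h : Step D Q A G M M') (h' : Step D Q A G M' M'') : Step D Q A G M M'' :=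
  ⟨fun st hst => (h.off st hst).trans (h'.off st hst), fun st v hv => h'.mono st v (h.mono st v hv),
    fun hok => h'.ok (h.ok hok)⟩

/-- Complete the target entry: set its flag, value and length. -/
def finishC : Cmd :=
  block [setN 22 (nv 30) (.const 1), setR 4 (nv 30) (rv 9), setN 1 (nv 30) (nv 33)]

/-- Entry `tg` has been overwritten with value `v` and list `L`. -/
structure Written (D tg : ℕ) (v : ℝ) (L : Schedule n) (M M' : Memory) : Prop where
  off : ∀ st, st ≠ tg → EntSame D st M M'
  fl : 0 < M'.nat 22 tg
  val : M'.real 4 tg = v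
  len : M'.nat 1 tg = L.length
  list : ListAt M'.cells (tg * D) L

theorem finishC_spec {M₀ M : Memory} {tg : ℕ} {v : ℝ} {L : Schedule n} (h : TargetIs D tg M L)
    (h30 : M.nat 30 0 = tg) (h9 : M.real 9 0 = v) (ho : CellsOff D tg M₀ M)
    (h22 : M.nat 22 = M₀.nat 22) (h1 : M.nat 1 = M₀.nat 1) (h4 : M.real 4 = M₀.real 4) :
    Written D tg v L M₀ (finishC.run f M) := by
  have e : finishC.run f M = ((M.setN 22 tg 1).setR 4 tg v).setN 1 tg L.length := by
    simp [finishC, block, run, NExp.eval, RExp.eval, h30, h9, Memory.setN_nat, h.2]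
  rw [e]
  refine ⟨fun st hst => ⟨?_, ?_, ?_, fun k hk => ?_⟩, ?_, ?_, ?_, h.1⟩
  · simp [Memory.setN_nat, hst, h22]
  · simp [Memory.setR_real, hst, h4]
  · simp [Memory.setN_nat, hst, h1]
  · exact ho _ (off_of_ne hst hk)
  · simp [Memory.setN_nat]
  · simp
  · simp

/-- Run `c`, which overwrites the target entry, if the candidate value is an improvement. -/
def relaxC (c : Cmd) : Cmd :=
  ite (.ltNat (.const 0) (.read 22 (nv 30)))
    (when [(true, .ltReal (.read 4 (nv 30)) (rv 9))] c) c

/-- As in shortest path algorithms: the candidate overwrites the entry only if this is invalid or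
strictly worse. So old lower bounds survive, the candidate value becomes a lower bound in either
case, and soundness needs to be checked only for the candidate. -/
theorem relaxC_spec {M : Memory} {c : Cmd} {tg : ℕ} {L : Schedule n} {A : Set ℕ}
    {G : ℕ → ℝ → Schedule n → Prop} (hQ : Q ≤ D) (h30 : M.nat 30 0 = tg)
    (h : Written D tg (M.real 9 0) L M (c.run f M)) (hL : L.length ≤ Q) (htg : tg ∈ A)
    (hG : G tg (M.real 9 0) L) :
    Step D Q A G M ((relaxC c).run f M) ∧ LB ((relaxC c).run f M) tg (M.real 9 0) := by
  have main : ((0 < M.nat 22 tg ∧ ¬ M.real 4 tg < M.real 9 0) ∧ (relaxC c).run f M = M) ∨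
      (¬ (0 < M.nat 22 tg ∧ ¬ M.real 4 tg < M.real 9 0) ∧ (relaxC c).run f M = c.run f M) := by
    by_cases h1 : 0 < M.nat 22 tg
    · by_cases h2 : M.real 4 tg < M.real 9 0
      · right
        rw [relaxC, run_ite_pos (by simpa [Test.Holds, NExp.eval, h30] using h1),
          run_when_true (by simpa [Test.Holds, RExp.eval, NExp.eval, h30] using h2)]
        exact ⟨by simp [h2], rfl⟩
      · left
        rw [relaxC, run_ite_pos (by simpa [Test.Holds, NExp.eval, h30] using h1),
          run_when_false (by simpa [Test.Holds, RExp.eval, NExp.eval, h30] using h2)]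
        exact ⟨⟨h1, h2⟩, rfl⟩
    · right
      rw [relaxC, run_ite_neg (by simpa [Test.Holds, NExp.eval, h30] using h1)]
      exact ⟨by simp [h1], rfl⟩
  rcases main with ⟨⟨h₁, h₂⟩, e⟩ | ⟨h₁, e⟩ <;> rw [e]
  · exact ⟨.of_same hQ fun st => .refl _ _ _, h₁, not_lt.1 h₂⟩
  · refine ⟨⟨fun st hst => h.off st fun h' => hst (h' ▸ htg), fun st v hv => ?_, fun hok st hst => ?_⟩,
      h.fl, h.val.ge⟩
    · by_cases hst : st = tg
      · subst hst
        refine ⟨h.fl, ?_⟩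
        rw [h.val]
        have := hv.2
        by_contra hlt
        exact h₁ ⟨hv.1, by linarith⟩
      · exact hv.same (h.off st hst)
    · by_cases hst' : st = tg
      · subst hst'
        exact fun _ => ⟨L, h.len, hL, h.list, h.val ▸ hG⟩
      · exact (hok st hst).same hQ (h.off st hst')

def startC : Cmd := setN 33 (.const 0) (.const 0)

/-- Make the target entry an empty list. -/
def bodyEmpty : Cmd := block [startC, finishC]

/-- Copy the first source entry. -/
def bodyCopy : Cmd := block [startC, appendSrc 31, finishC]

/-- Concatenate the source entries. -/
def bodyJoin : Cmd := block [startC, appendSrc 31, appendSrc 32, finishC]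

/-- Concatenate the source entries and fill the gaps of the second one. -/
def bodyFill : Cmd := block [startC, appendSrc 31,
  setR 10 (.const 0) (.add (.read 7 (nv 35)) (.read 5 (nv 37))), appendFill, finishC]

theorem startC_target (M : Memory) (tg : ℕ) :
    TargetIs D tg (startC.run f M) ([] : Schedule n) :=
  ⟨fun k hk => absurd hk (by simp), by simp [startC, NExp.eval]⟩

theorem bodyEmpty_spec {M : Memory} {tg : ℕ} (h30 : M.nat 30 0 = tg) :
    Written D tg (M.real 9 0) ([] : Schedule n) M (bodyEmpty.run f M) := by
  simp only [bodyEmpty, block, run_seq]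
  exact finishC_spec (startC_target M tg) (by rw [run_nat f M (by decide)]; exact h30)
    (by rw [run_real f M (by decide)]) (fun _ _ => rfl) (run_nat f M (by decide))
    (run_nat f M (by decide)) (run_real f M (by decide))

theorem bodyCopy_spec {M : Memory} {tg src : ℕ} {L : Schedule n} (h30 : M.nat 30 0 = tg)
    (h31 : M.nat 31 0 = src) (h14 : M.nat 14 0 = Q) (hQ : Q ≤ D)
    (h18 : M.nat 18 tg = tg * D) (h18' : M.nat 18 src = src * D) (h1 : M.nat 1 src = L.length)
    (hL : L.length ≤ Q) (hLs : ListAt M.cells (src * D) L) (hne : src ≠ tg) :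
    Written D tg (M.real 9 0) L M (bodyCopy.run f M) := by
  simp only [bodyCopy, block, run_seq]
  set M₁ := startC.run f M
  have hn : ∀ a, a ≠ 33 → M₁.nat a = M.nat a := fun a ha =>
    run_nat f M (by simpa [startC, wN] using ha)
  obtain ⟨i₁, i₂⟩ := appendSrc_spec (f := f) (M := M₁) (sv := 31) (Q := Q) (Ls := L) (.inl rfl)
    (startC_target M tg)
    (by rw [hn 30 (by decide), h30]) (by rw [hn 31 (by decide), h31])
    (by rw [hn 14 (by decide), h14]) (by rw [hn 1 (by decide), h1])
    (by rw [hn 18 (by decide), h18]) (by rw [hn 18 (by decide), h18'])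
    (by simp only [List.length_nil]; omega) hLs hL hne
  exact finishC_spec i₁ (by rw [run_nat f M₁ (by decide), hn 30 (by decide), h30])
    (by rw [run_real f M₁ (by decide), run_real f M (by decide)])
    i₂ (by rw [run_nat f M₁ (by decide), hn 22 (by decide)])
    (by rw [run_nat f M₁ (by decide), hn 1 (by decide)])
    (by rw [run_real f M₁ (by decide), run_real f M (by decide)])

theorem bodyJoin_spec {M : Memory} {tg src src' : ℕ} {L L' : Schedule n} (h30 : M.nat 30 0 = tg)
    (h31 : M.nat 31 0 = src) (h32 : M.nat 32 0 = src') (h14 : M.nat 14 0 = Q)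
    (h18 : M.nat 18 tg = tg * D) (h18' : M.nat 18 src = src * D)
    (h18'' : M.nat 18 src' = src' * D) (h1 : M.nat 1 src = L.length)
    (h1' : M.nat 1 src' = L'.length) (hL : L.length ≤ Q) (hL' : L'.length ≤ Q)
    (hLL : L.length + L'.length ≤ D)
    (hLs : ListAt M.cells (src * D) L) (hLs' : ListAt M.cells (src' * D) L') (hne : src ≠ tg)
    (hne' : src' ≠ tg) :
    Written D tg (M.real 9 0) (L ++ L') M (bodyJoin.run f M) := by
  simp only [bodyJoin, block, run_seq]
  set M₁ := startC.run f M
  have hn : ∀ a, a ≠ 33 → M₁.nat a = M.nat a := fun a ha =>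
    run_nat f M (by simpa [startC, wN] using ha)
  obtain ⟨i₁, i₂⟩ := appendSrc_spec (f := f) (M := M₁) (sv := 31) (Q := Q) (Ls := L) (.inl rfl)
    (startC_target M tg)
    (by rw [hn 30 (by decide), h30]) (by rw [hn 31 (by decide), h31])
    (by rw [hn 14 (by decide), h14]) (by rw [hn 1 (by decide), h1])
    (by rw [hn 18 (by decide), h18]) (by rw [hn 18 (by decide), h18'])
    (by simp only [List.length_nil]; omega) hLs hL hne
  rw [List.nil_append] at i₁
  set M₂ := (appendSrc 31).run f M₁
  have hn₂ : ∀ a, a ≠ 33 → a ∉ (appendSrc 31).wN → M₂.nat a = M.nat a := fun a ha ha' => by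
    rw [← hn a ha]; exact run_nat f M₁ ha'
  obtain ⟨j₁, j₂⟩ := appendSrc_spec (f := f) (M := M₂) (sv := 32) (Q := Q) (Ls := L') (.inr rfl)
    i₁
    (by rw [hn₂ 30 (by decide) (by decide), h30]) (by rw [hn₂ 32 (by decide) (by decide), h32])
    (by rw [hn₂ 14 (by decide) (by decide), h14]) (by rw [hn₂ 1 (by decide) (by decide), h1'])
    (by rw [hn₂ 18 (by decide) (by decide), h18]) (by rw [hn₂ 18 (by decide) (by decide), h18''])
    hLL (ListAt.off (M := M₁) hLs' (by omega) hne' i₂) hL' hne'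
  exact finishC_spec j₁ (by rw [run_nat f M₂ (by decide), hn₂ 30 (by decide) (by decide), h30])
    (by rw [run_real f M₂ (by decide), run_real f M₁ (by decide), run_real f M (by decide)])
    (CellsOff.trans (M' := M₂) i₂ j₂)
    (by rw [run_nat f M₂ (by decide), hn₂ 22 (by decide) (by decide)])
    (by rw [run_nat f M₂ (by decide), hn₂ 1 (by decide) (by decide)])
    (by rw [run_real f M₂ (by decide), run_real f M₁ (by decide), run_real f M (by decide)])

theorem bodyFill_spec {M : Memory} {tg src src' : ℕ} {k : Fin n} {L L' : Schedule n}
    {a : ℝ} (h30 : M.nat 30 0 = tg)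
    (h31 : M.nat 31 0 = src) (h32 : M.nat 32 0 = src') (h41 : M.nat 41 0 = k)
    (ha : M.real 7 (M.nat 35 0) + M.real 5 (M.nat 37 0) = a) (h14 : M.nat 14 0 = Q)
    (h18 : M.nat 18 tg = tg * D) (h18' : M.nat 18 src = src * D)
    (h18'' : M.nat 18 src' = src' * D) (h1 : M.nat 1 src = L.length)
    (h1' : M.nat 1 src' = L'.length) (hL : L.length ≤ Q) (hL' : L'.length ≤ Q)
    (hLL : L.length + (2 * L'.length + 1) ≤ D)
    (hLs : ListAt M.cells (src * D) L) (hLs' : ListAt M.cells (src' * D) L') (hne : src ≠ tg)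
    (hne' : src' ≠ tg) :
    Written D tg (M.real 9 0) (L ++ fill k a L' (M.real 8 0)) M (bodyFill.run f M) := by
  simp only [bodyFill, block, run_seq]
  set M₁ := startC.run f M
  have hn : ∀ a, a ≠ 33 → M₁.nat a = M.nat a := fun a ha =>
    run_nat f M (by simpa [startC, wN] using ha)
  obtain ⟨i₁, i₂⟩ := appendSrc_spec (f := f) (M := M₁) (sv := 31) (Q := Q) (Ls := L) (.inl rfl)
    (startC_target M tg)
    (by rw [hn 30 (by decide), h30]) (by rw [hn 31 (by decide), h31])
    (by rw [hn 14 (by decide), h14]) (by rw [hn 1 (by decide), h1])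
    (by rw [hn 18 (by decide), h18]) (by rw [hn 18 (by decide), h18'])
    (by simp only [List.length_nil]; omega) hLs hL hne
  rw [List.nil_append] at i₁
  set M₂ := (appendSrc 31).run f M₁
  have hn₂ : ∀ a, a ≠ 33 → a ∉ (appendSrc 31).wN → M₂.nat a = M.nat a := fun a ha ha' => by
    rw [← hn a ha]; exact run_nat f M₁ ha'
  have hr₂ : ∀ a, a ∉ (appendSrc 31).wR → M₂.real a = M.real a := fun a ha' =>
    run_real f M₁ ha'
  set M₃ := (setR 10 (.const 0) (.add (.read 7 (nv 35)) (.read 5 (nv 37)))).run f M₂ with hM₃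
  have hn₃ : M₃.nat = M₂.nat := rfl
  have hr₃ : ∀ b, b ≠ 10 → M₃.real b = M₂.real b := fun b hb => M₂.setR_row hb
  have h10 : M₃.real 10 0 = a := by
    rw [hM₃, run_setR]
    simp only [NExp.eval, RExp.eval, Memory.setR_same]
    rw [hn₂ 35 (by decide) (by decide), hn₂ 37 (by decide) (by decide), hr₂ 7 (by decide),
      hr₂ 5 (by decide), ha]
  have hc₃ : M₃.cells = M₂.cells := by
    funext x
    simp only [Memory.cells, hn₃, hr₃ 2 (by decide), hr₃ 3 (by decide)]
  have i₁' : TargetIs D tg M₃ L := ⟨hc₃ ▸ i₁.1, i₁.2⟩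
  obtain ⟨j₁, j₂⟩ := appendFill_spec (f := f) (M := M₃) (Q := Q) (Ls := L') (k := k) i₁'
    (by rw [hn₃, hn₂ 30 (by decide) (by decide), h30])
    (by rw [hn₃, hn₂ 32 (by decide) (by decide), h32])
    (by rw [hn₃, hn₂ 41 (by decide) (by decide), h41])
    (by rw [hn₃, hn₂ 14 (by decide) (by decide), h14])
    (by rw [hn₃, hn₂ 1 (by decide) (by decide), h1'])
    (by rw [hn₃, hn₂ 18 (by decide) (by decide), h18])
    (by rw [hn₃, hn₂ 18 (by decide) (by decide), h18''])
    hLL (hc₃ ▸ ListAt.off (M := M₁) hLs' (by omega) hne' i₂) hL' hne'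
  rw [h10, hr₃ 8 (by decide), hr₂ 8 (by decide)] at j₁
  refine finishC_spec j₁
    (by rw [run_nat f M₃ (by decide), hn₃, hn₂ 30 (by decide) (by decide), h30])
    (by rw [run_real f M₃ (by decide), hr₃ 9 (by decide), hr₂ 9 (by decide)])
    (CellsOff.trans (M' := M₃) (fun x hx => by rw [hc₃]; exact i₂ x hx) j₂)
    (by rw [run_nat f M₃ (by decide), hn₃, hn₂ 22 (by decide) (by decide)])
    (by rw [run_nat f M₃ (by decide), hn₃, hn₂ 1 (by decide) (by decide)])
    (by rw [run_real f M₃ (by decide), hr₃ 4 (by decide), hr₂ 4 (by decide)])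

end Relax
end GPSP

namespace GPSP

open Cmd

/-! ### The dynamic program: rows of the table -/

/-- The parameters and auxiliary tables of the dynamic program. -/
structure Tables (n : ℕ) where
  inst : Instance n
  E : ℕ
  Q : ℕ
  D : ℕ
  K : ℕ
  P : ℕ → ℝ
  R : ℕ → ℝ
  NX : ℕ → ℕ → ℕ
  w : ℕ → ℕ

section Rows

variable {n : ℕ}

/-- The row number `r` of the table. -/
def Tables.Row (T : Tables n) (r : ℕ) : Set ℕ :=
  {st | ∃ e < T.E, ∃ S < T.Q, st = addr T.D r e S}

/-- The properties of the auxiliary tables, apart from the weights. -/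
structure Tables.Sorted (T : Tables n) : Prop where
  E_le : T.E ≤ T.D
  Q_le : T.Q ≤ T.D
  Q_eq : T.Q = 2 ^ T.K
  R_mono : ∀ l l', l ≤ l' → l' < n → T.R l ≤ T.R l'
  R_surj : ∀ j : Fin n, ∃ l < n, T.R l = T.inst.release j
  P_mono : ∀ e e', e ≤ e' → e' < T.E → T.P e ≤ T.P e'
  P_nonneg : ∀ e < T.E, 0 ≤ T.P e
  NX_gt : ∀ l < n, ∀ e < T.E, l < T.NX l e
  NX_le : ∀ l < n, ∀ e < T.E, T.NX l e ≤ n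
  NX_ge : ∀ l < n, ∀ e < T.E, T.NX l e < n → T.R l + T.P e ≤ T.R (T.NX l e)
  NX_least : ∀ l < n, ∀ e < T.E, ∀ l', l < l' → l' < n → T.R l + T.P e ≤ T.R l' → T.NX l e ≤ l'

/-- The properties of the auxiliary tables. -/
structure Tables.Valid (T : Tables n) : Prop extends T.Sorted where
  w_pow : ∀ j : Fin n, ∃ b, T.w j = 2 ^ b

/-- The memory contains the auxiliary tables, apart from the weights. -/
structure Tables.In₀ (T : Tables n) (M : Memory) : Prop where
  hn : M.nat 0 0 = n
  E : M.nat 10 0 = T.E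
  Q : M.nat 14 0 = T.Q
  mul : ∀ x < (2 * n + 2) * T.D * T.D, M.nat 18 x = x * T.D
  pc : ∀ x < T.Q, M.nat 19 x = popc x
  nx : ∀ l < n, ∀ e < T.E, M.nat 20 (l * T.D + e) = T.NX l e
  P : ∀ e < T.E, M.real 5 e = T.P e
  R : ∀ l < n, M.real 7 l = T.R l
  rel : ∀ j : Fin n, M.real 0 j = T.inst.release j
  proc : ∀ j : Fin n, M.real 1 j = T.inst.proc j

/-- The memory contains the auxiliary tables. -/
structure Tables.In (T : Tables n) (M : Memory) : Prop extends T.In₀ M where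
  w : ∀ j : Fin n, M.nat 21 j = T.w j

theorem Tables.In₀.congr {T : Tables n} {M M' : Memory} (h : T.In₀ M) {wn wr : List ℕ}
    (hs : SameOff wn wr M M') (hn : ∀ a ∈ [0, 10, 14, 18, 19, 20], a ∉ wn)
    (hr : ∀ a ∈ [0, 1, 5, 7], a ∉ wr) : T.In₀ M' := by
  have en : ∀ a ∈ [0, 10, 14, 18, 19, 20], M'.nat a = M.nat a := fun a ha => hs.nat a (hn a ha)
  have er : ∀ a ∈ [0, 1, 5, 7], M'.real a = M.real a := fun a ha => hs.real a (hr a ha)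
  simp only [List.mem_cons, List.not_mem_nil, or_false, forall_eq_or_imp, forall_eq] at en er
  obtain ⟨e0, e10, e14, e18, e19, e20⟩ := en
  obtain ⟨r0, r1, r5, r7⟩ := er
  constructor
  · rw [e0]; exact h.hn
  · rw [e10]; exact h.E
  · rw [e14]; exact h.Q
  · rw [e18]; exact h.mul
  · rw [e19]; exact h.pc
  · rw [e20]; exact h.nx
  · rw [r5]; exact h.P
  · rw [r7]; exact h.R
  · rw [r0]; exact h.rel
  · rw [r1]; exact h.proc

theorem Tables.In.congr {T : Tables n} {M M' : Memory} (h : T.In M) {wn wr : List ℕ}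
    (hs : SameOff wn wr M M') (hn : ∀ a ∈ [0, 10, 14, 18, 19, 20, 21], a ∉ wn)
    (hr : ∀ a ∈ [0, 1, 5, 7], a ∉ wr) : T.In M' :=
  ⟨h.toIn₀.congr hs (fun a ha => hn a (by simp only [List.mem_cons] at ha ⊢; tauto)) hr,
    by rw [hs.nat 21 (hn 21 (by simp))]; exact h.w⟩

variable {T : Tables n} {M : Memory} {C : ℝ}

theorem Tables.In₀.mul' (h : T.In₀ M) {x D : ℕ} (hD : D < T.D) (hx : x < 2 * n + 2) :
    M.nat 18 x = x * T.D := by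
  refine h.mul x (hx.trans_le ?_)
  rw [mul_assoc]
  exact Nat.le_mul_of_pos_right _ (Nat.mul_pos (by omega) (by omega))

theorem Tables.In₀.mul_addr (h : T.In₀ M) {r e S : ℕ} (hr : r < 2 * n + 2) (he : e < T.D)
    (hS : S < T.D) : M.nat 18 (addr T.D r e S) = addr T.D r e S * T.D :=
  h.mul _ (addr_lt hr he hS)

theorem Tables.In₀.adr_eval (h : T.In₀ M) {r e S : NExp} {r' e' S' : ℕ} (hr : r.eval M = r')
    (he : e.eval M = e') (hS : S.eval M = S') (hr' : r' < 2 * n + 2) (he' : e' < T.D) :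
    (adr r e S).eval M = addr T.D r' e' S' := by
  simp only [NExp.eval, hr, he, hS, addr]
  rw [h.mul' he' hr', h.mul _ ?_]
  rw [mul_assoc]
  have h₁ : r' * T.D + e' < (2 * n + 2) * T.D := by
    have := Nat.mul_le_mul_right T.D (show r' + 1 ≤ 2 * n + 2 from hr')
    rw [add_mul, one_mul] at this
    omega
  refine h₁.trans_le ?_
  rw [← mul_assoc]
  exact Nat.le_mul_of_pos_right _ (by omega)

theorem Tables.Sorted.row_unique (hT : T.Sorted) {r r' st : ℕ} (h : st ∈ T.Row r)
    (h' : st ∈ T.Row r') : r = r' := by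
  obtain ⟨e, he, S, hS, rfl⟩ := h
  obtain ⟨e', he', S', hS', h⟩ := h'
  have h₁ := hT.E_le
  have h₂ := hT.Q_le
  exact (addr_inj (by omega) (by omega) (by omega) (by omega) h).1

theorem Tables.mem_row {r e S : ℕ} (he : e < T.E) (hS : S < T.Q) : addr T.D r e S ∈ T.Row r :=
  ⟨e, he, S, hS, rfl⟩

/-- Invalidate all entries of a row. -/
def clearRow (r : NExp) : Cmd :=
  loops [(47, 10), (46, 14)] (setN 22 (adr r (nv 47) (nv 46)) (.const 0))

theorem clearRow_spec (f : ℕ → ℝ → ℝ) (hT : T.Sorted) (hIn : T.In₀ M) {r : NExp} {r' : ℕ}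
    (hr' : r' < 2 * n + 2)
    (hr : ∀ M', SameOff (clearRow r).wN (clearRow r).wR M M' → r.eval M' = r') :
    (∀ st, st ∉ T.Row r' → EntSame T.D st M ((clearRow r).run f M)) ∧
      ∀ st ∈ T.Row r', ((clearRow r).run f M).nat 22 st = 0 := by
  have key := loops_rule (f := f) (c := setN 22 (adr r (nv 47) (nv 46)) (.const 0)) (M := M)
    (fun M M' => (∀ st, st ∉ T.Row r' → EntSame T.D st M M') ∧
      ∀ st, M.nat 22 st = 0 → M'.nat 22 st = 0)
    (fun M => ⟨fun st _ => .refl _ _ _, fun _ h => h⟩)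
    (fun M M' M'' h h' => ⟨fun st hst => (h.1 st hst).trans (h'.1 st hst),
      fun st hst => h'.2 st (h.2 st hst)⟩)
    [(47, 10), (46, 14)]
    (fun xs M => ∀ e S, xs = [e, S] → M.nat 22 (addr T.D r' e S) = 0)
    (fun xs M M' h h' e S hx => h.2 _ (h' e S hx))
    (by
      intro p hp M y
      simp only [List.mem_cons, List.not_mem_nil, or_false] at hp
      rcases hp with rfl | rfl <;> exact ⟨fun st _ => ⟨rfl, rfl, rfl, fun _ _ => rfl⟩, fun _ h => h⟩)
    (by rfl)
    (by
      intro M' hs hrange _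
      simp only [List.mem_cons, List.not_mem_nil, or_false, forall_eq_or_imp, forall_eq, hIn.E,
        hIn.Q] at hrange
      obtain ⟨he, hS⟩ := hrange
      have h₁ := hT.E_le
      have e : (setN 22 (adr r (nv 47) (nv 46)) (.const 0)).run f M' =
          M'.setN 22 (addr T.D r' (M'.nat 47 0) (M'.nat 46 0)) 0 := by
        rw [run_setN, (hIn.congr hs (by simp [loops, wN]) (by simp [loops, wR])).adr_eval
          (e' := M'.nat 47 0) (hr M' hs) rfl rfl hr' (by omega)]
        rfl
      rw [e]
      refine ⟨⟨fun st hst => ⟨?_, rfl, rfl, fun _ _ => rfl⟩, fun st hst => ?_⟩, ?_⟩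
      · rw [Memory.setN_nat, if_neg]
        rintro ⟨-, rfl⟩
        exact hst (Tables.mem_row he hS)
      · rw [Memory.setN_nat]
        split_ifs
        exacts [rfl, hst]
      · rintro e S hx
        simp only [List.map_cons, List.map_nil, List.cons.injEq, and_true] at hx
        rw [Memory.setN_nat, if_pos ⟨rfl, by rw [hx.1, hx.2]⟩])
    (by simp [loops, wN])
  refine ⟨key.1.1, ?_⟩
  rintro st ⟨e, he, S, hS, rfl⟩
  exact key.2 [e, S] (.cons (by simpa [hIn.E] using he) (.cons (by simpa [hIn.Q] using hS) .nil))
    e S rfl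

/-- Enter the empty list into the entries of a row for total length and weight zero. -/
def initRow (r : NExp) : Cmd :=
  loops [(47, 10), (46, 14)]
    (when [(false, .ltNat (.const 0) (nv 46)),
        (false, .ltReal (.read 5 (nv 47)) (.add (.read 5 (nv 47)) (.read 5 (nv 47))))]
      (block [setN 30 (.const 0) (adr r (nv 47) (nv 46)),
        setR 9 (.const 0) (.sub (.read 5 (nv 47)) (.read 5 (nv 47))), relaxC bodyEmpty]))

theorem initRow_spec (f : ℕ → ℝ → ℝ) (hT : T.Sorted) (hIn : T.In₀ M) {r : NExp} {r' : ℕ}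
    (hr' : r' < 2 * n + 2)
    (hr : ∀ M', SameOff (initRow r).wN (initRow r).wR M M' → r.eval M' = r')
    {G : ℕ → ℝ → Schedule n → Prop} (hG : ∀ e < T.E, T.P e = 0 → G (addr T.D r' e 0) 0 []) :
    Step T.D T.Q (T.Row r') G M ((initRow r).run f M) ∧
      ∀ e < T.E, T.P e = 0 → LB ((initRow r).run f M) (addr T.D r' e 0) 0 := by
  have hQ0 : 0 < T.Q := hT.Q_eq ▸ by positivity
  have key := loops_rule (f := f) (M := M)
    (c := when [(false, .ltNat (.const 0) (nv 46)),
        (false, .ltReal (.read 5 (nv 47)) (.add (.read 5 (nv 47)) (.read 5 (nv 47))))]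
      (block [setN 30 (.const 0) (adr r (nv 47) (nv 46)),
        setR 9 (.const 0) (.sub (.read 5 (nv 47)) (.read 5 (nv 47))), relaxC bodyEmpty]))
    (Step T.D T.Q (T.Row r') G)
    (fun M => .of_same hT.Q_le fun st => .refl _ _ _)
    (fun M M' M'' h h' => h.trans h')
    [(47, 10), (46, 14)]
    (fun xs M => ∀ e, xs = [e, 0] → T.P e = 0 → LB M (addr T.D r' e 0) 0)
    (fun xs M M' h h' e hx he => h.mono _ _ (h' e hx he))
    (by
      intro p hp M y
      simp only [List.mem_cons, List.not_mem_nil, or_false] at hp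
      rcases hp with rfl | rfl <;>
        exact .of_same hT.Q_le fun st => ⟨rfl, rfl, rfl, fun _ _ => rfl⟩)
    (by rfl)
    (by
      intro M' hs hrange _
      simp only [List.mem_cons, List.not_mem_nil, or_false, forall_eq_or_imp, forall_eq, hIn.E,
        hIn.Q] at hrange
      obtain ⟨he, hS⟩ := hrange
      have h₁ := hT.E_le
      have hIn' := hIn.congr hs
        (by simp [loops, wN, when, block, relaxC, bodyEmpty, startC, finishC])
        (by simp [loops, wR, when, block, relaxC, bodyEmpty, startC, finishC])
      by_cases hg : M'.nat 46 0 = 0 ∧ T.P (M'.nat 47 0) = 0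
      · obtain ⟨hS0, hP0⟩ := hg
        rw [run_when_pos (by simp [Guard, Test.Holds, NExp.eval, RExp.eval, hIn'.P _ he, hP0, hS0])]
        simp only [block, run_seq, run_setN, run_setR, NExp.eval, RExp.eval]
        have ha := hIn'.adr_eval (hr M' hs) (e := nv 47) (S := nv 46) rfl rfl hr'
          (show M'.nat 47 0 < T.D by omega)
        simp only [NExp.eval] at ha
        rw [ha, hS0, sub_self]
        obtain ⟨j₁, j₂⟩ := relaxC_spec (f := f) (Q := T.Q) (A := T.Row r') (G := G)
          (M := (M'.setN 30 0 (addr T.D r' (M'.nat 47 0) 0)).setR 9 0 0) hT.Q_le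
          (by rw [Memory.setR_nat, Memory.setN_same]) (bodyEmpty_spec (by simp)) (by simp)
          (Tables.mem_row he hQ0) (by rw [Memory.setR_same]; exact hG _ he hP0)
        have j₀ : Step T.D T.Q (T.Row r') G M'
            ((M'.setN 30 0 (addr T.D r' (M'.nat 47 0) 0)).setR 9 0 0) :=
          .of_same hT.Q_le fun st => ⟨rfl, rfl, rfl, fun _ _ => rfl⟩
        refine ⟨j₀.trans j₁, ?_⟩
        intro e hx _
        simp only [List.map_cons, List.map_nil, List.cons.injEq, and_true] at hx
        rw [Memory.setR_same] at j₂
        rw [← hx.1]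
        exact j₂
      · rw [run_when_neg]
        · refine ⟨.of_same hT.Q_le fun st => .refl _ _ _, fun e hx hP => ?_⟩
          simp only [List.map_cons, List.map_nil, List.cons.injEq, and_true] at hx
          exact absurd ⟨hx.2, hx.1 ▸ hP⟩ hg
        · intro h
          -- Real expressions have no constants. A nonnegative length is zero exactly if it is not
          -- less than its double; likewise the value zero is written as a difference of equal
          -- terms.
          simp only [Guard, Test.Holds, NExp.eval, RExp.eval, hIn'.P _ he] at h
          have := hT.P_nonneg _ he
          exact hg ⟨by omega, by linarith [h.2.1]⟩)
    (by simp [loops, wN, when, block, relaxC, bodyEmpty, startC, finishC])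
  refine ⟨key.1, fun e he hP => key.2 [e, 0] ?_ e rfl hP⟩
  exact .cons (by simpa [hIn.E] using he) (.cons (by simpa [hIn.Q] using hQ0) .nil)

/-- Properties of the entries for blocks that start at the release date number `i`. -/
def Tables.GB (T : Tables n) (i e S : ℕ) (v : ℝ) (L : Schedule n) : Prop :=
  T.inst.Good T.w (T.P e) S v L ∧ ∀ x ∈ L, T.R i ≤ x.start ∧ x.finish ≤ T.R i + T.P e

/-- Properties of the entries for chains of blocks from the release date number `l` until `C`. -/
def Tables.GZ (T : Tables n) (C : ℝ) (l e S : ℕ) (v : ℝ) (L : Schedule n) : Prop :=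
  T.inst.Good T.w (T.P e) S v L ∧ ∀ x ∈ L, (l < n ∧ T.R l ≤ x.start) ∧ x.finish ≤ C

/-- `Step` indexes its property by the number of the entry. Row, length and code are recovered by
quantifying over all representations of this number; since `addr` is injective in the relevant
range, this is no extra demand. The same applies to `zfam`. -/
def Tables.bfam (T : Tables n) (i st : ℕ) (v : ℝ) (L : Schedule n) : Prop :=
  ∀ e < T.E, ∀ S < T.Q, st = addr T.D (i + 1) e S → T.GB i e S v L

def Tables.zfam (T : Tables n) (C : ℝ) (l st : ℕ) (v : ℝ) (L : Schedule n) : Prop :=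
  ∀ e < T.E, ∀ S < T.Q, st = addr T.D (n + 1 + l) e S → T.GZ C l e S v L

/-- The entries for blocks that start at release date number `i` are correct. -/
def Tables.bOK (T : Tables n) (i : ℕ) (M : Memory) : Prop :=
  ∀ st ∈ T.Row (i + 1), EntOK T.D T.Q (T.bfam i st) M st

/-- The entries for chains of blocks from release date number `l` on are correct. -/
def Tables.zOK (T : Tables n) (C : ℝ) (l : ℕ) (M : Memory) : Prop :=
  ∀ st ∈ T.Row (n + 1 + l), EntOK T.D T.Q (T.zfam C l st) M st

theorem Tables.Sorted.addr_eq (hT : T.Sorted) {r e S e' S' : ℕ} (he : e < T.E) (hS : S < T.Q)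
    (he' : e' < T.E) (hS' : S' < T.Q) (h : addr T.D r e S = addr T.D r e' S') :
    e = e' ∧ S = S' := by
  have h₁ := hT.E_le
  have h₂ := hT.Q_le
  exact (addr_inj (by omega) (by omega) (by omega) (by omega) h).2

theorem Tables.bOK.get {i e S : ℕ} (h : T.bOK i M) (he : e < T.E) (hS : S < T.Q)
    (hfl : 0 < M.nat 22 (addr T.D (i + 1) e S)) :
    ∃ L : Schedule n, M.nat 1 (addr T.D (i + 1) e S) = L.length ∧ L.length ≤ T.Q ∧
      ListAt M.cells (addr T.D (i + 1) e S * T.D) L ∧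
      T.GB i e S (M.real 4 (addr T.D (i + 1) e S)) L := by
  obtain ⟨L, h₁, h₂, h₃, h₄⟩ := h _ (Tables.mem_row he hS) hfl
  exact ⟨L, h₁, h₂, h₃, h₄ e he S hS rfl⟩

theorem Tables.zOK.get {l e S : ℕ} (h : T.zOK C l M) (he : e < T.E) (hS : S < T.Q)
    (hfl : 0 < M.nat 22 (addr T.D (n + 1 + l) e S)) :
    ∃ L : Schedule n, M.nat 1 (addr T.D (n + 1 + l) e S) = L.length ∧ L.length ≤ T.Q ∧
      ListAt M.cells (addr T.D (n + 1 + l) e S * T.D) L ∧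
      T.GZ C l e S (M.real 4 (addr T.D (n + 1 + l) e S)) L := by
  obtain ⟨L, h₁, h₂, h₃, h₄⟩ := h _ (Tables.mem_row he hS) hfl
  exact ⟨L, h₁, h₂, h₃, h₄ e he S hS rfl⟩

theorem Tables.bOK.same {i : ℕ} {M' : Memory} (h : T.bOK i M) (hT : T.Sorted)
    (hs : ∀ st ∈ T.Row (i + 1), EntSame T.D st M M') : T.bOK i M' :=
  fun st hst => (h st hst).same hT.Q_le (hs st hst)

theorem Tables.zOK.same {l : ℕ} {M' : Memory} (h : T.zOK C l M) (hT : T.Sorted)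
    (hs : ∀ st ∈ T.Row (n + 1 + l), EntSame T.D st M M') : T.zOK C l M' :=
  fun st hst => (h st hst).same hT.Q_le (hs st hst)

/-- A code below `2 ^ K` has at most `K` binary ones, so the schedule has at most `K` jobs and fewer
than `2 ^ K` pieces. Thus lists fit into the storage of their entries and into the `Q` rounds of the
copying loops. -/
theorem Tables.Sorted.length_le (hT : T.Sorted) {e : ℝ} {S : ℕ} {v : ℝ} {L : Schedule n}
    {w : ℕ → ℕ} (h : T.inst.Good w e S v L) (hS : S < T.Q) : L.length + 1 ≤ T.Q := by
  refine h.length.trans ?_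
  rw [hT.Q_eq] at hS ⊢
  exact Nat.pow_le_pow_right (by norm_num) (h.popc ▸ popc_le_of_lt_two_pow hS)

/-- Copy an entry of row `n + 2 + l` to row `n + 1 + l`. -/
def copyBody : Cmd :=
  block [setN 31 (.const 0) (adr (.add (.add (nv 0) (.const 2)) (nv 42)) (nv 47) (nv 46)),
    when [(true, .ltNat (.const 0) (.read 22 (nv 31)))]
      (block [setN 30 (.const 0) (adr (.add (.add (nv 0) (.const 1)) (nv 42)) (nv 47) (nv 46)),
        setR 9 (.const 0) (.read 4 (nv 31)), relaxC bodyCopy])]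

/-- A chain that may start from position `l + 1` on may also start from position `l` on, since the
release dates are sorted. -/
theorem copyBody_spec (f : ℕ → ℝ → ℝ) (hT : T.Sorted) (hIn : T.In₀ M) {l e S : ℕ} (hl : l < n)
    (h42 : M.nat 42 0 = l) (h47 : M.nat 47 0 = e) (h46 : M.nat 46 0 = S) (he : e < T.E)
    (hS : S < T.Q) (hz : T.zOK C (l + 1) M) :
    Step T.D T.Q (T.Row (n + 1 + l)) (T.zfam C l) M (copyBody.run f M) ∧
      ∀ v, LB M (addr T.D (n + 1 + (l + 1)) e S) v →
        LB (copyBody.run f M) (addr T.D (n + 1 + l) e S) v := by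
  have h₁ := hT.E_le
  have h₂ := hT.Q_le
  simp only [copyBody, block, run_seq]
  rw [run_setN, hIn.adr_eval (r' := n + 1 + (l + 1)) (e' := e) (S' := S)
    (by simp [NExp.eval, hIn.hn, h42]; omega) (by simp [NExp.eval, h47])
    (by simp [NExp.eval, h46]) (by omega) (by omega)]
  set src := addr T.D (n + 1 + (l + 1)) e S with hsrc
  set M₁ := M.setN 31 ((NExp.const 0).eval M) src with hM₁
  by_cases hfl : 0 < M.nat 22 src
  · rw [run_when_true (by simpa [Test.Holds, NExp.eval, hM₁, Memory.setN_nat] using hfl)]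
    simp only [run_seq]
    rw [run_setN, (hIn.congr (M' := M₁) (wn := [31]) (wr := []) (sameOff_setN _ _ _ (by simp))
      (by decide) (by decide)).adr_eval (r' := n + 1 + l) (e' := e) (S' := S)
      (by simp [NExp.eval, hM₁, Memory.setN_nat, hIn.hn, h42])
      (by simp [NExp.eval, hM₁, Memory.setN_nat, h47])
      (by simp [NExp.eval, hM₁, Memory.setN_nat, h46]) (by omega) (by omega)]
    set tg := addr T.D (n + 1 + l) e S with htg
    set M₂ := M₁.setN 30 ((NExp.const 0).eval M₁) tg with hM₂
    have hv : (RExp.read 4 (nv 31)).eval f M₂ = M.real 4 src := by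
      simp [RExp.eval, NExp.eval, hM₁, hM₂, Memory.setN_nat]
    rw [run_setR, hv]
    set M₃ := M₂.setR 9 ((NExp.const 0).eval M₂) (M.real 4 src) with hM₃
    have hsame : ∀ st, EntSame T.D st M M₃ := fun st => ⟨rfl, rfl, rfl, fun _ _ => rfl⟩
    obtain ⟨L, g₁, g₂, g₃, g₄⟩ := hz.get he hS hfl
    have hne : src ≠ tg := fun h => by
      have := (addr_inj (by omega) (by omega) (by omega) (by omega) h).1
      omega
    have h9 : M₃.real 9 0 = M.real 4 src := by simp [hM₃, NExp.eval]
    obtain ⟨j₁, j₂⟩ := relaxC_spec (f := f) (Q := T.Q) (A := T.Row (n + 1 + l)) (M := M₃)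
      (G := T.zfam C l) (tg := tg) (L := L) hT.Q_le
      (by simp [hM₃, hM₂, NExp.eval])
      (bodyCopy_spec (src := src) (Q := T.Q) (by simp [hM₃, hM₂, NExp.eval])
        (by simp [hM₃, hM₂, hM₁, NExp.eval, Memory.setN_nat])
        (by simpa [hM₃, hM₂, hM₁, NExp.eval, Memory.setN_nat] using hIn.Q) hT.Q_le
        (by simpa [hM₃, hM₂, hM₁, NExp.eval, Memory.setN_nat] using
          hIn.mul_addr (r := n + 1 + l) (e := e) (S := S) (by omega) (by omega) (by omega))
        (by simpa [hM₃, hM₂, hM₁, NExp.eval, Memory.setN_nat] using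
          hIn.mul_addr (r := n + 1 + (l + 1)) (e := e) (S := S) (by omega) (by omega) (by omega))
        (by simpa [hM₃, hM₂, hM₁, NExp.eval, Memory.setN_nat] using g₁) g₂ g₃ hne)
      g₂ (Tables.mem_row he hS)
      (by
        rw [h9]
        intro e' he' S' hS' h
        obtain ⟨rfl, rfl⟩ := hT.addr_eq he hS he' hS' h
        refine ⟨g₄.1, fun x hx => ?_⟩
        obtain ⟨⟨i₁, i₂⟩, i₃⟩ := g₄.2 x hx
        exact ⟨⟨hl, (hT.R_mono l (l + 1) (by omega) i₁).trans i₂⟩, i₃⟩)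
    rw [h9] at j₂
    exact ⟨(Step.of_same hT.Q_le hsame).trans j₁, fun v hv => j₂.le hv.2⟩
  · rw [run_when_false (by simpa [Test.Holds, NExp.eval, hM₁, Memory.setN_nat] using hfl)]
    exact ⟨.of_same hT.Q_le fun st => ⟨rfl, rfl, rfl, fun _ _ => rfl⟩, fun v hv => absurd hv.1 hfl⟩

/-- Extend a chain of blocks by a block that starts at release date number `l`. -/
def chainBody : Cmd :=
  block [setN 31 (.const 0) (adr (.add (nv 42) (.const 1)) (nv 37) (nv 38)),
    setN 32 (.const 0) (adr (.add (.add (nv 0) (.const 1)) (.read 20 (ad (nv 42) (nv 37))))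
      (nv 39) (nv 40)),
    when [(true, .ltNat (.const 0) (.read 22 (nv 31))), (true, .ltNat (.const 0) (.read 22 (nv 32))),
        (true, .ltNat (.add (nv 38) (nv 40)) (nv 14)),
        (false, .ltNat (.read 19 (.add (nv 38) (nv 40)))
          (.add (.read 19 (nv 38)) (.read 19 (nv 40)))),
        (false, .ltReal (.add (.read 5 (nv 37)) (.read 5 (nv 39))) (.read 5 (nv 47))),
        (false, .ltReal (.read 5 (nv 47)) (.add (.read 5 (nv 37)) (.read 5 (nv 39)))),
        (false, .ltReal (rv 8) (.add (.read 7 (nv 42)) (.read 5 (nv 37))))]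
      (block [setN 30 (.const 0) (adr (.add (.add (nv 0) (.const 1)) (nv 42)) (nv 47)
          (.add (nv 38) (nv 40))),
        setR 9 (.const 0) (.add (.read 4 (nv 31)) (.read 4 (nv 32))), relaxC bodyJoin])]

/-- The first block occupies the time from `R l` to `R l + P e₁`; the rest of the chain starts at or
after release date `NX l e₁`, hence after this block. Equality of lengths and absence of carries are
tested explicitly, so the entry is sound for all values of the loop variables. -/
theorem chainBody_spec (f : ℕ → ℝ → ℝ) (hT : T.Valid) (hIn : T.In₀ M)
    {l e₁ S₁ e₂ S₂ e : ℕ} (hl : l < n) (h42 : M.nat 42 0 = l) (h37 : M.nat 37 0 = e₁)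
    (h38 : M.nat 38 0 = S₁) (h39 : M.nat 39 0 = e₂) (h40 : M.nat 40 0 = S₂)
    (h47 : M.nat 47 0 = e) (h8 : M.real 8 0 = C) (he₁ : e₁ < T.E) (hS₁ : S₁ < T.Q)
    (he₂ : e₂ < T.E) (hS₂ : S₂ < T.Q) (he : e < T.E) (hb : T.bOK l M)
    (hz : ∀ l', l < l' → l' ≤ n → T.zOK C l' M) :
    Step T.D T.Q (T.Row (n + 1 + l)) (T.zfam C l) M (chainBody.run f M) ∧
      ∀ v₁ v₂, LB M (addr T.D (l + 1) e₁ S₁) v₁ →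
        LB M (addr T.D (n + 1 + T.NX l e₁) e₂ S₂) v₂ → S₁ + S₂ < T.Q →
        popc S₁ + popc S₂ ≤ popc (S₁ + S₂) → T.P e₁ + T.P e₂ = T.P e → T.R l + T.P e₁ ≤ C →
        LB (chainBody.run f M) (addr T.D (n + 1 + l) e (S₁ + S₂)) (v₁ + v₂) := by
  have h₁ := hT.E_le
  have h₂ := hT.Q_le
  have hNX := hT.NX_le l hl e₁ he₁
  have hNX' := hT.NX_gt l hl e₁ he₁
  simp only [chainBody, block, run_seq]
  rw [run_setN _ M 31, hIn.adr_eval (r' := l + 1) (e' := e₁) (S' := S₁)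
    (by simp [NExp.eval, h42]) (by simp [NExp.eval, h37])
    (by simp [NExp.eval, h38]) (by omega) (by omega)]
  set s₁ := addr T.D (l + 1) e₁ S₁ with hs₁
  set M₁ := M.setN 31 ((NExp.const 0).eval M) s₁ with hM₁
  rw [run_setN _ M₁ 32, (hIn.congr (M' := M₁) (wn := [31]) (wr := []) (sameOff_setN _ _ _ (by simp))
      (by decide) (by decide)).adr_eval (r' := n + 1 + T.NX l e₁) (e' := e₂) (S' := S₂)
      (by simp [NExp.eval, hM₁, Memory.setN_nat, hIn.hn, h42, h37,
        hIn.mul' (x := l) (show e < T.D by omega) (by omega), hIn.nx l hl e₁ he₁])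
      (by simp [NExp.eval, hM₁, Memory.setN_nat, h39])
      (by simp [NExp.eval, hM₁, Memory.setN_nat, h40]) (by omega) (by omega)]
  set s₂ := addr T.D (n + 1 + T.NX l e₁) e₂ S₂ with hs₂
  set M₂ := M₁.setN 32 ((NExp.const 0).eval M₁) s₂ with hM₂
  have hgs : Guard f M₂ [(true, .ltNat (.const 0) (.read 22 (nv 31))),
        (true, .ltNat (.const 0) (.read 22 (nv 32))),
        (true, .ltNat (.add (nv 38) (nv 40)) (nv 14)),
        (false, .ltNat (.read 19 (.add (nv 38) (nv 40)))
          (.add (.read 19 (nv 38)) (.read 19 (nv 40)))),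
        (false, .ltReal (.add (.read 5 (nv 37)) (.read 5 (nv 39))) (.read 5 (nv 47))),
        (false, .ltReal (.read 5 (nv 47)) (.add (.read 5 (nv 37)) (.read 5 (nv 39)))),
        (false, .ltReal (rv 8) (.add (.read 7 (nv 42)) (.read 5 (nv 37))))] ↔
      0 < M.nat 22 s₁ ∧ 0 < M.nat 22 s₂ ∧ S₁ + S₂ < T.Q ∧
        popc S₁ + popc S₂ ≤ M.nat 19 (S₁ + S₂) ∧ T.P e ≤ T.P e₁ + T.P e₂ ∧
        T.P e₁ + T.P e₂ ≤ T.P e ∧ T.R l + T.P e₁ ≤ C := by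
    simp [Guard, Test.Holds, NExp.eval, RExp.eval, hM₂, hM₁, Memory.setN_nat, h42, h37, h38, h39,
      h40, h47, h8, hIn.Q, hIn.P _ he₁, hIn.P _ he₂, hIn.P _ he, hIn.R l hl, hIn.pc _ hS₁,
      hIn.pc _ hS₂]
  by_cases hg : 0 < M.nat 22 s₁ ∧ 0 < M.nat 22 s₂ ∧ S₁ + S₂ < T.Q ∧
        popc S₁ + popc S₂ ≤ M.nat 19 (S₁ + S₂) ∧ T.P e ≤ T.P e₁ + T.P e₂ ∧
        T.P e₁ + T.P e₂ ≤ T.P e ∧ T.R l + T.P e₁ ≤ C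
  · rw [run_when_pos (hgs.2 hg)]
    obtain ⟨g₁, g₂, g₃, g₄, g₅, g₆, g₇⟩ := hg
    rw [hIn.pc _ g₃] at g₄
    have hPe : T.P e₁ + T.P e₂ = T.P e := le_antisymm g₆ g₅
    simp only [run_seq]
    rw [run_setN _ M₂ 30, (hIn.congr (M' := M₂) (wn := [31, 32]) (wr := [])
      ((sameOff_setN _ _ _ (by simp)).trans (sameOff_setN _ _ _ (by simp)))
      (by decide) (by decide)).adr_eval (r' := n + 1 + l) (e' := e) (S' := S₁ + S₂)
      (by simp [NExp.eval, hM₂, hM₁, Memory.setN_nat, hIn.hn, h42])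
      (by simp [NExp.eval, hM₂, hM₁, Memory.setN_nat, h47])
      (by simp [NExp.eval, hM₂, hM₁, Memory.setN_nat, h38, h40]) (by omega) (by omega)]
    set tg := addr T.D (n + 1 + l) e (S₁ + S₂) with htg
    set M₃ := M₂.setN 30 ((NExp.const 0).eval M₂) tg with hM₃
    have hv : (RExp.add (.read 4 (nv 31)) (.read 4 (nv 32))).eval f M₃ =
        M.real 4 s₁ + M.real 4 s₂ := by
      simp [RExp.eval, NExp.eval, hM₁, hM₂, hM₃, Memory.setN_nat]
    rw [run_setR, hv]
    set M₄ := M₃.setR 9 ((NExp.const 0).eval M₃) (M.real 4 s₁ + M.real 4 s₂) with hM₄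
    have hsame : ∀ st, EntSame T.D st M M₄ := fun st => ⟨rfl, rfl, rfl, fun _ _ => rfl⟩
    obtain ⟨L, a₁, a₂, a₃, a₄⟩ := hb.get he₁ hS₁ g₁
    obtain ⟨L', b₁, b₂, b₃, b₄⟩ := (hz _ hNX' hNX).get he₂ hS₂ g₂
    have hne : s₁ ≠ tg := fun h => by
      have := (addr_inj (by omega) (by omega) (by omega) (by omega) h).1
      omega
    have hne' : s₂ ≠ tg := fun h => by
      have := (addr_inj (by omega) (by omega) (by omega) (by omega) h).1
      omega
    have h9 : M₄.real 9 0 = M.real 4 s₁ + M.real 4 s₂ := by simp [hM₄, NExp.eval]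
    have hgood : T.inst.Good T.w (T.P e) (S₁ + S₂) (M.real 4 s₁ + M.real 4 s₂) (L ++ L') := by
      rw [← hPe]
      refine a₄.1.append b₄.1 (fun x hx y hy => ?_) hT.w_pow g₄
      obtain ⟨⟨i₁, i₂⟩, -⟩ := b₄.2 y hy
      exact (a₄.2 x hx).2.trans ((hT.NX_ge l hl e₁ he₁ i₁).trans i₂)
    have hlen := hT.length_le hgood g₃
    rw [List.length_append] at hlen
    obtain ⟨j₁, j₂⟩ := relaxC_spec (f := f) (Q := T.Q) (A := T.Row (n + 1 + l)) (M := M₄)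
      (G := T.zfam C l) (tg := tg) (L := L ++ L') hT.Q_le
      (by simp [hM₄, hM₃, NExp.eval])
      (bodyJoin_spec (src := s₁) (src' := s₂) (Q := T.Q) (by simp [hM₄, hM₃, NExp.eval])
        (by simp [hM₄, hM₃, hM₂, hM₁, NExp.eval, Memory.setN_nat])
        (by simp [hM₄, hM₃, hM₂, NExp.eval, Memory.setN_nat])
        (by simpa [hM₄, hM₃, hM₂, hM₁, NExp.eval, Memory.setN_nat] using hIn.Q)
        (by simpa [hM₄, hM₃, hM₂, hM₁, NExp.eval, Memory.setN_nat] using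
          hIn.mul_addr (r := n + 1 + l) (e := e) (S := S₁ + S₂) (by omega) (by omega) (by omega))
        (by simpa [hM₄, hM₃, hM₂, hM₁, NExp.eval, Memory.setN_nat] using
          hIn.mul_addr (r := l + 1) (e := e₁) (S := S₁) (by omega) (by omega) (by omega))
        (by simpa [hM₄, hM₃, hM₂, hM₁, NExp.eval, Memory.setN_nat] using
          hIn.mul_addr (r := n + 1 + T.NX l e₁) (e := e₂) (S := S₂) (by omega)
              (by omega) (by omega))
        (by simpa [hM₄, hM₃, hM₂, hM₁, NExp.eval, Memory.setN_nat] using a₁)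
        (by simpa [hM₄, hM₃, hM₂, hM₁, NExp.eval, Memory.setN_nat] using b₁)
        a₂ b₂ (by omega) a₃ b₃ hne hne')
      (by rw [List.length_append]; omega) (Tables.mem_row he g₃)
      (by
        rw [h9]
        intro e' he' S' hS' h
        obtain ⟨rfl, rfl⟩ := hT.addr_eq he g₃ he' hS' h
        refine ⟨hgood, fun x hx => ?_⟩
        rcases List.mem_append.1 hx with hx | hx
        · have := a₄.2 x hx
          exact ⟨⟨hl, this.1⟩, this.2.trans g₇⟩
        · obtain ⟨⟨i₁, i₂⟩, i₃⟩ := b₄.2 x hx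
          exact ⟨⟨hl, (hT.R_mono l _ hNX'.le i₁).trans i₂⟩, i₃⟩)
    rw [h9] at j₂
    exact ⟨(Step.of_same hT.Q_le hsame).trans j₁,
      fun v₁ v₂ hv₁ hv₂ _ _ _ _ => j₂.le (add_le_add hv₁.2 hv₂.2)⟩
  · rw [run_when_neg (mt hgs.1 hg)]
    refine ⟨.of_same hT.Q_le fun st => ⟨rfl, rfl, rfl, fun _ _ => rfl⟩,
      fun v₁ v₂ hv₁ hv₂ g₃ g₄ g₅ g₆ => absurd ⟨hv₁.1, hv₂.1, g₃, ?_, g₅.ge, g₅.le, g₆⟩ hg⟩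
    rw [hIn.pc _ g₃]
    exact g₄

/-- Combine a block, a chain and the job `k` of lowest priority into a block. -/
def blockBody : Cmd :=
  block [setN 31 (.const 0) (adr (.add (nv 35) (.const 1)) (nv 37) (nv 38)),
    setN 32 (.const 0) (adr (.add (.add (nv 0) (.const 1)) (.read 20 (ad (nv 35) (nv 37))))
      (nv 39) (nv 40)),
    when [(true, .ltNat (.const 0) (.read 22 (nv 31))), (true, .ltNat (.const 0) (.read 22 (nv 32))),
        (true, .ltNat (.add (.add (nv 38) (nv 40)) (.read 21 (nv 41))) (nv 14)),
        (false, .ltNat (.read 19 (.add (.add (nv 38) (nv 40)) (.read 21 (nv 41))))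
          (.add (.add (.read 19 (nv 38)) (.read 19 (nv 40))) (.const 1))),
        (false, .ltReal (.add (.add (.read 5 (nv 37)) (.read 5 (nv 39))) (.read 1 (nv 41)))
          (.read 5 (nv 36))),
        (false, .ltReal (.read 5 (nv 36))
          (.add (.add (.read 5 (nv 37)) (.read 5 (nv 39))) (.read 1 (nv 41)))),
        (false, .ltReal (.add (.read 7 (nv 35)) (.read 5 (nv 37))) (.read 0 (nv 41)))]
      (block [setN 30 (.const 0) (adr (.add (nv 35) (.const 1)) (nv 36)
          (.add (.add (nv 38) (nv 40)) (.read 21 (nv 41)))),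
        setR 9 (.const 0) (.add (.add (.read 4 (nv 31)) (.read 4 (nv 32))) (.query (nv 41) (rv 8))),
        relaxC bodyFill])]

theorem add_two_mul_le {a b x y q : ℕ} (ha : a + 1 ≤ x) (hb : b + 1 ≤ y) (hq : x * y * 2 ≤ q) :
    a + (2 * b + 1) ≤ q := by
  have := Nat.mul_le_mul ha hb
  nlinarith [Nat.zero_le (a * b)]

-- The program version of the constructor `Blk.step`. The smaller block ends at `R i + P e₁`, the
-- chain lies between this time and `C`, and by the length equation the idle time there is precisely
-- the processing time of `k`.
set_option maxHeartbeats 800000 in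
theorem blockBody_spec (hT : T.Valid) (hIn : T.In M)
    {i e₁ S₁ e₂ S₂ e : ℕ} {k : Fin n} (hi : i < n) (h35 : M.nat 35 0 = i) (h37 : M.nat 37 0 = e₁)
    (h38 : M.nat 38 0 = S₁) (h39 : M.nat 39 0 = e₂) (h40 : M.nat 40 0 = S₂)
    (h36 : M.nat 36 0 = e) (h41 : M.nat 41 0 = k) (h8 : M.real 8 0 = C)
    (hC : C = T.R i + T.P e) (he₁ : e₁ < T.E) (hS₁ : S₁ < T.Q)
    (he₂ : e₂ < T.E) (hS₂ : S₂ < T.Q) (he : e < T.E) (hb : T.bOK i M)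
    (hz : ∀ l', i < l' → l' ≤ n → T.zOK C l' M) :
    Step T.D T.Q (T.Row (i + 1)) (T.bfam i) M (blockBody.run T.inst.oracle M) ∧
      ∀ v₁ v₂, LB M (addr T.D (i + 1) e₁ S₁) v₁ →
        LB M (addr T.D (n + 1 + T.NX i e₁) e₂ S₂) v₂ → S₁ + S₂ + T.w k < T.Q →
        popc S₁ + popc S₂ + 1 ≤ popc (S₁ + S₂ + T.w k) →
        T.P e₁ + T.P e₂ + T.inst.proc k = T.P e → T.inst.release k ≤ T.R i + T.P e₁ →
        LB (blockBody.run T.inst.oracle M) (addr T.D (i + 1) e (S₁ + S₂ + T.w k))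
          (v₁ + v₂ + T.inst.profit k C) := by
  set f := T.inst.oracle with hf
  have h₁ := hT.E_le
  have h₂ := hT.Q_le
  have hNX := hT.NX_le i hi e₁ he₁
  have hNX' := hT.NX_gt i hi e₁ he₁
  simp only [blockBody, block, run_seq]
  rw [run_setN _ M 31, hIn.adr_eval (r' := i + 1) (e' := e₁) (S' := S₁)
    (by simp [NExp.eval, h35]) (by simp [NExp.eval, h37])
    (by simp [NExp.eval, h38]) (by omega) (by omega)]
  set s₁ := addr T.D (i + 1) e₁ S₁ with hs₁
  set M₁ := M.setN 31 ((NExp.const 0).eval M) s₁ with hM₁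
  rw [run_setN _ M₁ 32, (hIn.congr (M' := M₁) (wn := [31]) (wr := []) (sameOff_setN _ _ _ (by simp))
      (by decide) (by decide)).adr_eval (r' := n + 1 + T.NX i e₁) (e' := e₂) (S' := S₂)
      (by simp [NExp.eval, hM₁, Memory.setN_nat, hIn.hn, h35, h37,
        hIn.mul' (x := i) (show e < T.D by omega) (by omega), hIn.nx i hi e₁ he₁])
      (by simp [NExp.eval, hM₁, Memory.setN_nat, h39])
      (by simp [NExp.eval, hM₁, Memory.setN_nat, h40]) (by omega) (by omega)]
  set s₂ := addr T.D (n + 1 + T.NX i e₁) e₂ S₂ with hs₂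
  set M₂ := M₁.setN 32 ((NExp.const 0).eval M₁) s₂ with hM₂
  have hgs : Guard f M₂ [(true, .ltNat (.const 0) (.read 22 (nv 31))),
        (true, .ltNat (.const 0) (.read 22 (nv 32))),
        (true, .ltNat (.add (.add (nv 38) (nv 40)) (.read 21 (nv 41))) (nv 14)),
        (false, .ltNat (.read 19 (.add (.add (nv 38) (nv 40)) (.read 21 (nv 41))))
          (.add (.add (.read 19 (nv 38)) (.read 19 (nv 40))) (.const 1))),
        (false, .ltReal (.add (.add (.read 5 (nv 37)) (.read 5 (nv 39))) (.read 1 (nv 41)))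
          (.read 5 (nv 36))),
        (false, .ltReal (.read 5 (nv 36))
          (.add (.add (.read 5 (nv 37)) (.read 5 (nv 39))) (.read 1 (nv 41)))),
        (false, .ltReal (.add (.read 7 (nv 35)) (.read 5 (nv 37))) (.read 0 (nv 41)))] ↔
      0 < M.nat 22 s₁ ∧ 0 < M.nat 22 s₂ ∧ S₁ + S₂ + T.w k < T.Q ∧
        popc S₁ + popc S₂ + 1 ≤ M.nat 19 (S₁ + S₂ + T.w k) ∧
        T.P e ≤ T.P e₁ + T.P e₂ + T.inst.proc k ∧
        T.P e₁ + T.P e₂ + T.inst.proc k ≤ T.P e ∧ T.inst.release k ≤ T.R i + T.P e₁ := by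
    simp [Guard, Test.Holds, NExp.eval, RExp.eval, hM₂, hM₁, Memory.setN_nat, h35, h36, h37, h38,
      h39, h40, h41, hIn.Q, hIn.P _ he₁, hIn.P _ he₂, hIn.P _ he, hIn.R i hi, hIn.pc _ hS₁,
      hIn.pc _ hS₂, hIn.w k, hIn.rel k, hIn.proc k]
  by_cases hg : 0 < M.nat 22 s₁ ∧ 0 < M.nat 22 s₂ ∧ S₁ + S₂ + T.w k < T.Q ∧
        popc S₁ + popc S₂ + 1 ≤ M.nat 19 (S₁ + S₂ + T.w k) ∧
        T.P e ≤ T.P e₁ + T.P e₂ + T.inst.proc k ∧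
        T.P e₁ + T.P e₂ + T.inst.proc k ≤ T.P e ∧ T.inst.release k ≤ T.R i + T.P e₁
  · rw [run_when_pos (hgs.2 hg)]
    obtain ⟨g₁, g₂, g₃, g₄, g₅, g₆, g₇⟩ := hg
    rw [hIn.pc _ g₃] at g₄
    have hPe : T.P e₁ + T.P e₂ + T.inst.proc k = T.P e := le_antisymm g₆ g₅
    simp only [run_seq]
    rw [run_setN _ M₂ 30, (hIn.congr (M' := M₂) (wn := [31, 32]) (wr := [])
      ((sameOff_setN _ _ _ (by simp)).trans (sameOff_setN _ _ _ (by simp)))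
      (by decide) (by decide)).adr_eval (r' := i + 1) (e' := e) (S' := S₁ + S₂ + T.w k)
      (by simp [NExp.eval, hM₂, hM₁, Memory.setN_nat, h35])
      (by simp [NExp.eval, hM₂, hM₁, Memory.setN_nat, h36])
      (by simp [NExp.eval, hM₂, hM₁, Memory.setN_nat, h38, h40, h41, hIn.w k]) (by omega)
      (by omega)]
    set tg := addr T.D (i + 1) e (S₁ + S₂ + T.w k) with htg
    set M₃ := M₂.setN 30 ((NExp.const 0).eval M₂) tg with hM₃
    have hfk : ∀ t, f k t = T.inst.profit k t := fun t => by simp [hf, Instance.oracle, extend]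
    have hv : (RExp.add (.add (.read 4 (nv 31)) (.read 4 (nv 32)))
        (.query (nv 41) (rv 8))).eval f M₃ =
        M.real 4 s₁ + M.real 4 s₂ + T.inst.profit k C := by
      simp [RExp.eval, NExp.eval, hM₁, hM₂, hM₃, Memory.setN_nat, h41, h8, hfk]
    rw [run_setR, hv]
    set M₄ := M₃.setR 9 ((NExp.const 0).eval M₃)
      (M.real 4 s₁ + M.real 4 s₂ + T.inst.profit k C) with hM₄
    have hsame : ∀ st, EntSame T.D st M M₄ := fun st => ⟨rfl, rfl, rfl, fun _ _ => rfl⟩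
    obtain ⟨L, a₁, a₂, a₃, a₄⟩ := hb.get he₁ hS₁ g₁
    obtain ⟨L', b₁, b₂, b₃, b₄⟩ := (hz _ hNX' hNX).get he₂ hS₂ g₂
    obtain ⟨b, hwk⟩ := hT.w_pow k
    have hpk := popc_add_le (S₁ + S₂) (T.w k)
    rw [hwk, popc_two_pow, ← hwk] at hpk
    have hpp := popc_add_le S₁ S₂
    have hwpos : 0 < T.w k := by rw [hwk]; positivity
    -- Source and target lie in the same row, but the target code is larger by at least the positive
    -- weight of `k`.
    have hne : s₁ ≠ tg := fun h => by
      have := (addr_inj (by omega) (by omega) (by omega) (by omega) h).2.2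
      omega
    have hne' : s₂ ≠ tg := fun h => by
      have := (addr_inj (by omega) (by omega) (by omega) (by omega) h).1
      omega
    have h9 : M₄.real 9 0 = M.real 4 s₁ + M.real 4 s₂ + T.inst.profit k C := by
      simp [hM₄, NExp.eval]
    have hstart : ∀ y ∈ L', T.R i + T.P e₁ ≤ y.start := fun y hy => by
      obtain ⟨⟨i₁, i₂⟩, -⟩ := b₄.2 y hy
      exact (hT.NX_ge i hi e₁ he₁ i₁).trans i₂
    have hfin : ∀ y ∈ L', y.finish ≤ C := fun y hy => (b₄.2 y hy).2
    have hp₂ := popc_add_le S₁ (S₂ + T.w k)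
    rw [← add_assoc] at hp₂
    have hlenC : C - (T.R i + T.P e₁) = T.P e₂ + T.inst.proc k := by rw [hC, ← hPe]; ring
    -- The guard compares all three digit sums at once. Subadditivity then leaves no room for a
    -- carry when `S₂` and the weight of `k` are added, nor when `S₁` is added to the result.
    have hfill := b₄.1.fill (k := k) g₇ hlenC hstart hfin hT.w_pow (by omega)
    have hbounds := fill_bounds (k := k) (a := T.R i + T.P e₁) (b := C) (by
      have := hT.P_nonneg _ he₂
      have := T.inst.proc_pos k
      linarith) b₄.1.nonempty_pieces b₄.1.sorted hstart hfin
    have hgood : T.inst.Good T.w (T.P e) (S₁ + S₂ + T.w k)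
        (M.real 4 s₁ + M.real 4 s₂ + T.inst.profit k C)
        (L ++ fill k (T.R i + T.P e₁) L' C) := by
      rw [← hPe, add_assoc (T.P e₁), add_assoc S₁, add_assoc (M.real 4 s₁)]
      refine a₄.1.append hfill (fun x hx y hy => ?_) hT.w_pow ?_
      · exact (a₄.2 x hx).2.trans (hbounds y hy).1
      · have := hfill.popc
        have := popc_add_le S₂ (T.w k)
        rw [hwk, popc_two_pow, ← hwk] at this
        rw [← add_assoc]
        omega
    have hlen := hT.length_le hgood g₃
    -- This bounds the number of pieces that may be written before empty gaps are discarded. It is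
    -- at most `2 ^ (popc S₁ + popc S₂ + 1)`, which is at most `Q` because the new code is below
    -- `Q`.
    have hLL : L.length + (2 * L'.length + 1) ≤ T.D := by
      have l₁ := a₄.1.length
      have l₂ := b₄.1.length
      rw [← a₄.1.popc] at l₁
      rw [← b₄.1.popc] at l₂
      have hle : 2 ^ (popc S₁ + popc S₂ + 1) ≤ T.Q := by
        rw [hT.Q_eq] at g₃ ⊢
        exact Nat.pow_le_pow_right (by norm_num) (g₄.trans (popc_le_of_lt_two_pow g₃))
      rw [pow_succ, pow_add] at hle
      exact (add_two_mul_le l₁ l₂ hle).trans h₂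
    obtain ⟨j₁, j₂⟩ := relaxC_spec (f := f) (Q := T.Q) (A := T.Row (i + 1)) (M := M₄)
      (G := T.bfam i) (tg := tg) (L := L ++ fill k (T.R i + T.P e₁) L' C) hT.Q_le
      (by simp [hM₄, hM₃, NExp.eval])
      (by
        have h8' : M₄.real 8 0 = C := by
          simpa [hM₄, hM₃, hM₂, hM₁, NExp.eval, Memory.setR_real] using h8
        have := bodyFill_spec (f := f) (M := M₄) (tg := tg) (src := s₁) (src' := s₂) (Q := T.Q)
          (D := T.D) (k := k) (L := L) (L' := L') (a := T.R i + T.P e₁)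
          (by simp [hM₄, hM₃, NExp.eval])
          (by simp [hM₄, hM₃, hM₂, hM₁, NExp.eval, Memory.setN_nat])
          (by simp [hM₄, hM₃, hM₂, NExp.eval, Memory.setN_nat])
          (by simpa [hM₄, hM₃, hM₂, hM₁, NExp.eval, Memory.setN_nat] using h41)
          (by simp [hM₄, hM₃, hM₂, hM₁, NExp.eval, Memory.setN_nat, Memory.setR_real, h35, h37,
            hIn.P _ he₁, hIn.R _ hi])
          (by simpa [hM₄, hM₃, hM₂, hM₁, NExp.eval, Memory.setN_nat] using hIn.Q)
          (by simpa [hM₄, hM₃, hM₂, hM₁, NExp.eval, Memory.setN_nat] using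
            hIn.mul_addr (r := i + 1) (e := e) (S := S₁ + S₂ + T.w k) (by omega)
                (by omega) (by omega))
          (by simpa [hM₄, hM₃, hM₂, hM₁, NExp.eval, Memory.setN_nat] using
            hIn.mul_addr (r := i + 1) (e := e₁) (S := S₁) (by omega) (by omega) (by omega))
          (by simpa [hM₄, hM₃, hM₂, hM₁, NExp.eval, Memory.setN_nat] using
            hIn.mul_addr (r := n + 1 + T.NX i e₁) (e := e₂) (S := S₂) (by omega)
                (by omega) (by omega))
          (by simpa [hM₄, hM₃, hM₂, hM₁, NExp.eval, Memory.setN_nat] using a₁)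
          (by simpa [hM₄, hM₃, hM₂, hM₁, NExp.eval, Memory.setN_nat] using b₁)
          a₂ b₂ hLL a₃ b₃ hne hne'
        rwa [h8'] at this)
      (by omega) (Tables.mem_row he g₃)
      (by
        rw [h9]
        intro e' he' S' hS' h
        obtain ⟨rfl, rfl⟩ := hT.addr_eq he g₃ he' hS' h
        refine ⟨hgood, fun x hx => ?_⟩
        have q₁ := hT.P_nonneg _ he₁
        have q₂ := hT.P_nonneg _ he₂
        have q₃ := T.inst.proc_pos k
        rcases List.mem_append.1 hx with hx | hx
        · have := a₄.2 x hx
          exact ⟨this.1, by linarith [this.2]⟩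
        · have := hbounds x hx
          exact ⟨by linarith [this.1], by linarith [this.2]⟩)
    rw [h9] at j₂
    exact ⟨(Step.of_same hT.Q_le hsame).trans j₁,
      fun v₁ v₂ hv₁ hv₂ _ _ _ _ => j₂.le (by linarith [hv₁.2, hv₂.2])⟩
  · rw [run_when_neg (mt hgs.1 hg)]
    refine ⟨.of_same hT.Q_le fun st => ⟨rfl, rfl, rfl, fun _ _ => rfl⟩,
      fun v₁ v₂ hv₁ hv₂ g₃ g₄ g₅ g₆ => absurd ⟨hv₁.1, hv₂.1, g₃, ?_, g₅.ge, g₅.le, g₆⟩ hg⟩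
    rw [hIn.pc _ g₃]
    exact g₄

end Rows
end GPSP

namespace GPSP

open Cmd

/-! ### The dynamic program: loops over the rows -/

section Fill

variable {n : ℕ} {T : Tables n} {M : Memory} {C : ℝ}

theorem Tables.bOK.step {i r : ℕ} {M' : Memory} {G : ℕ → ℝ → Schedule n → Prop} (h : T.bOK i M)
    (hT : T.Sorted) (hs : Step T.D T.Q (T.Row r) G M M') (hr : r ≠ i + 1) : T.bOK i M' :=
  h.same hT fun st hst => hs.off st fun h' => hr (hT.row_unique h' hst)

theorem Tables.zOK.step {l r : ℕ} {M' : Memory} {G : ℕ → ℝ → Schedule n → Prop} (h : T.zOK C l M)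
    (hT : T.Sorted) (hs : Step T.D T.Q (T.Row r) G M M') (hr : r ≠ n + 1 + l) : T.zOK C l M' :=
  h.same hT fun st hst => hs.off st fun h' => hr (hT.row_unique h' hst)

/-- Copy row `n + 2 + l` to row `n + 1 + l`. -/
def copyRow : Cmd := loops [(47, 10), (46, 14)] copyBody

theorem copyRow_spec (f : ℕ → ℝ → ℝ) (hT : T.Sorted) (hIn : T.In₀ M) {l : ℕ} (hl : l < n)
    (h42 : M.nat 42 0 = l) (hz : T.zOK C (l + 1) M) :
    Step T.D T.Q (T.Row (n + 1 + l)) (T.zfam C l) M (copyRow.run f M) ∧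
      ∀ e < T.E, ∀ S < T.Q, ∀ v, LB M (addr T.D (n + 1 + (l + 1)) e S) v →
        LB (copyRow.run f M) (addr T.D (n + 1 + l) e S) v := by
  have key := loops_rule (f := f) (c := copyBody) (M := M)
    (Step T.D T.Q (T.Row (n + 1 + l)) (T.zfam C l))
    (fun M => .of_same hT.Q_le fun st => .refl _ _ _) (fun M M' M'' h h' => h.trans h')
    [(47, 10), (46, 14)]
    (fun xs M' => ∀ e S, xs = [e, S] → ∀ v, LB M (addr T.D (n + 1 + (l + 1)) e S) v →
      LB M' (addr T.D (n + 1 + l) e S) v)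
    (fun xs M' M'' h h' e S hx v hv => h.mono _ _ (h' e S hx v hv))
    (by
      intro p hp M y
      simp only [List.mem_cons, List.not_mem_nil, or_false] at hp
      rcases hp with rfl | rfl <;>
        exact .of_same hT.Q_le fun st => ⟨rfl, rfl, rfl, fun _ _ => rfl⟩)
    (by decide)
    (by
      intro M' hs hrange hE
      simp only [List.mem_cons, List.not_mem_nil, or_false, forall_eq_or_imp, forall_eq, hIn.E,
        hIn.Q] at hrange
      obtain ⟨j₁, j₂⟩ := copyBody_spec f hT (hIn.congr hs (by decide) (by decide)) hl
        (by rw [hs.nat 42 (by decide), h42]) rfl rfl hrange.1 hrange.2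
        (hz.step hT hE (by omega))
      refine ⟨j₁, fun e S hx v hv => ?_⟩
      simp only [List.map_cons, List.map_nil, List.cons.injEq, and_true] at hx
      obtain ⟨rfl, rfl⟩ := hx
      exact j₂ v (hE.mono _ _ hv))
    (by decide)
  refine ⟨key.1, fun e he S hS v hv => key.2 [e, S] ?_ e S rfl v hv⟩
  exact .cons (by simpa [hIn.E] using he) (.cons (by simpa [hIn.Q] using hS) .nil)

/-- Extend chains of blocks by blocks that start at release date number `l`. -/
def chainRow : Cmd := loops [(37, 10), (38, 14), (39, 10), (40, 14), (47, 10)] chainBody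

theorem chainRow_spec (f : ℕ → ℝ → ℝ) (hT : T.Valid) (hIn : T.In₀ M) {l : ℕ} (hl : l < n)
    (h42 : M.nat 42 0 = l) (h8 : M.real 8 0 = C) (hb : T.bOK l M)
    (hz : ∀ l', l < l' → l' ≤ n → T.zOK C l' M) :
    Step T.D T.Q (T.Row (n + 1 + l)) (T.zfam C l) M (chainRow.run f M) ∧
      ∀ e₁ < T.E, ∀ S₁ < T.Q, ∀ e₂ < T.E, ∀ S₂ < T.Q, ∀ e < T.E, ∀ v₁ v₂,
        LB M (addr T.D (l + 1) e₁ S₁) v₁ →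
        LB M (addr T.D (n + 1 + T.NX l e₁) e₂ S₂) v₂ → S₁ + S₂ < T.Q →
        popc S₁ + popc S₂ ≤ popc (S₁ + S₂) → T.P e₁ + T.P e₂ = T.P e → T.R l + T.P e₁ ≤ C →
        LB (chainRow.run f M) (addr T.D (n + 1 + l) e (S₁ + S₂)) (v₁ + v₂) := by
  have hT' := hT.toSorted
  have key := loops_rule (f := f) (c := chainBody) (M := M)
    (Step T.D T.Q (T.Row (n + 1 + l)) (T.zfam C l))
    (fun M => .of_same hT.Q_le fun st => .refl _ _ _) (fun M M' M'' h h' => h.trans h')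
    [(37, 10), (38, 14), (39, 10), (40, 14), (47, 10)]
    (fun xs M' => ∀ e₁ S₁ e₂ S₂ e, xs = [e₁, S₁, e₂, S₂, e] → ∀ v₁ v₂,
        LB M (addr T.D (l + 1) e₁ S₁) v₁ →
        LB M (addr T.D (n + 1 + T.NX l e₁) e₂ S₂) v₂ → S₁ + S₂ < T.Q →
        popc S₁ + popc S₂ ≤ popc (S₁ + S₂) → T.P e₁ + T.P e₂ = T.P e → T.R l + T.P e₁ ≤ C →
        LB M' (addr T.D (n + 1 + l) e (S₁ + S₂)) (v₁ + v₂))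
    (fun xs M' M'' h h' e₁ S₁ e₂ S₂ e hx v₁ v₂ g₁ g₂ g₃ g₄ g₅ g₆ =>
      h.mono _ _ (h' e₁ S₁ e₂ S₂ e hx v₁ v₂ g₁ g₂ g₃ g₄ g₅ g₆))
    (by
      intro p hp M y
      simp only [List.mem_cons, List.not_mem_nil, or_false] at hp
      rcases hp with rfl | rfl | rfl | rfl | rfl <;>
        exact .of_same hT.Q_le fun st => ⟨rfl, rfl, rfl, fun _ _ => rfl⟩)
    (by decide)
    (by
      intro M' hs hrange hE
      simp only [List.mem_cons, List.not_mem_nil, or_false, forall_eq_or_imp, forall_eq, hIn.E,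
        hIn.Q] at hrange
      obtain ⟨r₁, r₂, r₃, r₄, r₅⟩ := hrange
      obtain ⟨j₁, j₂⟩ := chainBody_spec f hT (hIn.congr hs (by decide) (by decide)) hl
        (by rw [hs.nat 42 (by decide), h42]) rfl rfl rfl rfl rfl
        (by rw [hs.real 8 (by decide), h8]) r₁ r₂ r₃ r₄ r₅
        (hb.step hT' hE (by omega)) (fun l' h₁ h₂ => (hz l' h₁ h₂).step hT' hE (by omega))
      refine ⟨j₁, fun e₁ S₁ e₂ S₂ e hx v₁ v₂ g₁ g₂ => ?_⟩
      simp only [List.map_cons, List.map_nil, List.cons.injEq, and_true] at hx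
      obtain ⟨rfl, rfl, rfl, rfl, rfl⟩ := hx
      exact j₂ v₁ v₂ (hE.mono _ _ g₁) (hE.mono _ _ g₂))
    (by decide)
  refine ⟨key.1, fun e₁ h₁ S₁ h₂ e₂ h₃ S₂ h₄ e h₅ => key.2 [e₁, S₁, e₂, S₂, e] ?_ _ _ _ _ _ rfl⟩
  exact .cons (by simpa [hIn.E] using h₁) (.cons (by simpa [hIn.Q] using h₂)
    (.cons (by simpa [hIn.E] using h₃) (.cons (by simpa [hIn.Q] using h₄)
    (.cons (by simpa [hIn.E] using h₅) .nil))))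

/-- Enter the blocks with a given length that start at release date number `i`. -/
def blockRow : Cmd := loops [(37, 10), (38, 14), (39, 10), (40, 14), (41, 0)] blockBody

theorem blockRow_spec (hT : T.Valid) (hIn : T.In M) {i e : ℕ} (hi : i < n)
    (h35 : M.nat 35 0 = i) (h36 : M.nat 36 0 = e) (h8 : M.real 8 0 = C)
    (hC : C = T.R i + T.P e) (he : e < T.E) (hb : T.bOK i M)
    (hz : ∀ l', i < l' → l' ≤ n → T.zOK C l' M) :
    Step T.D T.Q (T.Row (i + 1)) (T.bfam i) M (blockRow.run T.inst.oracle M) ∧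
      ∀ e₁ < T.E, ∀ S₁ < T.Q, ∀ e₂ < T.E, ∀ S₂ < T.Q, ∀ k : Fin n, ∀ v₁ v₂,
        LB M (addr T.D (i + 1) e₁ S₁) v₁ →
        LB M (addr T.D (n + 1 + T.NX i e₁) e₂ S₂) v₂ → S₁ + S₂ + T.w k < T.Q →
        popc S₁ + popc S₂ + 1 ≤ popc (S₁ + S₂ + T.w k) →
        T.P e₁ + T.P e₂ + T.inst.proc k = T.P e → T.inst.release k ≤ T.R i + T.P e₁ →
        LB (blockRow.run T.inst.oracle M) (addr T.D (i + 1) e (S₁ + S₂ + T.w k))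
          (v₁ + v₂ + T.inst.profit k C) := by
  have hT' := hT.toSorted
  have key := loops_rule (f := T.inst.oracle) (c := blockBody) (M := M)
    (Step T.D T.Q (T.Row (i + 1)) (T.bfam i))
    (fun M => .of_same hT.Q_le fun st => .refl _ _ _) (fun M M' M'' h h' => h.trans h')
    [(37, 10), (38, 14), (39, 10), (40, 14), (41, 0)]
    (fun xs M' => ∀ e₁ S₁ e₂ S₂ : ℕ, ∀ k : Fin n, xs = [e₁, S₁, e₂, S₂, k] → ∀ v₁ v₂,
        LB M (addr T.D (i + 1) e₁ S₁) v₁ →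
        LB M (addr T.D (n + 1 + T.NX i e₁) e₂ S₂) v₂ → S₁ + S₂ + T.w k < T.Q →
        popc S₁ + popc S₂ + 1 ≤ popc (S₁ + S₂ + T.w k) →
        T.P e₁ + T.P e₂ + T.inst.proc k = T.P e → T.inst.release k ≤ T.R i + T.P e₁ →
        LB M' (addr T.D (i + 1) e (S₁ + S₂ + T.w k)) (v₁ + v₂ + T.inst.profit k C))
    (fun xs M' M'' h h' e₁ S₁ e₂ S₂ k hx v₁ v₂ g₁ g₂ g₃ g₄ g₅ g₆ =>
      h.mono _ _ (h' e₁ S₁ e₂ S₂ k hx v₁ v₂ g₁ g₂ g₃ g₄ g₅ g₆))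
    (by
      intro p hp M y
      simp only [List.mem_cons, List.not_mem_nil, or_false] at hp
      rcases hp with rfl | rfl | rfl | rfl | rfl <;>
        exact .of_same hT.Q_le fun st => ⟨rfl, rfl, rfl, fun _ _ => rfl⟩)
    (by decide)
    (by
      intro M' hs hrange hE
      simp only [List.mem_cons, List.not_mem_nil, or_false, forall_eq_or_imp, forall_eq, hIn.E,
        hIn.Q, hIn.hn] at hrange
      obtain ⟨r₁, r₂, r₃, r₄, r₅⟩ := hrange
      obtain ⟨j₁, j₂⟩ := blockBody_spec (k := ⟨M'.nat 41 0, r₅⟩) hT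
        (hIn.congr hs (by decide) (by decide)) hi
        (by rw [hs.nat 35 (by decide), h35]) rfl rfl rfl rfl
        (by rw [hs.nat 36 (by decide), h36]) rfl
        (by rw [hs.real 8 (by decide), h8]) hC r₁ r₂ r₃ r₄ he
        (fun st hst => hE.ok hb st hst)
        (fun l' h₁ h₂ => (hz l' h₁ h₂).step hT' hE (by omega))
      refine ⟨j₁, fun e₁ S₁ e₂ S₂ k hx v₁ v₂ g₁ g₂ => ?_⟩
      simp only [List.map_cons, List.map_nil, List.cons.injEq, and_true] at hx
      obtain ⟨rfl, rfl, rfl, rfl, hk⟩ := hx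
      have : k = ⟨M'.nat 41 0, r₅⟩ := Fin.ext hk.symm
      subst this
      exact j₂ v₁ v₂ (hE.mono _ _ g₁) (hE.mono _ _ g₂))
    (by decide)
  refine ⟨key.1, fun e₁ h₁ S₁ h₂ e₂ h₃ S₂ h₄ k => key.2 [e₁, S₁, e₂, S₂, k] ?_ _ _ _ _ _ rfl⟩
  exact .cons (by simpa [hIn.E] using h₁) (.cons (by simpa [hIn.Q] using h₂)
    (.cons (by simpa [hIn.E] using h₃) (.cons (by simpa [hIn.Q] using h₄)
    (.cons (by simp [hIn.hn]) .nil))))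

/-- The number of row `n + 1 + l`. -/
def zrow : NExp := .add (.add (nv 0) (.const 1)) (nv 42)

/-- Compute row `n + 1 + l`. -/
def zline : Cmd := block [clearRow zrow, copyRow, chainRow]

/-- Compute the rows for chains of blocks. -/
def zfill : Cmd :=
  block [setN 42 (.const 0) (nv 0), clearRow zrow, initRow zrow,
    loop 45 0 (block [setN 42 (.const 0) (.sub (nv 0) (.add (nv 45) (.const 1))),
      when [(false, .ltNat (nv 42) (nv 43))] zline])]

/-- The rows for chains of blocks from release date number `lo` on are complete. -/
structure Tables.ZClosed (T : Tables n) (C : ℝ) (lo : ℕ) (M : Memory) : Prop where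
  ok : ∀ l, lo ≤ l → l ≤ n → T.zOK C l M
  init : ∀ e < T.E, T.P e = 0 → LB M (addr T.D (n + 1 + n) e 0) 0
  copy : ∀ l, lo ≤ l → l < n → ∀ e < T.E, ∀ S < T.Q, ∀ v,
    LB M (addr T.D (n + 1 + (l + 1)) e S) v → LB M (addr T.D (n + 1 + l) e S) v
  join : ∀ l, lo ≤ l → l < n → ∀ e₁ < T.E, ∀ S₁ < T.Q, ∀ e₂ < T.E, ∀ S₂ < T.Q, ∀ e < T.E, ∀ v₁ v₂,
        LB M (addr T.D (l + 1) e₁ S₁) v₁ →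
        LB M (addr T.D (n + 1 + T.NX l e₁) e₂ S₂) v₂ → S₁ + S₂ < T.Q →
        popc S₁ + popc S₂ ≤ popc (S₁ + S₂) → T.P e₁ + T.P e₂ = T.P e → T.R l + T.P e₁ ≤ C →
        LB M (addr T.D (n + 1 + l) e (S₁ + S₂)) (v₁ + v₂)

/-- The entries outside the row `r` agree. -/
def Tables.RowOff (T : Tables n) (r : ℕ) (M M' : Memory) : Prop :=
  ∀ st, st ∉ T.Row r → EntSame T.D st M M'

theorem LB.back {D st : ℕ} {M' : Memory} {v : ℝ} (h : LB M' st v) (h' : EntSame D st M M') :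
    LB M st v := ⟨h'.fl ▸ h.1, h'.val ▸ h.2⟩

theorem Tables.RowOff.ent (hT : T.Sorted) {r r' e S : ℕ} {M' : Memory} (h : T.RowOff r M M')
    (hr : r' ≠ r) (he : e < T.E) (hS : S < T.Q) : EntSame T.D (addr T.D r' e S) M M' :=
  h _ fun h' => hr (hT.row_unique (Tables.mem_row he hS) h')

theorem EntOK.of_invalid {D Q st : ℕ} {G : ℝ → Schedule n → Prop} (h : M.nat 22 st = 0) :
    EntOK D Q G M st := fun h' => by omega

/-- The row is cleared first because it may contain chains for another deadline `C`. It depends only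
on later chain rows and on the block row `l`, so the closure properties of the later rows are
untouched. -/
theorem zline_spec (f : ℕ → ℝ → ℝ) (hT : T.Valid) (hIn : T.In₀ M) {l : ℕ} (hl : l < n)
    (h42 : M.nat 42 0 = l) (h8 : M.real 8 0 = C) (hb : T.bOK l M) (hz : T.ZClosed C (l + 1) M) :
    T.RowOff (n + 1 + l) M (zline.run f M) ∧ T.ZClosed C l (zline.run f M) := by
  have hT' := hT.toSorted
  have hzr : ∀ M', M'.nat 0 = M.nat 0 → M'.nat 42 = M.nat 42 → zrow.eval M' = n + 1 + l := by
    intro M' h₁ h₂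
    simp [zrow, NExp.eval, h₁, h₂, hIn.hn, h42]
  simp only [zline, block, run_seq]
  obtain ⟨a₁, a₂⟩ := clearRow_spec f hT' hIn (r := zrow) (r' := n + 1 + l) (by omega)
    (fun M' hs => hzr M' (hs.nat 0 (by decide)) (hs.nat 42 (by decide)))
  have s₁ := sameOff_run f (clearRow zrow) M
  set M₁ := (clearRow zrow).run f M
  have ra₁ : T.RowOff (n + 1 + l) M M₁ := a₁
  have hIn₁ := hIn.congr s₁ (by decide) (by decide)
  have hz₁ : ∀ l', l < l' → l' ≤ n → T.zOK C l' M₁ := fun l' h₁ h₂ =>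
    (hz.ok l' h₁ h₂).same hT' fun st hst => a₁ st fun h' => by
      have := hT'.row_unique h' hst
      omega
  obtain ⟨b₁, b₂⟩ := copyRow_spec f hT' hIn₁ hl (by rw [s₁.nat 42 (by decide), h42])
    (hz₁ (l + 1) (by omega) (by omega))
  have s₂ := sameOff_run f copyRow M₁
  set M₂ := copyRow.run f M₁
  have rb₁ : T.RowOff (n + 1 + l) M₁ M₂ := b₁.off
  have hIn₂ := hIn₁.congr s₂ (by decide) (by decide)
  have hz₂ : ∀ l', l < l' → l' ≤ n → T.zOK C l' M₂ := fun l' h₁ h₂ =>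
    (hz₁ l' h₁ h₂).step hT' b₁ (by omega)
  have hb₂ : T.bOK l M₂ := by
    refine Tables.bOK.step (hb.same hT' fun st hst => a₁ st fun h' => ?_) hT' b₁ (by omega)
    have := hT'.row_unique h' hst
    omega
  obtain ⟨c₁, c₂⟩ := chainRow_spec f hT hIn₂ hl
    (by rw [s₂.nat 42 (by decide), s₁.nat 42 (by decide), h42])
    (by rw [s₂.real 8 (by decide), s₁.real 8 (by decide), h8]) hb₂ hz₂
  set M₃ := chainRow.run f M₂
  have off : T.RowOff (n + 1 + l) M M₃ := fun st hst =>
    ((a₁ st hst).trans (b₁.off st hst)).trans (c₁.off st hst)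
  have off₂ : T.RowOff (n + 1 + l) M M₂ := fun st hst => (a₁ st hst).trans (b₁.off st hst)
  have hQ0 : 0 < T.Q := hT.Q_eq ▸ by positivity
  refine ⟨off, ⟨fun l' h₁ h₂ => ?_, fun e he hP => ?_, fun l' h₁ h₂ e he S hS v hv => ?_,
    fun l' h₁ h₂ e₁ he₁ S₁ hS₁ e₂ he₂ S₂ hS₂ e he v₁ v₂ g₁ g₂ g₃ g₄ g₅ g₆ => ?_⟩⟩
  · by_cases h : l' = l
    · subst h
      exact c₁.ok (b₁.ok fun st hst => .of_invalid (a₂ st hst))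
    · exact (hz₂ l' (by omega) h₂).step hT' c₁ (by omega)
  · exact (hz.init e he hP).same (off.ent hT' (by omega) he hQ0)
  · have hv' := hv.back (off.ent hT' (by omega) he hS)
    by_cases h : l' = l
    · subst h
      exact c₁.mono _ _ (b₂ e he S hS v (hv'.same (ra₁.ent hT' (by omega) he hS)))
    · exact (hz.copy l' (by omega) h₂ e he S hS v hv').same (off.ent hT' (by omega) he hS)
  · have i₁ := hT.NX_gt l' h₂ e₁ he₁
    have g₁' := g₁.back (off.ent hT' (by omega) he₁ hS₁)
    have g₂' := g₂.back (off.ent hT' (by omega) he₂ hS₂)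
    by_cases h : l' = l
    · subst h
      exact c₂ e₁ he₁ S₁ hS₁ e₂ he₂ S₂ hS₂ e he v₁ v₂ (g₁'.same (off₂.ent hT' (by omega) he₁ hS₁))
        (g₂'.same (off₂.ent hT' (by omega) he₂ hS₂)) g₃ g₄ g₅ g₆
    · exact (hz.join l' (by omega) h₂ e₁ he₁ S₁ hS₁ e₂ he₂ S₂ hS₂ e he v₁ v₂ g₁' g₂' g₃ g₄ g₅
        g₆).same (off.ent hT' (by omega) he g₃)

/-- Rows are computed from position `n`, which holds only empty chains, downwards. The limit `lo`
keeps the program away from block rows that are not yet complete. -/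
theorem zfill_spec (f : ℕ → ℝ → ℝ) (hT : T.Valid) (hIn : T.In₀ M) {lo : ℕ}
    (h43 : M.nat 43 0 = lo) (h8 : M.real 8 0 = C) (hb : ∀ l, lo ≤ l → l < n → T.bOK l M) :
    (∀ st, (∀ l ≤ n, st ∉ T.Row (n + 1 + l)) → EntSame T.D st M (zfill.run f M)) ∧
      T.ZClosed C lo (zfill.run f M) := by
  have hT' := hT.toSorted
  simp only [zfill, block, run_seq]
  rw [run_setN]
  set M₀ := M.setN 42 ((NExp.const 0).eval M) ((nv 0).eval M) with hM₀
  have h42 : M₀.nat 42 0 = n := by simp [hM₀, NExp.eval, hIn.hn]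
  have s₀ : SameOff [42] [] M M₀ := sameOff_setN _ _ _ (by simp)
  have e₀ : ∀ st, EntSame T.D st M M₀ := fun st => ⟨rfl, rfl, rfl, fun _ _ => rfl⟩
  have hIn₀ := hIn.congr s₀ (by decide) (by decide)
  have hzr : ∀ M', M'.nat 0 = M₀.nat 0 → M'.nat 42 = M₀.nat 42 → zrow.eval M' = n + 1 + n := by
    intro M' h₁ h₂
    simp [zrow, NExp.eval, h₁, h₂, hIn₀.hn, h42]
  obtain ⟨a₁, a₂⟩ := clearRow_spec f hT' hIn₀ (r := zrow) (r' := n + 1 + n) (by omega)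
    (fun M' hs => hzr M' (hs.nat 0 (by decide)) (hs.nat 42 (by decide)))
  have s₁ := sameOff_run f (clearRow zrow) M₀
  set M₁ := (clearRow zrow).run f M₀
  have hIn₁ := hIn₀.congr s₁ (by decide) (by decide)
  obtain ⟨b₁, b₂⟩ := initRow_spec f hT' hIn₁ (r := zrow) (r' := n + 1 + n) (by omega)
    (fun M' hs => hzr M' ((hs.nat 0 (by decide)).trans (s₁.nat 0 (by decide)))
      ((hs.nat 42 (by decide)).trans (s₁.nat 42 (by decide)))) (G := T.zfam C n) (by
        intro e he hP e' he' S' hS' h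
        obtain ⟨rfl, rfl⟩ := hT'.addr_eq he (by omega) he' hS' h
        refine ⟨?_, by simp⟩
        rw [hP]
        exact T.inst.good_nil T.w)
  have s₂ := sameOff_run f (initRow zrow) M₁
  set M₂ := (initRow zrow).run f M₁
  have s02 : SameOff ([42] ++ ((clearRow zrow).wN ++ (initRow zrow).wN))
      ((clearRow zrow).wR ++ (initRow zrow).wR) M M₂ :=
    ((s₀.mono (by simp) (by simp)).trans (s₁.mono (by simp) (by simp))).trans
      (s₂.mono (by simp) (by simp))
  have e02 : ∀ st, st ∉ T.Row (n + 1 + n) → EntSame T.D st M M₂ := fun st hst =>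
    ((e₀ st).trans (a₁ st hst)).trans (b₁.off st hst)
  -- Loops count upwards, so round `x` treats position `n - (x + 1)` and skips positions below `lo`;
  -- the completed range therefore starts at `max lo (n - x)`.
  have key := loop_rule (f := f) (v := 45) (d := 0) (M := M₂)
    (c := seq (setN 42 (.const 0) (.sub (nv 0) (.add (nv 45) (.const 1))))
      (when [(false, .ltNat (nv 42) (nv 43))] zline))
    (fun x M' => (∀ st, (∀ l ≤ n, st ∉ T.Row (n + 1 + l)) → EntSame T.D st M M') ∧
      T.ZClosed C (max lo (n - x)) M')
    (fun x M' y h => ⟨fun st hst => (h.1 st hst).trans ⟨rfl, rfl, rfl, fun _ _ => rfl⟩,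
      ⟨fun l h₁ h₂ => (h.2.ok l h₁ h₂).same hT' fun st _ => ⟨rfl, rfl, rfl, fun _ _ => rfl⟩,
        h.2.init, h.2.copy, h.2.join⟩⟩)
    ⟨fun st hst => e02 st (hst n le_rfl), fun l h₁ h₂ => ?_, b₂, fun l h₁ h₂ => by omega,
      fun l h₁ h₂ => by omega⟩ ?_
  · have e : M₂.nat 0 0 = n := by rw [s02.nat 0 (by decide), hIn.hn]
    rw [e, Nat.sub_self] at key
    refine ⟨key.1, ?_⟩
    simpa using key.2
  · have : l = n := by omega
    subst this
    exact b₁.ok fun st hst => .of_invalid (a₂ st hst)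
  · intro x hx M' hs hx' ⟨g₁, g₂⟩
    have hx₂ : x < n := by
      rwa [s02.nat 0 (by decide), hIn.hn] at hx
    have hIn' := (hIn.congr s02 (by decide) (by decide)).congr hs (by decide) (by decide)
    rw [run_seq, run_setN]
    have ev : (NExp.sub (nv 0) (.add (nv 45) (.const 1))).eval M' = n - (x + 1) := by
      simp [NExp.eval, hx', hIn'.hn]
    rw [ev]
    set l := n - (x + 1) with hl
    set M'' := M'.setN 42 ((NExp.const 0).eval M') l with hM''
    have hIn'' := hIn'.congr (M' := M'') (wn := [42]) (wr := []) (sameOff_setN _ _ _ (by simp))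
      (by decide) (by decide)
    have e'' : ∀ st, EntSame T.D st M' M'' := fun st => ⟨rfl, rfl, rfl, fun _ _ => rfl⟩
    have h42' : M''.nat 42 0 = l := by simp [hM'', NExp.eval]
    have h43' : M''.nat 43 0 = lo := by
      have : M''.nat 43 = M'.nat 43 := by simp [hM'', Memory.setN_row]
      rw [this, hs.nat 43 (by decide), s02.nat 43 (by decide), h43]
    have h8' : M''.real 8 0 = C := by
      have : M''.real 8 = M'.real 8 := rfl
      rw [this, hs.real 8 (by decide), s02.real 8 (by decide), h8]
    have g₂' : T.ZClosed C (max lo (n - x)) M'' :=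
      ⟨fun l h₁ h₂ => (g₂.ok l h₁ h₂).same hT' fun st _ => e'' st, g₂.init, g₂.copy, g₂.join⟩
    by_cases hlt : l < lo
    · rw [run_when_neg (by simp [Guard, Test.Holds, NExp.eval, h42', h43', hlt])]
      refine ⟨fun st hst => (g₁ st hst).trans (e'' st), ?_⟩
      have : max lo (n - (x + 1)) = max lo (n - x) := by omega
      rwa [this]
    · rw [run_when_pos (by simpa [Guard, Test.Holds, NExp.eval, h42', h43'] using hlt)]
      have h₁ : max lo (n - x) = l + 1 := by omega
      have h₂ : max lo (n - (x + 1)) = l := by omega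
      rw [h₁] at g₂'
      rw [h₂]
      obtain ⟨j₁, j₂⟩ := zline_spec f hT hIn'' (show l < n by omega) h42' h8'
        ((hb l (by omega) (by omega)).same hT' fun st hst =>
          (g₁ st fun l' hl' h' => by
            have := hT'.row_unique h' hst
            omega).trans (e'' st)) g₂'
      exact ⟨fun st hst => ((g₁ st hst).trans (e'' st)).trans (j₁ st (hst l (by omega))), j₂⟩

end Fill
end GPSP

namespace GPSP

open Cmd

/-! ### Completeness: chains of jobs with different colours are found. -/

section Target

variable {n : ℕ} {T : Tables n} {M : Memory} {C : ℝ}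

/-- The jobs in `J` have different weights, and the table of lengths covers all subsets of `J`. -/
structure Tables.Covers (T : Tables n) (J : Finset (Fin n)) : Prop where
  popc_code : J.card ≤ popc (∑ j ∈ J, T.w j)
  code_lt : ∑ j ∈ J, T.w j < T.Q
  cover : ∀ J' ⊆ J, ∃ e < T.E, T.P e = T.inst.len J'

/-- The code of a set of jobs. -/
def Tables.code (T : Tables n) (J : Finset (Fin n)) : ℕ := ∑ j ∈ J, T.w j

variable {Jt : Finset (Fin n)}

theorem Tables.Covers.code_lt' (h : T.Covers Jt) {J : Finset (Fin n)} (hJ : J ⊆ Jt) :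
    T.code J < T.Q :=
  (Finset.sum_le_sum_of_subset hJ).trans_lt h.code_lt

/-- If a sum of powers of two has no carries, neither has a partial sum: a loss of digits in `J`
could not be regained by adding the weights of the other jobs. -/
theorem Tables.Covers.popc_eq (h : T.Covers Jt) (hT : T.Valid) {J : Finset (Fin n)}
    (hJ : J ⊆ Jt) : popc (T.code J) = J.card := by
  have hw : ∀ j : Fin n, ∃ b, T.w j = 2 ^ b := hT.w_pow
  have h₁ := popc_sum_le J (fun j => T.w j) hw
  have h₂ := popc_sum_le (Jt \ J) (fun j => T.w j) hw
  have h₃ := popc_add_le (∑ j ∈ Jt \ J, T.w j) (∑ j ∈ J, T.w j)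
  rw [Finset.sum_sdiff hJ] at h₃
  have h₄ := h.popc_code
  have h₅ := Finset.card_sdiff_add_card_eq_card hJ
  unfold Tables.code
  omega

theorem Tables.code_union {J J' : Finset (Fin n)} (h : Disjoint J J') :
    T.code (J ∪ J') = T.code J + T.code J' := Finset.sum_union h

theorem Tables.code_insert {J : Finset (Fin n)} {k : Fin n} (h : k ∉ J) :
    T.code (insert k J) = T.code J + T.w k := (Finset.sum_insert h).trans (add_comm _ _)

/-- The entries for blocks of target jobs from release date number `l` on are good enough. -/
def Tables.BComplete (T : Tables n) (Jt : Finset (Fin n)) (l e : ℕ) (M : Memory) : Prop :=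
  ∀ J ⊆ Jt, ∀ v, T.inst.Blk (T.R l) J v → T.P e = T.inst.len J →
    LB M (addr T.D (l + 1) e (T.code J)) v

theorem Tables.ZClosed.copy_to {lo : ℕ} (h : T.ZClosed C lo M) {l l' e S : ℕ} {v : ℝ} (hlo : lo ≤ l)
    (hl : l ≤ l') (hl' : l' ≤ n) (he : e < T.E) (hS : S < T.Q)
    (hv : LB M (addr T.D (n + 1 + l') e S) v) : LB M (addr T.D (n + 1 + l) e S) v := by
  induction l', hl using Nat.le_induction with
  | base => exact hv
  | succ m hm ih => exact ih (by omega) (h.copy m (by omega) (by omega) e he S hS v hv)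

/-- A chain of blocks of target jobs has its entry in the completed rows. -/
theorem Tables.ZClosed.chain {lo : ℕ} (h : T.ZClosed C lo M) (hT : T.Valid) (ht : T.Covers Jt)
    (hB : ∀ l, lo ≤ l → l < n → ∀ e < T.E, T.BComplete Jt l e M) (s : List (Segment n)) :
    ∀ (a : ℝ) (l : ℕ), lo ≤ l → l ≤ n → T.inst.Chain a s →
      (∀ b ∈ s, T.inst.Blk b.start b.jobs b.val) → (∀ b ∈ s, T.inst.fin b ≤ C) →
      allJobs s ⊆ Jt → (∀ b ∈ s.head?, ∃ l', l ≤ l' ∧ l' < n ∧ T.R l' = b.start) →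
      ∀ e < T.E, T.P e = T.inst.len (allJobs s) →
        LB M (addr T.D (n + 1 + l) e (T.code (allJobs s))) (allVal s) := by
  have hT' := hT.toSorted
  have hQ0 : 0 < T.Q := hT.Q_eq ▸ by positivity
  induction s with
  | nil =>
    intro a l h₁ h₂ _ _ _ _ _ e he hP
    have e0 : T.code (allJobs ([] : List (Segment n))) = 0 := by simp [Tables.code]
    rw [e0, allVal_nil]
    exact h.copy_to h₁ h₂ le_rfl he hQ0 (h.init e he (by simpa [Instance.len] using hP))
  | cons b s ih =>
    intro a l h₁ h₂ hch hblk hfin hJ hhead e he hP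
    obtain ⟨l', g₁, g₂, g₃⟩ := hhead b (by simp)
    obtain ⟨-, -, hne, hdis, hch'⟩ := hch
    rw [allJobs_cons] at hJ hP ⊢
    have hJb : b.jobs ⊆ Jt := Finset.union_subset_left hJ
    have hJs : allJobs s ⊆ Jt := Finset.union_subset_right hJ
    rw [Instance.len_union _ hdis] at hP
    rw [Tables.code_union hdis, allVal_cons]
    obtain ⟨e₁, he₁, hP₁⟩ := ht.cover _ hJb
    obtain ⟨e₂, he₂, hP₂⟩ := ht.cover _ hJs
    have hfb : T.R l' + T.P e₁ = T.inst.fin b := by rw [g₃, hP₁]; rfl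
    have hlt : T.code b.jobs + T.code (allJobs s) < T.Q := by
      rw [← Tables.code_union hdis]; exact ht.code_lt' hJ
    have hpop : popc (T.code b.jobs) + popc (T.code (allJobs s)) ≤
        popc (T.code b.jobs + T.code (allJobs s)) := by
      rw [← Tables.code_union hdis, ht.popc_eq hT hJb, ht.popc_eq hT hJs, ht.popc_eq hT hJ,
        Finset.card_union_of_disjoint hdis]
    have i₁ : LB M (addr T.D (l' + 1) e₁ (T.code b.jobs)) b.val :=
      hB l' (by omega) g₂ e₁ he₁ _ hJb _ (g₃ ▸ hblk b (by simp)) hP₁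
    have i₂ : LB M (addr T.D (n + 1 + T.NX l' e₁) e₂ (T.code (allJobs s))) (allVal s) := by
      refine ih _ _ (by have := hT.NX_gt l' g₂ e₁ he₁; omega) (hT.NX_le l' g₂ e₁ he₁) hch'
        (fun b hb => hblk b (by simp [hb])) (fun b hb => hfin b (by simp [hb])) hJs ?_ e₂ he₂ hP₂
      intro c hc
      cases s with
      | nil => simp at hc
      | cons d s =>
        simp only [List.head?_cons, Option.mem_def, Option.some.injEq] at hc
        subst hc
        obtain ⟨k₁, ⟨j, hj⟩, -⟩ := hch'
        obtain ⟨l₂, k₂, k₃⟩ := hT.R_surj j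
        have hpos := T.inst.len_pos hne
        -- Equal release dates occupy several positions, so a later start has to be turned into a
        -- larger position. The block at `l'` has positive length; hence the next one starts
        -- strictly later, and sortedness gives the inequality.
        have hlt' : l' < l₂ := by
          by_contra hle
          have := hT.R_mono l₂ l' (by omega) g₂
          rw [k₃, hj, g₃] at this
          unfold Instance.fin at k₁
          linarith
        exact ⟨l₂, hT.NX_least l' g₂ e₁ he₁ l₂ hlt' k₂ (by rw [hfb, k₃, hj]; exact k₁), k₂,
          by rw [k₃, hj]⟩
    refine h.copy_to h₁ g₁ g₂.le he hlt ?_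
    exact h.join l' (by omega) g₂ e₁ he₁ _ (ht.code_lt' hJb) e₂ he₂ _ (ht.code_lt' hJs) e he _ _ i₁ i₂
      hlt hpop (by rw [hP₁, hP₂, hP]) (by rw [hfb]; exact hfin b (by simp))

end Target

/-! ### Completeness of the rows for blocks, by induction on the total length. -/

section Blocks

variable {n : ℕ} {T : Tables n} {M : Memory} {C : ℝ}

/-- The number of row `i + 1`. -/
def brow : NExp := .add (nv 35) (.const 1)

/-- Enter the blocks that start at release date number `i`. -/
def bline : Cmd :=
  block [setN 43 (.const 0) (.add (nv 35) (.const 1)), clearRow brow, initRow brow,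
    loop 36 10 (block [setR 8 (.const 0) (.add (.read 7 (nv 35)) (.read 5 (nv 36))), zfill,
      blockRow])]

/-- The entry for the output. -/
def Tables.OutSame (T : Tables n) (i : ℕ) (M M' : Memory) : Prop :=
  ∀ st, (∀ l ≤ n, st ∉ T.Row (n + 1 + l)) → st ∉ T.Row (i + 1) → EntSame T.D st M M'

theorem Tables.not_zrow (hT : T.Sorted) {l : ℕ} (hl : l < n) {st : ℕ} (h : st ∈ T.Row (l + 1)) :
    ∀ l' ≤ n, st ∉ T.Row (n + 1 + l') := fun l' _ h' => by
  have := hT.row_unique h h'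
  omega

theorem Tables.BComplete.same {Jt : Finset (Fin n)} {l e : ℕ} {M' : Memory} (ht : T.Covers Jt)
    (he : e < T.E) (h : T.BComplete Jt l e M) (hs : ∀ st ∈ T.Row (l + 1), EntSame T.D st M M') :
    T.BComplete Jt l e M' :=
  fun J hJ v hv hP => (h J hJ v hv hP).same (hs _ (Tables.mem_row he (ht.code_lt' hJ)))

/-- Case analysis on the last constructor of `Blk`. The smaller block has an entry in the same row
for a smaller length index, the chain has one in the rows for deadline `C` just computed, and `hcl`
joins both with the job of lowest priority. -/
theorem Tables.block_complete {Jt : Finset (Fin n)} {i e : ℕ} {M' : Memory} (hT : T.Valid)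
    (ht : T.Covers Jt) (hi : i < n) (he : e < T.E) (hC : C = T.R i + T.P e)
    (hz : T.ZClosed C (i + 1) M) (hB : ∀ l, i < l → l < n → ∀ e < T.E, T.BComplete Jt l e M)
    (hB' : ∀ e' < e, T.BComplete Jt i e' M)
    (hinit : ∀ e < T.E, T.P e = 0 → LB M (addr T.D (i + 1) e 0) 0)
    (hs : Step T.D T.Q (T.Row (i + 1)) (T.bfam i) M M')
    (hcl : ∀ e₁ < T.E, ∀ S₁ < T.Q, ∀ e₂ < T.E, ∀ S₂ < T.Q, ∀ k : Fin n, ∀ v₁ v₂,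
        LB M (addr T.D (i + 1) e₁ S₁) v₁ →
        LB M (addr T.D (n + 1 + T.NX i e₁) e₂ S₂) v₂ → S₁ + S₂ + T.w k < T.Q →
        popc S₁ + popc S₂ + 1 ≤ popc (S₁ + S₂ + T.w k) →
        T.P e₁ + T.P e₂ + T.inst.proc k = T.P e → T.inst.release k ≤ T.R i + T.P e₁ →
        LB M' (addr T.D (i + 1) e (S₁ + S₂ + T.w k)) (v₁ + v₂ + T.inst.profit k C)) :
    T.BComplete Jt i e M' := by
  have hT' := hT.toSorted
  intro J hJ v hv hP
  generalize ha : T.R i = a at hv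
  cases hv with
  | empty =>
    have e0 : T.code (∅ : Finset (Fin n)) = 0 := by simp [Tables.code]
    rw [e0]
    exact hs.mono _ _ (hinit e he (by simpa [Instance.len] using hP))
  | @step _ J₁ v₁ s k C' hJ₁ hl hch hgt hfin hC' hd hk hr =>
    have hJ₁t : J₁ ⊆ Jt := (Finset.subset_union_left.trans (Finset.subset_insert _ _)).trans hJ
    have hJst : allJobs s ⊆ Jt :=
      (Finset.subset_union_right.trans (Finset.subset_insert _ _)).trans hJ
    have hJu : J₁ ∪ allJobs s ⊆ Jt := Finset.union_subset hJ₁t hJst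
    obtain ⟨e₁, he₁, hP₁⟩ := ht.cover _ hJ₁t
    obtain ⟨e₂, he₂, hP₂⟩ := ht.cover _ hJst
    have hk₀ := T.inst.proc_pos k
    have hl₀ := T.inst.len_nonneg (allJobs s)
    rw [Instance.len_insert _ hk, Instance.len_union _ hd] at hP
    have hCC : C' = C := by rw [hC', hC, hP, ← ha]; ring
    -- The table of lengths is sorted and the removed job has positive processing time. This makes
    -- increasing `e` a valid order of computation, even if the table contains equal lengths.
    have hlt : e₁ < e := by
      by_contra hle
      have := hT.P_mono e e₁ (by omega) he₁
      linarith
    have hcode : T.code (insert k (J₁ ∪ allJobs s)) = T.code J₁ + T.code (allJobs s) + T.w k := by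
      rw [Tables.code_insert hk, Tables.code_union hd]
    have hcard := Finset.card_insert_of_notMem hk
    have hcard' := Finset.card_union_of_disjoint hd
    rw [hcode, hCC]
    refine hcl e₁ he₁ _ (ht.code_lt' hJ₁t) e₂ he₂ _ (ht.code_lt' hJst) k _ _
      (hB' e₁ hlt J₁ hJ₁t v₁ (ha ▸ hJ₁) hP₁) ?_ (by rw [← hcode]; exact ht.code_lt' hJ) ?_
      (by rw [hP₁, hP₂, hP]; ring) (by rw [hP₁, ha]; exact hr)
    · have g₁ := hT.NX_gt i hi e₁ he₁
      refine hz.chain hT ht (fun l h₁ h₂ => hB l (by omega) h₂) s _ _ (by omega)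
        (hT.NX_le i hi e₁ he₁) hch hl (fun b hb => (hfin b hb).trans hCC.le) hJst ?_ e₂ he₂ hP₂
      intro c hc
      cases s with
      | nil => simp at hc
      | cons d s =>
        simp only [List.head?_cons, Option.mem_def, Option.some.injEq] at hc
        subst hc
        obtain ⟨k₁, ⟨j, hj⟩, -⟩ := hch
        obtain ⟨l₂, k₂, k₃⟩ := hT.R_surj j
        -- The smaller block may be empty, so its length does not help here. This is the purpose of
        -- the condition in `Blk` that the blocks of the chain start strictly after `a`.
        have hlt' : i < l₂ := by
          by_contra hle
          have := hT.R_mono l₂ i (by omega) hi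
          have := hgt d (by simp)
          linarith
        exact ⟨l₂, hT.NX_least i hi e₁ he₁ l₂ hlt' k₂ (by rw [hP₁, ha, k₃, hj]; exact k₁), k₂,
          by rw [k₃, hj]⟩
    · rw [← hcode, ht.popc_eq hT hJ₁t, ht.popc_eq hT hJst, ht.popc_eq hT hJ]
      omega

/-- For each length index `e` the chain rows are recomputed with deadline `R i + P e`, from position
`i + 1` on; they need only block rows that are already complete. Completeness is stated for every
covered set `Jt` at once, because the program does not know the set of an optimal schedule. -/
theorem bline_spec (hT : T.Valid) (hIn : T.In M) {i : ℕ} (hi : i < n) (h35 : M.nat 35 0 = i)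
    (hb : ∀ l, i < l → l < n → T.bOK l M) :
    T.OutSame i M (bline.run T.inst.oracle M) ∧ T.bOK i (bline.run T.inst.oracle M) ∧
      ∀ Jt, T.Covers Jt → (∀ l, i < l → l < n → ∀ e < T.E, T.BComplete Jt l e M) →
        ∀ e < T.E, T.BComplete Jt i e (bline.run T.inst.oracle M) := by
  have hT' := hT.toSorted
  set f := T.inst.oracle with hf
  simp only [bline, block, run_seq]
  rw [run_setN]
  set M₀ := M.setN 43 ((NExp.const 0).eval M) ((NExp.add (nv 35) (.const 1)).eval M) with hM₀
  have h43 : M₀.nat 43 0 = i + 1 := by simp [hM₀, NExp.eval, h35]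
  have s₀ : SameOff [43] [] M M₀ := sameOff_setN _ _ _ (by simp)
  have e₀ : ∀ st, EntSame T.D st M M₀ := fun st => ⟨rfl, rfl, rfl, fun _ _ => rfl⟩
  have hIn₀ := hIn.congr s₀ (by decide) (by decide)
  have hbr : ∀ M', M'.nat 35 = M₀.nat 35 → brow.eval M' = i + 1 := by
    intro M' h
    have : M'.nat 35 0 = i := by rw [h, s₀.nat 35 (by decide), h35]
    simp [brow, NExp.eval, this]
  obtain ⟨a₁, a₂⟩ := clearRow_spec f hT' hIn₀.toIn₀ (r := brow) (r' := i + 1) (by omega)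
    (fun M' hs => hbr M' (hs.nat 35 (by decide)))
  have s₁ := sameOff_run f (clearRow brow) M₀
  set M₁ := (clearRow brow).run f M₀
  have hIn₁ := hIn₀.congr s₁ (by decide) (by decide)
  obtain ⟨b₁, b₂⟩ := initRow_spec f hT' hIn₁.toIn₀ (r := brow) (r' := i + 1) (by omega)
    (fun M' hs => hbr M' ((hs.nat 35 (by decide)).trans (s₁.nat 35 (by decide))))
    (G := T.bfam i) (by
        intro e he hP e' he' S' hS' h
        obtain ⟨rfl, rfl⟩ := hT'.addr_eq he (by omega) he' hS' h
        refine ⟨?_, by simp⟩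
        rw [hP]
        exact T.inst.good_nil T.w)
  have s₂ := sameOff_run f (initRow brow) M₁
  set M₂ := (initRow brow).run f M₁
  have s02 : SameOff ([43] ++ ((clearRow brow).wN ++ (initRow brow).wN))
      ((clearRow brow).wR ++ (initRow brow).wR) M M₂ :=
    ((s₀.mono (by simp) (by simp)).trans (s₁.mono (by simp) (by simp))).trans
      (s₂.mono (by simp) (by simp))
  have e02 : T.OutSame i M M₂ := fun st _ hst =>
    ((e₀ st).trans (a₁ st hst)).trans (b₁.off st hst)
  have hIn₂ := hIn.congr s02 (by decide) (by decide)
  have hrow : ∀ {M M' : Memory} {l : ℕ}, T.OutSame i M M' → i < l → l < n →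
      ∀ st ∈ T.Row (l + 1), EntSame T.D st M M' := fun h h₁ h₂ st hst =>
    h st (Tables.not_zrow hT' h₂ hst) fun h' => by
      have := hT'.row_unique hst h'
      omega
  have hrow' : ∀ {M M' : Memory} {l : ℕ},
      (∀ st, (∀ l ≤ n, st ∉ T.Row (n + 1 + l)) → EntSame T.D st M M') → l < n →
      ∀ st ∈ T.Row (l + 1), EntSame T.D st M M' := fun h h₂ st hst =>
    h st (Tables.not_zrow hT' h₂ hst)
  have hQ0 : 0 < T.Q := hT.Q_eq ▸ by positivity
  have key := loop_rule (f := f) (v := 36) (d := 10) (M := M₂)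
    (c := seq (setR 8 (.const 0) (.add (.read 7 (nv 35)) (.read 5 (nv 36)))) (seq zfill blockRow))
    (fun x M' => T.OutSame i M M' ∧ T.bOK i M' ∧
      (∀ e < T.E, T.P e = 0 → LB M' (addr T.D (i + 1) e 0) 0) ∧
      ∀ Jt, T.Covers Jt → (∀ l, i < l → l < n → ∀ e < T.E, T.BComplete Jt l e M) →
        ∀ e < x, e < T.E → T.BComplete Jt i e M')
    (fun x M' y h => ⟨fun st h₁ h₂ => (h.1 st h₁ h₂).trans ⟨rfl, rfl, rfl, fun _ _ => rfl⟩,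
      h.2.1.same hT' fun st _ => ⟨rfl, rfl, rfl, fun _ _ => rfl⟩, h.2.2.1, h.2.2.2⟩)
    ⟨e02, b₁.ok fun st hst => .of_invalid (a₂ st hst), b₂, by simp⟩ ?_
  · rw [hIn₂.E] at key
    exact ⟨key.1, key.2.1, fun Jt h₁ h₂ e he => key.2.2.2 Jt h₁ h₂ e he he⟩
  · intro e he M₃ s₃ h36 ⟨g₁, g₂, g₃, g₄⟩
    rw [hIn₂.E] at he
    have hIn₃ := hIn₂.congr s₃ (by decide) (by decide)
    have h35₃ : M₃.nat 35 0 = i := by rw [s₃.nat 35 (by decide), s02.nat 35 (by decide), h35]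
    have h43₃ : M₃.nat 43 0 = i + 1 := by
      rw [s₃.nat 43 (by decide), s₂.nat 43 (by decide), s₁.nat 43 (by decide), h43]
    rw [run_seq, run_seq, run_setR]
    have ev : (RExp.add (.read 7 (nv 35)) (.read 5 (nv 36))).eval f M₃ = T.R i + T.P e := by
      simp [RExp.eval, NExp.eval, h35₃, h36, hIn₃.R i hi, hIn₃.P e he]
    rw [ev]
    set C := T.R i + T.P e with hC
    set M₄ := M₃.setR 8 ((NExp.const 0).eval M₃) C with hM₄
    have s₄ : SameOff [] [8] M₃ M₄ := ⟨fun _ _ => rfl, fun b hb => M₃.setR_row (by simpa using hb)⟩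
    have e₄ : ∀ st, EntSame T.D st M₃ M₄ := fun st => ⟨rfl, rfl, rfl, fun _ _ => rfl⟩
    have hIn₄ := hIn₃.congr s₄ (by decide) (by decide)
    have h8₄ : M₄.real 8 0 = C := by simp [hM₄, NExp.eval]
    have o₄ : T.OutSame i M M₄ := fun st h₁ h₂ => (g₁ st h₁ h₂).trans (e₄ st)
    obtain ⟨z₁, z₂⟩ := zfill_spec f hT hIn₄.toIn₀ (lo := i + 1) h43₃ h8₄
      (fun l h₁ h₂ => (hb l (by omega) h₂).same hT' (hrow o₄ h₁ h₂))
    have s₅ := sameOff_run f zfill M₄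
    set M₅ := zfill.run f M₄
    have o₅ : T.OutSame i M M₅ := fun st h₁ h₂ => (o₄ st h₁ h₂).trans (z₁ st h₁)
    have hIn₅ := hIn₄.congr s₅ (by decide) (by decide)
    have e₃₅ : ∀ st ∈ T.Row (i + 1), EntSame T.D st M₃ M₅ := fun st hst =>
      (e₄ st).trans (hrow' z₁ hi st hst)
    obtain ⟨y₁, y₂⟩ := blockRow_spec hT hIn₅ hi (e := e) (C := C)
      (by rw [s₅.nat 35 (by decide)]; exact h35₃) (by rw [s₅.nat 36 (by decide)]; exact h36)
      (by rw [s₅.real 8 (by decide)]; exact h8₄) hC he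
      (g₂.same hT' e₃₅) (fun l' h₁ h₂ => z₂.ok l' (by omega) h₂)
    refine ⟨fun st h₁ h₂ => (o₅ st h₁ h₂).trans (y₁.off st h₂), y₁.ok (g₂.same hT' e₃₅), ?_, ?_⟩
    · exact fun e he hP => y₁.mono _ _ ((g₃ e he hP).same (e₃₅ _ (Tables.mem_row he hQ0)))
    · intro Jt ht hB e' he' heE
      have hB₅ : ∀ l, i < l → l < n → ∀ e < T.E, T.BComplete Jt l e M₅ := fun l h₁ h₂ e he =>
        (hB l h₁ h₂ e he).same ht he (hrow o₅ h₁ h₂)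
      have hB' : ∀ e' < e, T.BComplete Jt i e' M₅ := fun e' he' =>
        (g₄ Jt ht hB e' he' (he'.trans he)).same ht (he'.trans he) e₃₅
      rcases Nat.lt_succ_iff_lt_or_eq.1 he' with he' | rfl
      · exact fun J hJ v hv hP => y₁.mono _ _ (hB' e' he' J hJ v hv hP)
      · exact Tables.block_complete hT ht hi he hC z₂ hB₅ hB'
          (fun e he hP => (g₃ e he hP).same (e₃₅ _ (Tables.mem_row he hQ0))) y₁ y₂

end Blocks

/-! ### The dynamic program for one colouring, and its result in entry `0`. -/

section Output

variable {n : ℕ} {T : Tables n} {M : Memory} {C : ℝ}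

/-- Copy an entry for a chain of blocks to the output, if there are at most `s` jobs. -/
def outBody : Cmd :=
  block [setN 31 (.const 0) (adr (.add (nv 0) (.const 1)) (nv 47) (nv 46)),
    when [(true, .ltNat (.const 0) (.read 22 (nv 31))),
        (false, .ltNat (.read 0 (.const 1)) (.read 19 (nv 46)))]
      (block [setN 30 (.const 0) (.const 0), setR 9 (.const 0) (.read 4 (nv 31)),
        relaxC bodyCopy])]

/-- The stored list is a feasible schedule of at least the stored value. -/
def OutOK (I : Instance n) (s : ℕ) (_ : ℕ) (v : ℝ) (L : Schedule n) : Prop :=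
  I.Feasible s L ∧ v ≤ I.value L

/-- Entry `0` lies in no row used by blocks or chains, and its list starts at cell `0`, so it has
the required output format. The digit sum of the code is the number of jobs, which is compared with
`s`. -/
theorem outBody_spec (f : ℕ → ℝ → ℝ) (hT : T.Sorted) (hIn : T.In₀ M) {e S s : ℕ}
    (hs : M.nat 0 1 = s) (h47 : M.nat 47 0 = e) (h46 : M.nat 46 0 = S) (he : e < T.E)
    (hS : S < T.Q) (hz : T.zOK C 0 M) :
    Step T.D T.Q {0} (OutOK T.inst s) M (outBody.run f M) ∧
      ∀ v, LB M (addr T.D (n + 1 + 0) e S) v → popc S ≤ s → LB (outBody.run f M) 0 v := by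
  have h₁ := hT.E_le
  have h₂ := hT.Q_le
  simp only [outBody, block, run_seq]
  rw [run_setN _ M 31, hIn.adr_eval (r' := n + 1 + 0) (e' := e) (S' := S)
    (by simp [NExp.eval, hIn.hn]) (by simp [NExp.eval, h47])
    (by simp [NExp.eval, h46]) (by omega) (by omega)]
  set src := addr T.D (n + 1 + 0) e S with hsrc
  set M₁ := M.setN 31 ((NExp.const 0).eval M) src with hM₁
  have hgs : Guard f M₁ [(true, .ltNat (.const 0) (.read 22 (nv 31))),
        (false, .ltNat (.read 0 (.const 1)) (.read 19 (nv 46)))] ↔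
      0 < M.nat 22 src ∧ popc S ≤ s := by
    simp [Guard, Test.Holds, NExp.eval, hM₁, Memory.setN_nat, h46, hIn.pc _ hS, hs]
  by_cases hg : 0 < M.nat 22 src ∧ popc S ≤ s
  · rw [run_when_pos (hgs.2 hg)]
    obtain ⟨hfl, hp⟩ := hg
    simp only [run_seq]
    rw [run_setN _ M₁ 30]
    set M₂ := M₁.setN 30 ((NExp.const 0).eval M₁) ((NExp.const 0).eval M₁) with hM₂
    have hv : (RExp.read 4 (nv 31)).eval f M₂ = M.real 4 src := by
      simp [RExp.eval, NExp.eval, hM₁, hM₂, Memory.setN_nat]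
    rw [run_setR, hv]
    set M₃ := M₂.setR 9 ((NExp.const 0).eval M₂) (M.real 4 src) with hM₃
    have hsame : ∀ st, EntSame T.D st M M₃ := fun st => ⟨rfl, rfl, rfl, fun _ _ => rfl⟩
    obtain ⟨L, g₁, g₂, g₃, g₄⟩ := hz.get he hS hfl
    have hne : src ≠ 0 := (addr_pos (by omega) (by omega)).ne'
    have h9 : M₃.real 9 0 = M.real 4 src := by simp [hM₃, NExp.eval]
    obtain ⟨j₁, j₂⟩ := relaxC_spec (f := f) (Q := T.Q) (A := {0}) (M := M₃)
      (G := OutOK T.inst s) (tg := 0) (L := L) hT.Q_le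
      (by simp [hM₃, hM₂, NExp.eval])
      (bodyCopy_spec (src := src) (Q := T.Q) (by simp [hM₃, hM₂, NExp.eval])
        (by simp [hM₃, hM₂, hM₁, NExp.eval, Memory.setN_nat])
        (by simpa [hM₃, hM₂, hM₁, NExp.eval, Memory.setN_nat] using hIn.Q) hT.Q_le
        (by simpa [hM₃, hM₂, hM₁, NExp.eval, Memory.setN_nat] using
          hIn.mul' (x := 0) (show e < T.D by omega) (by omega))
        (by simpa [hM₃, hM₂, hM₁, NExp.eval, Memory.setN_nat] using
          hIn.mul_addr (r := n + 1 + 0) (e := e) (S := S) (by omega) (by omega) (by omega))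
        (by simpa [hM₃, hM₂, hM₁, NExp.eval, Memory.setN_nat] using g₁) g₂ g₃ hne)
      g₂ rfl (by rw [h9]; exact ⟨g₄.1.feasible hp, g₄.1.le_value⟩)
    rw [h9] at j₂
    exact ⟨(Step.of_same hT.Q_le hsame).trans j₁, fun v hv _ => j₂.le hv.2⟩
  · rw [run_when_neg (mt hgs.1 hg)]
    exact ⟨.of_same hT.Q_le fun st => ⟨rfl, rfl, rfl, fun _ _ => rfl⟩,
      fun v hv hp => absurd ⟨hv.1, hp⟩ hg⟩

/-- Copy the best chain of blocks of at most `s` jobs to the output. -/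
def outRow : Cmd := loops [(47, 10), (46, 14)] outBody

theorem outRow_spec (f : ℕ → ℝ → ℝ) (hT : T.Sorted) (hIn : T.In₀ M) {s : ℕ}
    (hs : M.nat 0 1 = s) (hz : T.zOK C 0 M) :
    Step T.D T.Q {0} (OutOK T.inst s) M (outRow.run f M) ∧
      ∀ e < T.E, ∀ S < T.Q, ∀ v, LB M (addr T.D (n + 1 + 0) e S) v → popc S ≤ s →
        LB (outRow.run f M) 0 v := by
  have h₁ := hT.E_le
  have key := loops_rule (f := f) (c := outBody) (M := M)
    (Step T.D T.Q {0} (OutOK T.inst s))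
    (fun M => .of_same hT.Q_le fun st => .refl _ _ _) (fun M M' M'' h h' => h.trans h')
    [(47, 10), (46, 14)]
    (fun xs M' => ∀ e S, xs = [e, S] → ∀ v, LB M (addr T.D (n + 1 + 0) e S) v → popc S ≤ s →
      LB M' 0 v)
    (fun xs M' M'' h h' e S hx v hv hp => h.mono _ _ (h' e S hx v hv hp))
    (by
      intro p hp M y
      simp only [List.mem_cons, List.not_mem_nil, or_false] at hp
      rcases hp with rfl | rfl <;>
        exact .of_same hT.Q_le fun st => ⟨rfl, rfl, rfl, fun _ _ => rfl⟩)
    (by decide)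
    (by
      intro M' hsame hrange hE
      simp only [List.mem_cons, List.not_mem_nil, or_false, forall_eq_or_imp, forall_eq, hIn.E,
        hIn.Q] at hrange
      obtain ⟨j₁, j₂⟩ := outBody_spec f hT (hIn.congr hsame (by decide) (by decide))
        (by rw [hsame.nat 0 (by decide), hs]) rfl rfl hrange.1 hrange.2
        (hz.same hT fun st hst => hE.off st fun h => by
          obtain ⟨e, he, S, hS, h'⟩ := hst
          have := addr_pos (D := T.D) (r := n + 1 + 0) (e := e) (S := S) (by omega) (by omega)
          rw [Set.mem_singleton_iff] at h
          omega)
      refine ⟨j₁, fun e S hx v hv => ?_⟩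
      simp only [List.map_cons, List.map_nil, List.cons.injEq, and_true] at hx
      obtain ⟨rfl, rfl⟩ := hx
      exact j₂ v (hE.mono _ _ hv))
    (by decide)
  refine ⟨key.1, fun e he S hS v hv => key.2 [e, S] ?_ e S rfl v hv⟩
  exact .cons (by simpa [hIn.E] using he) (.cons (by simpa [hIn.Q] using hS) .nil)

/-- The dynamic program for one colouring of the jobs. -/
def dynProg : Cmd :=
  block [loop 44 0 (block [setN 35 (.const 0) (.sub (nv 0) (.add (nv 44) (.const 1))), bline]),
    setN 43 (.const 0) (.const 0), setR 8 (.const 0) (rv 11), zfill, outRow]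

/-- Block rows are computed from the last release date backwards; a final pass over the chain rows
with deadline `C` combines them into complete schedules. The first two claims hold for every
colouring, the third only if the target jobs have different colours. So an unsuitable colouring
never spoils the output. -/
theorem dynProg_spec (hT : T.Valid) (hIn : T.In M) {s : ℕ} (hs : M.nat 0 1 = s)
    (h11 : M.real 11 0 = C) :
    (∀ v, LB M 0 v → LB (dynProg.run T.inst.oracle M) 0 v) ∧
      (EntOK T.D T.Q (OutOK T.inst s 0) M 0 →
        EntOK T.D T.Q (OutOK T.inst s 0) (dynProg.run T.inst.oracle M) 0) ∧
      ∀ Jt, T.Covers Jt → Jt.card ≤ s → ∀ l : List (Segment n), T.inst.Chain 0 l →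
        (∀ b ∈ l, T.inst.Blk b.start b.jobs b.val) → (∀ b ∈ l, T.inst.fin b ≤ C) →
        allJobs l = Jt → LB (dynProg.run T.inst.oracle M) 0 (allVal l) := by
  have hT' := hT.toSorted
  set f := T.inst.oracle with hf
  have hQ0 : 0 < T.Q := hT.Q_eq ▸ by positivity
  have hD0 : 0 < T.D := hQ0.trans_le hT.Q_le
  have h0 : ∀ r, 0 < r → 0 ∉ T.Row r := by
    rintro r hr ⟨e, he, S, hS, h⟩
    have := addr_pos (D := T.D) (r := r) (e := e) (S := S) hD0 hr
    omega
  simp only [dynProg, block, run_seq]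
  set c := seq (setN 35 (.const 0) (.sub (nv 0) (.add (nv 44) (.const 1)))) bline with hc
  have key := loop_rule (f := f) (v := 44) (d := 0) (M := M) (c := c)
    (fun x M' => EntSame T.D 0 M M' ∧ (∀ l, n - x ≤ l → l < n → T.bOK l M') ∧
      ∀ Jt, T.Covers Jt → ∀ l, n - x ≤ l → l < n → ∀ e < T.E, T.BComplete Jt l e M')
    (fun x M' y h => ⟨h.1.trans ⟨rfl, rfl, rfl, fun _ _ => rfl⟩,
      fun l h₁ h₂ => (h.2.1 l h₁ h₂).same hT' fun st _ => ⟨rfl, rfl, rfl, fun _ _ => rfl⟩,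
      h.2.2⟩)
    ⟨.refl _ _ _, fun l h₁ h₂ => by omega, fun Jt _ l h₁ h₂ => by omega⟩ ?_
  · have s₁ := sameOff_run f (loop 44 0 c) M
    set M₁ := (loop 44 0 c).run f M
    rw [hIn.hn, Nat.sub_self] at key
    obtain ⟨a₁, a₂, a₃⟩ := key
    have hIn₁ := hIn.congr s₁ (by decide) (by decide)
    rw [run_setN _ M₁ 43]
    set M₂ := M₁.setN 43 ((NExp.const 0).eval M₁) ((NExp.const 0).eval M₁) with hM₂
    have s₂ : SameOff [43] [] M₁ M₂ := sameOff_setN _ _ _ (by simp)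
    rw [run_setR]
    set M₃ := M₂.setR 8 ((NExp.const 0).eval M₂) ((rv 11).eval f M₂) with hM₃
    have s₃ : SameOff [] [8] M₂ M₃ := ⟨fun _ _ => rfl, fun b hb => M₂.setR_row (by simpa using hb)⟩
    have e₃ : ∀ st, EntSame T.D st M₁ M₃ := fun st => ⟨rfl, rfl, rfl, fun _ _ => rfl⟩
    have hIn₃ := (hIn₁.congr s₂ (by decide) (by decide)).congr s₃ (by decide) (by decide)
    have h8 : M₃.real 8 0 = C := by
      have e₁ : M₂.real 11 0 = C := by
        rw [s₂.real 11 (by decide), s₁.real 11 (by decide), h11]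
      simp [hM₃, RExp.eval, NExp.eval, e₁]
    obtain ⟨z₁, z₂⟩ := zfill_spec f hT hIn₃.toIn₀ (lo := 0) (by simp [hM₃, hM₂, NExp.eval]) h8
      (fun l h₁ h₂ => (a₂ l h₁ h₂).same hT' fun st _ => e₃ st)
    have s₄ := sameOff_run f zfill M₃
    set M₄ := zfill.run f M₃
    have hIn₄ := hIn₃.congr s₄ (by decide) (by decide)
    obtain ⟨o₁, o₂⟩ := outRow_spec f hT' hIn₄.toIn₀ (s := s)
      (by rw [s₄.nat 0 (by decide), s₃.nat 0 (by decide), s₂.nat 0 (by decide),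
        s₁.nat 0 (by decide), hs]) (z₂.ok 0 le_rfl (by omega))
    have e₀ : EntSame T.D 0 M M₄ :=
      (a₁.trans (e₃ 0)).trans (z₁ 0 fun l _ => h0 _ (by omega))
    refine ⟨fun v hv => o₁.mono _ _ (hv.same e₀), fun hok => ?_, ?_⟩
    · exact o₁.ok (fun st hst => by
        rw [Set.mem_singleton_iff] at hst
        subst hst
        exact hok.same hT.Q_le e₀) 0 rfl
    · intro Jt ht hcard l hch hblk hfin hJ
      obtain ⟨e, he, hP⟩ := ht.cover Jt subset_rfl
      have hB : ∀ l, 0 ≤ l → l < n → ∀ e < T.E, T.BComplete Jt l e M₄ := fun l h₁ h₂ e he =>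
        (a₃ Jt ht l h₁ h₂ e he).same ht he fun st hst =>
          (e₃ st).trans (z₁ st (Tables.not_zrow hT' h₂ hst))
      have hch' := z₂.chain hT ht hB l 0 0 le_rfl (by omega) hch hblk hfin hJ.le
        (by
          intro b hb
          cases l with
          | nil => simp at hb
          | cons d l =>
            simp only [List.head?_cons, Option.mem_def, Option.some.injEq] at hb
            subst hb
            obtain ⟨-, ⟨j, hj⟩, -⟩ := hch
            obtain ⟨l₂, k₂, k₃⟩ := hT.R_surj j
            exact ⟨l₂, by omega, k₂, by rw [k₃, hj]⟩) e he (by rw [hJ, hP])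
      exact o₂ e he _ (ht.code_lt' hJ.le) _ hch' (by rw [hJ, ht.popc_eq hT subset_rfl]; exact hcard)
  · intro x hx M' hs' hx' ⟨g₁, g₂, g₃⟩
    rw [hIn.hn] at hx
    have hIn' := hIn.congr hs' (by decide) (by decide)
    rw [hc, run_seq, run_setN]
    have ev : (NExp.sub (nv 0) (.add (nv 44) (.const 1))).eval M' = n - (x + 1) := by
      simp [NExp.eval, hx', hIn'.hn]
    rw [ev]
    set i := n - (x + 1) with hi
    set M'' := M'.setN 35 ((NExp.const 0).eval M') i with hM''
    have hIn'' := hIn'.congr (M' := M'') (wn := [35]) (wr := []) (sameOff_setN _ _ _ (by simp))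
      (by decide) (by decide)
    have e'' : ∀ st, EntSame T.D st M' M'' := fun st => ⟨rfl, rfl, rfl, fun _ _ => rfl⟩
    obtain ⟨j₁, j₂, j₃⟩ := bline_spec hT hIn'' (i := i) (by omega) (by simp [hM'', NExp.eval])
      (fun l h₁ h₂ => (g₂ l (by omega) h₂).same hT' fun st _ => e'' st)
    have hrow : ∀ l, i < l → l < n → ∀ st ∈ T.Row (l + 1), EntSame T.D st M'
        (bline.run f M'') := fun l h₁ h₂ st hst =>
      (e'' st).trans (j₁ st (Tables.not_zrow hT' h₂ hst) fun h' => by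
        have := hT'.row_unique hst h'
        omega)
    refine ⟨(g₁.trans (e'' 0)).trans (j₁ 0 (fun l _ => h0 _ (by omega)) (h0 _ (by omega))), ?_, ?_⟩
    · intro l h₁ h₂
      by_cases h : l = i
      · exact h ▸ j₂
      · exact (g₂ l (by omega) h₂).same hT' (hrow l (by omega) h₂)
    · intro Jt ht l h₁ h₂ e he
      by_cases h : l = i
      · rw [h]
        exact j₃ Jt ht (fun l h₁ h₂ e he => g₃ Jt ht l (by omega) h₂ e he) e he
      · exact (g₃ Jt ht l (by omega) h₂ e he).same ht he (hrow l (by omega) h₂)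

end Output
end GPSP

namespace GPSP

open Cmd

/-! ### Arithmetic and sorting -/

section Arithmetic

variable (f : ℕ → ℝ → ℝ) {M : Memory}

/-- Multiplication by repeated addition. -/
def mulC (dst lv d : ℕ) (u w : NExp) : Cmd :=
  seq (setN dst (.const 0) (.const 0))
    (loop lv d (when [(true, .ltNat (nv lv) w)] (setN dst (.const 0) (.add (nv dst) u))))

theorem mulC_spec {dst lv d : ℕ} {u w : NExp} {U W : ℕ} (hne : dst ≠ lv) (hd : d ≠ dst)
    (hu : ∀ M', SameOff [lv, dst] [] M M' → u.eval M' = U)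
    (hw : ∀ M', SameOff [lv, dst] [] M M' → w.eval M' = W) (hW : W ≤ M.nat d 0) :
    ((mulC dst lv d u w).run f M).nat dst 0 = U * W := by
  rw [mulC, run_seq, run_setN]
  set M₀ := M.setN dst ((NExp.const 0).eval M) ((NExp.const 0).eval M) with hM₀
  have s₀ : SameOff [lv, dst] [] M M₀ := sameOff_setN _ _ _ (by simp)
  have hdim : M₀.nat d 0 = M.nat d 0 := by rw [hM₀, Memory.setN_row _ hd]
  have key := loop_rule (f := f) (v := lv) (d := d) (M := M₀)
    (c := when [(true, .ltNat (nv lv) w)] (setN dst (.const 0) (.add (nv dst) u)))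
    (fun x M' => M'.nat dst 0 = U * min x W)
    (fun x M' y h => by rw [Memory.setN_row _ hne]; exact h) (by simp [hM₀, NExp.eval]) ?_
  · rw [key, hdim, min_eq_right hW]
  · intro x hx M' hs hx' h
    have s₁ : SameOff [lv, dst] [] M M' := s₀.trans (hs.mono (by simp [when, wN]) (by simp [when, wR]))
    by_cases hlt : x < W
    · rw [run_when_true (by simpa [Test.Holds, NExp.eval, hx', hw M' s₁] using hlt), run_setN]
      simp only [NExp.eval, Memory.setN_same, h, hu M' s₁]
      rw [min_eq_left hlt.le, min_eq_left hlt, mul_add, mul_one]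
    · rw [run_when_false (by simpa [Test.Holds, NExp.eval, hx', hw M' s₁] using hlt), h]
      rw [min_eq_right (by omega), min_eq_right (by omega)]

/-- Division with remainder by repeated subtraction. -/
def divC (v qv lv d : ℕ) (m : NExp) : Cmd :=
  seq (setN qv (.const 0) (.const 0))
    (loop lv d (when [(false, .ltNat (nv v) m)]
      (seq (setN v (.const 0) (.sub (nv v) m)) (setN qv (.const 0) (.add (nv qv) (.const 1))))))

/-- Invariant: quotient and remainder represent `V`, and either a subtraction took place in each
round or the remainder is already small. Since the loop makes at least `V / m'` rounds, the
remainder is small at the end. -/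
theorem divC_spec {v qv lv d : ℕ} {m : NExp} {m' V : ℕ} (h₁ : v ≠ lv) (h₂ : qv ≠ lv) (h₃ : v ≠ qv)
    (hd : d ≠ qv) (hm : ∀ M', SameOff [lv, v, qv] [] M M' → m.eval M' = m') (hV : M.nat v 0 = V)
    (hle : V / m' ≤ M.nat d 0) (hm' : 0 < m') :
    ((divC v qv lv d m).run f M).nat v 0 = V % m' ∧
      ((divC v qv lv d m).run f M).nat qv 0 = V / m' := by
  rw [divC, run_seq, run_setN]
  set M₀ := M.setN qv ((NExp.const 0).eval M) ((NExp.const 0).eval M) with hM₀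
  have s₀ : SameOff [lv, v, qv] [] M M₀ := sameOff_setN _ _ _ (by simp)
  have hdim : M₀.nat d 0 = M.nat d 0 := by rw [hM₀, Memory.setN_row _ hd]
  have key := loop_rule (f := f) (v := lv) (d := d) (M := M₀)
    (c := when [(false, .ltNat (nv v) m)]
      (seq (setN v (.const 0) (.sub (nv v) m)) (setN qv (.const 0) (.add (nv qv) (.const 1)))))
    (fun x M' => V = m' * M'.nat qv 0 + M'.nat v 0 ∧ (M'.nat qv 0 = x ∨ M'.nat v 0 < m'))
    (fun x M' y h => by rw [Memory.setN_row _ h₁, Memory.setN_row _ h₂]; exact h)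
    (by simp [hM₀, NExp.eval, Memory.setN_row _ h₃, hV]) ?_
  · rw [hdim] at key
    generalize run f _ M₀ = M' at key ⊢
    obtain ⟨k₁, k₂⟩ := key
    have hlt : M'.nat v 0 < m' := by
      rcases k₂ with k₂ | k₂
      · by_contra hge
        have : M'.nat qv 0 + 1 ≤ V / m' := by
          rw [Nat.le_div_iff_mul_le hm', k₁, add_mul, one_mul, mul_comm]
          omega
        omega
      · exact k₂
    have := (Nat.div_mod_unique hm').2 ⟨show M'.nat v 0 + m' * M'.nat qv 0 = V by omega, hlt⟩
    exact ⟨this.2.symm, this.1.symm⟩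
  · intro x hx M' hs hx' ⟨g₁, g₂⟩
    have s₁ : SameOff [lv, v, qv] [] M M' := s₀.trans (hs.mono (by simp [when, wN]) (by simp [when, wR]))
    have hmv := hm M' s₁
    by_cases hlt : M'.nat v 0 < m'
    · rw [run_when_neg (by simp [Guard, Test.Holds, NExp.eval, hmv, hlt])]
      exact ⟨g₁, .inr hlt⟩
    · rw [run_when_pos (by simpa [Guard, Test.Holds, NExp.eval, hmv] using hlt), run_seq, run_setN,
        run_setN]
      simp only [NExp.eval, hmv, Memory.setN_same]
      rw [Memory.setN_row _ h₃, Memory.setN_same, Memory.setN_row _ h₃.symm]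
      have : m' * (M'.nat qv 0 + 1) = m' * M'.nat qv 0 + m' := by ring
      exact ⟨by omega, by omega⟩

/-- Evaluation of a hash function. -/
def hashC (v qv lv d : ℕ) (a x p m : NExp) : Cmd :=
  block [mulC v lv d a x, divC v qv lv d p, divC v qv lv d m]

/-- One loop bound `d` serves the multiplication and both divisions: it has to dominate the second
factor, the quotient modulo `p'`, and `p'` itself, which bounds the second quotient. -/
theorem hashC_spec {v qv lv d : ℕ} {a x p m : NExp} {a' x' p' m' : ℕ} (h₁ : v ≠ lv) (h₂ : qv ≠ lv)
    (h₃ : v ≠ qv) (hd : d ≠ qv) (hd' : d ≠ v) (hd'' : d ≠ lv)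
    (ha : ∀ M', SameOff [lv, v, qv] [] M M' → a.eval M' = a')
    (hx : ∀ M', SameOff [lv, v, qv] [] M M' → x.eval M' = x')
    (hp : ∀ M', SameOff [lv, v, qv] [] M M' → p.eval M' = p')
    (hm : ∀ M', SameOff [lv, v, qv] [] M M' → m.eval M' = m')
    (hle : x' ≤ M.nat d 0) (hle' : a' * x' / p' ≤ M.nat d 0) (hp' : 0 < p')
    (hpd : p' ≤ M.nat d 0) (hm' : 0 < m') :
    ((hashC v qv lv d a x p m).run f M).nat v 0 = hsh a' x' p' m' := by
  simp only [hashC, block, run_seq]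
  have e₁ := mulC_spec f (M := M) (u := a) (w := x) h₁ hd'
    (fun M' hs => ha M' (hs.mono (by simp) (by simp)))
    (fun M' hs => hx M' (hs.mono (by simp) (by simp))) hle
  have s₁ := sameOff_run f (mulC v lv d a x) M
  set M₁ := (mulC v lv d a x).run f M
  have s₁' : SameOff [lv, v, qv] [] M M₁ := s₁.mono (by simp [mulC, when, wN]) (by simp [mulC, when, wR])
  have hd₁ : M₁.nat d 0 = M.nat d 0 := by rw [s₁'.nat d (by simp [hd, hd', hd''])]
  have e₂ := (divC_spec f (M := M₁) (m := p) h₁ h₂ h₃ hd (fun M' hs => hp M' (s₁'.trans hs)) e₁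
    (by rw [hd₁]; exact hle') hp').1
  have s₂ := sameOff_run f (divC v qv lv d p) M₁
  set M₂ := (divC v qv lv d p).run f M₁
  have s₂' : SameOff [lv, v, qv] [] M M₂ :=
    s₁'.trans (s₂.mono (by simp [divC, when, wN]) (by simp [divC, when, wR]))
  have hd₂ : M₂.nat d 0 = M.nat d 0 := by rw [s₂'.nat d (by simp [hd, hd', hd''])]
  refine (divC_spec f (M := M₂) (m := m) h₁ h₂ h₃ hd (fun M' hs => hm M' (s₂'.trans hs)) e₂
    ?_ hm').1
  rw [hd₂]
  exact (Nat.div_le_self _ _).trans ((Nat.mod_lt _ hp').le.trans hpd)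

end Arithmetic

/-! ### Sorting by counting predecessors. -/

section Sorting

/-- The number of predecessors in the order of values. -/
noncomputable def rank (a : ℕ → ℝ) (N x : ℕ) : ℕ :=
  ((Finset.range N).filter fun y => a y < a x ∨ ¬ a x < a y ∧ y < x).card

/-- Ties are broken by position, so the comparison is a strict total order and the rank is strictly
monotone for it. Hence ranks are a permutation of the positions, also for repeated values. -/
theorem rank_lt_rank {a : ℕ → ℝ} {N x x' : ℕ} (hx : x < N)
    (h : a x < a x' ∨ ¬ a x' < a x ∧ x < x') : rank a N x < rank a N x' := by
  refine Finset.card_lt_card ⟨fun y hy => ?_, fun hsub => ?_⟩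
  · rw [Finset.mem_filter] at hy ⊢
    refine ⟨hy.1, ?_⟩
    rcases hy.2 with h₁ | ⟨h₁, h₂⟩ <;> rcases h with h₃ | ⟨h₃, h₄⟩
    · exact .inl (h₁.trans h₃)
    · exact .inl (h₁.trans_le (not_lt.1 h₃))
    · exact .inl ((not_lt.1 h₁).trans_lt h₃)
    · exact .inr ⟨fun h => h₃ (h.trans_le (not_lt.1 h₁)), h₂.trans h₄⟩
  · have := hsub (Finset.mem_filter.2 ⟨Finset.mem_range.2 hx, h⟩)
    simp at this

theorem rank_lt {a : ℕ → ℝ} {N x : ℕ} (hx : x < N) : rank a N x < N := by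
  have : rank a N x < (Finset.range N).card :=
    Finset.card_lt_card (Finset.filter_ssubset.2 ⟨x, Finset.mem_range.2 hx, by simp⟩)
  simpa using this

theorem rank_trichotomy (a : ℕ → ℝ) (x x' : ℕ) :
    (a x < a x' ∨ ¬ a x' < a x ∧ x < x') ∨ x = x' ∨ (a x' < a x ∨ ¬ a x < a x' ∧ x' < x) := by
  rcases lt_trichotomy (a x) (a x') with h | h | h
  · exact .inl (.inl h)
  · rcases lt_trichotomy x x' with h' | h' | h'
    · exact .inl (.inr ⟨by rw [h]; exact lt_irrefl _, h'⟩)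
    · exact .inr (.inl h')
    · exact .inr (.inr (.inr ⟨by rw [h]; exact lt_irrefl _, h'⟩))
  · exact .inr (.inr (.inl h))

theorem rank_inj {a : ℕ → ℝ} {N x x' : ℕ} (hx : x < N) (hx' : x' < N)
    (h : rank a N x = rank a N x') : x = x' := by
  rcases rank_trichotomy a x x' with h' | h' | h'
  · exact absurd h (rank_lt_rank hx h').ne
  · exact h'
  · exact absurd h (rank_lt_rank hx' h').ne'

theorem rank_surj {a : ℕ → ℝ} {N r : ℕ} (hr : r < N) : ∃ x < N, rank a N x = r := by
  have := Finset.surj_on_of_inj_on_of_card_le (s := Finset.range N) (t := Finset.range N)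
    (fun x _ => rank a N x) (fun x hx => Finset.mem_range.2 (rank_lt (Finset.mem_range.1 hx)))
    (fun x x' hx hx' h => rank_inj (Finset.mem_range.1 hx) (Finset.mem_range.1 hx') h) le_rfl r
    (Finset.mem_range.2 hr)
  obtain ⟨x, hx, h⟩ := this
  exact ⟨x, Finset.mem_range.1 hx, h.symm⟩

/-- `b` is a sorted rearrangement of the first `N` values of `a`. -/
structure IsSorted (a b : ℕ → ℝ) (N : ℕ) : Prop where
  mono : ∀ r r', r ≤ r' → r' < N → b r ≤ b r'
  of_src : ∀ x < N, ∃ r < N, b r = a x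
  to_src : ∀ r < N, ∃ x < N, b r = a x

theorem IsSorted.of_rank {a b : ℕ → ℝ} {N : ℕ} (h : ∀ x < N, b (rank a N x) = a x) :
    IsSorted a b N := by
  refine ⟨fun r r' hr hr' => ?_, fun x hx => ⟨_, rank_lt hx, h x hx⟩, fun r hr => ?_⟩
  · obtain ⟨x, hx, rfl⟩ := rank_surj (a := a) (hr.trans_lt hr')
    obtain ⟨x', hx', rfl⟩ := rank_surj (a := a) hr'
    rw [h x hx, h x' hx']
    by_contra hlt
    have := rank_lt_rank (a := a) (N := N) (x' := x) hx' (.inl (not_le.1 hlt))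
    omega
  · obtain ⟨x, hx, rfl⟩ := rank_surj (a := a) hr
    exact ⟨x, hx, h x hx⟩

/-- Add one to the counter `59`. -/
def incr : Cmd := setN 59 (.const 0) (.add (nv 59) (.const 1))

/-- Sort a real array. -/
def sortC (dst src d : ℕ) : Cmd :=
  loop 58 d (block [setN 59 (.const 0) (.const 0),
    loop 60 d (ite (.ltReal (.read src (nv 60)) (.read src (nv 58))) incr
      (when [(false, .ltReal (.read src (nv 58)) (.read src (nv 60))),
        (true, .ltNat (nv 60) (nv 58))] incr)),
    setR dst (nv 59) (.read src (nv 58))])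

/-- The inner loop computes the rank of `x`, and the value is written at this position. Injectivity
of the rank ensures that no earlier value is overwritten. -/
theorem sortC_spec (f : ℕ → ℝ → ℝ) {M : Memory} {dst src d : ℕ} (hne : src ≠ dst)
    (hd : d ∉ [58, 59, 60]) :
    IsSorted (M.real src) (((sortC dst src d).run f M).real dst) (M.nat d 0) := by
  set N := M.nat d 0 with hN
  set a := M.real src with ha
  refine .of_rank fun x hx => ?_
  have key := loop_rule (f := f) (v := 58) (d := d) (M := M)
    (c := block [setN 59 (.const 0) (.const 0),
    loop 60 d (ite (.ltReal (.read src (nv 60)) (.read src (nv 58))) incr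
      (when [(false, .ltReal (.read src (nv 58)) (.read src (nv 60))),
        (true, .ltNat (nv 60) (nv 58))] incr)),
    setR dst (nv 59) (.read src (nv 58))])
    (fun y M' => ∀ x < y, M'.real dst (rank a N x) = a x) (fun _ _ _ h => h) (by simp) ?_
  · exact key x hx
  · intro x hx M' hs hx' h
    have hsrc : M'.real src = a := hs.real src (by simp [block, wR, when, incr, hne])
    have hd₁ : M'.nat d 0 = N := by rw [hs.nat d (by simp at hd; simp [block, wN, when, incr]; tauto)]
    simp only [block, run_seq]
    rw [run_setN _ M' 59]
    set M₁ := M'.setN 59 ((NExp.const 0).eval M') ((NExp.const 0).eval M') with hM₁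
    have hx₁ : M₁.nat 58 0 = x := by simp [hM₁, Memory.setN_nat, hx']
    have hd₂ : M₁.nat d 0 = N := by
      rw [hM₁, Memory.setN_row _ (by simp at hd; omega), hd₁]
    set c := ite (.ltReal (.read src (nv 60)) (.read src (nv 58))) incr
      (when [(false, .ltReal (.read src (nv 58)) (.read src (nv 60))),
        (true, .ltNat (nv 60) (nv 58))] incr) with hc
    have key₁ := loop_rule (f := f) (v := 60) (d := d) (M := M₁) (c := c)
      (fun y M' => M'.nat 59 0 =
        ((Finset.range y).filter fun y => a y < a x ∨ ¬ a x < a y ∧ y < x).card)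
      (fun _ _ _ h => h) (by simp [hM₁, NExp.eval]) ?_
    · rw [hd₂] at key₁
      have s₂ := sameOff_run f (loop 60 d c) M₁
      set M₂ := (loop 60 d c).run f M₁
      have hsrc₂ : M₂.real src = a := (s₂.real src (by simp [hc, wR, when, incr])).trans hsrc
      have hdst₂ : M₂.real dst = M'.real dst := s₂.real dst (by simp [hc, wR, when, incr])
      have hx₂ : M₂.nat 58 0 = x := by rw [s₂.nat 58 (by simp [hc, wN, when, incr]), hx₁]
      rw [run_setR]
      have e : (nv 59).eval M₂ = rank a N x := key₁
      have e' : (RExp.read src (nv 58)).eval f M₂ = a x := by simp [RExp.eval, NExp.eval, hx₂, hsrc₂]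
      rw [e, e']
      intro z hz
      rcases Nat.lt_succ_iff_lt_or_eq.1 hz with hz | rfl
      · rw [Memory.setR_real, if_neg, hdst₂, h z hz]
        rintro ⟨-, h'⟩
        have := rank_inj (hz.trans hx) hx h'
        omega
      · simp
    · intro y hy M₃ hs₃ hy₃ h₃
      have hsrc₃ : M₃.real src = a := (hs₃.real src (by simp [hc, wR, when, incr])).trans hsrc
      have hx₃ : M₃.nat 58 0 = x := by rw [hs₃.nat 58 (by simp [hc, wN, when, incr]), hx₁]
      rw [Finset.range_add_one, Finset.filter_insert]
      have hinc : (incr.run f M₃).nat 59 0 = M₃.nat 59 0 + 1 := by simp [incr, NExp.eval]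
      have hnm : y ∉ (Finset.range y).filter fun y => a y < a x ∨ ¬ a x < a y ∧ y < x := by simp
      by_cases h₁ : a y < a x
      · rw [hc, run_ite_pos (by simpa [Test.Holds, RExp.eval, NExp.eval, hsrc₃, hx₃, hy₃] using h₁),
          hinc, if_pos (.inl h₁), Finset.card_insert_of_notMem hnm, h₃]
      · rw [hc, run_ite_neg (by simpa [Test.Holds, RExp.eval, NExp.eval, hsrc₃, hx₃, hy₃] using h₁)]
        by_cases h₂ : ¬ a x < a y ∧ y < x
        · rw [run_when_pos (by simpa [Guard, Test.Holds, RExp.eval, NExp.eval, hsrc₃, hx₃, hy₃]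
            using h₂), hinc, if_pos (.inr h₂), Finset.card_insert_of_notMem hnm, h₃]
        · rw [run_when_neg (fun h => h₂ (by simpa [Guard, Test.Holds, RExp.eval, NExp.eval, hsrc₃,
            hx₃, hy₃] using h)), if_neg (by tauto), h₃]

end Sorting

/-! ### Enumeration of the distinct processing times. -/

section Distinct

/-- Run `c` for every job whose processing time differs from those of all previous jobs. -/
def forNew (c : Cmd) : Cmd :=
  loop 58 0 (block [setN 59 (.const 0) (.const 0),
    loop 60 0 (when [(true, .ltNat (nv 60) (nv 58)),
      (false, .ltReal (.read 1 (nv 60)) (.read 1 (nv 58))),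
      (false, .ltReal (.read 1 (nv 58)) (.read 1 (nv 60)))] (setN 59 (.const 0) (.const 1))),
    when [(false, .ltNat (.const 0) (nv 59))] c])

/-- A job is new if no earlier job has the same processing time. The invariant is indexed by the set
of values seen so far; it changes only in rounds in which `c` is executed, and then by a value that
was not in the set. -/
theorem forNew_rule {f : ℕ → ℝ → ℝ} {c : Cmd} {M : Memory} (Inv : Finset ℝ → Memory → Prop)
    (hInv : ∀ V M M', SameOff [58, 59, 60] [] M M' → Inv V M → Inv V M')
    (hc0 : 0 ∉ c.wN) (hc1 : 1 ∉ c.wR) (h0 : Inv ∅ M)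
    (hs : ∀ V M', SameOff (forNew c).wN (forNew c).wR M M' → M'.nat 58 0 < M.nat 0 0 →
      M.real 1 (M'.nat 58 0) ∉ V → Inv V M' →
        Inv (insert (M.real 1 (M'.nat 58 0)) V) (c.run f M')) :
    Inv ((Finset.range (M.nat 0 0)).image (M.real 1)) ((forNew c).run f M) := by
  set a := M.real 1 with ha
  have key := loop_rule (f := f) (v := 58) (d := 0) (M := M)
    (c := block [setN 59 (.const 0) (.const 0),
      loop 60 0 (when [(true, .ltNat (nv 60) (nv 58)),
        (false, .ltReal (.read 1 (nv 60)) (.read 1 (nv 58))),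
        (false, .ltReal (.read 1 (nv 58)) (.read 1 (nv 60)))] (setN 59 (.const 0) (.const 1))),
      when [(false, .ltNat (.const 0) (nv 59))] c])
    (fun x M' => Inv ((Finset.range x).image a) M')
    (fun x M' y h => hInv _ _ _ (sameOff_setN _ _ _ (by simp)) h) (by simpa using h0) ?_
  · exact key
  · intro x hx M' hs' hx' h
    have ha' : M'.real 1 = a := hs'.real 1 (by simpa [block, wR, when] using hc1)
    have h0' : M'.nat 0 0 = M.nat 0 0 := by
      rw [hs'.nat 0 (by simpa [block, wN, when] using hc0)]
    simp only [block, run_seq]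
    rw [run_setN _ M' 59]
    set M₁ := M'.setN 59 ((NExp.const 0).eval M') ((NExp.const 0).eval M') with hM₁
    have hx₁ : M₁.nat 58 0 = x := by simp [hM₁, Memory.setN_nat, hx']
    have h0₁ : M₁.nat 0 0 = M.nat 0 0 := by rw [hM₁, Memory.setN_row _ (by norm_num), h0']
    set d := when [(true, .ltNat (nv 60) (nv 58)),
        (false, .ltReal (.read 1 (nv 60)) (.read 1 (nv 58))),
        (false, .ltReal (.read 1 (nv 58)) (.read 1 (nv 60)))] (setN 59 (.const 0) (.const 1)) with hd
    have key₁ := loop_rule (f := f) (v := 60) (d := 0) (M := M₁) (c := d)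
      (fun y M' => 0 < M'.nat 59 0 ↔ ∃ z < y, z < x ∧ a z = a x)
      (fun _ _ _ h => h) (by simp [hM₁, NExp.eval]) ?_
    · rw [h0₁] at key₁
      have s₂ := sameOff_run f (loop 60 0 d) M₁
      set M₂ := (loop 60 0 d).run f M₁
      have s₂' : SameOff [58, 59, 60] [] M' M₂ :=
        (sameOff_setN _ _ _ (by simp)).trans (s₂.mono (by simp [hd, when, wN]) (by simp [hd, when, wR]))
      have hx₂ : M₂.nat 58 0 = x := by rw [s₂.nat 58 (by simp [hd, when, wN]), hx₁]
      have hI₂ := hInv _ _ _ s₂' h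
      rw [Finset.range_add_one, Finset.image_insert]
      have hmem : a x ∈ (Finset.range x).image a ↔ 0 < M₂.nat 59 0 := by
        rw [key₁, Finset.mem_image]
        exact ⟨fun ⟨z, hz, e⟩ => ⟨z, (Finset.mem_range.1 hz).trans hx, Finset.mem_range.1 hz, e⟩,
          fun ⟨z, _, hz, e⟩ => ⟨z, Finset.mem_range.2 hz, e⟩⟩
      by_cases hm : a x ∈ (Finset.range x).image a
      · rw [run_when_neg (by simpa [Guard, Test.Holds, NExp.eval, Nat.pos_iff_ne_zero] using hmem.1 hm),
          Finset.insert_eq_of_mem hm]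
        exact hI₂
      · rw [run_when_pos (by simpa [Guard, Test.Holds, NExp.eval] using mt hmem.2 hm)]
        have := hs _ M₂ ?_ (by rw [hx₂]; exact hx) (by rw [hx₂]; exact hm) hI₂
        · rwa [hx₂] at this
        · exact (show SameOff (forNew c).wN (forNew c).wR M M' from hs').trans
            (s₂'.mono (by intro y; simp [forNew, block, when, wN]; tauto) (by simp))
    · intro y hy M₃ hs₃ hy₃ h₃
      have ha₃ : M₃.real 1 = a := (hs₃.real 1 (by simp [hd, wR, when])).trans ha'
      have hx₃ : M₃.nat 58 0 = x := by rw [hs₃.nat 58 (by simp [hd, wN, when]), hx₁]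
      by_cases h₁ : y < x ∧ ¬ a y < a x ∧ ¬ a x < a y
      · rw [hd, run_when_pos (by simpa [Guard, Test.Holds, RExp.eval, NExp.eval, ha₃, hx₃, hy₃]
          using h₁)]
        simp only [run_setN, NExp.eval, Memory.setN_same]
        exact ⟨fun _ => ⟨y, by omega, h₁.1, le_antisymm (not_lt.1 h₁.2.2) (not_lt.1 h₁.2.1)⟩,
          fun _ => one_pos⟩
      · rw [hd, run_when_neg (fun h => h₁ (by simpa [Guard, Test.Holds, RExp.eval, NExp.eval, ha₃,
          hx₃, hy₃] using h)), h₃]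
        constructor
        · rintro ⟨z, hz, h⟩
          exact ⟨z, by omega, h⟩
        · rintro ⟨z, hz, hzx, e⟩
          rcases Nat.lt_succ_iff_lt_or_eq.1 hz with hz | rfl
          · exact ⟨z, hz, hzx, e⟩
          · exact absurd ⟨hzx, by rw [e]; simp, by rw [e]; simp⟩ h₁

end Distinct
end GPSP

namespace GPSP

open Cmd

/-! ### Computation of the parameters -/

section Parameters

variable (f : ℕ → ℝ → ℝ) {M : Memory}

/-- Simple functions of the numbers `n` and `s`. -/
def prelude : Cmd :=
  block [setN 3 (.const 0) (.read 0 (.const 1)),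
    setN 4 (.const 0) (.add (.read 0 (.const 1)) (.const 1)),
    setN 5 (.const 0) (.add (.add (nv 3) (nv 3)) (.add (nv 3) (nv 3))),
    setN 6 (.const 0) (.add (nv 0) (nv 0)),
    setN 7 (.const 0) (.add (.add (nv 0) (nv 0)) (.const 2))]

theorem prelude_spec {n s : ℕ} (h0 : M.nat 0 0 = n) (h1 : M.nat 0 1 = s) :
    (prelude.run f M).nat 3 0 = s ∧ (prelude.run f M).nat 4 0 = s + 1 ∧
      (prelude.run f M).nat 5 0 = 4 * s ∧ (prelude.run f M).nat 6 0 = n + n ∧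
      (prelude.run f M).nat 7 0 = 2 * n + 2 := by
  simp [prelude, block, NExp.eval, Memory.setN_nat, h0, h1]
  omega

/-- The least power of two that is at least `4 * s`. -/
def powerC : Cmd :=
  block [setN 8 (.const 0) (.const 1), setN 9 (.const 0) (.const 1),
    loop 61 5 (when [(true, .ltNat (nv 8) (nv 5))]
      (seq (setN 8 (.const 0) (.add (nv 8) (nv 8))) (setN 9 (.const 0) (.add (nv 9) (.const 1)))))]

/-- Either the doubling has stopped or the exponent is at least the number of rounds; as `x ≤ 2 ^
x`, the `4 * s` rounds are enough. A doubling happens only below `4 * s`, whence the upper bound. -/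
theorem powerC_spec {s : ℕ} (h5 : M.nat 5 0 = 4 * s) (hs : 1 ≤ s) :
    ∃ t, (powerC.run f M).nat 8 0 = 2 ^ t ∧ (powerC.run f M).nat 9 0 = t + 1 ∧ 4 * s ≤ 2 ^ t ∧
      2 ^ t < 8 * s := by
  simp only [powerC, block, run_seq]
  have e : ((setN 9 (.const 0) (.const 1)).run f ((setN 8 (.const 0) (.const 1)).run f M)) =
    (M.setN 8 0 1).setN 9 0 1 := rfl
  rw [e]
  set M₀ := (M.setN 8 0 1).setN 9 0 1 with hM₀
  have h5₀ : M₀.nat 5 0 = 4 * s := by simpa [hM₀, Memory.setN_nat] using h5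
  have key := loop_rule (f := f) (v := 61) (d := 5) (M := M₀)
    (c := when [(true, .ltNat (nv 8) (nv 5))]
      (seq (setN 8 (.const 0) (.add (nv 8) (nv 8))) (setN 9 (.const 0) (.add (nv 9) (.const 1)))))
    (fun x M' => ∃ t, M'.nat 8 0 = 2 ^ t ∧ M'.nat 9 0 = t + 1 ∧ (4 * s ≤ 2 ^ t ∨ x ≤ t) ∧
      2 ^ t < 8 * s)
    (fun _ _ _ h => h) ⟨0, by simp [hM₀, Memory.setN_nat], by simp [hM₀], by simp, by simp; omega⟩ ?_
  · obtain ⟨t, h₁, h₂, h₃, h₄⟩ := key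
    refine ⟨t, h₁, h₂, ?_, h₄⟩
    rcases h₃ with h₃ | h₃
    · exact h₃
    · rw [h5₀] at h₃
      exact h₃.trans t.lt_two_pow_self.le
  · intro x hx M' hs' hx' ⟨t, h₁, h₂, h₃, h₄⟩
    have h5' : M'.nat 5 0 = 4 * s := by rw [hs'.nat 5 (by decide), h5₀]
    by_cases hlt : 2 ^ t < 4 * s
    · rw [run_when_true (by simpa [Test.Holds, NExp.eval, h₁, h5'] using hlt)]
      refine ⟨t + 1, ?_, ?_, .inr (by omega), by rw [pow_succ]; omega⟩
      · simp [NExp.eval, Memory.setN_nat, h₁, pow_succ]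
        ring
      · simp [NExp.eval, Memory.setN_nat, h₂]
    · rw [run_when_false (by simpa [Test.Holds, NExp.eval, h₁, h5'] using hlt)]
      exact ⟨t, h₁, h₂, .inl (by omega), h₄⟩

/-- The number of the relevant total processing times. -/
def countC : Cmd :=
  seq (setN 10 (.const 0) (.const 1))
    (forNew (seq (mulC 62 63 4 (nv 10) (nv 4)) (setN 10 (.const 0) (nv 62))))

theorem countC_spec {n s : ℕ} (h0 : M.nat 0 0 = n) (h4 : M.nat 4 0 = s + 1) :
    (countC.run f M).nat 10 0 = (s + 1) ^ ((Finset.range n).image (M.real 1)).card := by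
  rw [countC, run_seq, run_setN]
  set M₀ := M.setN 10 ((NExp.const 0).eval M) ((NExp.const 1).eval M) with hM₀
  have h0₀ : M₀.nat 0 0 = n := by simpa [hM₀, Memory.setN_nat] using h0
  have h4₀ : M₀.nat 4 0 = s + 1 := by simpa [hM₀, Memory.setN_nat] using h4
  have key := forNew_rule (f := f) (M := M₀)
    (c := seq (mulC 62 63 4 (nv 10) (nv 4)) (setN 10 (.const 0) (nv 62)))
    (fun V M' => M'.nat 10 0 = (s + 1) ^ V.card)
    (fun V M M' hs h => by rw [hs.nat 10 (by decide)]; exact h) (by decide) (by decide)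
    (by simp [hM₀, NExp.eval]) (fun V M' hs hj hV h => ?_)
  · rw [h0₀] at key
    exact key
  · have h4' : M'.nat 4 0 = s + 1 := by rw [hs.nat 4 (by decide), h4₀]
    rw [run_seq, run_setN]
    have hev : (NExp.const 0).eval ((mulC 62 63 4 (nv 10) (nv 4)).run f M') = 0 := rfl
    rw [hev, Memory.setN_same]
    have := mulC_spec f (M := M') (dst := 62) (lv := 63) (d := 4) (u := nv 10) (w := nv 4)
      (U := (s + 1) ^ V.card) (W := s + 1) (by decide) (by decide)
      (fun M'' hs' => by simp [NExp.eval, hs'.nat 10 (by decide), h])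
      (fun M'' hs' => by simp [NExp.eval, hs'.nat 4 (by decide), h4']) h4'.ge
    rw [Finset.card_insert_of_notMem hV, pow_succ]
    simpa [NExp.eval] using this

/-- The number of colours and the ranges of the hash functions. -/
def rangesC : Cmd :=
  block [setN 11 (.const 0) (.add (nv 8) (nv 8)), mulC 12 63 8 (nv 8) (nv 8),
    setN 13 (.const 0) (.add (nv 12) (nv 12))]

theorem rangesC_spec {W : ℕ} (h8 : M.nat 8 0 = W) :
    (rangesC.run f M).nat 11 0 = 2 * W ∧ (rangesC.run f M).nat 12 0 = W * W ∧
      (rangesC.run f M).nat 13 0 = W * W + W * W := by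
  simp only [rangesC, block, run_seq]
  rw [run_setN _ M 11]
  set M₁ := M.setN 11 ((NExp.const 0).eval M) ((NExp.add (nv 8) (nv 8)).eval M) with hM₁
  have h8₁ : M₁.nat 8 0 = W := by simpa [hM₁, Memory.setN_nat] using h8
  have h11 : M₁.nat 11 0 = 2 * W := by simp [hM₁, NExp.eval, h8, two_mul]
  have := mulC_spec f (M := M₁) (dst := 12) (lv := 63) (d := 8) (u := nv 8) (w := nv 8)
      (U := W) (W := W) (by decide) (by decide)
      (fun M'' hs' => by simp [NExp.eval, hs'.nat 8 (by decide), h8₁])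
      (fun M'' hs' => by simp [NExp.eval, hs'.nat 8 (by decide), h8₁]) h8₁.ge
  have s₂ := sameOff_run f (mulC 12 63 8 (nv 8) (nv 8)) M₁
  set M₂ := (mulC 12 63 8 (nv 8) (nv 8)).run f M₁
  have h11₂ : M₂.nat 11 0 = 2 * W := by rw [s₂.nat 11 (by decide), h11]
  simp [NExp.eval, Memory.setN_nat, this, h11₂]

/-- The powers of two, and the numbers of codes and of multiplier vectors. -/
def codesC : Cmd :=
  block [setN 17 (.const 0) (.const 1),
    loop 61 11 (setN 17 (.add (nv 61) (.const 1)) (.add (.read 17 (nv 61)) (.read 17 (nv 61)))),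
    setN 14 (.const 0) (.read 17 (nv 11)), setN 15 (.const 0) (.const 1),
    loop 61 9 (seq (mulC 62 63 13 (nv 15) (nv 13)) (setN 15 (.const 0) (nv 62))),
    setN 16 (.const 0) (.add (nv 10) (nv 14))]

theorem codesC_spec {K A t E : ℕ} (h11 : M.nat 11 0 = K) (h13 : M.nat 13 0 = A)
    (h9 : M.nat 9 0 = t) (h10 : M.nat 10 0 = E) :
    (∀ b ≤ K, (codesC.run f M).nat 17 b = 2 ^ b) ∧ (codesC.run f M).nat 14 0 = 2 ^ K ∧
      (codesC.run f M).nat 15 0 = A ^ t ∧ (codesC.run f M).nat 16 0 = E + 2 ^ K := by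
  simp only [codesC, block, run_seq]
  rw [run_setN _ M 17]
  set M₁ := M.setN 17 ((NExp.const 0).eval M) ((NExp.const 1).eval M) with hM₁
  have s₁ : SameOff [17] [] M M₁ := sameOff_setN _ _ _ (by simp)
  set c := setN 17 (.add (nv 61) (.const 1)) (.add (.read 17 (nv 61)) (.read 17 (nv 61))) with hc
  have key := loop_rule (f := f) (v := 61) (d := 11) (M := M₁) (c := c)
    (fun x M' => ∀ b ≤ x, M'.nat 17 b = 2 ^ b) (fun _ _ _ h => h)
    (by simp [hM₁, NExp.eval]) ?_
  · have s₂ := sameOff_run f (loop 61 11 c) M₁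
    set M₂ := (loop 61 11 c).run f M₁
    rw [s₁.nat 11 (by decide), h11] at key
    have h11₂ : M₂.nat 11 0 = K := by rw [s₂.nat 11 (by decide), s₁.nat 11 (by decide), h11]
    have h13₂ : M₂.nat 13 0 = A := by rw [s₂.nat 13 (by decide), s₁.nat 13 (by decide), h13]
    have h9₂ : M₂.nat 9 0 = t := by rw [s₂.nat 9 (by decide), s₁.nat 9 (by decide), h9]
    have h10₂ : M₂.nat 10 0 = E := by rw [s₂.nat 10 (by decide), s₁.nat 10 (by decide), h10]
    rw [run_setN _ M₂ 14]
    set M₃ := M₂.setN 14 ((NExp.const 0).eval M₂) ((NExp.read 17 (nv 11)).eval M₂) with hM₃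
    rw [run_setN _ M₃ 15]
    set M₄ := M₃.setN 15 ((NExp.const 0).eval M₃) ((NExp.const 1).eval M₃) with hM₄
    have s₄ : SameOff [14, 15] [] M₂ M₄ :=
      (sameOff_setN _ _ _ (by simp)).trans (sameOff_setN _ _ _ (by simp))
    have h14₄ : M₄.nat 14 0 = 2 ^ K := by
      simp [hM₄, hM₃, Memory.setN_nat, NExp.eval, h11₂, key K le_rfl]
    have h13₄ : M₄.nat 13 0 = A := by rw [s₄.nat 13 (by decide), h13₂]
    have key' := loop_rule (f := f) (v := 61) (d := 9) (M := M₄)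
      (c := seq (mulC 62 63 13 (nv 15) (nv 13)) (setN 15 (.const 0) (nv 62)))
      (fun x M' => M'.nat 15 0 = A ^ x) (fun _ _ _ h => h) (by simp [hM₄, NExp.eval]) ?_
    · have s₅ := sameOff_run f (loop 61 9 (seq (mulC 62 63 13 (nv 15) (nv 13))
        (setN 15 (.const 0) (nv 62)))) M₄
      set M₅ := (loop 61 9 (seq (mulC 62 63 13 (nv 15) (nv 13))
        (setN 15 (.const 0) (nv 62)))).run f M₄
      rw [s₄.nat 9 (by decide), h9₂] at key'
      have h14₅ : M₅.nat 14 0 = 2 ^ K := by rw [s₅.nat 14 (by decide), h14₄]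
      have h10₅ : M₅.nat 10 0 = E := by rw [s₅.nat 10 (by decide), s₄.nat 10 (by decide), h10₂]
      refine ⟨fun b hb => ?_, ?_, ?_, ?_⟩
      · rw [run_setN, Memory.setN_row _ (by norm_num), s₅.nat 17 (by decide), s₄.nat 17 (by decide),
          key b hb]
      · rw [run_setN, Memory.setN_row _ (by norm_num), h14₅]
      · rw [run_setN, Memory.setN_row _ (by norm_num), key']
      · simp [NExp.eval, h10₅, h14₅]
    · intro x hx M' hs hx' h
      have h13' : M'.nat 13 0 = A := by rw [hs.nat 13 (by decide), h13₄]
      rw [run_seq, run_setN]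
      have hev : (NExp.const 0).eval ((mulC 62 63 13 (nv 15) (nv 13)).run f M') = 0 := rfl
      rw [hev, Memory.setN_same]
      have := mulC_spec f (M := M') (dst := 62) (lv := 63) (d := 13) (u := nv 15) (w := nv 13)
        (U := A ^ x) (W := A) (by decide) (by decide)
        (fun M'' hs' => by simp [NExp.eval, hs'.nat 15 (by decide), h])
        (fun M'' hs' => by simp [NExp.eval, hs'.nat 13 (by decide), h13']) h13'.ge
      rw [pow_succ]
      simpa [NExp.eval] using this
  · intro x hx M' hs hx' h b hb
    rw [hc, run_setN]
    have e : (NExp.add (nv 61) (.const 1)).eval M' = x + 1 := by simp [NExp.eval, hx']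
    have e' : (NExp.add (.read 17 (nv 61)) (.read 17 (nv 61))).eval M' = 2 ^ (x + 1) := by
      simp [NExp.eval, hx', h x le_rfl, pow_succ, mul_two]
    rw [e, e', Memory.setN_nat]
    by_cases hb' : b = x + 1
    · simp [hb']
    · rw [if_neg (fun h => hb' h.2), h b (by omega)]

end Parameters

/-! ### Multiples, digit sums, total processing times, and next release dates. -/

section AuxTables

variable (f : ℕ → ℝ → ℝ) {M : Memory}

/-- The table of multiples. -/
def multC : Cmd :=
  block [setN 18 (.const 0) (.const 0), setN 62 (.const 0) (.const 0),
    loop 61 7 (loop 63 16 (loop 64 16 (seq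
      (setN 18 (.add (nv 62) (.const 1)) (.add (.read 18 (nv 62)) (nv 16)))
      (setN 62 (.const 0) (.add (nv 62) (.const 1))))))]

/-- The three nested loops only serve to count to `N * D * D`, since this product itself is not
available as a small loop bound; cell `62` is the flattened counter. -/
theorem multC_spec {N D : ℕ} (h7 : M.nat 7 0 = N) (h16 : M.nat 16 0 = D) :
    ∀ x < N * D * D, (multC.run f M).nat 18 x = x * D := by
  simp only [multC, block, run_seq]
  have e : ((setN 62 (.const 0) (.const 0)).run f ((setN 18 (.const 0) (.const 0)).run f M)) =
    (M.setN 18 0 0).setN 62 0 0 := rfl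
  rw [e]
  set M₀ := (M.setN 18 0 0).setN 62 0 0 with hM₀
  set c := seq (setN 18 (.add (nv 62) (.const 1)) (.add (.read 18 (nv 62)) (nv 16)))
      (setN 62 (.const 0) (.add (nv 62) (.const 1))) with hc
  set Inv : ℕ → Memory → Prop := fun x M' =>
    M'.nat 62 0 = x ∧ (∀ y ≤ x, M'.nat 18 y = y * D) ∧ M'.nat 16 0 = D ∧ M'.nat 7 0 = N with hInv
  have step : ∀ x M', Inv x M' → Inv (x + 1) (c.run f M') := by
    rintro x M' ⟨h₁, h₂, h₃, h₄⟩
    refine ⟨by simp [hc, NExp.eval, Memory.setN_nat, h₁], fun y hy => ?_,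
      by simp [hc, Memory.setN_nat, h₃], by simp [hc, Memory.setN_nat, h₄]⟩
    simp only [hc, run_seq, run_setN, NExp.eval, Memory.setN_nat, h₁, h₃]
    by_cases hy' : y = x + 1
    · simp [hy', h₂ x le_rfl, add_mul]
    · simp [hy', h₂ y (by omega)]
  have loop1 : ∀ x M', Inv x M' → Inv (x + D) ((loop 64 16 c).run f M') := by
    intro x M' h
    have := loop_rule (f := f) (v := 64) (d := 16) (M := M') (c := c) (fun y => Inv (x + y))
      (fun _ _ _ h => h) h (fun y _ M'' _ _ h => step _ _ h)
    rwa [h.2.2.1] at this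
  have loop2 : ∀ x M', Inv x M' → Inv (x + D * D) ((loop 63 16 (loop 64 16 c)).run f M') := by
    intro x M' h
    have := loop_rule (f := f) (v := 63) (d := 16) (M := M') (c := loop 64 16 c)
      (fun y => Inv (x + y * D)) (fun _ _ _ h => h) (by simpa using h) (fun y _ M'' _ _ h => by
        have := loop1 _ _ h
        rwa [show x + (y + 1) * D = x + y * D + D by ring])
    rwa [h.2.2.1] at this
  have key := loop_rule (f := f) (v := 61) (d := 7) (M := M₀) (c := loop 63 16 (loop 64 16 c))
      (fun y => Inv (y * (D * D))) (fun _ _ _ h => h)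
      ⟨by simp [hM₀], by simp [hM₀, Memory.setN_nat], by simpa [hM₀, Memory.setN_nat] using h16,
        by simpa [hM₀, Memory.setN_nat] using h7⟩ (fun y _ M'' _ _ h => by
        have := loop2 _ _ h
        rwa [show (y + 1) * (D * D) = y * (D * D) + D * D by ring])
  have h7₀ : M₀.nat 7 0 = N := by simpa [hM₀, Memory.setN_nat] using h7
  rw [h7₀] at key
  intro x hx
  exact key.2.1 x (by rw [mul_assoc] at hx; exact hx.le)

/-- The table of digit sums. -/
def popC : Cmd :=
  seq (setN 19 (.const 0) (.const 0))
    (loop 61 14 (seq (setN 19 (.add (nv 61) (nv 61)) (.read 19 (nv 61)))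
      (setN 19 (.add (.add (nv 61) (nv 61)) (.const 1)) (.add (.read 19 (nv 61)) (.const 1)))))

/-- The value for `x` yields those for `2 * x` and `2 * x + 1`, so it is known before it is needed.
The case `x = 0` is kept separately in the invariant. -/
theorem popC_spec {Q : ℕ} (h14 : M.nat 14 0 = Q) : ∀ x < Q, (popC.run f M).nat 19 x = popc x := by
  rw [popC, run_seq, run_setN]
  set M₀ := M.setN 19 ((NExp.const 0).eval M) ((NExp.const 0).eval M) with hM₀
  have h14₀ : M₀.nat 14 0 = Q := by simpa [hM₀, Memory.setN_nat] using h14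
  have p0 : popc 0 = 0 := by simp [popc]
  have key := loop_rule (f := f) (v := 61) (d := 14) (M := M₀)
    (c := seq (setN 19 (.add (nv 61) (nv 61)) (.read 19 (nv 61)))
      (setN 19 (.add (.add (nv 61) (nv 61)) (.const 1)) (.add (.read 19 (nv 61)) (.const 1))))
    (fun x M' => M'.nat 19 0 = 0 ∧ ∀ y < 2 * x, M'.nat 19 y = popc y)
    (fun _ _ _ h => h) (by simp [hM₀, NExp.eval]) ?_
  · rw [h14₀] at key
    exact fun x hx => key.2 x (by omega)
  · intro x hx M' hs hx' ⟨h₁, h₂⟩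
    have hpx : M'.nat 19 x = popc x := by
      rcases Nat.eq_zero_or_pos x with rfl | h
      · rw [h₁, p0]
      · exact h₂ x (by omega)
    set M₁ := M'.setN 19 (x + x) (popc x) with hM₁
    have e₁ : (setN 19 (.add (nv 61) (nv 61)) (.read 19 (nv 61))).run f M' = M₁ := by
      simp [NExp.eval, hx', hpx, hM₁]
    have hpx₁ : M₁.nat 19 x = popc x := by
      rw [hM₁, Memory.setN_nat]
      split_ifs
      exacts [rfl, hpx]
    have hx₁ : M₁.nat 61 0 = x := by simpa [hM₁, Memory.setN_nat] using hx'
    rw [run_seq, e₁, run_setN]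
    have e₂ : (NExp.add (.add (nv 61) (nv 61)) (.const 1)).eval M₁ = x + x + 1 := by
      simp [NExp.eval, hx₁]
    have e₃ : (NExp.add (.read 19 (nv 61)) (.const 1)).eval M₁ = popc x + 1 := by
      simp [NExp.eval, hx₁, hpx₁]
    rw [e₂, e₃]
    have hall : ∀ y < 2 * (x + 1), (M₁.setN 19 (x + x + 1) (popc x + 1)).nat 19 y = popc y := by
      intro y hy
      by_cases h₃ : y = x + x + 1
      · rw [Memory.setN_nat, if_pos ⟨rfl, h₃⟩, h₃, ← two_mul, popc_two_mul_add_one]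
      · rw [Memory.setN_nat, if_neg (fun h => h₃ h.2), hM₁, Memory.setN_nat]
        by_cases h₄ : y = x + x
        · rw [if_pos ⟨rfl, h₄⟩, h₄, ← two_mul, popc_two_mul]
        · rw [if_neg (fun h => h₄ h.2), h₂ y (by omega)]
    exact ⟨by rw [hall 0 (by omega), p0], hall⟩

/-- All relevant total processing times. -/
def sumsC : Cmd :=
  block [setN 62 (.const 0) (.const 1), setR 6 (.const 0) (.sub (rv 6) (rv 6)),
    forNew (block [setN 64 (.const 0) (.const 0),
      loop 65 3 (seq
        (loop 66 10 (when [(true, .ltNat (nv 66) (nv 62))]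
          (setR 6 (.add (.add (nv 64) (nv 62)) (nv 66))
            (.add (.read 6 (.add (nv 64) (nv 66))) (.read 1 (nv 58))))))
        (setN 64 (.const 0) (.add (nv 64) (nv 62)))),
      setN 62 (.const 0) (.add (nv 64) (nv 62))])]

/-- Real array `6` contains all sums of at most `s` copies of each element of `V`. -/
structure SumsOK (s : ℕ) (V : Finset ℝ) (a : ℕ → ℝ) : Prop where
  nonneg : ∀ x < (s + 1) ^ V.card, 0 ≤ a x
  exists_eq : ∀ c : ℝ → ℕ, (∀ v ∈ V, c v ≤ s) → ∃ x < (s + 1) ^ V.card, a x = ∑ v ∈ V, c v * v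

/-- Positions are in base `s + 1`: the new leading digit `b` is the number of copies of `p`. -/
theorem SumsOK.insert_new {s : ℕ} {V : Finset ℝ} {a a' : ℕ → ℝ} {p : ℝ} (h : SumsOK s V a)
    (hp : p ∉ V) (hp₀ : 0 ≤ p)
    (ha : ∀ b ≤ s, ∀ x < (s + 1) ^ V.card, a' (b * (s + 1) ^ V.card + x) = a x + b * p) :
    SumsOK s (insert p V) a' := by
  have hE : 0 < (s + 1) ^ V.card := by positivity
  set E := (s + 1) ^ V.card
  have hcard : (s + 1) ^ (insert p V).card = (s + 1) * E := by
    rw [Finset.card_insert_of_notMem hp, pow_succ, mul_comm]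
  refine ⟨fun x hx => ?_, fun c hc => ?_⟩
  · rw [hcard] at hx
    have h₁ := ha (x / E) (by
      have := (Nat.div_lt_iff_lt_mul hE).2 hx
      omega) (x % E) (Nat.mod_lt _ hE)
    rw [Nat.div_add_mod' x E] at h₁
    rw [h₁]
    have := h.nonneg _ (Nat.mod_lt x hE)
    positivity
  · obtain ⟨x, hx, hax⟩ := h.exists_eq c fun v hv => hc v (by simp [hv])
    refine ⟨c p * E + x, ?_, ?_⟩
    · rw [hcard]
      have := Nat.mul_le_mul_right E (hc p (by simp))
      rw [add_mul, one_mul]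
      omega
    · rw [ha _ (hc p (by simp)) x hx, hax, Finset.sum_insert hp, add_comm]

theorem sumsC_spec {n s : ℕ} (h0 : M.nat 0 0 = n) (h3 : M.nat 3 0 = s)
    (h10 : M.nat 10 0 = (s + 1) ^ ((Finset.range n).image (M.real 1)).card)
    (hpos : ∀ j < n, 0 ≤ M.real 1 j) :
    SumsOK s ((Finset.range n).image (M.real 1)) ((sumsC.run f M).real 6) := by
  set Vn := (Finset.range n).image (M.real 1) with hVn
  simp only [sumsC, block, run_seq]
  rw [run_setN _ M 62]
  set M₁ := M.setN 62 ((NExp.const 0).eval M) ((NExp.const 1).eval M) with hM₁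
  rw [run_setR _ M₁ 6]
  -- The initial entry, the empty sum, is obtained as a difference, because there is no expression
  -- for the real number zero.
  set M₂ := M₁.setR 6 ((NExp.const 0).eval M₁) ((RExp.sub (rv 6) (rv 6)).eval f M₁) with hM₂
  have s₂ : SameOff [62] [6] M M₂ :=
    ⟨fun a ha => M.setN_row (by simpa using ha), fun a ha => M.setR_row (by simpa using ha)⟩
  have h0₂ : M₂.nat 0 0 = n := by rw [s₂.nat 0 (by decide), h0]
  have h1₂ : M₂.real 1 = M.real 1 := s₂.real 1 (by decide)
  set d := when [(true, .ltNat (nv 66) (nv 62))]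
          (setR 6 (.add (.add (nv 64) (nv 62)) (nv 66))
            (.add (.read 6 (.add (nv 64) (nv 66))) (.read 1 (nv 58)))) with hd
  have key := forNew_rule (f := f) (M := M₂)
    (c := seq (setN 64 (.const 0) (.const 0))
      (seq (loop 65 3 (seq (loop 66 10 d) (setN 64 (.const 0) (.add (nv 64) (nv 62)))))
        (setN 62 (.const 0) (.add (nv 64) (nv 62)))))
    (fun V M' => V ⊆ Vn ∧ M'.nat 62 0 = (s + 1) ^ V.card ∧ SumsOK s V (M'.real 6))
    (fun V M M' hs h => by rw [hs.nat 62 (by decide), hs.real 6 (by decide)]; exact h)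
    (by decide) (by decide)
    ⟨by simp, by simp [hM₂, hM₁, NExp.eval], ?_⟩ ?_
  · rw [h0₂, h1₂] at key
    exact key.2.2
  · have e6 : M₂.real 6 0 = 0 := by simp [hM₂, RExp.eval, NExp.eval]
    exact ⟨fun x hx => by simp at hx; rw [hx, e6], fun c _ => ⟨0, by simp, by simpa using e6⟩⟩
  · rintro V M₃ s₃ hj hp ⟨hV, h62, hS⟩
    set j := M₃.nat 58 0 with hjdef
    rw [h0₂] at hj
    rw [h1₂] at hp ⊢
    set p := M.real 1 j with hpdef
    set E := (s + 1) ^ V.card with hE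
    have hV' : insert p V ⊆ Vn := Finset.insert_subset
      (Finset.mem_image.2 ⟨j, Finset.mem_range.2 hj, rfl⟩) hV
    -- The innermost loop runs up to the final number of sums and is guarded by the current one.
    -- This inequality shows that it covers all current sums.
    have hEle : E ≤ (s + 1) ^ Vn.card := Nat.pow_le_pow_right (by omega) (Finset.card_le_card hV)
    have h1₃ : M₃.real 1 = M.real 1 := by rw [s₃.real 1 (by decide), h1₂]
    have h3₃ : M₃.nat 3 0 = s := by rw [s₃.nat 3 (by decide), s₂.nat 3 (by decide), h3]
    have h10₃ : M₃.nat 10 0 = (s + 1) ^ Vn.card := by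
      rw [s₃.nat 10 (by decide), s₂.nat 10 (by decide), h10]
    rw [run_seq, run_seq, run_setN _ M₃ 64]
    set M₄ := M₃.setN 64 ((NExp.const 0).eval M₃) ((NExp.const 0).eval M₃) with hM₄
    have s₄ : SameOff [64] [] M₃ M₄ := sameOff_setN _ _ _ (by simp)
    set a := M₃.real 6 with ha
    have key₁ := loop_rule (f := f) (v := 65) (d := 3) (M := M₄)
      (c := seq (loop 66 10 d) (setN 64 (.const 0) (.add (nv 64) (nv 62))))
      (fun b M' => M'.nat 64 0 = b * E ∧
        ∀ b' ≤ b, ∀ x < E, M'.real 6 (b' * E + x) = a x + b' * p)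
      (fun _ _ _ h => h) ⟨by simp [hM₄, NExp.eval], by
        intro b' hb' x hx
        obtain rfl : b' = 0 := by omega
        simp [hM₄, ha]⟩ ?_
    · have s₅ := sameOff_run f (loop 65 3 (seq (loop 66 10 d)
        (setN 64 (.const 0) (.add (nv 64) (nv 62))))) M₄
      set M₅ := (loop 65 3 (seq (loop 66 10 d)
        (setN 64 (.const 0) (.add (nv 64) (nv 62))))).run f M₄
      rw [s₄.nat 3 (by decide), h3₃] at key₁
      have h62₅ : M₅.nat 62 0 = E := by rw [s₅.nat 62 (by decide), s₄.nat 62 (by decide), h62]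
      refine ⟨hV', ?_, hS.insert_new hp (hpos j hj) key₁.2⟩
      rw [Finset.card_insert_of_notMem hp, pow_succ, ← hE]
      simp [NExp.eval, key₁.1, h62₅]
      ring
    · rintro b hb M₆ s₆ - ⟨g₁, g₂⟩
      have h62₆ : M₆.nat 62 0 = E := by rw [s₆.nat 62 (by decide), s₄.nat 62 (by decide), h62]
      have h10₆ : M₆.nat 10 0 = (s + 1) ^ Vn.card := by
        rw [s₆.nat 10 (by decide), s₄.nat 10 (by decide), h10₃]
      have h58₆ : M₆.nat 58 0 = j := by rw [s₆.nat 58 (by decide), s₄.nat 58 (by decide)]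
      have h1₆ : M₆.real 1 = M.real 1 := by
        rw [s₆.real 1 (by decide), s₄.real 1 (by decide), h1₃]
      have key₂ := loop_rule (f := f) (v := 66) (d := 10) (M := M₆) (c := d)
        (fun y M' => (∀ b' ≤ b, ∀ x < E, M'.real 6 (b' * E + x) = a x + b' * p) ∧
          ∀ x < E, x < y → M'.real 6 (b * E + E + x) = a x + (b + 1 : ℕ) * p)
        (fun _ _ _ h => h) ⟨g₂, by simp⟩ ?_
      · have s₇ := sameOff_run f (loop 66 10 d) M₆
        rw [run_seq, run_setN]
        set M₇ := (loop 66 10 d).run f M₆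
        rw [h10₆] at key₂
        refine ⟨?_, fun b' hb' x hx => ?_⟩
        · have h64₇ : M₇.nat 64 0 = b * E := by rw [s₇.nat 64 (by decide), g₁]
          have h62₇ : M₇.nat 62 0 = E := by rw [s₇.nat 62 (by decide), h62₆]
          simp [NExp.eval, h64₇, h62₇, add_mul]
        · rcases Nat.lt_succ_iff_lt_or_eq.1 (Nat.lt_succ_of_le hb') with hb' | rfl
          · exact key₂.1 b' (by omega) x hx
          · rw [add_mul, one_mul]
            exact key₂.2 x hx (by omega)
      · rintro y hy M₈ s₈ hy₈ ⟨k₁, k₂⟩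
        have h62₈ : M₈.nat 62 0 = E := by rw [s₈.nat 62 (by decide), h62₆]
        have h64₈ : M₈.nat 64 0 = b * E := by rw [s₈.nat 64 (by decide), g₁]
        have h58₈ : M₈.nat 58 0 = j := by rw [s₈.nat 58 (by decide), h58₆]
        have h1₈ : M₈.real 1 = M.real 1 := by rw [s₈.real 1 (by decide), h1₆]
        by_cases hlt : y < E
        · rw [hd, run_when_true (by simpa [Test.Holds, NExp.eval, hy₈, h62₈] using hlt), run_setR]
          have e₁ : (NExp.add (.add (nv 64) (nv 62)) (nv 66)).eval M₈ = b * E + E + y := by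
            simp [NExp.eval, h64₈, h62₈, hy₈]
          have e₂ : (RExp.add (.read 6 (.add (nv 64) (nv 66))) (.read 1 (nv 58))).eval f M₈ =
              a y + (b + 1 : ℕ) * p := by
            simp [RExp.eval, NExp.eval, h64₈, hy₈, h58₈, h1₈, k₁ b le_rfl y hlt, ← hpdef]
            ring
          rw [e₁, e₂]
          refine ⟨fun b' hb' x hx => ?_, fun x hx hxy => ?_⟩
          · have := Nat.mul_le_mul_right E hb'
            rw [Memory.setR_real, if_neg (by omega), k₁ b' hb' x hx]
          · rw [Memory.setR_real]
            by_cases hxy' : x = y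
            · rw [if_pos ⟨rfl, by rw [hxy']⟩, hxy']
            · rw [if_neg (by omega), k₂ x hx (by omega)]
        · rw [hd, run_when_false (by simpa [Test.Holds, NExp.eval, hy₈, h62₈] using hlt)]
          exact ⟨k₁, fun x hx hxy => k₂ x hx (by omega)⟩

/-- The table of the first release dates after the ends of blocks. -/
def nextC : Cmd :=
  loop 61 0 (loop 63 10 (block [setN 62 (.const 0) (nv 0),
    loop 64 0 (seq (setN 65 (.const 0) (.sub (nv 0) (.add (nv 64) (.const 1))))
      (when [(true, .ltNat (nv 61) (nv 65)),
        (false, .ltReal (.read 7 (nv 65)) (.add (.read 7 (nv 61)) (.read 5 (nv 63))))]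
        (setN 62 (.const 0) (nv 65)))),
    setN 20 (ad (nv 61) (nv 63)) (nv 62)]))

/-- `x` is the first position after `l` with a release date of at least `c`. -/
structure IsNext (n : ℕ) (R : ℕ → ℝ) (l : ℕ) (c : ℝ) (x : ℕ) : Prop where
  gt : l < x
  le : x ≤ n
  ge : x < n → c ≤ R x
  least : ∀ l', l < l' → l' < n → c ≤ R l' → x ≤ l'

/-- For each pair the positions are scanned downwards, and the last admissible one found is the
least. The initial value `n` stands for the absence of a further release date. -/
theorem nextC_spec {n D E : ℕ} (h0 : M.nat 0 0 = n) (h10 : M.nat 10 0 = E) (hE : E ≤ D)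
    (h18 : ∀ x < n, M.nat 18 x = x * D) :
    ∀ l < n, ∀ e < E, IsNext n (M.real 7) l (M.real 7 l + M.real 5 e)
      ((nextC.run f M).nat 20 (l * D + e)) := by
  set d := seq (setN 65 (.const 0) (.sub (nv 0) (.add (nv 64) (.const 1))))
      (when [(true, .ltNat (nv 61) (nv 65)),
        (false, .ltReal (.read 7 (nv 65)) (.add (.read 7 (nv 61)) (.read 5 (nv 63))))]
        (setN 62 (.const 0) (nv 65))) with hd
  set c := seq (setN 62 (.const 0) (nv 0)) (seq (loop 64 0 d)
    (setN 20 (ad (nv 61) (nv 63)) (nv 62))) with hc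
  have body : ∀ M' l e, SameOff (nextC.wN) [] M M' → M'.nat 61 0 = l → M'.nat 63 0 = e → l < n →
      e < E → IsNext n (M.real 7) l (M.real 7 l + M.real 5 e) ((c.run f M').nat 20 (l * D + e)) ∧
        ∀ x, x ≠ l * D + e → (c.run f M').nat 20 x = M'.nat 20 x := by
    intro M' l e hs hl he hl' he'
    set cc := M.real 7 l + M.real 5 e with hcc
    rw [hc, run_seq, run_seq, run_setN _ M' 62]
    have h0' : M'.nat 0 0 = n := by rw [hs.nat 0 (by decide), h0]
    set M₁ := M'.setN 62 ((NExp.const 0).eval M') ((nv 0).eval M') with hM₁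
    have s₁ : SameOff [62] [] M' M₁ := sameOff_setN _ _ _ (by simp)
    have key := loop_rule (f := f) (v := 64) (d := 0) (M := M₁) (c := d)
      (fun x M'' => l < M''.nat 62 0 ∧ M''.nat 62 0 ≤ n ∧
        (M''.nat 62 0 < n → cc ≤ M.real 7 (M''.nat 62 0)) ∧
        ∀ l', l < l' → l' < n → n - x ≤ l' → cc ≤ M.real 7 l' → M''.nat 62 0 ≤ l')
      (fun _ _ _ h => h) ?_ ?_
    · have s₂ := sameOff_run f (loop 64 0 d) M₁
      set M₂ := (loop 64 0 d).run f M₁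
      rw [s₁.nat 0 (by decide), h0', Nat.sub_self] at key
      have e₁ : (ad (nv 61) (nv 63)).eval M₂ = l * D + e := by
        simp only [NExp.eval]
        rw [s₂.nat 61 (by decide), s₁.nat 61 (by decide), s₂.nat 18 (by decide),
          s₁.nat 18 (by decide), s₂.nat 63 (by decide), s₁.nat 63 (by decide), hl, he,
          hs.nat 18 (by decide), h18 l hl']
      rw [run_setN, e₁]
      refine ⟨?_, fun x hx => ?_⟩
      · rw [Memory.setN_same]
        exact ⟨key.1, key.2.1, key.2.2.1, fun l' h₁ h₂ h₃ => key.2.2.2 l' h₁ h₂ (by omega) h₃⟩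
      · rw [Memory.setN_nat, if_neg (fun h => hx h.2), s₂.nat 20 (by decide), s₁.nat 20 (by decide)]
    · have : M₁.nat 62 0 = n := by simp [hM₁, NExp.eval, h0']
      rw [this]
      exact ⟨hl', le_rfl, fun h => absurd h (lt_irrefl _), fun l' _ h₁ h₂ => by omega⟩
    · rintro x hx M₃ s₃ hx₃ ⟨k₁, k₂, k₃, k₄⟩
      rw [s₁.nat 0 (by decide), h0'] at hx
      have h0₃ : M₃.nat 0 0 = n := by rw [s₃.nat 0 (by decide), s₁.nat 0 (by decide), h0']
      rw [hd, run_seq, run_setN]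
      have ev : (NExp.sub (nv 0) (.add (nv 64) (.const 1))).eval M₃ = n - (x + 1) := by
        simp [NExp.eval, hx₃, h0₃]
      rw [ev]
      set i := n - (x + 1) with hi
      set M₄ := M₃.setN 65 ((NExp.const 0).eval M₃) i with hM₄
      have s₄ : SameOff [65] [] M₃ M₄ := sameOff_setN _ _ _ (by simp)
      have h65 : M₄.nat 65 0 = i := by simp [hM₄, NExp.eval]
      have h61 : M₄.nat 61 0 = l := by
        rw [s₄.nat 61 (by decide), s₃.nat 61 (by decide), s₁.nat 61 (by decide), hl]
      have h63 : M₄.nat 63 0 = e := by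
        rw [s₄.nat 63 (by decide), s₃.nat 63 (by decide), s₁.nat 63 (by decide), he]
      have h62 : M₄.nat 62 = M₃.nat 62 := s₄.nat 62 (by decide)
      have r7 : M₄.real 7 = M.real 7 := by
        rw [s₄.real 7 (by decide), s₃.real 7 (by decide), s₁.real 7 (by decide),
          hs.real 7 (by decide)]
      have r5 : M₄.real 5 = M.real 5 := by
        rw [s₄.real 5 (by decide), s₃.real 5 (by decide), s₁.real 5 (by decide),
          hs.real 5 (by decide)]
      by_cases hg : l < i ∧ cc ≤ M.real 7 i
      · rw [run_when_pos (by simpa [Guard, Test.Holds, RExp.eval, NExp.eval, h61, h65, h63, r7, r5]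
          using hg)]
        have e : (setN 62 (.const 0) (nv 65)).run f M₄ = M₄.setN 62 0 i := by simp [NExp.eval, h65]
        rw [e, Memory.setN_same]
        exact ⟨hg.1, by omega, fun _ => hg.2, fun l' h₁ h₂ h₃ h₄ => h₃⟩
      · rw [run_when_neg (fun h => hg (by simpa [Guard, Test.Holds, RExp.eval, NExp.eval, h61, h65,
          h63, r7, r5] using h)), h62]
        refine ⟨k₁, k₂, k₃, fun l' h₁ h₂ h₃ h₄ => ?_⟩
        by_cases h : l' = i
        · exact absurd ⟨h ▸ h₁, h ▸ h₄⟩ hg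
        · exact k₄ l' h₁ h₂ (by omega) h₄
  have inj : ∀ {l e l' e'}, e < E → e' < E → l * D + e = l' * D + e' → l = l' ∧ e = e' := by
    intro l e l' e' he he' h
    have := addr_inj (D := D) (r := 0) (r' := 0) (e := 0) (e' := 0) (S := 0) (S' := 0)
      (by omega) (by omega) (by omega) (by omega) rfl
    have h₁ : l = l' := by
      rcases lt_trichotomy l l' with h' | h' | h'
      · have := off_of_ne (D := D) (k := e) h'.ne (by omega)
        have := Nat.mul_le_mul_right D (show l + 1 ≤ l' from h')
        rw [add_mul, one_mul] at this
        omega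
      · exact h'
      · have := Nat.mul_le_mul_right D (show l' + 1 ≤ l from h')
        rw [add_mul, one_mul] at this
        omega
    subst h₁
    exact ⟨rfl, by omega⟩
  have key := loop_rule (f := f) (v := 61) (d := 0) (M := M) (c := loop 63 10 c)
    (fun x M' => ∀ l < x, ∀ e < E, IsNext n (M.real 7) l (M.real 7 l + M.real 5 e)
      (M'.nat 20 (l * D + e))) (fun _ _ _ h => h) (by simp) ?_
  · rw [h0] at key
    exact key
  · intro l hl M₁ s₁ hl₁ h₁
    rw [h0] at hl
    have h10₁ : M₁.nat 10 0 = E := by rw [s₁.nat 10 (by decide), h10]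
    have key₁ := loop_rule (f := f) (v := 63) (d := 10) (M := M₁) (c := c)
      (fun y M' => (∀ l' < l, ∀ e < E, IsNext n (M.real 7) l' (M.real 7 l' + M.real 5 e)
        (M'.nat 20 (l' * D + e))) ∧
        ∀ e < E, e < y → IsNext n (M.real 7) l (M.real 7 l + M.real 5 e) (M'.nat 20 (l * D + e)))
      (fun _ _ _ h => h) ⟨h₁, by simp⟩ ?_
    · rw [h10₁] at key₁
      intro l' hl' e he
      rcases Nat.lt_succ_iff_lt_or_eq.1 hl' with hl' | rfl
      · exact key₁.1 l' hl' e he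
      · exact key₁.2 e he he
    · rintro e he M₂ s₂ he₂ ⟨k₁, k₂⟩
      rw [h10₁] at he
      obtain ⟨b₁, b₂⟩ := body M₂ l e ((s₁.mono (by decide) (by decide)).trans
        (s₂.mono (by decide) (by decide))) (by rw [s₂.nat 61 (by decide), hl₁]) he₂ hl he
      refine ⟨fun l' hl' e' he' => ?_, fun e' he' hlt => ?_⟩
      · rw [b₂ _ fun h => by have := (inj he' he h).1; omega]
        exact k₁ l' hl' e' he'
      · by_cases h : e' = e
        · rw [h]
          exact b₁
        · rw [b₂ _ fun h' => h (inj he' he h').2]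
          exact k₂ e' he' (by omega)

end AuxTables
end GPSP

namespace GPSP

open Cmd

/-! ### Schedules of a single job -/

section Single

variable {n : ℕ} {D Q : ℕ} {M : Memory}

/-- Write the schedule of the job `41` alone to the output. -/
def bodySingle : Cmd :=
  block [startC, emit (nv 41) (.read 0 (nv 41)) (.add (.read 0 (nv 41)) (.read 1 (nv 41))), finishC]

theorem bodySingle_spec (f : ℕ → ℝ → ℝ) {k : Fin n} {a p : ℝ} (hD : 0 < D) (h30 : M.nat 30 0 = 0)
    (h18 : M.nat 18 0 = 0) (h41 : M.nat 41 0 = k) (ha : M.real 0 k = a) (hp : M.real 1 k = p) :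
    Written D 0 (M.real 9 0) [(⟨k, a, a + p⟩ : Piece n)] M (bodySingle.run f M) := by
  simp only [bodySingle, block, run_seq]
  set M₁ := startC.run f M
  have hn : ∀ a, a ≠ 33 → M₁.nat a = M.nat a := fun a ha =>
    run_nat f M (by simpa [startC, wN] using ha)
  obtain ⟨i₁, i₂⟩ := emit_target (f := f) (M := M₁) (D := D) (tg := 0) (L := [])
    (x := (⟨k, a, a + p⟩ : Piece n)) (j := nv 41) (a := .read 0 (nv 41))
    (b := .add (.read 0 (nv 41)) (.read 1 (nv 41))) (startC_target M 0)
    (by rw [hn 30 (by decide), h30]) (by rw [hn 18 (by decide), h18, zero_mul]) hD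
    (by simp [NExp.eval, hn 41 (by decide), h41])
    (by simp [RExp.eval, NExp.eval, Memory.setN_nat, h41, ← ha, M₁, startC])
    (by simp [RExp.eval, NExp.eval, Memory.setN_nat, Memory.setR_real, h41, ← ha,
      ← hp, M₁, startC])
  rw [List.nil_append] at i₁
  set M₂ := (emit (nv 41) (.read 0 (nv 41)) (.add (.read 0 (nv 41)) (.read 1 (nv 41)))).run f M₁
  exact finishC_spec i₁ (by rw [run_nat f M₁ (by decide), hn 30 (by decide), h30])
    (by rw [run_real f M₁ (by decide), run_real f M (by decide)])
    i₂ (by rw [run_nat f M₁ (by decide), hn 22 (by decide)])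
    (by rw [run_nat f M₁ (by decide), hn 1 (by decide)])
    (by rw [run_real f M₁ (by decide), run_real f M (by decide)])

theorem Instance.outOK_nil (I : Instance n) (s : ℕ) : OutOK I s 0 0 [] :=
  ⟨(I.good_nil (fun _ => 1)).feasible (by simp [popc]), (I.good_nil (fun _ => 1)).le_value⟩

theorem Instance.outOK_single (I : Instance n) {s : ℕ} (hs : 1 ≤ s) (k : Fin n) :
    OutOK I s 0 (I.profit k (I.release k + I.proc k))
      [⟨k, I.release k, I.release k + I.proc k⟩] := by
  have h := (I.good_nil (fun _ => 1)).fill (k := k) (a := I.release k)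
    (b := I.release k + I.proc k) le_rfl (by ring) (by simp) (by simp) (fun _ => ⟨0, rfl⟩)
    (by simp [popc])
  have hlt : I.release k < I.release k + I.proc k := by linarith [I.proc_pos k]
  simp only [fill, gap, if_pos hlt, zero_add] at h
  exact ⟨h.feasible (by simpa [popc] using hs), h.le_value⟩

/-- Find the best schedule of at most one job. -/
def singleC : Cmd :=
  block [setN 22 (.const 0) (.const 1), setN 30 (.const 0) (.const 0),
    loop 41 0 (seq
      (setR 9 (.const 0) (.query (nv 41) (.add (.read 0 (nv 41)) (.read 1 (nv 41)))))
      (relaxC bodySingle))]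

/-- The zero cells of entry `0` already represent the empty schedule of value zero, so setting its
flag makes it valid. The result solves the cases of at most one job, and otherwise it is the initial
output that the search improves. -/
theorem singleC_spec (I : Instance n) {s : ℕ} (hs : 1 ≤ s) (hQ : 1 ≤ Q) (hQD : Q ≤ D)
    (h0 : M.nat 0 0 = n) (h18 : M.nat 18 0 = 0) (h1 : M.nat 1 0 = 0) (h4 : M.real 4 0 = 0)
    (hrel : ∀ j : Fin n, M.real 0 j = I.release j) (hproc : ∀ j : Fin n, M.real 1 j = I.proc j) :
    EntOK D Q (OutOK I s 0) (singleC.run I.oracle M) 0 ∧ LB (singleC.run I.oracle M) 0 0 ∧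
      ∀ j : Fin n, LB (singleC.run I.oracle M) 0 (I.profit j (I.release j + I.proc j)) := by
  set f := I.oracle with hf
  simp only [singleC, block, run_seq]
  rw [run_setN _ M 22]
  set M₁ := M.setN 22 ((NExp.const 0).eval M) ((NExp.const 1).eval M) with hM₁
  rw [run_setN _ M₁ 30]
  set M₂ := M₁.setN 30 ((NExp.const 0).eval M₁) ((NExp.const 0).eval M₁) with hM₂
  set c := seq (setR 9 (.const 0) (.query (nv 41) (.add (.read 0 (nv 41)) (.read 1 (nv 41)))))
      (relaxC bodySingle) with hc
  have e1 : M₂.nat 1 0 = 0 := by simp [hM₂, hM₁, Memory.setN_nat, h1]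
  have e4 : M₂.real 4 0 = 0 := h4
  have e22 : M₂.nat 22 0 = 1 := by simp [hM₂, hM₁, Memory.setN_nat, NExp.eval]
  have e0 : M₂.nat 0 0 = n := by simp [hM₂, hM₁, Memory.setN_nat, h0]
  have e18 : M₂.nat 18 0 = 0 := by simp [hM₂, hM₁, Memory.setN_nat, h18]
  have e30 : M₂.nat 30 0 = 0 := by simp [hM₂, NExp.eval]
  have key := loop_rule (f := f) (v := 41) (d := 0) (M := M₂) (c := c)
    (fun x M' => EntOK D Q (OutOK I s 0) M' 0 ∧ LB M' 0 0 ∧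
      ∀ j : Fin n, (j : ℕ) < x → LB M' 0 (I.profit j (I.release j + I.proc j)))
    (fun x M' y h => ⟨h.1.same hQD ⟨rfl, rfl, rfl, fun _ _ => rfl⟩, h.2.1, h.2.2⟩)
    ⟨fun _ => ⟨[], by simpa using e1, by simp, fun k hk => absurd hk (by simp), by
      rw [e4]; exact I.outOK_nil s⟩, ⟨by rw [e22]; exact one_pos, e4.ge⟩, by simp⟩ ?_
  · rw [e0] at key
    exact ⟨key.1, key.2.1, fun j => key.2.2 j j.2⟩
  · intro x hx M₃ s₃ hx₃ ⟨g₁, g₂, g₃⟩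
    rw [e0] at hx
    rw [hc, run_seq, run_setR]
    have r0 : M₃.real 0 x = I.release ⟨x, hx⟩ := by
      rw [s₃.real 0 (by decide)]; exact hrel ⟨x, hx⟩
    have r1 : M₃.real 1 x = I.proc ⟨x, hx⟩ := by
      rw [s₃.real 1 (by decide)]; exact hproc ⟨x, hx⟩
    have ev : (RExp.query (nv 41) (.add (.read 0 (nv 41)) (.read 1 (nv 41)))).eval f M₃ =
        I.profit ⟨x, hx⟩ (I.release ⟨x, hx⟩ + I.proc ⟨x, hx⟩) := by
      simp [RExp.eval, NExp.eval, hx₃, r0, r1, hf, Instance.oracle, extend, hx]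
    rw [ev]
    set v := I.profit ⟨x, hx⟩ (I.release ⟨x, hx⟩ + I.proc ⟨x, hx⟩) with hv
    set M₄ := M₃.setR 9 ((NExp.const 0).eval M₃) v with hM₄
    have h9 : M₄.real 9 0 = v := by simp [hM₄, NExp.eval]
    obtain ⟨j₁, j₂⟩ := relaxC_spec (f := f) (D := D) (Q := Q) (A := {0}) (M := M₄)
      (c := bodySingle) (G := OutOK I s) (tg := 0)
      (L := [⟨⟨x, hx⟩, I.release ⟨x, hx⟩, I.release ⟨x, hx⟩ + I.proc ⟨x, hx⟩⟩]) hQD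
      (by rw [hM₄, Memory.setR_nat, s₃.nat 30 (by decide), e30])
      (bodySingle_spec f (by omega) (by rw [hM₄, Memory.setR_nat, s₃.nat 30 (by decide), e30])
        (by rw [hM₄, Memory.setR_nat, s₃.nat 18 (by decide), e18])
        (by rw [hM₄, Memory.setR_nat, hx₃]) (by rw [hM₄, Memory.setR_row _ (by norm_num)]; exact r0)
        (by rw [hM₄, Memory.setR_row _ (by norm_num)]; exact r1))
      (by simpa using hQ) rfl (by rw [h9]; exact I.outOK_single hs _)
    have e' : EntSame D 0 M₃ M₄ := ⟨rfl, rfl, rfl, fun _ _ => rfl⟩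
    refine ⟨j₁.ok (fun st hst => ?_) 0 rfl, j₁.mono _ _ (g₂.same e'), fun j hj => ?_⟩
    · rw [Set.mem_singleton_iff] at hst
      subst hst
      exact g₁.same hQD e'
    · rcases Nat.lt_succ_iff_lt_or_eq.1 hj with hj | hj
      · exact j₁.mono _ _ ((g₃ j hj).same e')
      · have : j = ⟨x, hx⟩ := Fin.ext hj
        rw [this, ← hv, ← h9]
        exact j₂

/-- By the interval condition a job cannot complete before its release date plus its processing
time. -/
theorem Instance.Feasible.value_le_of_card_le_one {I : Instance n} {s : ℕ} {L : Schedule n}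
    (h : I.Feasible s L) (hc : L.jobs.card ≤ 1) :
    I.value L ≤ 0 ∨ ∃ j : Fin n, I.value L ≤ I.profit j (I.release j + I.proc j) := by
  rcases Nat.le_one_iff_eq_zero_or_eq_one.1 hc with hc | hc
  · left
    rw [Instance.value, Finset.card_eq_zero.1 hc, Finset.sum_empty]
  · right
    obtain ⟨j, hj⟩ := Finset.card_eq_one.1 hc
    refine ⟨j, ?_⟩
    rw [Instance.value, hj, Finset.sum_singleton]
    have h₁ := h.add_sum_proc_le (J := {j}) (a := I.release j) (b := L.completion j) hj.ge
      (by simp) (by simp) (by simp)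
    rw [Finset.sum_singleton] at h₁
    have h₂ := I.release_nonneg j
    have h₃ := I.proc_pos j
    exact I.profit_antitoneOn j (Set.mem_Ici.2 (by linarith)) (Set.mem_Ici.2 (by linarith)) h₁

end Single

/-! ### Colourings of the jobs -/

section Colours

variable {M : Memory} {n t : ℕ}

/-- The memory contains the parameters of the families of hash functions. -/
structure HashIn (n t : ℕ) (M : Memory) : Prop where
  h0 : M.nat 0 0 = n
  h6 : M.nat 6 0 = n + n
  h9 : M.nat 9 0 = t + 1
  h11 : M.nat 11 0 = 2 ^ (t + 1)
  h12 : M.nat 12 0 = 2 ^ t * 2 ^ t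
  h13 : M.nat 13 0 = 2 ^ t * 2 ^ t + 2 ^ t * 2 ^ t
  h14 : M.nat 14 0 = 2 ^ 2 ^ (t + 1)
  h15 : M.nat 15 0 = (2 ^ t * 2 ^ t + 2 ^ t * 2 ^ t) ^ (t + 1)
  h17 : ∀ b ≤ 2 ^ (t + 1), M.nat 17 b = 2 ^ b

theorem HashIn.congr {M' : Memory} (h : HashIn n t M) {wn wr : List ℕ} (hs : SameOff wn wr M M')
    (hn : ∀ a ∈ [0, 6, 9, 11, 12, 13, 14, 15, 17], a ∉ wn) : HashIn n t M' := by
  have e : ∀ a ∈ [0, 6, 9, 11, 12, 13, 14, 15, 17], M'.nat a = M.nat a :=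
    fun a ha => hs.nat a (hn a ha)
  simp only [List.mem_cons, List.not_mem_nil, or_false, forall_eq_or_imp, forall_eq] at e
  obtain ⟨e0, e6, e9, e11, e12, e13, e14, e15, e17⟩ := e
  constructor
  · rw [e0]; exact h.h0
  · rw [e6]; exact h.h6
  · rw [e9]; exact h.h9
  · rw [e11]; exact h.h11
  · rw [e12]; exact h.h12
  · rw [e13]; exact h.h13
  · rw [e14]; exact h.h14
  · rw [e15]; exact h.h15
  · rw [e17]; exact h.h17

/-- The digits of a number. -/
def digitsC (dst src d₁ d₂ : ℕ) (m : NExp) : Cmd :=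
  seq (setN 66 (.const 0) (nv src)) (loop 61 d₁ (block [setN 67 (.const 0) (nv 66),
    divC 67 68 63 d₂ m, setN dst (nv 61) (nv 67), setN 66 (.const 0) (nv 68)]))

theorem digitsC_spec (f : ℕ → ℝ → ℝ) {dst src d₁ d₂ g m' : ℕ} {m : NExp}
    (hdst : dst ∉ [61, 63, 66, 67, 68]) (hd₂ : d₂ ∉ [61, 63, 66, 67, 68]) (hdd : d₂ ≠ dst)
    (hd₁ : d₁ ≠ 66)
    (hm : ∀ M', SameOff [dst, 61, 63, 66, 67, 68] [] M M' → m.eval M' = m')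
    (hg : M.nat src 0 = g) (hle : g ≤ M.nat d₂ 0) (hm' : 0 < m') :
    ∀ i < M.nat d₁ 0, ((digitsC dst src d₁ d₂ m).run f M).nat dst i = g / m' ^ i % m' := by
  simp only [List.mem_cons, List.not_mem_nil, or_false, not_or] at hdst hd₂
  rw [digitsC, run_seq, run_setN]
  set M₀ := M.setN 66 ((NExp.const 0).eval M) ((nv src).eval M) with hM₀
  have s₀ : SameOff [dst, 61, 63, 66, 67, 68] [] M M₀ := sameOff_setN _ _ _ (by simp)
  have e₁ : M₀.nat d₁ 0 = M.nat d₁ 0 := by rw [hM₀, Memory.setN_row _ hd₁]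
  have key := loop_rule (f := f) (v := 61) (d := d₁) (M := M₀)
    (c := block [setN 67 (.const 0) (nv 66),
      divC 67 68 63 d₂ m, setN dst (nv 61) (nv 67), setN 66 (.const 0) (nv 68)])
    (fun x M' => M'.nat 66 0 = g / m' ^ x ∧ ∀ i < x, M'.nat dst i = g / m' ^ i % m')
    (fun x M' y h => ⟨h.1, fun i hi => by
      rw [Memory.setN_row _ (show dst ≠ 61 by omega)]; exact h.2 i hi⟩)
    ⟨by simp [hM₀, NExp.eval, hg], by simp⟩ ?_
  · rw [e₁] at key
    exact key.2
  · intro x hx M₁ s₁ hx₁ ⟨g₁, g₂⟩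
    have s₁' : SameOff [dst, 61, 63, 66, 67, 68] [] M M₁ := by
      refine s₀.trans (s₁.mono ?_ (by simp [block, divC, when, wR]))
      intro a
      simp [block, divC, when, wN]
      omega
    simp only [block, run_seq]
    rw [run_setN _ M₁ 67]
    set M₂ := M₁.setN 67 ((NExp.const 0).eval M₁) ((nv 66).eval M₁) with hM₂
    have s₂ : SameOff [dst, 61, 63, 66, 67, 68] [] M M₂ := s₁'.trans (sameOff_setN _ _ _ (by simp))
    have hd : M₂.nat d₂ 0 = M.nat d₂ 0 := by
      rw [s₂.nat d₂ (by simp; omega)]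
    obtain ⟨k₁, k₂⟩ := divC_spec f (M := M₂) (v := 67) (qv := 68) (lv := 63) (d := d₂) (m := m)
      (V := g / m' ^ x) (by decide) (by decide) (by decide) (by omega)
      (fun M' hs => hm M' (s₂.trans (hs.mono (by intro a; simp; omega) (by simp))))
      (by simp [hM₂, NExp.eval, g₁])
      (by rw [hd]; exact ((Nat.div_le_self _ _).trans (Nat.div_le_self _ _)).trans hle) hm'
    have s₃ := sameOff_run f (divC 67 68 63 d₂ m) M₂
    set M₃ := (divC 67 68 63 d₂ m).run f M₂
    have h61 : M₃.nat 61 0 = x := by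
      rw [s₃.nat 61 (by simp [divC, when, wN]), hM₂, Memory.setN_row _ (by norm_num), hx₁]
    have e₂ : (setN dst (nv 61) (nv 67)).run f M₃ = M₃.setN dst x (g / m' ^ x % m') := by
      simp [NExp.eval, h61, k₁]
    rw [e₂, run_setN]
    refine ⟨?_, fun i hi => ?_⟩
    · have : M₃.nat 68 0 = g / m' ^ x / m' := k₂
      have e68 : (M₃.setN dst x (g / m' ^ x % m')).nat 68 0 = g / m' ^ x / m' := by
        rw [Memory.setN_row _ (by omega), k₂]
      simp [NExp.eval, e68, pow_succ, Nat.div_div_eq_div_mul]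
    · rw [Memory.setN_row _ (by omega), Memory.setN_nat]
      by_cases hi' : i = x
      · rw [if_pos ⟨rfl, hi'⟩, hi']
      · rw [if_neg (fun h => hi' h.2), s₃.nat dst (by simp [divC, when, wN]; omega), hM₂,
          Memory.setN_row _ (by omega), g₂ i (by omega)]

/-- The colour of the number `62`. -/
def colC : Cmd :=
  seq (setN 73 (.const 0) (.const 0))
    (loop 61 9 (block [hashC 67 68 63 13 (.read 70 (nv 61)) (nv 62) (nv 57) (.read 17 (nv 61)),
      setN 69 (.const 0) (.add (.read 17 (nv 61)) (nv 67)),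
      when [(false, .ltNat (.const 0) (.read 71 (nv 69)))] (setN 73 (.const 0) (nv 69))]))

/-- The levels are scanned upwards, and each unmarked bucket overwrites the previous result. So the
highest unmarked level wins, which is the recursion of `col`. -/
theorem colC_spec (f : ℕ → ℝ → ℝ) (h : HashIn n t M) {p y : ℕ} {as B : ℕ → ℕ}
    (h57 : M.nat 57 0 = p) (h62 : M.nat 62 0 = y) (hp : 2 ^ t * 2 ^ t < p)
    (hp' : p ≤ 2 ^ t * 2 ^ t + 2 ^ t * 2 ^ t) (hy : y < 2 ^ t * 2 ^ t)
    (has : ∀ i < t + 1, M.nat 70 i = as i)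
    (has' : ∀ i < t + 1, as i < 2 ^ t * 2 ^ t + 2 ^ t * 2 ^ t)
    (hB : ∀ b < 2 ^ (t + 1), M.nat 71 b = B b) :
    (colC.run f M).nat 73 0 = col p as B (t + 1) y := by
  set m := 2 ^ t * 2 ^ t with hm
  rw [colC, run_seq, run_setN]
  set M₀ := M.setN 73 ((NExp.const 0).eval M) ((NExp.const 0).eval M) with hM₀
  have s₀ : SameOff [73] [] M M₀ := sameOff_setN _ _ _ (by simp)
  have h₀ := h.congr s₀ (by decide)
  have key := loop_rule (f := f) (v := 61) (d := 9) (M := M₀)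
    (c := block [hashC 67 68 63 13 (.read 70 (nv 61)) (nv 62) (nv 57) (.read 17 (nv 61)),
      setN 69 (.const 0) (.add (.read 17 (nv 61)) (nv 67)),
      when [(false, .ltNat (.const 0) (.read 71 (nv 69)))] (setN 73 (.const 0) (nv 69))])
    (fun x M' => M'.nat 73 0 = col p as B x y) (fun _ _ _ h => h) (by simp [hM₀, NExp.eval, col]) ?_
  · rw [h₀.h9] at key
    exact key
  · intro x hx M₁ s₁ hx₁ g
    rw [h₀.h9] at hx
    have hx2 : 2 ^ x * 2 ≤ 2 ^ (t + 1) := by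
      rw [← pow_succ]
      exact Nat.pow_le_pow_right (by norm_num) (by omega)
    have h₁ := h₀.congr s₁ (by decide)
    have h57₁ : M₁.nat 57 0 = p := by rw [s₁.nat 57 (by decide), s₀.nat 57 (by decide), h57]
    have h62₁ : M₁.nat 62 0 = y := by rw [s₁.nat 62 (by decide), s₀.nat 62 (by decide), h62]
    have h70₁ : M₁.nat 70 = M.nat 70 := by rw [s₁.nat 70 (by decide), s₀.nat 70 (by decide)]
    have h71₁ : M₁.nat 71 = M.nat 71 := by rw [s₁.nat 71 (by decide), s₀.nat 71 (by decide)]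
    have h17₁ : M₁.nat 17 x = 2 ^ x := h₁.h17 x ((Nat.lt_two_pow_self.le).trans (by omega))
    simp only [block, run_seq]
    have hh := hashC_spec f (M := M₁) (v := 67) (qv := 68) (lv := 63) (d := 13)
      (a := .read 70 (nv 61)) (x := nv 62) (p := nv 57) (m := .read 17 (nv 61)) (a' := as x)
      (x' := y) (p' := p) (m' := 2 ^ x) (by decide) (by decide) (by decide) (by decide) (by decide)
      (by decide)
      (fun M' hs => by
        simp [NExp.eval, hs.nat 61 (by decide), hs.nat 70 (by decide), hx₁, h70₁, has x hx])
      (fun M' hs => by simp [NExp.eval, hs.nat 62 (by decide), h62₁])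
      (fun M' hs => by simp [NExp.eval, hs.nat 57 (by decide), h57₁])
      (fun M' hs => by simp [NExp.eval, hs.nat 61 (by decide), hs.nat 17 (by decide), hx₁, h17₁])
      (by rw [h₁.h13]; omega)
      (by
        rw [h₁.h13]
        -- The hashed number is below `m < p` and the multiplier is below `2 * m`, so the quotient
        -- in the reduction modulo `p` is at most `2 * m`, the loop bound in array `13`.
        refine (Nat.div_le_of_le_mul ?_)
        rw [mul_comm (as x)]
        exact Nat.mul_le_mul (by omega) (has' x hx).le)
      (by omega) (by rw [h₁.h13]; exact hp') (by positivity)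
    have s₂ := sameOff_run f (hashC 67 68 63 13 (.read 70 (nv 61)) (nv 62) (nv 57)
      (.read 17 (nv 61))) M₁
    set M₂ := (hashC 67 68 63 13 (.read 70 (nv 61)) (nv 62) (nv 57) (.read 17 (nv 61))).run f M₁
    have h17₂ : M₂.nat 17 x = 2 ^ x := by rw [s₂.nat 17 (by decide), h17₁]
    have h61₂ : M₂.nat 61 0 = x := by rw [s₂.nat 61 (by decide), hx₁]
    have h73₂ : M₂.nat 73 0 = col p as B x y := by rw [s₂.nat 73 (by decide), g]
    have h71₂ : M₂.nat 71 = M.nat 71 := by rw [s₂.nat 71 (by decide), h71₁]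
    set b := 2 ^ x + hsh (as x) y p (2 ^ x) with hb
    have hbl : b < 2 ^ (t + 1) := (bucket_lt (as x) y p x).trans_le (by rw [pow_succ]; exact hx2)
    have e : (setN 69 (.const 0) (.add (.read 17 (nv 61)) (nv 67))).run f M₂ = M₂.setN 69 0 b := by
      simp [NExp.eval, h61₂, h17₂, hh, hb]
    rw [e, col, ← hb]
    set M₃ := M₂.setN 69 0 b with hM₃
    have h71₃ : M₃.nat 71 b = B b := by rw [hM₃, Memory.setN_row _ (by norm_num), h71₂, hB b hbl]
    have h69₃ : M₃.nat 69 0 = b := by simp [hM₃]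
    by_cases hpos : 0 < B b
    · rw [run_when_neg (by simp [Guard, Test.Holds, NExp.eval, h69₃, h71₃]; omega), if_pos hpos]
      simpa [hM₃, Memory.setN_nat] using h73₂
    · rw [run_when_pos (by simpa [Guard, Test.Holds, NExp.eval, h69₃, h71₃] using hpos),
        if_neg hpos]
      simp [NExp.eval, h69₃]

/-- The weights of the jobs for the colouring with the parameters `50` to `54`. -/
def weightsC : Cmd :=
  block [digitsC 70 53 9 15 (nv 13), digitsC 71 54 11 14 (.const 2),
    setN 55 (.const 0) (.add (.add (nv 0) (.const 1)) (nv 50)),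
    setN 57 (.const 0) (.add (.add (nv 12) (.const 1)) (nv 52)),
    loop 72 0 (block [hashC 67 68 63 6 (nv 51) (nv 72) (nv 55) (nv 12),
      setN 62 (.const 0) (nv 67), colC, setN 21 (nv 72) (.read 17 (nv 73))])]

theorem weightsC_spec (f : ℕ → ℝ → ℝ) (h : HashIn n t M) {pp a q g Dm : ℕ}
    (h50 : M.nat 50 0 = pp) (h51 : M.nat 51 0 = a) (h52 : M.nat 52 0 = q) (h53 : M.nat 53 0 = g)
    (h54 : M.nat 54 0 = Dm) (hpp : pp < n) (ha : a < n + n) (hq : q < 2 ^ t * 2 ^ t)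
    (hg : g < (2 ^ t * 2 ^ t + 2 ^ t * 2 ^ t) ^ (t + 1)) (hDm : Dm < 2 ^ 2 ^ (t + 1)) :
    ∀ x < n, (weightsC.run f M).nat 21 x =
      2 ^ colour (n + 1 + pp) a (2 ^ t * 2 ^ t) (2 ^ t * 2 ^ t + 1 + q)
        (2 ^ t * 2 ^ t + 2 ^ t * 2 ^ t) g Dm (t + 1) x := by
  set m := 2 ^ t * 2 ^ t with hm
  have hm0 : 0 < m := by positivity
  simp only [weightsC, block, run_seq]
  have d₁ := digitsC_spec f (M := M) (dst := 70) (src := 53) (d₁ := 9) (d₂ := 15) (m := nv 13)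
    (g := g) (m' := m + m) (by decide) (by decide) (by decide) (by decide)
    (fun M' hs => by simp [NExp.eval, hs.nat 13 (by decide), h.h13, hm]) h53
    (by rw [h.h15]; exact hg.le) (by omega)
  have s₁ := sameOff_run f (digitsC 70 53 9 15 (nv 13)) M
  set M₁ := (digitsC 70 53 9 15 (nv 13)).run f M
  have h₁ := h.congr s₁ (by decide)
  rw [h.h9] at d₁
  have d₂ := digitsC_spec f (M := M₁) (dst := 71) (src := 54) (d₁ := 11) (d₂ := 14) (m := .const 2)
    (g := Dm) (m' := 2) (by decide) (by decide) (by decide) (by decide)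
    (fun M' hs => rfl) (by rw [s₁.nat 54 (by decide), h54])
    (by rw [h₁.h14]; exact hDm.le) (by omega)
  have s₂ := sameOff_run f (digitsC 71 54 11 14 (.const 2)) M₁
  set M₂ := (digitsC 71 54 11 14 (.const 2)).run f M₁
  have h₂ := h₁.congr s₂ (by decide)
  rw [h₁.h11] at d₂
  have d₁' : ∀ i < t + 1, M₂.nat 70 i = g / (m + m) ^ i % (m + m) := fun i hi => by
    rw [s₂.nat 70 (by decide), d₁ i hi]
  have e₃ : (setN 55 (.const 0) (.add (.add (nv 0) (.const 1)) (nv 50))).run f M₂ =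
      M₂.setN 55 0 (n + 1 + pp) := by
    simp [NExp.eval, h₂.h0, s₂.nat 50 (by decide), s₁.nat 50 (by decide), h50]
  rw [e₃]
  set M₃ := M₂.setN 55 0 (n + 1 + pp) with hM₃
  have e₄ : (setN 57 (.const 0) (.add (.add (nv 12) (.const 1)) (nv 52))).run f M₃ =
      M₃.setN 57 0 (m + 1 + q) := by
    simp [NExp.eval, hM₃, Memory.setN_nat, h₂.h12, s₂.nat 52 (by decide), s₁.nat 52 (by decide), h52,
      hm]
  rw [e₄]
  set M₄ := M₃.setN 57 0 (m + 1 + q) with hM₄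
  have s₄ : SameOff [55, 57] [] M₂ M₄ :=
    (sameOff_setN _ _ _ (by simp)).trans (sameOff_setN _ _ _ (by simp))
  have h₄ := h₂.congr s₄ (by decide)
  set c := seq (hashC 67 68 63 6 (nv 51) (nv 72) (nv 55) (nv 12))
    (seq (setN 62 (.const 0) (nv 67)) (seq colC (setN 21 (nv 72) (.read 17 (nv 73))))) with hc
  have key := loop_rule (f := f) (v := 72) (d := 0) (M := M₄) (c := c)
    (fun x M' => ∀ z < x, M'.nat 21 z = 2 ^ colour (n + 1 + pp) a m (m + 1 + q) (m + m) g Dm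
      (t + 1) z) (fun _ _ _ h => h) (by simp) ?_
  · rw [h₄.h0] at key
    exact key
  · intro x hx M₅ s₅ hx₅ hI
    rw [h₄.h0] at hx
    have h₅ := h₄.congr s₅ (by decide)
    have h51₅ : M₅.nat 51 0 = a := by
      rw [s₅.nat 51 (by decide), s₄.nat 51 (by decide), s₂.nat 51 (by decide), s₁.nat 51 (by decide),
        h51]
    have h55₅ : M₅.nat 55 0 = n + 1 + pp := by
      rw [s₅.nat 55 (by decide)]; simp [hM₄, hM₃, Memory.setN_nat]
    have h57₅ : M₅.nat 57 0 = m + 1 + q := by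
      rw [s₅.nat 57 (by decide)]; simp [hM₄]
    have h70₅ : M₅.nat 70 = M₂.nat 70 := by rw [s₅.nat 70 (by decide), s₄.nat 70 (by decide)]
    have h71₅ : M₅.nat 71 = M₂.nat 71 := by rw [s₅.nat 71 (by decide), s₄.nat 71 (by decide)]
    rw [hc, run_seq, run_seq, run_seq]
    have hh := hashC_spec f (M := M₅) (v := 67) (qv := 68) (lv := 63) (d := 6)
      (a := nv 51) (x := nv 72) (p := nv 55) (m := nv 12) (a' := a)
      (x' := x) (p' := n + 1 + pp) (m' := m) (by decide) (by decide) (by decide) (by decide)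
      (by decide) (by decide)
      (fun M' hs => by simp [NExp.eval, hs.nat 51 (by decide), h51₅])
      (fun M' hs => by simp [NExp.eval, hs.nat 72 (by decide), hx₅])
      (fun M' hs => by simp [NExp.eval, hs.nat 55 (by decide), h55₅])
      (fun M' hs => by simp [NExp.eval, hs.nat 12 (by decide), h₅.h12, hm])
      (by rw [h₅.h6]; omega)
      (by
        rw [h₅.h6]
        refine Nat.div_le_of_le_mul ?_
        rw [mul_comm a]
        exact Nat.mul_le_mul (by omega) ha.le)
      (by omega) (by rw [h₅.h6]; omega) hm0
    have s₆ := sameOff_run f (hashC 67 68 63 6 (nv 51) (nv 72) (nv 55) (nv 12)) M₅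
    set M₆ := (hashC 67 68 63 6 (nv 51) (nv 72) (nv 55) (nv 12)).run f M₅
    set y := hsh a x (n + 1 + pp) m with hy
    have e₇ : (setN 62 (.const 0) (nv 67)).run f M₆ = M₆.setN 62 0 y := by simp [NExp.eval, hh]
    rw [e₇]
    set M₇ := M₆.setN 62 0 y with hM₇
    have s₇ : SameOff [62] [] M₆ M₇ := sameOff_setN _ _ _ (by simp)
    have h₇ := (h₅.congr s₆ (by decide)).congr s₇ (by decide)
    have hcol := colC_spec f h₇ (p := m + 1 + q) (y := y)
      (as := fun i => g / (m + m) ^ i % (m + m)) (B := fun b => Dm / 2 ^ b % 2)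
      (by rw [s₇.nat 57 (by decide), s₆.nat 57 (by decide), h57₅]) (by simp [hM₇])
      (by omega) (by omega) (Nat.mod_lt _ hm0)
      (fun i hi => by rw [s₇.nat 70 (by decide), s₆.nat 70 (by decide), h70₅, d₁' i hi])
      (fun i hi => Nat.mod_lt _ (by omega))
      (fun b hb => by rw [s₇.nat 71 (by decide), s₆.nat 71 (by decide), h71₅, d₂ b hb])
    have s₈ := sameOff_run f colC M₇
    set M₈ := colC.run f M₇
    have h₈ := h₇.congr s₈ (by decide)
    have h72₈ : M₈.nat 72 0 = x := by
      rw [s₈.nat 72 (by decide), s₇.nat 72 (by decide), s₆.nat 72 (by decide), hx₅]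
    have e₈ : (setN 21 (nv 72) (.read 17 (nv 73))).run f M₈ = M₈.setN 21 x
        (2 ^ colour (n + 1 + pp) a m (m + 1 + q) (m + m) g Dm (t + 1) x) := by
      simp only [run_setN, NExp.eval, h72₈, hcol]
      rw [h₈.h17 _ (col_lt _ _ _ _ _).le]
      rfl
    rw [e₈]
    intro z hz
    rw [Memory.setN_nat]
    by_cases hz' : z = x
    · rw [if_pos ⟨rfl, hz'⟩, hz']
    · rw [if_neg (fun h => hz' h.2), s₈.nat 21 (by decide), s₇.nat 21 (by decide),
        s₆.nat 21 (by decide), hI z (by omega)]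

end Colours
end GPSP

namespace GPSP

open Cmd

/-! ### The search for a colouring -/

variable {n : ℕ}

/-- The tables with other weights. -/
def Tables.withW (T : Tables n) (w : ℕ → ℕ) : Tables n := { T with w := w }

theorem Tables.Sorted.withW {T : Tables n} (h : T.Sorted) (w : ℕ → ℕ) : (T.withW w).Sorted :=
  ⟨h.E_le, h.Q_le, h.Q_eq, h.R_mono, h.R_surj, h.P_mono, h.P_nonneg, h.NX_gt, h.NX_le, h.NX_ge,
    h.NX_least⟩

theorem Tables.In₀.withW {T : Tables n} {M : Memory} (h : T.In₀ M) (w : ℕ → ℕ) :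
    (T.withW w).In₀ M :=
  ⟨h.hn, h.E, h.Q, h.mul, h.pc, h.nx, h.P, h.R, h.rel, h.proc⟩

theorem sum_two_pow_lt {B : Finset ℕ} {K : ℕ} (h : ∀ b ∈ B, b < K) : ∑ b ∈ B, 2 ^ b < 2 ^ K := by
  have h₁ : ∑ b ∈ B, 2 ^ b ≤ ∑ b ∈ Finset.range K, 2 ^ b :=
    Finset.sum_le_sum_of_subset fun b hb => Finset.mem_range.2 (h b hb)
  have h₂ := Nat.geomSum_eq (le_refl 2) K
  rw [h₂] at h₁
  have : 0 < 2 ^ K := by positivity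
  simp only [Nat.add_one_sub_one, Nat.div_one] at h₁
  omega

/-- If the colours are distinct, the code is a sum of distinct powers of two below `2 ^ K`. -/
theorem Tables.covers_of_injOn {T : Tables n} {J : Finset (Fin n)} {κ : ℕ → ℕ}
    (hQ : T.Q = 2 ^ T.K) (hw : ∀ j ∈ J, T.w j = 2 ^ κ j) (hκ : ∀ j ∈ J, κ j < T.K)
    (hinj : Set.InjOn (fun j : Fin n => κ j) J)
    (hcov : ∀ J' ⊆ J, ∃ e < T.E, T.P e = T.inst.len J') : T.Covers J := by
  have e : ∑ j ∈ J, T.w j = ∑ b ∈ J.image (fun j : Fin n => κ j), 2 ^ b := by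
    rw [Finset.sum_image hinj]
    exact Finset.sum_congr rfl hw
  refine ⟨?_, ?_, hcov⟩
  · rw [e, popc_sum_two_pow, Finset.card_image_of_injOn hinj]
  · rw [e, hQ]
    refine sum_two_pow_lt fun b hb => ?_
    obtain ⟨j, hj, rfl⟩ := Finset.mem_image.1 hb
    exact hκ j hj

/-- The dynamic program for all colourings. -/
def search : Cmd :=
  loops [(50, 0), (51, 6), (52, 12), (53, 15), (54, 14)] (seq weightsC dynProg)

/-- For each tuple of parameters, the established fact concerns the chains whose jobs get distinct
colours under that tuple. For a given chain with at most `s` jobs, `exists_colour` supplies a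
suitable tuple within the loop ranges, and later rounds do not spoil its result. -/
theorem search_spec {T : Tables n} {M : Memory} {s t : ℕ} {C : ℝ} (hT : T.Sorted) (hIn : T.In₀ M)
    (hH : HashIn n t M) (hK : T.K = 2 ^ (t + 1)) (hs : M.nat 0 1 = s) (hst : 4 * s ≤ 2 ^ t)
    (hn : n ≠ 0) (h11 : M.real 11 0 = C)
    (hcov : ∀ J : Finset (Fin n), J.card ≤ s → ∃ e < T.E, T.P e = T.inst.len J) :
    (EntOK T.D T.Q (OutOK T.inst s 0) M 0 →
        EntOK T.D T.Q (OutOK T.inst s 0) (search.run T.inst.oracle M) 0) ∧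
      (∀ v, LB M 0 v → LB (search.run T.inst.oracle M) 0 v) ∧
      ∀ l : List (Segment n), (allJobs l).card ≤ s → T.inst.Chain 0 l →
        (∀ b ∈ l, T.inst.Blk b.start b.jobs b.val) → (∀ b ∈ l, T.inst.fin b ≤ C) →
        LB (search.run T.inst.oracle M) 0 (allVal l) := by
  set f := T.inst.oracle with hf
  set κ : ℕ → ℕ → ℕ → ℕ → ℕ → ℕ → ℕ := fun p a q g Dm => colour (n + 1 + p) a (2 ^ t * 2 ^ t)
    (2 ^ t * 2 ^ t + 1 + q) (2 ^ t * 2 ^ t + 2 ^ t * 2 ^ t) g Dm (t + 1) with hκ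
  have key := loops_rule (f := f) (c := seq weightsC dynProg) (M := M)
    (fun M M' => (∀ v, LB M 0 v → LB M' 0 v) ∧
      (EntOK T.D T.Q (OutOK T.inst s 0) M 0 → EntOK T.D T.Q (OutOK T.inst s 0) M' 0))
    (fun M => ⟨fun _ h => h, fun h => h⟩)
    (fun M M' M'' h h' => ⟨fun v hv => h'.1 v (h.1 v hv), fun hv => h'.2 (h.2 hv)⟩)
    [(50, 0), (51, 6), (52, 12), (53, 15), (54, 14)]
    (fun xs M' => ∀ p a q g Dm, xs = [p, a, q, g, Dm] → ∀ l : List (Segment n),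
      Set.InjOn (fun j : Fin n => κ p a q g Dm j) (allJobs l) → (allJobs l).card ≤ s →
      T.inst.Chain 0 l → (∀ b ∈ l, T.inst.Blk b.start b.jobs b.val) →
      (∀ b ∈ l, T.inst.fin b ≤ C) → LB M' 0 (allVal l))
    (fun xs M M' h h' p a q g Dm hx l h₁ h₂ h₃ h₄ h₅ => h.1 _ (h' p a q g Dm hx l h₁ h₂ h₃ h₄ h₅))
    (by
      intro p hp M y
      simp only [List.mem_cons, List.not_mem_nil, or_false] at hp
      have : p.1 ≠ 22 ∧ p.1 ≠ 1 ∧ p.1 ≠ 2 := by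
        rcases hp with rfl | rfl | rfl | rfl | rfl <;> decide
      have hsame : EntSame T.D 0 M (M.setN p.1 0 y) :=
        .of_sameOff (wn := [p.1]) (wr := []) (sameOff_setN _ _ _ (by simp))
          (by simp [this.1.symm, this.2.1.symm, this.2.2.symm]) (by simp) 0
      exact ⟨fun v h => h.same hsame, fun h => h.same hT.Q_le hsame⟩)
    (by decide) ?_ (by decide)
  · refine ⟨key.1.2, key.1.1, fun l h₂ h₃ h₄ h₅ => ?_⟩
    obtain ⟨p, hp, a, ha, q, hq, g, hg, Dm, hDm, hinj⟩ := exists_colour (s := s) (T := t) hn rfl hst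
      rfl rfl ((allJobs l).image Fin.val) (by simp) (Finset.card_image_le.trans h₂)
    have hW : 2 * 2 ^ t = 2 ^ (t + 1) := by rw [pow_succ, mul_comm]
    rw [hW] at hDm
    refine key.2 [p, a, q, g, Dm] ?_ p a q g Dm rfl l ?_ h₂ h₃ h₄ h₅
    · exact .cons (by simpa [hH.h0] using hp) (.cons (by simpa [hH.h6] using ha)
        (.cons (by simpa [hH.h12] using hq) (.cons (by simpa [hH.h15] using hg)
          (.cons (by simpa [hH.h14] using hDm) .nil))))
    · intro i hi j hj hij
      exact Fin.ext (hinj (by exact_mod_cast Finset.mem_image_of_mem _ hi)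
        (by exact_mod_cast Finset.mem_image_of_mem _ hj) hij)
  · intro M₀ hs₀ hr _
    have hH₀ : HashIn n t M₀ := hH.congr hs₀ (by decide)
    have hIn₀ : T.In₀ M₀ := hIn.congr hs₀ (by decide) (by decide)
    simp only [List.mem_cons, List.not_mem_nil, or_false, forall_eq_or_imp, forall_eq, hH.h0,
      hH.h6, hH.h12, hH.h15, hH.h14] at hr
    obtain ⟨hr₁, hr₂, hr₃, hr₄, hr₅⟩ := hr
    have hw := weightsC_spec f hH₀ rfl rfl rfl rfl rfl hr₁ hr₂ hr₃ hr₄ hr₅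
    have s₁ := sameOff_run f weightsC M₀
    rw [run_seq]
    set M₁ := weightsC.run f M₀ with hM₁
    have hsame : EntSame T.D 0 M₀ M₁ := .of_sameOff s₁ (by decide) (by decide) 0
    set κ₀ := κ (M₀.nat 50 0) (M₀.nat 51 0) (M₀.nat 52 0) (M₀.nat 53 0) (M₀.nat 54 0) with hκ₀
    have hT₁ : (T.withW fun x => 2 ^ κ₀ x).Valid := ⟨hT.withW _, fun j => ⟨_, rfl⟩⟩
    have hIn₁ : (T.withW fun x => 2 ^ κ₀ x).In M₁ :=
      ⟨(hIn₀.congr s₁ (by decide) (by decide)).withW _, fun j => hw j j.2⟩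
    obtain ⟨k₁, k₂, k₃⟩ := dynProg_spec (C := C) (s := s) hT₁ hIn₁
      (by rw [s₁.nat 0 (by decide), hs₀.nat 0 (by decide), hs])
      (by rw [s₁.real 11 (by decide), hs₀.real 11 (by decide), h11])
    refine ⟨⟨fun v h => k₁ v (h.same hsame), fun h => k₂ (h.same hT.Q_le hsame)⟩, ?_⟩
    intro p a q g Dm hx l h₁ h₂ h₃ h₄ h₅
    simp only [List.map_cons, List.map_nil, List.cons.injEq, and_true] at hx
    obtain ⟨rfl, rfl, rfl, rfl, rfl⟩ := hx
    refine k₃ (allJobs l) ?_ h₂ l h₃ h₄ h₅ rfl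
    refine Tables.covers_of_injOn (κ := κ₀) hT.Q_eq (fun j _ => rfl) (fun j _ => ?_) h₁
      fun J' hJ' => hcov J' ((Finset.card_le_card hJ').trans h₂)
    exact (col_lt _ _ _ _ _).trans_eq hK.symm

end GPSP

namespace GPSP

open Cmd

/-! ### The tables -/

variable {n : ℕ}

theorem Cmd.SameOff.trans' {wn wr wn' wr' : List ℕ} {M M' M'' : Memory} (h : SameOff wn wr M M')
    (h' : SameOff wn' wr' M' M'') : SameOff (wn ++ wn') (wr ++ wr') M M'' :=
  (h.mono (by simp) (by simp)).trans (h'.mono (by simp) (by simp))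

theorem subset_allJobs {l : List (Segment n)} {b : Segment n} (h : b ∈ l) :
    b.jobs ⊆ allJobs l := by
  induction l with
  | nil => simp at h
  | cons c l ih =>
    rw [allJobs_cons]
    rcases List.mem_cons.1 h with rfl | h
    · exact Finset.subset_union_left
    · exact (ih h).trans Finset.subset_union_right

theorem Instance.Chain.exists_release {I : Instance n} {a : ℝ} {l : List (Segment n)}
    (h : I.Chain a l) : ∀ b ∈ l, ∃ j, I.release j = b.start := by
  induction l generalizing a with
  | nil => simp
  | cons c l ih =>
    intro b hb
    rcases List.mem_cons.1 hb with rfl | hb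
    · exact h.2.1
    · exact ih h.2.2.2.2 b hb

/-- The auxiliary tables of the dynamic program. -/
def tablesC : Cmd :=
  block [multC, popC, sumsC, sortC 5 6 10, sortC 7 0 0, nextC,
    setR 11 (.const 0) (.add (.read 7 (.sub (nv 0) (.const 1)))
      (.read 5 (.sub (nv 10) (.const 1))))]

theorem Instance.image_proc (I : Instance n) {a : ℕ → ℝ} (ha : ∀ j : Fin n, a j = I.proc j) :
    (Finset.range n).image a = Finset.univ.image I.proc := by
  ext v
  simp only [Finset.mem_image, Finset.mem_range, Finset.mem_univ, true_and]
  constructor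
  · rintro ⟨x, hx, rfl⟩
    exact ⟨⟨x, hx⟩, (ha ⟨x, hx⟩).symm⟩
  · rintro ⟨j, rfl⟩
    exact ⟨j, j.2, ha j⟩

theorem Instance.numProc_eq (I : Instance n) {a : ℕ → ℝ} (ha : ∀ j : Fin n, a j = I.proc j) :
    I.numProc = ((Finset.range n).image a).card := by
  rw [I.image_proc ha, Instance.numProc, ← Set.ncard_coe_finset, Finset.coe_image,
    Finset.coe_univ, Set.image_univ]

/-- Group the jobs of `J` by processing time; each group has at most `s` members. -/
theorem SumsOK.exists_len {I : Instance n} {s : ℕ} {a : ℕ → ℝ} {V : Finset ℝ}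
    (h : SumsOK s V a) (hV : V = Finset.univ.image I.proc) {J : Finset (Fin n)}
    (hJ : J.card ≤ s) : ∃ x < (s + 1) ^ V.card, a x = I.len J := by
  classical
  obtain ⟨x, hx, e⟩ := h.exists_eq (fun v => (J.filter fun j => I.proc j = v).card)
    fun v _ => (Finset.card_filter_le _ _).trans hJ
  refine ⟨x, hx, e.trans ?_⟩
  rw [Instance.len, ← Finset.sum_fiberwise_of_maps_to (s := J) (t := V) (g := I.proc)
    (fun j _ => by simp [hV])]
  refine Finset.sum_congr rfl fun v _ => ?_
  rw [Finset.sum_congr rfl (g := fun _ => v) fun j hj => (Finset.mem_filter.1 hj).2,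
    Finset.sum_const, nsmul_eq_mul]

/-- The last real value computed is the latest release date plus the largest table length. It bounds
the end of each block of at most `s` jobs and serves as the deadline of the final pass, where no
deadline is wanted. -/
theorem tablesC_spec (I : Instance n) {M : Memory} {s K : ℕ} (h0 : M.nat 0 0 = n)
    (h3 : M.nat 3 0 = s) (h7 : M.nat 7 0 = 2 * n + 2) (h10 : M.nat 10 0 = (s + 1) ^ I.numProc)
    (h14 : M.nat 14 0 = 2 ^ K) (h16 : M.nat 16 0 = (s + 1) ^ I.numProc + 2 ^ K)
    (hrel : ∀ j : Fin n, M.real 0 j = I.release j) (hproc : ∀ j : Fin n, M.real 1 j = I.proc j) :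
    ∃ T : Tables n, T.inst = I ∧ T.K = K ∧ T.Q = 2 ^ K ∧ T.Sorted ∧
      T.In₀ (tablesC.run I.oracle M) ∧
      (∀ J : Finset (Fin n), J.card ≤ s → ∃ e < T.E, T.P e = I.len J) ∧
      ∀ l : List (Segment n), ∀ a, I.Chain a l → (allJobs l).card ≤ s →
        ∀ b ∈ l, I.fin b ≤ (tablesC.run I.oracle M).real 11 0 := by
  set f := I.oracle
  set E := (s + 1) ^ I.numProc with hE
  set D := E + 2 ^ K with hD
  have hE0 : 0 < E := by positivity
  have hQ0 : 0 < 2 ^ K := by positivity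
  have hnum := I.numProc_eq hproc
  simp only [tablesC, block, run_seq]
  have k₁ := multC_spec (f := f) h7 h16
  have s₁ := sameOff_run f multC M
  set M₁ := multC.run f M
  have k₂ := popC_spec (f := f) (M := M₁) (Q := 2 ^ K) (by rw [s₁.nat 14 (by decide), h14])
  have s₂ := s₁.trans' (sameOff_run f popC M₁)
  set M₂ := popC.run f M₁
  have k₃ := sumsC_spec (f := f) (M := M₂) (n := n) (s := s) (by rw [s₂.nat 0 (by decide), h0])
    (by rw [s₂.nat 3 (by decide), h3])
    (by rw [s₂.nat 10 (by decide), s₂.real 1 (by decide), h10, hE, hnum])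
    (fun j hj => by rw [s₂.real 1 (by decide), hproc ⟨j, hj⟩]; exact (I.proc_pos _).le)
  have s₃ := s₂.trans' (sameOff_run f sumsC M₂)
  have t₃ := sameOff_run f sumsC M₂
  set M₃ := sumsC.run f M₂
  rw [s₂.real 1 (by decide)] at k₃
  set V := (Finset.range n).image (M.real 1) with hV
  have k₄ := sortC_spec f (M := M₃) (dst := 5) (src := 6) (d := 10) (by decide) (by decide)
  rw [s₃.nat 10 (by decide), h10] at k₄
  have s₄ := s₃.trans' (sameOff_run f (sortC 5 6 10) M₃)
  have t₄ := t₃.trans' (sameOff_run f (sortC 5 6 10) M₃)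
  set M₄ := (sortC 5 6 10).run f M₃
  have k₅ := sortC_spec f (M := M₄) (dst := 7) (src := 0) (d := 0) (by decide) (by decide)
  rw [s₄.nat 0 (by decide), h0, s₄.real 0 (by decide)] at k₅
  have s₅ := s₄.trans' (sameOff_run f (sortC 7 0 0) M₄)
  have t₅ := t₄.trans' (sameOff_run f (sortC 7 0 0) M₄)
  have r₅ := sameOff_run f (sortC 7 0 0) M₄
  set M₅ := (sortC 7 0 0).run f M₄
  have hM₅18 : ∀ x < (2 * n + 2) * D * D, M₅.nat 18 x = x * D := by
    rw [t₅.nat 18 (by decide), (sameOff_run f popC M₁).nat 18 (by decide)]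
    exact k₁
  have k₆ := nextC_spec (f := f) (M := M₅) (n := n) (D := D) (E := E)
    (by rw [s₅.nat 0 (by decide), h0]) (by rw [s₅.nat 10 (by decide), h10]) (by omega)
    (fun x hx => hM₅18 x (by
      have h1 := Nat.mul_le_mul_right (D * D) (show x + 1 ≤ 2 * n + 2 by omega)
      have h2 : 1 ≤ D * D := Nat.mul_pos (by omega) (by omega)
      nlinarith))
  have s₆ := s₅.trans' (sameOff_run f nextC M₅)
  have r₆ := sameOff_run f nextC M₅
  set M₆ := nextC.run f M₅
  rw [run_setR]
  set M₇ := M₆.setR 11 _ _ with hM₇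
  have hreal : ∀ a, a ≠ 11 → M₇.real a = M₆.real a := fun a ha => M₆.setR_row ha
  have hM₇11 : M₇.real 11 0 = M₅.real 7 (n - 1) + M₅.real 5 (E - 1) := by
    simp [hM₇, NExp.eval, RExp.eval, s₆.nat 0 (by decide), h0,
      s₆.nat 10 (by decide), h10, r₆.real 7 (by decide), r₆.real 5 (by decide)]
  have e5 : M₅.real 5 = M₄.real 5 := r₅.real 5 (by decide)
  have hEV : E = (s + 1) ^ V.card := by rw [hE, hnum]
  have hcov : ∀ J : Finset (Fin n), J.card ≤ s → ∃ e < E, M₅.real 5 e = I.len J := by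
    intro J hJ
    obtain ⟨x, hx, e⟩ := k₃.exists_len (I.image_proc hproc) hJ
    obtain ⟨r, hr, e'⟩ := k₄.of_src x (by rw [hEV]; exact hx)
    exact ⟨r, hr, by rw [e5, e', e]⟩
  have hRs : ∀ j : Fin n, ∃ l < n, M₅.real 7 l = I.release j := by
    intro j
    obtain ⟨r, hr, e⟩ := k₅.of_src j j.2
    exact ⟨r, hr, by rw [e, hrel]⟩
  -- The weights are placeholders: neither `Sorted` nor `In₀` refers to them, and the search
  -- substitutes the weights of the current colouring.
  refine ⟨⟨I, E, 2 ^ K, D, K, M₅.real 5, M₅.real 7, fun l e => M₆.nat 20 (l * D + e), fun _ => 1⟩,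
    rfl, rfl, rfl, ?_, ?_, hcov, ?_⟩
  · constructor
    · exact Nat.le_add_right _ _
    · exact Nat.le_add_left _ _
    · rfl
    · exact k₅.mono
    · exact hRs
    · simp only [e5]
      exact k₄.mono
    · intro e he
      obtain ⟨x, hx, e'⟩ := k₄.to_src e he
      simp only [e5, e']
      exact k₃.nonneg x (by rw [← hEV]; exact hx)
    · exact fun l hl e he => (k₆ l hl e he).gt
    · exact fun l hl e he => (k₆ l hl e he).le
    · exact fun l hl e he => (k₆ l hl e he).ge
    · exact fun l hl e he => (k₆ l hl e he).least
  · constructor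
    · exact (congrFun (s₆.nat 0 (by decide)) 0).trans h0
    · exact (congrFun (s₆.nat 10 (by decide)) 0).trans h10
    · exact (congrFun (s₆.nat 14 (by decide)) 0).trans h14
    · intro x hx
      exact (congrFun (r₆.nat 18 (by decide)) x).trans (hM₅18 x hx)
    · intro x hx
      exact (congrFun ((t₅.trans' r₆).nat 19 (by decide)) x).trans (k₂ x hx)
    · exact fun l hl e he => rfl
    · intro e he
      rw [hreal 5 (by decide), r₆.real 5 (by decide)]
    · intro e he
      rw [hreal 7 (by decide), r₆.real 7 (by decide)]
    · intro j
      rw [hreal 0 (by decide), s₆.real 0 (by decide), hrel]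
    · intro j
      rw [hreal 1 (by decide), s₆.real 1 (by decide), hproc]
  · intro l a hl hcard b hb
    rw [hM₇11, Instance.fin]
    obtain ⟨j, hj⟩ := hl.exists_release b hb
    obtain ⟨r, hr, e⟩ := hRs j
    obtain ⟨x, hx, e'⟩ := hcov b.jobs ((Finset.card_le_card (subset_allJobs hb)).trans hcard)
    rw [← hj, ← e, ← e', e5]
    exact add_le_add (k₅.mono _ _ (by omega) (by omega)) (k₄.mono _ _ (by omega) (by omega))

end GPSP

namespace GPSP

open Cmd

/-! ### The algorithm -/

variable {n : ℕ}

/-- The loop bounds that are linear in the number of jobs. -/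
def isLinear (d : ℕ) : Bool := d == 0 || d == 6 || d == 7

/-- The main part of the algorithm. -/
def mainProgram : Program :=
  .seq prelude.toProgram (.seq (seq powerC countC).toProgram (.seq rangesC.toProgram
    (.seq codesC.toProgram (.seq tablesC.toProgram search.toProgram))))

/-- The first step of the algorithm: a schedule of a single job. -/
def firstC : Cmd := when [(true, .ltNat (.const 0) (.read 0 (.const 1)))] singleC

/-- The algorithm. -/
def algorithm : Program :=
  .seq firstC.toProgram (.ifThenElse (.ltNat (.const 1) (.read 0 (.const 1)))
    (.ifThenElse (.ltNat (.const 1) (.read 0 (.const 0))) mainProgram .skip) .skip)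

/-- A bound for the size of the parts of the algorithm. -/
def sizeBound : ℕ :=
  prelude.size + (seq powerC countC).size + rangesC.size + codesC.size + tablesC.size +
    search.size + firstC.size

/-- A bound for the nesting depth of the loops whose bounds do not depend on the number of jobs. -/
def degBound : ℕ :=
  prelude.deg (fun d => !isLinear d) + (seq powerC countC).deg (fun d => !isLinear d) +
    rangesC.deg (fun d => !isLinear d) + codesC.deg (fun d => !isLinear d) +
    tablesC.deg (fun d => !isLinear d) + search.deg (fun d => !isLinear d) +
    firstC.deg (fun d => !isLinear d)

theorem Cmd.runs_bound (f : ℕ → ℝ → ℝ) {N X b : ℕ} (hN : 1 ≤ N) (hX : 1 ≤ X) (c : Cmd)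
    (hwf : c.wf = true) (hd : ∀ d ∈ c.dims, d ∉ c.wN) (hdeg : c.deg isLinear ≤ 4)
    (hb : c.deg (fun d => !isLinear d) ≤ b) (M : Memory) (l : List ℕ) (hl : ∀ d ∈ c.dims, d ∈ l)
    (hM : ∀ d ∈ l, M.nat d 0 ≤ if isLinear d then N else X) :
    ∃ t ≤ c.size * (N ^ 4 * X ^ b), Runs f c.toProgram M t (c.run f M) := by
  obtain ⟨t, ht, h⟩ := c.runs f isLinear hN hX hwf M hd fun d h => hM d (hl d h)
  exact ⟨t, ht.trans (Nat.mul_le_mul_left _ (Nat.mul_le_mul (Nat.pow_le_pow_right hN hdeg)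
    (Nat.pow_le_pow_right hX hb))), h⟩

/-- A bound for the number of codes, and for the other numbers that the running time depends on. -/
def workBound (s p : ℕ) : ℕ := 2 ^ (64 * s) * s ^ (2 * p)

/-- The left side is the binary logarithm of the number of multiplier vectors. That it is linear in
`2 ^ t`, hence in `s`, is what makes the derandomization affordable. -/
theorem exponent_le (t : ℕ) : (2 * t + 1) * (t + 1) ≤ 8 * 2 ^ t := by
  induction t with
  | zero => norm_num
  | succ t ih =>
    rcases Nat.lt_or_ge t 4 with h | h
    · interval_cases t <;> norm_num
    · rw [pow_succ]
      nlinarith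

theorem multipliers_le {s t : ℕ} (h : 2 ^ t < 8 * s) :
    (2 ^ t * 2 ^ t + 2 ^ t * 2 ^ t) ^ (t + 1) ≤ 2 ^ (64 * s) := by
  have e : 2 ^ t * 2 ^ t + 2 ^ t * 2 ^ t = 2 ^ (2 * t + 1) := by ring
  rw [e, ← pow_mul]
  refine Nat.pow_le_pow_right (by norm_num) ((exponent_le t).trans ?_)
  omega

/-- The loop bounds other than those that are linear in the number of jobs are at most `X`. -/
structure SmallNumbers (s p t X : ℕ) : Prop where
  one : 1 ≤ X
  four : 4 * s ≤ X
  pow : 2 ^ t ≤ X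
  succ : t + 1 ≤ X
  colours : 2 ^ (t + 1) ≤ X
  square : 2 ^ t * 2 ^ t ≤ X
  squares : 2 ^ t * 2 ^ t + 2 ^ t * 2 ^ t ≤ X
  codes : 2 ^ 2 ^ (t + 1) ≤ X
  vectors : (2 ^ t * 2 ^ t + 2 ^ t * 2 ^ t) ^ (t + 1) ≤ X
  lengths : (s + 1) ^ p ≤ X
  stride : (s + 1) ^ p + 2 ^ 2 ^ (t + 1) ≤ X

/-- Codes and multiplier vectors are at most `2 ^ (64 * s)` because `2 ^ t < 8 * s`, and the number
of lengths is at most `s ^ (2 * p)` because `s + 1 ≤ s ^ 2`. The last estimate fails for `s = 1`. -/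
theorem smallNumbers {s p t : ℕ} (hs : 2 ≤ s) (h₁ : 4 * s ≤ 2 ^ t) (h₂ : 2 ^ t < 8 * s) :
    SmallNumbers s p t (workBound s p) := by
  have hp : 1 ≤ s ^ (2 * p) := Nat.one_le_pow _ _ (by omega)
  have hY : 2 ^ (64 * s) ≤ workBound s p := Nat.le_mul_of_pos_right _ hp
  have hg := multipliers_le h₂
  have hA : 2 ^ t * 2 ^ t + 2 ^ t * 2 ^ t ≤ (2 ^ t * 2 ^ t + 2 ^ t * 2 ^ t) ^ (t + 1) :=
    Nat.le_self_pow (by omega) _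
  have ht : 1 ≤ 2 ^ t := Nat.one_le_two_pow
  have ht' : t < 2 ^ t := Nat.lt_two_pow_self
  have hm : 2 ^ t ≤ 2 ^ t * 2 ^ t := Nat.le_mul_of_pos_right _ ht
  have hW : 2 ^ (t + 1) = 2 ^ t + 2 ^ t := by ring
  have hQ : 2 * 2 ^ 2 ^ (t + 1) ≤ 2 ^ (64 * s) := by
    rw [← pow_succ']
    exact Nat.pow_le_pow_right (by norm_num) (by omega)
  have hE : (s + 1) ^ p ≤ s ^ (2 * p) := by
    rw [pow_mul]
    exact Nat.pow_le_pow_left (by nlinarith) _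
  have hQ0 : 1 ≤ 2 ^ 2 ^ (t + 1) := Nat.one_le_two_pow
  have hstride : (s + 1) ^ p + 2 ^ 2 ^ (t + 1) ≤ workBound s p := by
    have : s ^ (2 * p) + 2 ^ 2 ^ (t + 1) ≤ 2 * 2 ^ 2 ^ (t + 1) * s ^ (2 * p) := by nlinarith
    exact (Nat.add_le_add_right hE _).trans (this.trans (Nat.mul_le_mul_right _ hQ))
  constructor <;> omega

/-- Each part of the program is run with its loop bounds known from the preceding parts. The linear
bound `3 * n` dominates `2 * n + 2` only if `n ≥ 2`. The hypothesis `hM` allows all strides because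
the first step takes place before the stride is computed. -/
theorem main_spec (I : Instance n) {M : Memory} {s : ℕ} (hn : 2 ≤ n) (hs : 2 ≤ s)
    (h0 : M.nat 0 0 = n) (h1 : M.nat 0 1 = s) (hrel : ∀ j : Fin n, M.real 0 j = I.release j)
    (hproc : ∀ j : Fin n, M.real 1 j = I.proc j)
    (hM : ∀ D Q, 1 ≤ Q → Q ≤ D → EntOK D Q (OutOK I s 0) M 0) :
    ∃ t M', Runs I.oracle mainProgram M t M' ∧ (∃ D Q, EntOK D Q (OutOK I s 0) M' 0) ∧
      (∀ l : List (Segment n), (allJobs l).card ≤ s → I.Chain 0 l →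
        (∀ b ∈ l, I.Blk b.start b.jobs b.val) → LB M' 0 (allVal l)) ∧
      t + firstC.size * ((3 * n) ^ 4 * workBound s I.numProc ^ degBound) ≤
        sizeBound * ((3 * n) ^ 4 * workBound s I.numProc ^ degBound) := by
  set f := I.oracle with hf
  obtain ⟨p₃, p₄, p₅, p₆, p₇⟩ := prelude_spec (f := f) h0 h1
  have s₁ := sameOff_run f prelude M
  have r₁ := fun X (hX : 1 ≤ X) => prelude.runs_bound f (N := 3 * n) (X := X) (b := degBound)
    (by omega) hX (by decide) (by decide) (by decide) (by unfold degBound; omega) M []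
    (by decide) (by simp)
  set M₁ := prelude.run f M
  have e0₁ : M₁.nat 0 0 = n := by rw [s₁.nat 0 (by decide), h0]
  obtain ⟨t, q₈, q₉, ht₁, ht₂⟩ := powerC_spec (f := f) p₅ (by omega)
  have hX := smallNumbers (p := I.numProc) hs ht₁ ht₂
  set X := workBound s I.numProc
  have s' := sameOff_run f powerC M₁
  have c₁₀ := countC_spec (f := f) (M := powerC.run f M₁) (n := n) (s := s)
    (by rw [s'.nat 0 (by decide), e0₁]) (by rw [s'.nat 4 (by decide), p₄])
  rw [s'.real 1 (by decide), s₁.real 1 (by decide), ← I.numProc_eq hproc] at c₁₀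
  have s'' := sameOff_run f countC (powerC.run f M₁)
  have s₂ := sameOff_run f (seq powerC countC) M₁
  have r₂ := (seq powerC countC).runs_bound f (N := 3 * n) (X := X) (b := degBound)
    (by omega) hX.one (by decide) (by decide) (by decide) (by unfold degBound; omega) M₁ [0, 4, 5]
    (by decide) (by
      simp only [List.forall_mem_cons, List.not_mem_nil, false_imp_iff, implies_true, and_true,
        e0₁, p₄, p₅]
      have := hX.four
      refine ⟨?_, ?_, ?_⟩ <;> simp [isLinear] <;> omega)
  rw [← run_seq] at c₁₀
  have q₈' : ((seq powerC countC).run f M₁).nat 8 0 = 2 ^ t := by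
    rw [run_seq, s''.nat 8 (by decide), q₈]
  have q₉' : ((seq powerC countC).run f M₁).nat 9 0 = t + 1 := by
    rw [run_seq, s''.nat 9 (by decide), q₉]
  set M₂ := (seq powerC countC).run f M₁
  have c := rangesC_spec (f := f) q₈'
  obtain ⟨c₁₁, c₁₂, c₁₃⟩ := c
  have s₃ := sameOff_run f rangesC M₂
  have r₃ := rangesC.runs_bound f (N := 3 * n) (X := X) (b := degBound)
    (by omega) hX.one (by decide) (by decide) (by decide) (by unfold degBound; omega) M₂ [8]
    (by decide) (by simpa [isLinear, q₈'] using hX.pow)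
  set M₃ := rangesC.run f M₂
  have hW : 2 * 2 ^ t = 2 ^ (t + 1) := by rw [pow_succ, mul_comm]
  rw [hW] at c₁₁
  have e9₃ : M₃.nat 9 0 = t + 1 := by rw [s₃.nat 9 (by decide), q₉']
  have e10₃ : M₃.nat 10 0 = (s + 1) ^ I.numProc := by rw [s₃.nat 10 (by decide), c₁₀]
  obtain ⟨d₁₇, d₁₄, d₁₅, d₁₆⟩ := codesC_spec (f := f) c₁₁ c₁₃ e9₃ e10₃
  have s₄ := sameOff_run f codesC M₃
  have r₄ := codesC.runs_bound f (N := 3 * n) (X := X) (b := degBound)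
    (by omega) hX.one (by decide) (by decide) (by decide) (by unfold degBound; omega) M₃ [11, 9, 13]
    (by decide) (by
      simp only [List.forall_mem_cons, List.not_mem_nil, false_imp_iff, implies_true, and_true,
        c₁₁, e9₃, c₁₃]
      exact ⟨hX.colours, hX.succ, hX.squares⟩)
  set M₄ := codesC.run f M₃
  have o₂ := (s₂.trans' s₃).trans' s₄
  have e0₄ : M₄.nat 0 0 = n := by rw [o₂.nat 0 (by decide), e0₁]
  have e3₄ : M₄.nat 3 0 = s := by rw [o₂.nat 3 (by decide), p₃]
  have e7₄ : M₄.nat 7 0 = 2 * n + 2 := by rw [o₂.nat 7 (by decide), p₇]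
  have e10₄ : M₄.nat 10 0 = (s + 1) ^ I.numProc := by rw [s₄.nat 10 (by decide), e10₃]
  have o₁ := s₁.trans' o₂
  obtain ⟨T, rfl, hK, hQ, hT, hIn, hcov, hfin⟩ := tablesC_spec I (M := M₄) (s := s)
    (K := 2 ^ (t + 1)) e0₄ e3₄ e7₄ e10₄ d₁₄ d₁₆
    (fun j => by rw [o₁.real 0 (by decide), hrel]) (fun j => by rw [o₁.real 1 (by decide), hproc])
  have s₅ := sameOff_run f tablesC M₄
  have r₅ := tablesC.runs_bound f (N := 3 * n) (X := X) (b := degBound)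
    (by omega) hX.one (by decide) (by decide) (by decide) (by unfold degBound; omega) M₄
    [0, 3, 7, 10, 14, 16]
    (by decide) (by
      simp only [List.forall_mem_cons, List.not_mem_nil, false_imp_iff, implies_true, and_true,
        e0₄, e3₄, e7₄, e10₄, d₁₄, d₁₆]
      have := hX.four
      have := hX.lengths
      have := hX.codes
      have := hX.stride
      refine ⟨?_, ?_, ?_, ?_, ?_, ?_⟩ <;> simp [isLinear] <;> omega)
  have hH : HashIn n t (tablesC.run f M₄) := by
    have o₄ := s₄.trans' s₅
    have o₃ := s₃.trans' o₄
    refine ⟨?_, ?_, ?_, ?_, ?_, ?_, ?_, ?_, ?_⟩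
    · rw [s₅.nat 0 (by decide), e0₄]
    · rw [(o₂.trans' s₅).nat 6 (by decide), p₆]
    · rw [o₄.nat 9 (by decide), e9₃]
    · rw [o₄.nat 11 (by decide), c₁₁]
    · rw [o₄.nat 12 (by decide), c₁₂]
    · rw [o₄.nat 13 (by decide), c₁₃]
    · rw [s₅.nat 14 (by decide), d₁₄]
    · rw [s₅.nat 15 (by decide), d₁₅]
    · rw [s₅.nat 17 (by decide)]
      exact d₁₇
  have o₅ := o₁.trans' s₅
  have hEnt : EntOK T.D T.Q (OutOK T.inst s 0) (tablesC.run f M₄) 0 :=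
    (hM T.D T.Q (by rw [hQ]; exact Nat.one_le_two_pow) hT.Q_le).same hT.Q_le
      (.of_sameOff o₅ (by decide) (by decide) 0)
  rw [← hf] at hIn hfin
  have e10₅ : (tablesC.run f M₄).nat 10 0 = (s + 1) ^ T.inst.numProc := by
    rw [s₅.nat 10 (by decide), e10₄]
  have e1₅ : (tablesC.run f M₄).nat 0 1 = s := by rw [o₅.nat 0 (by decide), h1]
  set M₅ := tablesC.run f M₄
  obtain ⟨g₁, -, g₃⟩ := search_spec hT hIn hH hK e1₅ ht₁ (by omega) rfl hcov
  have r₆ := search.runs_bound f (N := 3 * n) (X := X) (b := degBound)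
    (by omega) hX.one (by decide) (by decide) (by decide) (by unfold degBound; omega) M₅
    [0, 6, 9, 10, 11, 12, 13, 14, 15]
    (by decide) (by
      simp only [List.forall_mem_cons, List.not_mem_nil, false_imp_iff, implies_true, and_true,
        hH.h0, hH.h6, hH.h9, e10₅, hH.h11, hH.h12, hH.h13, hH.h14,
        hH.h15]
      refine ⟨?_, ?_, hX.succ, hX.lengths, hX.colours, hX.square, hX.squares,
        hX.codes, hX.vectors⟩ <;>
        simp [isLinear] <;> omega)
  obtain ⟨t₁, b₁, r₁⟩ := r₁ X hX.one
  obtain ⟨t₂, b₂, r₂⟩ := r₂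
  obtain ⟨t₃, b₃, r₃⟩ := r₃
  obtain ⟨t₄, b₄, r₄⟩ := r₄
  obtain ⟨t₅, b₅, r₅⟩ := r₅
  obtain ⟨t₆, b₆, r₆⟩ := r₆
  refine ⟨_, _, r₁.seq (r₂.seq (r₃.seq (r₄.seq (r₅.seq r₆)))), ⟨_, _, g₁ hEnt⟩,
    fun l h₁ h₂ h₃ => g₃ l h₁ h₂ h₃ (hfin l 0 h₂ h₁), ?_⟩
  simp only [sizeBound, add_mul]
  omega

end GPSP

/-! ### Reading the output, small cases, and the final running time. -/

namespace GPSP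

open Cmd

variable {n : ℕ}

theorem EntOK.holds {D Q s : ℕ} {I : Instance n} {M : Memory} (h : EntOK D Q (OutOK I s 0) M 0)
    (hfl : 0 < M.nat 22 0) :
    ∃ L : Schedule n, M.Holds L ∧ I.Feasible s L ∧ M.real 4 0 ≤ I.value L := by
  obtain ⟨L, h₁, -, h₃, h₄⟩ := h hfl
  refine ⟨L, ⟨h₁, fun k hk => ?_⟩, h₄⟩
  have := h₃ k hk
  simpa [Memory.cells, Piece.triple] using this

theorem Instance.optimal_nil (I : Instance n) : I.Optimal 0 [] := by
  refine ⟨⟨by simp, by simp, by simp, by simp [Schedule.jobs], by simp [Schedule.jobs]⟩, ?_⟩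
  intro L hL
  have : L.jobs = ∅ := Finset.card_eq_zero.1 (Nat.le_zero.1 hL.card_le)
  rw [Instance.value, this]
  simp [Instance.value, Schedule.jobs]

theorem firstC_spec (I : Instance n) {s : ℕ} (hs : 1 ≤ s) :
    (∀ D Q, 1 ≤ Q → Q ≤ D → EntOK D Q (OutOK I s 0) (firstC.run I.oracle (I.input s)) 0) ∧
      LB (firstC.run I.oracle (I.input s)) 0 0 ∧
      ∀ j, LB (firstC.run I.oracle (I.input s)) 0 (I.profit j (I.release j + I.proc j)) := by
  have e : firstC.run I.oracle (I.input s) = singleC.run I.oracle (I.input s) :=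
    run_when_true (by simp [Test.Holds, NExp.eval, Instance.input, update]; omega)
  rw [e]
  have key := fun D Q (h₁ : 1 ≤ Q) (h₂ : Q ≤ D) => singleC_spec (D := D) (Q := Q) (M := I.input s) I
    hs h₁ h₂ (by simp [Instance.input, update]) (by simp [Instance.input, update])
    (by simp [Instance.input, update]) (by simp [Instance.input])
    (fun j => by simp [Instance.input, extend]) (fun j => by simp [Instance.input, extend])
  exact ⟨fun D Q h₁ h₂ => (key D Q h₁ h₂).1, (key 1 1 le_rfl le_rfl).2⟩

/-- Here 8 is the cost of the two tests between the parts, and `162 = 2 * 3 ^ 4` collects the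
constant of `(3 * N) ^ 4` and the factor 2 lost to `log N ≥ 1 / 2`. All constant factors are moved
into the exponent of `2`. -/
theorem algorithm_time {s p N S b t : ℕ} (hn : 2 ≤ N) (hs : 1 ≤ s)
    (ht : t ≤ 8 + S * ((3 * N) ^ 4 * workBound s p ^ b)) :
    (t : ℝ) ≤ (2 : ℝ) ^ ((64 * b + 162 * (S + 8)) * s) *
      (s : ℝ) ^ ((64 * b + 162 * (S + 8)) * p) * (N : ℝ) ^ 4 * Real.log N := by
  have hX : 1 ≤ workBound s p := Nat.mul_pos (by positivity) (Nat.pow_pos hs)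
  have h1 : 1 ≤ (3 * N) ^ 4 * workBound s p ^ b :=
    Nat.mul_pos (by positivity) (Nat.pow_pos hX)
  have h2 : t ≤ (S + 8) * ((3 * N) ^ 4 * workBound s p ^ b) := by
    rw [add_mul]
    omega
  have h3 : 162 * (S + 8) ≤ 2 ^ (162 * (S + 8) * s) :=
    (Nat.lt_two_pow_self).le.trans (Nat.pow_le_pow_right (by norm_num)
      (Nat.le_mul_of_pos_right _ hs))
  have h4 : s ^ (2 * p * b) ≤ s ^ ((64 * b + 162 * (S + 8)) * p) :=
    Nat.pow_le_pow_right hs (by nlinarith [Nat.zero_le (p * b), Nat.zero_le (S * p)])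
  have h5 : 2 * t ≤ 2 ^ ((64 * b + 162 * (S + 8)) * s) *
      s ^ ((64 * b + 162 * (S + 8)) * p) * N ^ 4 := by
    calc 2 * t ≤ 2 * ((S + 8) * ((3 * N) ^ 4 * workBound s p ^ b)) := by omega
      _ = (162 * (S + 8)) * (2 ^ (64 * b * s) * s ^ (2 * p * b) * N ^ 4) := by
        rw [workBound, mul_pow (2 ^ (64 * s)), ← pow_mul, ← pow_mul, mul_pow,
          show 64 * s * b = 64 * b * s by ring]
        ring
      _ ≤ 2 ^ (162 * (S + 8) * s) * (2 ^ (64 * b * s) * s ^ ((64 * b + 162 * (S + 8)) * p) *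
          N ^ 4) := by gcongr
      _ = _ := by
        rw [add_mul (64 * b) (162 * (S + 8)) s, pow_add]
        ring
  have h6 : (1 : ℝ) / 2 ≤ Real.log N :=
    (by linarith [Real.log_two_gt_d9] : (1 : ℝ) / 2 ≤ Real.log 2).trans
      (Real.log_le_log (by norm_num) (by exact_mod_cast hn))
  have h7 : (2 : ℝ) * t ≤ 2 ^ ((64 * b + 162 * (S + 8)) * s) *
      (s : ℝ) ^ ((64 * b + 162 * (S + 8)) * p) * (N : ℝ) ^ 4 := by exact_mod_cast h5
  nlinarith [mul_le_mul h7 h6 (by norm_num) (by positivity)]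

end GPSP

theorem mainTheorem9 :
    ∃ (A : GPSP.Program) (c : ℕ),
      ∀ (n s : ℕ) (I : GPSP.Instance n),
        ∃ (t : ℕ) (M : GPSP.Memory) (L : GPSP.Schedule n),
          GPSP.Runs I.oracle A (I.input s) t M ∧
          M.Holds L ∧
          I.Optimal s L ∧
          (2 ≤ n → 1 ≤ s →
            (t : ℝ) ≤ (2 : ℝ) ^ (c * s) * (s : ℝ) ^ (c * I.numProc) * (n : ℝ) ^ 4 * Real.log n) := by
  open GPSP Cmd in
  refine ⟨algorithm, 64 * degBound + 162 * (sizeBound + 8), fun n s I => ?_⟩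
  have hin0 : (I.input s).nat 0 0 = n := by simp [Instance.input, update]
  have hin1 : (I.input s).nat 0 1 = s := by simp [Instance.input, update]
  have hf := sameOff_run I.oracle firstC (I.input s)
  -- The increased bounds are positive for all `n` and `s`, so this yields a run in all cases. The
  -- sharper time bound for `n ≥ 2` and `s ≥ 1` refers to the same run by determinism.
  obtain ⟨t₁, ht₁, r₁⟩ := firstC.runs_bound I.oracle (N := 3 * n + 1)
    (X := workBound s I.numProc + 1) (b := degBound) (by omega) (by omega) (by decide) (by decide)
    (by decide) (by unfold degBound; omega) (I.input s) [0] (by decide)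
    (by simp only [List.forall_mem_cons, hin0]; simp [isLinear]; omega)
  have ht₁' : 2 ≤ n → 1 ≤ s →
      t₁ ≤ firstC.size * ((3 * n) ^ 4 * workBound s I.numProc ^ degBound) := by
    intro hn hs
    obtain ⟨t, ht, r⟩ := firstC.runs_bound I.oracle (N := 3 * n)
      (X := workBound s I.numProc) (b := degBound) (by omega)
      (Nat.mul_pos (by positivity) (Nat.pow_pos hs)) (by decide) (by decide)
      (by decide) (by unfold degBound; omega) (I.input s) [0] (by decide)
      (by simp only [List.forall_mem_cons, hin0]; simp [isLinear]; omega)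
    rwa [(r₁.deterministic r).1]
  have hsz : firstC.size ≤ sizeBound := Nat.le_add_left _ _
  have spec := fun hs : 1 ≤ s => firstC_spec I hs
  have e0 : (firstC.run I.oracle (I.input s)).nat 0 0 = n := by
    rw [hf.nat 0 (by decide), hin0]
  have e1 : (firstC.run I.oracle (I.input s)).nat 0 1 = s := by
    rw [hf.nat 0 (by decide), hin1]
  have hrel : ∀ j : Fin n, (firstC.run I.oracle (I.input s)).real 0 j = I.release j := fun j => by
    rw [hf.real 0 (by decide)]
    simp [Instance.input, extend]
  have hproc : ∀ j : Fin n, (firstC.run I.oracle (I.input s)).real 1 j = I.proc j := fun j => by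
    rw [hf.real 1 (by decide)]
    simp [Instance.input, extend]
  rcases Nat.eq_zero_or_pos s with rfl | hs
  · have e : firstC.run I.oracle (I.input 0) = I.input 0 :=
      run_when_false (by simp [Test.Holds, NExp.eval, hin1])
    rw [e] at r₁
    refine ⟨_, I.input 0, [], r₁.seq (.ifFalse ?_ (.skip _)), ⟨rfl, by simp⟩, I.optimal_nil,
      fun _ h => absurd h (by omega)⟩
    simp [Test.Holds, NExp.eval, hin1]
  obtain ⟨g₁, g₂, g₃⟩ := spec hs
  set M₁ := firstC.run I.oracle (I.input s)
  by_cases hbig : 1 < s ∧ 1 < n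
  · obtain ⟨t₂, M', r₂, ⟨D, Q, k₁⟩, k₂, k₃⟩ := main_spec I (M := M₁) hbig.2 hbig.1 e0 e1 hrel hproc
      g₁
    -- The empty chain shows that entry `0` is valid in the final memory, so soundness yields a
    -- schedule.
    have hnil := k₂ [] (by simp) trivial (by simp)
    obtain ⟨L, hL₁, hL₂, hL₃⟩ := k₁.holds hnil.1
    refine ⟨_, M', L, r₁.seq (.ifTrue ?_ (.ifTrue ?_ r₂)), hL₁, ⟨hL₂, fun L' hL' => ?_⟩,
      fun h₁ h₂ => algorithm_time h₁ h₂ ?_⟩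
    · simpa [Test.Holds, NExp.eval, e1] using hbig.1
    · simpa [Test.Holds, NExp.eval, e0] using hbig.2
    -- A competing schedule is worth at most its chain of blocks, which is at most the stored value,
    -- which is at most the value of the output.
    · obtain ⟨l, l₁, l₂, l₃, l₄⟩ := hL'.exists_chain
      have := k₂ l (by rw [l₃]; exact hL'.card_le) l₁ fun b hb => (l₂ b hb).1
      exact l₄.trans (this.2.trans hL₃)
    · have := ht₁' h₁ h₂
      simp only [Test.cost, NExp.cost]
      omega
  -- Now `s = 1` or `n ≤ 1`, so a competing schedule has at most one job and the first step is
  -- already optimal.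
  · obtain ⟨L, hL₁, hL₂, hL₃⟩ := (g₁ 1 1 le_rfl le_rfl).holds g₂.1
    have hopt : I.Optimal s L := by
      refine ⟨hL₂, fun L' hL' => ?_⟩
      have hc : L'.jobs.card ≤ 1 := by
        have h₁ := hL'.card_le
        have h₂ := (Finset.card_le_univ L'.jobs).trans_eq (Fintype.card_fin n)
        omega
      rcases hL'.value_le_of_card_le_one hc with h | ⟨j, h⟩
      · exact h.trans (g₂.2.trans hL₃)
      · exact h.trans ((g₃ j).2.trans hL₃)
    have time : ∀ t, t ≤ t₁ + 8 → 2 ≤ n → 1 ≤ s →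
        t ≤ 8 + sizeBound * ((3 * n) ^ 4 * workBound s I.numProc ^ degBound) := by
      intro t ht h₁ h₂
      have := ht₁' h₁ h₂
      have := Nat.mul_le_mul_right ((3 * n) ^ 4 * workBound s I.numProc ^ degBound) hsz
      omega
    by_cases hs' : 1 < s
    · refine ⟨_, M₁, L, r₁.seq (.ifTrue ?_ (.ifFalse ?_ (.skip _))), hL₁, hopt,
        fun h₁ h₂ => by omega⟩
      · simpa [Test.Holds, NExp.eval, e1] using hs'
      · simpa [Test.Holds, NExp.eval, e0] using fun h => hbig ⟨hs', h⟩
    · refine ⟨_, M₁, L, r₁.seq (.ifFalse ?_ (.skip _)), hL₁, hopt,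
        fun h₁ h₂ => algorithm_time h₁ h₂ (time _ ?_ h₁ h₂)⟩
      · simpa [Test.Holds, NExp.eval, e1] using hs'
      · simp only [Test.cost, NExp.cost]
        omega
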